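/- \textbf{Setting.} Let $\Omega=\prod_{i=1}^d[\ell_i,h_i]\subset\mathbb R^d$ ($\ell_i<h_i$) be a compact rectangle, $\Upsilon\subset\mathbb R$ a compact interval, $a<c<b$ with $a,b$ in the interior of $\Upsilon$, let $\gamma^a,\gamma^b>0$ satisfy $\gamma^a+\gamma^b=1/|\Omega|$, and let $m_\Omega,m_\Upsilon,T>0$. Put $$\pi_0(dx\,dy)=\gamma^a\,dx\,\delta_a(dy)+\gamma^b\,dx\,\delta_b(dy)\qquad\text{on }\Omega\times\Upsilon .$$ \textbf{Tilts.} Let $\mathcal F:\mathcal P(\Omega\times\Upsilon)\to\mathbb R$ be continuously differentiable with respect to the total-variation norm, with derivative $D\mathcal F(\rho)\in C_b(\Omega\times\Upsilon)$ satisfying $\sup_\rho\|D\mathcal F(\rho)\|_\infty<\infty$ and such that $x\mapsto D\mathcal F(\rho)(x,y)$ is Lipschitz with a constant independent of $\rho\in\mathcal P(\Omega\times\Upsilon)$ and $y\in\Upsilon$. Set $\mathcal E_0^{\mathcal F}(\rho)=\mathrm{RelEnt}(\rho|\pi_0)+\mathcal F(\rho)\in(-\infty,\infty]$. \textbf{Contracted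 continuity equation.} Let $\rho:[0,T]\to\mathcal P(\Omega\times\Upsilon)$ be narrowly continuous, and let $j^x(t)\in\mathcal M(\Omega\times\Upsilon;\mathbb R^d)$, $\bar\jmath(t)\in\mathcal M(\Omega)$, $t\in[0,T]$, be finite measures depending measurably on $t$ (narrow topology), with $\int_0^T(|j^x(t)|+|\bar\jmath(t)|)\,dt$ finite measures. Write $(\rho,j)=(\rho,(j^x,\bar\jmath))\in\widetilde{\mathrm{CE}}(0,T)$ if for all $\varphi\in C^1_c((0,T)\times\mathbb R^d\times\{a,b\})$ $$\int_0^T\!\!\int_{\mathbb R^d}\sum_{y=a,b}\bigl(\partial_t\varphi(t,x,y)\,\rho(t,dx,y)+\nabla_x\varphi(t,x,y)\cdot j^x(t,dx,y)\bigr)dt+\int_0^T\!\!\int_{\mathbb R^d}(\varphi(t,x,b)-\varphi(t,x,a))\,\bar\jmath(t,dx)\,dt=0,$$ where $\rho(t,dx,y)$, $j^x(t,dx,y)$ denote the parts of $\rho(t)$, $j^x(t)$ on $\mathbb R^d\times\{y\}$. \textbf{Dissipation.} Let $\mathsf C(s)=2s\log\frac{s+\sqrt{s^2+4}}2-2\sqrt{s^2+4}+4$,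 and let $\mathsf C(j|\sigma)=\sigma\,\mathsf C(j/\sigma)$ for $\sigma>0$, $\mathsf C(0|0)=0$, $\mathsf C(j|0)=+\infty$ for $j\neq0$. Write $F^\rho(t,\cdot)=D\mathcal F(\rho(t))$, $u=d\rho/d\pi_0$, $u^{\mathcal F}=u\,e^{F^\rho}$ and $$\sigma(t,x)=\frac{m_\Upsilon}{|\Omega|}\,e^{-F^\rho(t,x,c)}\sqrt{u^{\mathcal F}(t,x,a)\,u^{\mathcal F}(t,x,b)} .$$ For $(\rho,j)\in\widetilde{\mathrm{CE}}(0,T)$ such that $\rho(t)\ll\pi_0$, $j^x(t)\ll\rho(t)$ and $\bar\jmath(t)\ll dx$ for almost every $t$ (with $\bar\jmath(t,x)$ the density), set $$\mathcal D_0^T(\rho,j;\mathcal F)=\int_0^T\Bigl\{\int\frac1{2m_\Omega}\Bigl|\frac{dj^x}{d\rho}\Bigr|^2d\rho+\int2m_\Omega\,e^{-F^\rho}\bigl|\nabla_x\sqrt{u^{\mathcal F}}\bigr|^2d\pi_0+\int_\Omega\Bigl[\mathsf C(\bar\jmath\,|\,\sigma)+\frac{2m_\Upsilon}{|\Omega|}e^{-F^\rho(t,x,c)}\bigl(\sqrt{u^{\mathcal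 F}(t,x,b)}-\sqrt{u^{\mathcal F}(t,x,a)}\bigr)^2\Bigr]dx\Bigr\}dt ,$$ where $\nabla_x$ is the weak gradient in the interior of $\Omega$ for $y=a,b$, and the second term is $+\infty$ if it does not exist. In all other cases $\mathcal D_0^T(\rho,j;\mathcal F)=+\infty$. \textbf{Claim.} For every such $\mathcal F$ and every $(\rho,j)\in\widetilde{\mathrm{CE}}(0,T)$ with $\mathcal E_0^{\mathcal F}(\rho(0))<\infty$, $$\bigl|\mathcal E_0^{\mathcal F}(\rho(T))-\mathcal E_0^{\mathcal F}(\rho(0))\bigr|\le\mathcal D_0^T(\rho,j;\mathcal F),$$ and in particular $\mathcal I_0(\rho,j;\mathcal F):=\mathcal E_0^{\mathcal F}(\rho(T))-\mathcal E_0^{\mathcal F}(\rho(0))+\mathcal D_0^T(\rho,j;\mathcal F)\ge0$. -/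

import Mathlib

open MeasureTheory Set Filter Topology
open scoped ENNReal ContDiff

noncomputable section

namespace Kramers

/-- Spatial variables live in `ℝ^d` with its Euclidean norm. -/
abbrev Space (d : ℕ) : Type := EuclideanSpace ℝ (Fin d)

/-- The geometric and physical parameters of the limiting two-well system: the compact rectangle
`Ω = ∏ᵢ [loᵢ, hiᵢ]`, the compact interval `Υ = [y₀, y₁]`, the wells `a < b` in the interior of `Υ`,
the position `c` of the barrier in between, the positive weights `γᵃ, γᵇ` of the wells, normalized
by `γᵃ + γᵇ = 1 / |Ω|`, and the positive mobilities `m_Ω` and `m_Υ`. -/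
structure Setting (d : ℕ) where
  lo : Fin d → ℝ
  hi : Fin d → ℝ
  lo_lt_hi : ∀ i, lo i < hi i
  y₀ : ℝ
  y₁ : ℝ
  a : ℝ
  b : ℝ
  c : ℝ
  y₀_lt_a : y₀ < a
  a_lt_c : a < c
  c_lt_b : c < b
  b_lt_y₁ : b < y₁
  γa : ℝ
  γb : ℝ
  γa_pos : 0 < γa
  γb_pos : 0 < γb
  γ_add : γa + γb = 1 / (volume : Measure (Space d)).real {x | ∀ i, x i ∈ Icc (lo i) (hi i)}
  mΩ : ℝ
  mΥ : ℝ
  mΩ_pos : 0 < mΩ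
  mΥ_pos : 0 < mΥ

/-- The cosh-type dissipation function
`C(s) = 2 s log ((s + √(s² + 4)) / 2) - 2 √(s² + 4) + 4`. -/
def coshC (s : ℝ) : ℝ :=
  2 * s * Real.log ((s + Real.sqrt (s ^ 2 + 4)) / 2) - 2 * Real.sqrt (s ^ 2 + 4) + 4

open Classical in
/-- The perspective function `C(j|σ)`, for `σ ≥ 0`: it is `σ C(j/σ)` if `σ > 0`, and for `σ = 0` it
is `0` if `j = 0` and `+∞` otherwise. -/
def perspC (j σ : ℝ) : ℝ≥0∞ :=
  if 0 < σ then ENNReal.ofReal (σ * coshC (j / σ)) else if j = 0 then 0 else ⊤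

/-- The integral of `f` against a finite signed measure. -/
def sintegral {α : Type*} [MeasurableSpace α] (μ : SignedMeasure α) (f : α → ℝ) : ℝ :=
  (∫ z, f z ∂μ.toJordanDecomposition.posPart) - ∫ z, f z ∂μ.toJordanDecomposition.negPart

/-- The total-variation distance `sup_A |μ(A) - ν(A)|` of two probability measures. -/
def tvDist {α : Type*} [MeasurableSpace α] (μ ν : Measure α) : ℝ :=
  sSup {r : ℝ | ∃ A, MeasurableSet A ∧ r = |μ.real A - ν.real A|}

/-- `g` is the weak gradient of `f` in the interior of `Ω`. -/
def IsWeakGradient {d : ℕ} (Ω : Set (Space d)) (f : Space d → ℝ) (g : Space d → Space d) : Prop :=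
  LocallyIntegrableOn f (interior Ω) ∧ LocallyIntegrableOn g (interior Ω) ∧
    ∀ φ : Space d → ℝ, ContDiff ℝ ∞ φ → HasCompactSupport φ → tsupport φ ⊆ interior Ω →
      ∀ i : Fin d, ∫ x in interior Ω, f x * fderiv ℝ φ x (EuclideanSpace.single i 1)
        = - ∫ x in interior Ω, g x i * φ x

/-- A time-dependent flux `(jˣ, j̄)`: `jˣ(t)` is an `ℝ^d`-valued measure on `ℝ^d × ℝ`, given by
its components, and `j̄(t)` is a real-valued measure on `ℝ^d`. -/
structure Flux (d : ℕ) where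
  jx : ℝ → Fin d → SignedMeasure (Space d × ℝ)
  jbar : ℝ → SignedMeasure (Space d)

namespace Setting

variable {d : ℕ} (S : Setting d)

/-- The rectangle `Ω`. -/
def Ω : Set (Space d) := {x | ∀ i, x i ∈ Icc (S.lo i) (S.hi i)}

/-- The interval `Υ`. -/
def Υ : Set ℝ := Icc S.y₀ S.y₁

/-- The state space `Ω × Υ`. -/
def nodes : Set (Space d × ℝ) := S.Ω ×ˢ S.Υ

/-- The Lebesgue measure `|Ω|`. -/
def volΩ : ℝ := (volume : Measure (Space d)).real S.Ω

/-- `π₀(dx dy) = γᵃ dx δ_a(dy) + γᵇ dx δ_b(dy)` on `Ω × Υ`. -/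
def π₀ : Measure (Space d × ℝ) :=
  ENNReal.ofReal S.γa • (volume.restrict S.Ω).prod (Measure.dirac S.a) +
    ENNReal.ofReal S.γb • (volume.restrict S.Ω).prod (Measure.dirac S.b)

/-- `ρ` is a probability measure on `Ω × Υ`. -/
def IsNodeProb (ρ : Measure (Space d × ℝ)) : Prop :=
  IsProbabilityMeasure ρ ∧ ρ S.nodesᶜ = 0

/-- A tilt: a functional `𝓕` on the probability measures on `Ω × Υ` that is continuously
differentiable with respect to the total variation, with derivative `D𝓕(ρ)` in `C_b(Ω × Υ)`
bounded uniformly in `ρ`, and Lipschitz in the spatial variable, uniformly in `ρ`.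
(As a derivative on the probability measures, `D𝓕(ρ)` is unique up to additive constants, which
are immaterial below. Values outside `Ω × Υ` are irrelevant.) -/
structure Tilt where
  /-- the functional `𝓕` -/
  toFun : Measure (Space d × ℝ) → ℝ
  /-- its derivative `ρ ↦ D𝓕(ρ)` -/
  deriv : Measure (Space d × ℝ) → Space d × ℝ → ℝ
  continuousOn_deriv : ∀ ρ, S.IsNodeProb ρ → ContinuousOn (deriv ρ) S.nodes
  bounded_deriv : ∃ M : ℝ, ∀ ρ, S.IsNodeProb ρ → ∀ z ∈ S.nodes, |deriv ρ z| ≤ M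
  hasDeriv : ∀ ρ, S.IsNodeProb ρ → ∀ ε > 0, ∃ δ > 0, ∀ ρ', S.IsNodeProb ρ' → tvDist ρ ρ' < δ →
    |toFun ρ' - toFun ρ - ((∫ z, deriv ρ z ∂ρ') - ∫ z, deriv ρ z ∂ρ)| ≤ ε * tvDist ρ ρ'
  continuous_deriv : ∀ ρ, S.IsNodeProb ρ → ∀ ε > 0, ∃ δ > 0, ∀ ρ', S.IsNodeProb ρ' →
    tvDist ρ ρ' < δ → ∀ z ∈ S.nodes, |deriv ρ' z - deriv ρ z| ≤ ε
  lipschitz_deriv : ∃ L : ℝ, ∀ ρ, S.IsNodeProb ρ → ∀ x ∈ S.Ω, ∀ x' ∈ S.Ω, ∀ y ∈ S.Υ,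
    |deriv ρ (x, y) - deriv ρ (x', y)| ≤ L * ‖x - x'‖

/-- The contribution of the well `y` at time `t` to the weak continuity equation:
`∫ ∂ₜφ(t,x) ρ(t,dx,y) + ∫ ∇ₓφ(t,x) · jˣ(t,dx,y)`. -/
def wellTerm (ρ : ℝ → Measure (Space d × ℝ)) (j : Flux d) (y : ℝ) (φ : ℝ × Space d → ℝ)
    (t : ℝ) : ℝ :=
  (∫ z in univ ×ˢ {y}, fderiv ℝ φ (t, z.1) (1, 0) ∂(ρ t)) +
    ∑ i : Fin d, sintegral ((j.jx t i).restrict (univ ×ˢ {y}))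
      (fun z => fderiv ℝ φ (t, z.1) (0, EuclideanSpace.single i 1))

/-- Admissible test functions: `C¹` with compact support in `(0,T) × ℝ^d`. -/
def IsTest (T : ℝ) (φ : ℝ × Space d → ℝ) : Prop :=
  ContDiff ℝ 1 φ ∧ HasCompactSupport φ ∧ tsupport φ ⊆ Ioo 0 T ×ˢ univ

/-- The contracted continuity equation on `[0,T]`. A test function on `(0,T) × ℝ^d × {a,b}` is a
pair `φa, φb` of test functions on `(0,T) × ℝ^d`. -/
structure ContractedCE (T : ℝ) (ρ : ℝ → Measure (Space d × ℝ)) (j : Flux d) : Prop where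
  /-- `ρ(t)` is a probability measure on `Ω × Υ` -/
  prob : ∀ t ∈ Icc 0 T, S.IsNodeProb (ρ t)
  /-- `t ↦ ρ(t)` is narrowly continuous -/
  narrow : ∀ φ : BoundedContinuousFunction (Space d × ℝ) ℝ,
    ContinuousOn (fun t => ∫ z, φ z ∂(ρ t)) (Icc 0 T)
  /-- `jˣ(t)` lives on `Ω × Υ` -/
  supp_jx : ∀ t ∈ Icc 0 T, ∀ i, (j.jx t i).totalVariation S.nodesᶜ = 0
  /-- `j̄(t)` lives on `Ω` -/
  supp_jbar : ∀ t ∈ Icc 0 T, (j.jbar t).totalVariation S.Ωᶜ = 0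
  /-- `t ↦ jˣ(t)` is measurable -/
  meas_jx : ∀ i, ∀ φ : BoundedContinuousFunction (Space d × ℝ) ℝ,
    AEMeasurable (fun t => sintegral (j.jx t i) φ) (volume.restrict (Icc 0 T))
  /-- `t ↦ j̄(t)` is measurable -/
  meas_jbar : ∀ φ : BoundedContinuousFunction (Space d) ℝ,
    AEMeasurable (fun t => sintegral (j.jbar t) φ) (volume.restrict (Icc 0 T))
  /-- the space-time flux `jˣ` has finite total variation -/
  finite_jx : ∀ i, ∫⁻ t in Icc 0 T, (j.jx t i).totalVariation univ < ⊤
  /-- the space-time flux `j̄` has finite total variation -/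
  finite_jbar : ∫⁻ t in Icc 0 T, (j.jbar t).totalVariation univ < ⊤
  /-- the weak form of the equation -/
  weak : ∀ φa φb : ℝ × Space d → ℝ, IsTest T φa → IsTest T φb →
    (∫ t in Icc 0 T, (wellTerm ρ j S.a φa t + wellTerm ρ j S.b φb t)) +
      ∫ t in Icc 0 T, sintegral (j.jbar t) (fun x => φb (t, x) - φa (t, x)) = 0

/-- The tilted limiting energy `RelEnt(ρ|π₀) + 𝓕(ρ)`. -/
def energy (F : S.Tilt) (ρ : Measure (Space d × ℝ)) : EReal :=
  ((InformationTheory.klDiv ρ S.π₀ : ℝ≥0∞) : EReal) + ((F.toFun ρ : ℝ) : EReal)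

/-- The tilted density `u^𝓕 = (dρ/dπ₀) e^{D𝓕(ρ)}`. -/
def tiltedDensity (F : S.Tilt) (ρ : Measure (Space d × ℝ)) (x : Space d) (y : ℝ) : ℝ :=
  (ρ.rnDeriv S.π₀ (x, y)).toReal * Real.exp (F.deriv ρ (x, y))

/-- The rate `σ(x; ρ, 𝓕) = (m_Υ / |Ω|) e^{-D𝓕(ρ)(x,c)} √(u^𝓕(x,a) u^𝓕(x,b))`. -/
def sigma (F : S.Tilt) (ρ : Measure (Space d × ℝ)) (x : Space d) : ℝ :=
  S.mΥ / S.volΩ * Real.exp (-F.deriv ρ (x, S.c)) *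
    Real.sqrt (S.tiltedDensity F ρ x S.a * S.tiltedDensity F ρ x S.b)

/-- `∫_Ω e^{-D𝓕(ρ)(x,y)} |∇ₓ √u^𝓕(x,y)|² dx` for fixed `y`, equal to `+∞` if `√u^𝓕(·,y)` is not
weakly differentiable. (The weak gradient is unique up to null sets, so that the infimum is over a
set with at most one element.) -/
def fisher (F : S.Tilt) (ρ : Measure (Space d × ℝ)) (y : ℝ) : ℝ≥0∞ :=
  ⨅ (g : Space d → Space d)
    (_ : IsWeakGradient S.Ω (fun x => Real.sqrt (S.tiltedDensity F ρ x y)) g),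
    ∫⁻ x in S.Ω, ENNReal.ofReal (Real.exp (-F.deriv ρ (x, y)) * ‖g x‖ ^ 2)

/-- The integrand in time of the limiting dissipation functional, for absolutely continuous
`ρ ≪ π₀`, `jˣ ≪ ρ`, `j̄ ≪ dx`. -/
def dissipationRate (F : S.Tilt) (ρ : Measure (Space d × ℝ))
    (jx : Fin d → SignedMeasure (Space d × ℝ)) (jbar : SignedMeasure (Space d)) : ℝ≥0∞ :=
  (∫⁻ z, ENNReal.ofReal (1 / (2 * S.mΩ) * ∑ i, ((jx i).rnDeriv ρ z) ^ 2) ∂ρ) +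
  ENNReal.ofReal (2 * S.mΩ) *
    (ENNReal.ofReal S.γa * S.fisher F ρ S.a + ENNReal.ofReal S.γb * S.fisher F ρ S.b) +
  ∫⁻ x in S.Ω,
    (perspC (jbar.rnDeriv (volume.restrict S.Ω) x) (S.sigma F ρ x) +
      ENNReal.ofReal (2 * (S.mΥ / S.volΩ) * Real.exp (-F.deriv ρ (x, S.c)) *
        (Real.sqrt (S.tiltedDensity F ρ x S.b) - Real.sqrt (S.tiltedDensity F ρ x S.a)) ^ 2))

open Classical in
/-- The limiting dissipation functional `𝓓₀ᵀ(ρ, j; 𝓕)`. -/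
def dissipation (F : S.Tilt) (T : ℝ) (ρ : ℝ → Measure (Space d × ℝ)) (j : Flux d) : ℝ≥0∞ :=
  if S.ContractedCE T ρ j ∧
      (∀ᵐ t ∂(volume.restrict (Icc 0 T)),
        ρ t ≪ S.π₀ ∧ (∀ i, (j.jx t i).totalVariation ≪ ρ t) ∧
          (j.jbar t).totalVariation ≪ volume.restrict S.Ω)
  then ∫⁻ t in Icc 0 T, S.dissipationRate F (ρ t) (j.jx t) (j.jbar t)
  else ⊤

/-- The limiting energy-dissipation functional
`𝓘₀(ρ, j; 𝓕) = 𝓔₀^𝓕(ρ(T)) - 𝓔₀^𝓕(ρ(0)) + 𝓓₀ᵀ(ρ, j; 𝓕)`. -/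
def edpFunctional (F : S.Tilt) (T : ℝ) (ρ : ℝ → Measure (Space d × ℝ)) (j : Flux d) : EReal :=
  S.energy F (ρ T) - S.energy F (ρ 0) + ((S.dissipation F T ρ j : ℝ≥0∞) : EReal)

end Setting

end Kramers

end

/-! Write `u` for the density of `ρ` with respect to `π₀`, `J` for the density of the spatial flux
divided by the weight of the well, and `r` for the density of the jump flux. Formally, the energy
changes at the rate `∑_w γ_w ∫ ∇(log u_w + D𝓕) · J_w + ∫ (log u^𝓕_b - log u^𝓕_a) r`. With `J = v u`
and `u ∇ log u^𝓕 = 2 √u^𝓕 ∇√u^𝓕 e^{-D𝓕}`, Young's inequality with weight `m_Ω` bounds the first sum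
by the two diffusive terms of the dissipation. The second is bounded by Fenchel-Young duality for
`C` and its conjugate `4 (cosh (ξ/2) - 1)`: at `ξ = log u^𝓕_b - log u^𝓕_a`, the conjugate weighted
by `σ` is exactly the term with `(√u^𝓕_b - √u^𝓕_a)²`. Both bounds hold for the absolute value of the
rate, hence the two-sided estimate (`abs_limitRate_zero_le`).

The work lies in the chain rule, because `u` is neither smooth nor bounded away from zero and the
equation holds only weakly. The state is mollified in space by the product over the coordinates of
the Neumann reflections of normalized kernels `(1 + cos θ)^N`. These kernels are positive, symmetric
and of mass one. They have finite rank (`isSeparated_kernel`), so the mollified curve is described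
by finitely many moments, absolutely continuous in time. Their derivative in one variable is minus
the derivative of a Dirichlet kernel in the other (`fderiv_kernel_none`). Thus the gradient of a
Neumann regularization is the Dirichlet regularization of the gradient, without boundary terms
(`HasWeakDeriv.fderiv_op`). Finally the Dirichlet kernels are dominated by the Neumann ones, so
Cauchy-Schwarz bounds such as `J² ≤ u W` survive regularization (`op_sq_le`).

With the entropy density shifted to `klFun (u + δ)`, the energy is differentiable along the
mollified curve, which yields an exact energy balance (`freeEnergy_sub_eq_integral`,
`freeEnergy_mollify_sub_eq_integral`). At almost every time of finite dissipation the rate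
converges, first as `N → ∞` and then as `δ → 0`, to the formal rate above
(`Regular.tendsto_mollRate`, `Regular.tendsto_limitRate`). It is bounded by an affine function of
the dissipation rate, uniformly in `N` and `δ` (`exists_abs_mollRate_le`). Integration in time uses
a reverse Fatou lemma, since the rates are not known to be measurable in time.

The end point `ρ(T)` is not assumed to have finite energy. The balance at `δ = 1` bounds the
entropies of its mollifications, which gives uniform integrability, hence absolute continuity and
finite entropy (`absolutelyContinuous_and_integrableOn_klFun`). Afterwards the two energies are
limits of the regularized ones (`enorm_freeEnergy_sub_le`). -/

namespace Kramers

/-! ### A positive even trigonometric kernel on the circle -/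

/-- The positive, even, `2π`-periodic kernel `(1 + cos θ)^N`, normalized on `[-π, π]`. -/
noncomputable def cosKernel (N : ℕ) (θ : ℝ) : ℝ :=
  (∫ τ in (-Real.pi)..Real.pi, (1 + Real.cos τ) ^ N)⁻¹ * (1 + Real.cos θ) ^ N

lemma one_add_cos_nonneg (θ : ℝ) : 0 ≤ 1 + Real.cos θ := by linarith [Real.neg_one_le_cos θ]

lemma integral_one_add_cos_pow_pos (N : ℕ) :
    0 < ∫ τ in (-Real.pi)..Real.pi, (1 + Real.cos τ) ^ N := by
  have hpi := Real.pi_pos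
  refine intervalIntegral.integral_pos (by linarith) (by fun_prop)
    (fun x _ => pow_nonneg (one_add_cos_nonneg x) N) ⟨0, ⟨by linarith, hpi.le⟩, ?_⟩
  simp only [Real.cos_zero]
  positivity

lemma cosKernel_nonneg (N : ℕ) (θ : ℝ) : 0 ≤ cosKernel N θ :=
  mul_nonneg (inv_nonneg.2 (integral_one_add_cos_pow_pos N).le)
    (pow_nonneg (one_add_cos_nonneg θ) N)

lemma cosKernel_neg (N : ℕ) (θ : ℝ) : cosKernel N (-θ) = cosKernel N θ := by
  simp [cosKernel]

lemma cosKernel_add_two_pi (N : ℕ) (θ : ℝ) : cosKernel N (θ + 2 * Real.pi) = cosKernel N θ := by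
  simp [cosKernel]

lemma contDiff_cosKernel (N : ℕ) : ContDiff ℝ ∞ (cosKernel N) := by
  unfold cosKernel
  exact contDiff_const.mul ((contDiff_const.add Real.contDiff_cos).pow N)

@[fun_prop]
lemma continuous_cosKernel (N : ℕ) : Continuous (cosKernel N) := (contDiff_cosKernel N).continuous

lemma integral_cosKernel (N : ℕ) : ∫ θ in (-Real.pi)..Real.pi, cosKernel N θ = 1 := by
  unfold cosKernel
  rw [intervalIntegral.integral_const_mul]
  exact inv_mul_cancel₀ (integral_one_add_cos_pow_pos N).ne'

/-- The spread of `cosKernel N`. -/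
noncomputable def cosKernelSpread (N : ℕ) : ℝ :=
  ∫ θ in (-Real.pi)..Real.pi, cosKernel N θ * (1 - Real.cos θ)

/-- On `[-π, π]` the function `1 + cos θ` has its only maximum at `0`, so its normalized powers
concentrate there, and `1 - cos θ` vanishes at that point. -/
lemma tendsto_cosKernelSpread : Tendsto cosKernelSpread atTop (𝓝 0) := by
  have hpi := Real.pi_pos
  have h := tendsto_setIntegral_pow_smul_of_unique_maximum_of_isCompact_of_continuousOn
    (μ := (volume : Measure ℝ)) (s := Icc (-Real.pi) Real.pi) (x₀ := (0 : ℝ)) isCompact_Icc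
    (c := fun θ => 1 + Real.cos θ) (g := fun θ => 1 - Real.cos θ) (by fun_prop) ?_
    (fun x _ => one_add_cos_nonneg x) (by simp) ?_ (by fun_prop)
  · simp only [Real.cos_zero, sub_self] at h
    refine h.congr fun N => ?_
    simp only [cosKernelSpread, cosKernel, smul_eq_mul]
    rw [intervalIntegral.integral_of_le (by linarith), intervalIntegral.integral_of_le (by linarith),
      integral_Icc_eq_integral_Ioc, integral_Icc_eq_integral_Ioc, ← integral_const_mul]
    simp only [mul_assoc]
  · intro y hy hy0
    simp only [Real.cos_zero]
    have : Real.cos y < 1 := by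
      refine lt_of_le_of_ne (Real.cos_le_one y) fun hc => hy0 ?_
      exact (Real.cos_eq_one_iff_of_lt_of_lt (by linarith [hy.1]) (by linarith [hy.2])).1 hc
    linarith
  · rw [closure_interior_Icc (by linarith)]
    exact ⟨by linarith, hpi.le⟩

/-- Unfolding the reflection: `t ↦ -t` turns the half with `s + t` into an integral over `[-π, 0]`,
and periodicity allows the translation by `s`. Composing `G` with the cosine provides the evenness
and periodicity that both steps need. -/
lemma integral_cosKernel_fold (N : ℕ) (s : ℝ) {G : ℝ → ℝ} (hG : Continuous G) :
    ∫ t in (0:ℝ)..Real.pi, (cosKernel N (s - t) + cosKernel N (s + t)) * G (Real.cos t) =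
      ∫ τ in (-Real.pi)..Real.pi, cosKernel N τ * G (Real.cos (s - τ)) := by
  have h1 : ∫ t in (-Real.pi)..0, cosKernel N (s - t) * G (Real.cos t) =
      ∫ t in (0:ℝ)..Real.pi, cosKernel N (s + t) * G (Real.cos t) := by
    have := intervalIntegral.integral_comp_neg (a := 0) (b := Real.pi)
      (fun t => cosKernel N (s - t) * G (Real.cos t))
    simp only [sub_neg_eq_add, Real.cos_neg, neg_zero] at this
    exact this.symm
  have h2 : ∫ t in (-Real.pi)..Real.pi, cosKernel N (s - t) * G (Real.cos t) =
      ∫ τ in (-Real.pi)..Real.pi, cosKernel N τ * G (Real.cos (s - τ)) := by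
    set H : ℝ → ℝ := fun t => cosKernel N (s - t) * G (Real.cos t) with hH
    have hper : Function.Periodic H (2 * Real.pi) := by
      intro t
      simp only [hH]
      rw [show s - (t + 2 * Real.pi) = s - t - 2 * Real.pi by ring, Real.cos_add_two_pi,
        ← cosKernel_add_two_pi N (s - t - 2 * Real.pi)]
      congr 2
      ring
    have e1 := intervalIntegral.integral_comp_sub_left (a := -Real.pi) (b := Real.pi) H s
    have e2 := hper.intervalIntegral_add_eq (-Real.pi) (s - Real.pi)
    rw [show -Real.pi + 2 * Real.pi = Real.pi by ring,
      show s - Real.pi + 2 * Real.pi = s - -Real.pi by ring] at e2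
    rw [e2, ← e1]
    simp [hH]
  have hi : ∀ a b : ℝ, IntervalIntegrable (fun t => cosKernel N (s - t) * G (Real.cos t))
      volume a b := fun a b => by
    apply Continuous.intervalIntegrable
    fun_prop
  rw [← h2, ← intervalIntegral.integral_add_adjacent_intervals (hi _ 0) (hi _ _), h1,
    ← intervalIntegral.integral_add]
  · congr 1
    ext t
    ring
  · apply Continuous.intervalIntegrable
    fun_prop
  · apply Continuous.intervalIntegrable
    fun_prop

/-! ### The Neumann and Dirichlet kernels on an interval -/

/-- The affine map of `[l, h]` onto `[0, π]`. -/
noncomputable def angle (l h x : ℝ) : ℝ := Real.pi / (h - l) * x - Real.pi / (h - l) * l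

lemma angle_left (l h : ℝ) : angle l h l = 0 := by simp [angle]

lemma angle_right {l h : ℝ} (hlh : l < h) : angle l h h = Real.pi := by
  have : h - l ≠ 0 := by linarith
  unfold angle
  field_simp

lemma contDiff_angle (l h : ℝ) : ContDiff ℝ ∞ (angle l h) := by
  unfold angle; fun_prop

@[fun_prop]
lemma continuous_angle (l h : ℝ) : Continuous (angle l h) := (contDiff_angle l h).continuous

lemma strictMono_angle {l h : ℝ} (hlh : l < h) : StrictMono (angle l h) := by
  intro x y hxy
  have : 0 < Real.pi / (h - l) := div_pos Real.pi_pos (by linarith)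
  simp only [angle]
  nlinarith

lemma angle_mem_Icc {l h x : ℝ} (hlh : l < h) (hx : x ∈ Icc l h) :
    angle l h x ∈ Icc 0 Real.pi := by
  have := (strictMono_angle hlh).monotone
  exact ⟨angle_left l h ▸ this hx.1, angle_right hlh ▸ this hx.2⟩

lemma angle_mem_Ioo {l h x : ℝ} (hlh : l < h) (hx : x ∈ Ioo l h) :
    angle l h x ∈ Ioo 0 Real.pi := by
  have := strictMono_angle hlh
  exact ⟨angle_left l h ▸ this hx.1, angle_right hlh ▸ this hx.2⟩

lemma integral_comp_angle {l h : ℝ} (hlh : l < h) (F : ℝ → ℝ) :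
    ∫ x in Icc l h, Real.pi / (h - l) * F (angle l h x) = ∫ t in (0:ℝ)..Real.pi, F t := by
  have hc : Real.pi / (h - l) ≠ 0 := (div_pos Real.pi_pos (by linarith)).ne'
  rw [integral_Icc_eq_integral_Ioc, ← intervalIntegral.integral_of_le hlh.le,
    intervalIntegral.integral_const_mul]
  have := intervalIntegral.integral_comp_mul_sub (a := l) (b := h) F hc (Real.pi / (h - l) * l)
  have e1 : Real.pi / (h - l) * l - Real.pi / (h - l) * l = 0 := by ring
  have e2 : Real.pi / (h - l) * h - Real.pi / (h - l) * l = Real.pi := angle_right hlh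
  rw [e1, e2] at this
  simp only [angle]
  rw [this, smul_eq_mul, mul_inv_cancel_left₀ hc]

/-- The Neumann kernel (`neumann1`) is the even reflection of `cosKernel`. -/
noncomputable def neumann1 (l h : ℝ) (N : ℕ) (x y : ℝ) : ℝ :=
  Real.pi / (h - l) * (cosKernel N (angle l h x - angle l h y) +
    cosKernel N (angle l h x + angle l h y))

/-- The Dirichlet kernel (`dirichlet1`) is the odd reflection of `cosKernel`. -/
noncomputable def dirichlet1 (l h : ℝ) (N : ℕ) (x y : ℝ) : ℝ :=
  Real.pi / (h - l) * (cosKernel N (angle l h x - angle l h y) -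
    cosKernel N (angle l h x + angle l h y))

section

variable {l h : ℝ} (hlh : l < h) (N : ℕ)

lemma cosKernel_sub_comm (a b : ℝ) : cosKernel N (a - b) = cosKernel N (b - a) := by
  rw [← cosKernel_neg, neg_sub]

lemma neumann1_comm (x y : ℝ) : neumann1 l h N x y = neumann1 l h N y x := by
  simp only [neumann1]
  rw [cosKernel_sub_comm, add_comm (angle l h x) (angle l h y)]

lemma dirichlet1_comm (x y : ℝ) : dirichlet1 l h N x y = dirichlet1 l h N y x := by
  simp only [dirichlet1]
  rw [cosKernel_sub_comm, add_comm (angle l h x) (angle l h y)]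

include hlh in
lemma neumann1_nonneg (x y : ℝ) : 0 ≤ neumann1 l h N x y :=
  mul_nonneg (div_pos Real.pi_pos (by linarith)).le
    (add_nonneg (cosKernel_nonneg _ _) (cosKernel_nonneg _ _))

include hlh in
-- The difference of two nonnegative numbers is at most their sum. Through this domination all
-- estimates for Dirichlet kernels reduce to the positive kernels of mass one.
lemma abs_dirichlet1_le (x y : ℝ) : |dirichlet1 l h N x y| ≤ neumann1 l h N x y := by
  have h0 : 0 ≤ Real.pi / (h - l) := (div_pos Real.pi_pos (by linarith)).le
  rw [dirichlet1, neumann1, abs_mul, abs_of_nonneg h0]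
  refine mul_le_mul_of_nonneg_left ?_ h0
  rw [abs_le]
  constructor <;> linarith [cosKernel_nonneg N (angle l h x - angle l h y),
    cosKernel_nonneg N (angle l h x + angle l h y)]

lemma dirichlet1_left (x : ℝ) : dirichlet1 l h N x l = 0 := by
  simp [dirichlet1, angle_left]

include hlh in
-- At angle `π` the two arguments of the kernel differ by a full period.
lemma dirichlet1_right (x : ℝ) : dirichlet1 l h N x h = 0 := by
  simp only [dirichlet1, angle_right hlh]
  rw [← cosKernel_add_two_pi N (angle l h x - Real.pi)]
  ring_nf

lemma contDiff_neumann1 (x : ℝ) : ContDiff ℝ ∞ (neumann1 l h N x) := by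
  unfold neumann1
  exact contDiff_const.mul
    (((contDiff_cosKernel N).comp (contDiff_const.sub (contDiff_angle l h))).add
      ((contDiff_cosKernel N).comp (contDiff_const.add (contDiff_angle l h))))

lemma contDiff_dirichlet1 (x : ℝ) : ContDiff ℝ ∞ (dirichlet1 l h N x) := by
  unfold dirichlet1
  exact contDiff_const.mul
    (((contDiff_cosKernel N).comp (contDiff_const.sub (contDiff_angle l h))).sub
      ((contDiff_cosKernel N).comp (contDiff_const.add (contDiff_angle l h))))

lemma continuous_neumann1 : Continuous (fun p : ℝ × ℝ => neumann1 l h N p.1 p.2) := by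
  unfold neumann1; fun_prop

lemma continuous_dirichlet1 : Continuous (fun p : ℝ × ℝ => dirichlet1 l h N p.1 p.2) := by
  unfold dirichlet1; fun_prop

lemma hasDerivAt_angle (x : ℝ) : HasDerivAt (angle l h) (Real.pi / (h - l)) x := by
  unfold angle
  exact (by simpa using (hasDerivAt_id x).const_mul (Real.pi / (h - l)) :
    HasDerivAt (fun y => Real.pi / (h - l) * y) (Real.pi / (h - l)) x).sub_const _

lemma hasDerivAt_cosKernel (θ : ℝ) : HasDerivAt (cosKernel N) (deriv (cosKernel N) θ) θ :=
  (((contDiff_cosKernel N).differentiable (by simp)) θ).hasDerivAt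

/-- The derivative of the Neumann kernel in one variable is, up to the sign, the derivative of the
Dirichlet kernel in the other one. -/
lemma deriv_neumann1_eq (x y : ℝ) :
    deriv (neumann1 l h N x) y = - deriv (dirichlet1 l h N y) x := by
  have h1 : HasDerivAt (neumann1 l h N x)
      (Real.pi / (h - l) * (deriv (cosKernel N) (angle l h x - angle l h y) * -(Real.pi / (h - l)) +
        deriv (cosKernel N) (angle l h x + angle l h y) * (Real.pi / (h - l)))) y := by
    unfold neumann1
    exact (((hasDerivAt_cosKernel N _).comp y ((hasDerivAt_angle y).const_sub _)).add
      ((hasDerivAt_cosKernel N _).comp y ((hasDerivAt_angle y).const_add _))).const_mul _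
  have h2 : HasDerivAt (fun x => dirichlet1 l h N x y)
      (Real.pi / (h - l) * (deriv (cosKernel N) (angle l h x - angle l h y) * (Real.pi / (h - l)) -
        deriv (cosKernel N) (angle l h x + angle l h y) * (Real.pi / (h - l)))) x := by
    unfold dirichlet1
    exact (((hasDerivAt_cosKernel N _).comp x ((hasDerivAt_angle x).sub_const _)).sub
      ((hasDerivAt_cosKernel N _).comp x ((hasDerivAt_angle x).add_const _))).const_mul _
  have h3 : (fun x => dirichlet1 l h N x y) = dirichlet1 l h N y := by
    ext x; exact dirichlet1_comm N x y
  rw [h3] at h2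
  rw [h1.deriv, h2.deriv]
  ring

include hlh in
lemma integral_neumann1_mul (x : ℝ) {G : ℝ → ℝ} (hG : Continuous G) :
    ∫ y in Icc l h, neumann1 l h N x y * G (Real.cos (angle l h y)) =
      ∫ τ in (-Real.pi)..Real.pi, cosKernel N τ * G (Real.cos (angle l h x - τ)) := by
  rw [← integral_cosKernel_fold N (angle l h x) hG, ← integral_comp_angle hlh]
  simp only [neumann1, mul_assoc]

include hlh in
lemma integral_neumann1 (x : ℝ) : ∫ y in Icc l h, neumann1 l h N x y = 1 := by
  have := integral_neumann1_mul hlh N x (G := fun _ => 1) continuous_const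
  simpa [integral_cosKernel] using this

include hlh in
-- After unfolding, the integrand is a difference of cosines at angles `s` and `s - τ`, which is at
-- most the chord `|1 - e^{iτ}|`.
lemma integral_neumann1_mul_sq_le (x : ℝ) :
    ∫ y in Icc l h, neumann1 l h N x y * (Real.cos (angle l h x) - Real.cos (angle l h y)) ^ 2 ≤
      2 * cosKernelSpread N := by
  have hpi := Real.pi_pos
  rw [integral_neumann1_mul hlh N x (G := fun c => (Real.cos (angle l h x) - c) ^ 2) (by fun_prop),
    cosKernelSpread, ← intervalIntegral.integral_const_mul]
  refine intervalIntegral.integral_mono_on (by linarith)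
    (Continuous.intervalIntegrable (by fun_prop) _ _)
    (Continuous.intervalIntegrable (by fun_prop) _ _) fun τ _ => ?_
  -- The squared chord is `2 (1 - cos τ)`; the square passed to `nlinarith` is its discarded
  -- imaginary part.
  have key : (Real.cos (angle l h x) - Real.cos (angle l h x - τ)) ^ 2 ≤ 2 * (1 - Real.cos τ) := by
    have h1 := Real.sin_sq_add_cos_sq (angle l h x)
    have h2 := Real.sin_sq_add_cos_sq τ
    rw [Real.cos_sub]
    set a := Real.cos (angle l h x)
    set b := Real.sin (angle l h x)
    nlinarith [sq_nonneg (b * (1 - Real.cos τ) + a * Real.sin τ)]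
  calc _ ≤ cosKernel N τ * (2 * (1 - Real.cos τ)) :=
        mul_le_mul_of_nonneg_left key (cosKernel_nonneg N τ)
    _ = _ := by ring

include hlh in
-- The difference is twice the reflected kernel, evaluated at `s + t` with `s` in the open interval
-- `(0, π)` and `t ∈ [0, π]`. These angles stay away from the multiples of `2π`, so `1 - cos (s +
-- t)` has a positive minimum `c`, and the mass there is at most the spread divided by `c`.
lemma tendsto_integral_neumann1_sub_dirichlet1 {x : ℝ} (hx : x ∈ Ioo l h) :
    Tendsto (fun N => ∫ y in Icc l h, (neumann1 l h N x y - dirichlet1 l h N x y)) atTop (𝓝 0) := by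
  have hpi := Real.pi_pos
  set s := angle l h x with hs
  have hs0 : s ∈ Ioo 0 Real.pi := angle_mem_Ioo hlh hx
  obtain ⟨t₀, ht₀, hmin⟩ := isCompact_Icc.exists_isMinOn (s := Icc 0 Real.pi)
    (f := fun t => 1 - Real.cos (s + t)) ⟨0, le_rfl, hpi.le⟩ (by fun_prop)
  set c := 1 - Real.cos (s + t₀) with hc
  have hc0 : 0 < c := by
    have : Real.cos (s + t₀) ≠ 1 := by
      intro h1
      have := (Real.cos_eq_one_iff_of_lt_of_lt (x := s + t₀)
        (by linarith [hs0.1, ht₀.1]) (by linarith [hs0.2, ht₀.2])).1 h1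
      linarith [hs0.1, ht₀.1]
    have := lt_of_le_of_ne (Real.cos_le_one (s + t₀)) this
    linarith
  have e1 : ∀ N, ∫ y in Icc l h, (neumann1 l h N x y - dirichlet1 l h N x y) =
      ∫ t in (0:ℝ)..Real.pi, 2 * cosKernel N (s + t) := fun N => by
    rw [← integral_comp_angle hlh]
    congr 1
    ext y
    simp only [neumann1, dirichlet1]
    ring
  have e2 : ∀ N, ∫ t in (0:ℝ)..Real.pi, cosKernel N (s + t) * (1 - Real.cos (s + t)) ≤
      cosKernelSpread N := fun N => by
    set H : ℝ → ℝ := fun t => cosKernel N t * (1 - Real.cos t) with hH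
    have hHn : ∀ t, 0 ≤ H t := fun t => mul_nonneg (cosKernel_nonneg _ _)
      (by linarith [Real.cos_le_one t])
    have hHc : Continuous H := by fun_prop
    have hper : Function.Periodic H (2 * Real.pi) := fun t => by
      simp only [hH, cosKernel_add_two_pi, Real.cos_add_two_pi]
    have a1 := intervalIntegral.integral_comp_add_left (a := 0) (b := Real.pi) H s
    have a2 := hper.intervalIntegral_add_eq (-Real.pi) s
    rw [show -Real.pi + 2 * Real.pi = Real.pi by ring] at a2
    change ∫ t in (0:ℝ)..Real.pi, H (s + t) ≤ _
    rw [a1, cosKernelSpread, a2, add_zero,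
      ← intervalIntegral.integral_add_adjacent_intervals (a := s) (b := s + Real.pi)
        (c := s + 2 * Real.pi) (hHc.intervalIntegrable _ _) (hHc.intervalIntegrable _ _)]
    have := intervalIntegral.integral_nonneg (a := s + Real.pi) (b := s + 2 * Real.pi)
      (by linarith) (fun t _ => hHn t) (μ := volume)
    linarith
  have e3 : ∀ N, ∫ y in Icc l h, (neumann1 l h N x y - dirichlet1 l h N x y) ≤
      2 / c * cosKernelSpread N := fun N => by
    rw [e1]
    calc _ ≤ ∫ t in (0:ℝ)..Real.pi, 2 / c * (cosKernel N (s + t) * (1 - Real.cos (s + t))) := by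
          refine intervalIntegral.integral_mono_on hpi.le
            (Continuous.intervalIntegrable (by fun_prop) _ _)
            (Continuous.intervalIntegrable (by fun_prop) _ _) fun t ht => ?_
          have h1 : c ≤ 1 - Real.cos (s + t) := hmin ht
          have h2 := cosKernel_nonneg N (s + t)
          rw [div_mul_eq_mul_div, le_div_iff₀ hc0]
          nlinarith [mul_le_mul_of_nonneg_left h1 h2]
      _ ≤ _ := by
          rw [intervalIntegral.integral_const_mul]
          exact mul_le_mul_of_nonneg_left (e2 N) (by positivity)
  refine squeeze_zero (fun N => ?_) e3 (by simpa using tendsto_cosKernelSpread.const_mul (2 / c))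
  refine setIntegral_nonneg measurableSet_Icc fun y _ => ?_
  have := abs_le.1 (abs_dirichlet1_le hlh N x y)
  linarith

end


/-! ### The box `Ω` -/

namespace Setting

variable {d : ℕ} (S : Setting d)

lemma Ω_eq_preimage : S.Ω = (MeasurableEquiv.toLp 2 (Fin d → ℝ)).symm ⁻¹'
    (Set.pi univ fun i => Icc (S.lo i) (S.hi i)) := by
  ext x
  simp [Ω, Set.mem_pi, -Set.pi_univ_Icc]

lemma isClosed_Ω : IsClosed S.Ω := by
  have : S.Ω = ⋂ i, {x : Space d | x i ∈ Icc (S.lo i) (S.hi i)} := by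
    ext x; simp [Ω]
  rw [this]
  refine isClosed_iInter fun i => isClosed_Icc.preimage ?_
  fun_prop

lemma measurableSet_Ω : MeasurableSet S.Ω := S.isClosed_Ω.measurableSet

lemma isCompact_Ω : IsCompact S.Ω := by
  have h : IsCompact (Set.pi univ fun i => Icc (S.lo i) (S.hi i)) :=
    isCompact_univ_pi fun i => isCompact_Icc
  have e : S.Ω = (WithLp.toLp 2) '' (Set.pi univ fun i => Icc (S.lo i) (S.hi i)) := by
    ext x
    constructor
    · intro hx
      exact ⟨WithLp.ofLp x, fun i _ => hx i, by simp⟩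
    · rintro ⟨y, hy, rfl⟩ i
      exact hy i (mem_univ i)
  rw [e]
  exact h.image (PiLp.continuous_toLp 2 _)

lemma convex_Ω : Convex ℝ S.Ω := by
  intro x hx y hy a b ha hb hab i
  have := convex_Icc (S.lo i) (S.hi i) (hx i) (hy i) ha hb hab
  simpa using this

lemma interior_Ω : interior S.Ω = {x | ∀ i, x i ∈ Ioo (S.lo i) (S.hi i)} := by
  have e : S.Ω = (PiLp.homeomorph 2 (fun _ : Fin d => ℝ)) ⁻¹'
    (Set.pi univ fun i => Icc (S.lo i) (S.hi i)) := by
    ext x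
    simp [Ω, PiLp.homeomorph, Set.mem_pi, -Set.pi_univ_Icc]
  rw [e, ← Homeomorph.preimage_interior, interior_pi_set finite_univ]
  ext x
  simp [PiLp.homeomorph]

/-- The boundary of a convex set is a null set; weak gradients live in the interior, the dissipation
integrals on the closed box. -/
lemma restrict_interior_Ω :
    (volume : Measure (Space d)).restrict (interior S.Ω) = volume.restrict S.Ω :=
  Measure.restrict_congr_set (interior_ae_eq_of_null_frontier (S.convex_Ω.addHaar_frontier _))

lemma ae_mem_interior_Ω : ∀ᵐ x ∂(volume : Measure (Space d)).restrict S.Ω, x ∈ interior S.Ω := by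
  rw [← S.restrict_interior_Ω]
  exact ae_restrict_mem isOpen_interior.measurableSet

instance isFiniteMeasure_restrict_Ω :
    IsFiniteMeasure ((volume : Measure (Space d)).restrict S.Ω) :=
  ⟨by simpa using S.isCompact_Ω.measure_lt_top⟩

lemma integral_Ω_prod (f : Fin d → ℝ → ℝ) :
    ∫ x in S.Ω, ∏ j, f j (x j) = ∏ j, ∫ t in Icc (S.lo j) (S.hi j), f j t := by
  have h1 := (EuclideanSpace.volume_preserving_symm_measurableEquiv_toLp (Fin d)).setIntegral_preimage_emb
    (MeasurableEquiv.measurableEmbedding _) (fun y : Fin d → ℝ => ∏ j, f j (y j))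
    (Set.pi univ fun i => Icc (S.lo i) (S.hi i))
  rw [← S.Ω_eq_preimage] at h1
  have h2 : (volume : Measure (Fin d → ℝ)).restrict (Set.pi univ fun i => Icc (S.lo i) (S.hi i)) =
      Measure.pi fun i => (volume : Measure ℝ).restrict (Icc (S.lo i) (S.hi i)) :=
    Measure.restrict_pi_pi _ _
  rw [h2, integral_fintype_prod_eq_prod] at h1
  exact h1

end Setting

/-! ### Products of functions of one coordinate -/

section Tensor

variable {d : ℕ}

lemma contDiff_tensor {f : Fin d → ℝ → ℝ} (hf : ∀ j, ContDiff ℝ ∞ (f j)) :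
    ContDiff ℝ ∞ (fun x : Space d => ∏ j, f j (x j)) := by
  refine contDiff_prod fun j _ => (hf j).comp ?_
  fun_prop

lemma fderiv_tensor {f : Fin d → ℝ → ℝ} (hf : ∀ j, ContDiff ℝ ∞ (f j)) (i : Fin d) (x : Space d) :
    fderiv ℝ (fun x : Space d => ∏ j, f j (x j)) x (EuclideanSpace.single i 1) =
      ∏ j, (if j = i then deriv (f j) else f j) (x j) := by
  have hd : DifferentiableAt ℝ (fun x : Space d => ∏ j, f j (x j)) x :=
    ((contDiff_tensor hf).differentiable (by simp)) x
  have h1 : HasDerivAt (fun t : ℝ => ∏ j, f j ((x + t • EuclideanSpace.single i (1:ℝ)) j))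
      (fderiv ℝ (fun x : Space d => ∏ j, f j (x j)) x (EuclideanSpace.single i 1)) 0 :=
    hd.hasFDerivAt.hasLineDerivAt (EuclideanSpace.single i 1)
  -- Along the line through `x` in direction `i` only the factor `i` varies.
  have h2 : (fun t : ℝ => ∏ j, f j ((x + t • EuclideanSpace.single i (1:ℝ)) j)) =
      fun t : ℝ => f i (x i + t) * ∏ j ∈ Finset.univ.erase i, f j (x j) := by
    ext t
    rw [← Finset.mul_prod_erase _ _ (Finset.mem_univ i)]
    congr 1
    · simp
    · refine Finset.prod_congr rfl fun j hj => ?_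
      simp [Finset.ne_of_mem_erase hj]
  rw [h2] at h1
  have h3 : HasDerivAt (fun t : ℝ => f i (x i + t) * ∏ j ∈ Finset.univ.erase i, f j (x j))
      (deriv (f i) (x i) * ∏ j ∈ Finset.univ.erase i, f j (x j)) 0 := by
    refine HasDerivAt.mul_const ?_ _
    have : HasDerivAt (f i) (deriv (f i) (x i)) (x i + 0) := by
      rw [add_zero]
      exact ((hf i).differentiable (by simp) _).hasDerivAt
    simpa using this.comp_const_add (x i) 0
  rw [h1.unique h3, ← Finset.mul_prod_erase _ _ (Finset.mem_univ i)]
  congr 1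
  · simp
  · refine Finset.prod_congr rfl fun j hj => ?_
    simp [Finset.ne_of_mem_erase hj]

end Tensor

/-! ### Separated kernels -/

/-- A finite sum of products of smooth functions of one of the two variables. -/
def IsSeparated {d : ℕ} (k : Space d → Space d → ℝ) : Prop :=
  ∃ (n : ℕ) (A B : Fin n → Space d → ℝ), (∀ l, ContDiff ℝ ∞ (A l)) ∧ (∀ l, ContDiff ℝ ∞ (B l)) ∧
    ∀ x y, k x y = ∑ l, A l x * B l y

section Separated

variable {d : ℕ} {k k' : Space d → Space d → ℝ}

lemma isSeparated_of_fintype {ι : Type*} [Fintype ι] {A B : ι → Space d → ℝ}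
    (hA : ∀ l, ContDiff ℝ ∞ (A l)) (hB : ∀ l, ContDiff ℝ ∞ (B l))
    (hk : ∀ x y, k x y = ∑ l, A l x * B l y) : IsSeparated k := by
  let e := Fintype.equivFin ι
  refine ⟨_, fun l => A (e.symm l), fun l => B (e.symm l), fun l => hA _, fun l => hB _,
    fun x y => ?_⟩
  rw [hk, ← e.symm.sum_comp]

lemma isSeparated_mul_of_contDiff {a b : Space d → ℝ} (ha : ContDiff ℝ ∞ a) (hb : ContDiff ℝ ∞ b) :
    IsSeparated (fun x y => a x * b y) :=
  isSeparated_of_fintype (ι := Unit) (A := fun _ => a) (B := fun _ => b) (fun _ => ha) (fun _ => hb)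
    (by simp)

lemma isSeparated_const (c : ℝ) : IsSeparated (fun _ _ : Space d => c) := by
  simpa using isSeparated_mul_of_contDiff (d := d) (a := fun _ => c) (b := fun _ => 1)
    contDiff_const contDiff_const

lemma IsSeparated.add (h : IsSeparated k) (h' : IsSeparated k') :
    IsSeparated (fun x y => k x y + k' x y) := by
  obtain ⟨n, A, B, hA, hB, e⟩ := h
  obtain ⟨n', A', B', hA', hB', e'⟩ := h'
  refine isSeparated_of_fintype (ι := Fin n ⊕ Fin n') (A := Sum.elim A A') (B := Sum.elim B B')
    (by rintro (l | l) <;> simp [hA, hA']) (by rintro (l | l) <;> simp [hB, hB'])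
    (fun x y => ?_)
  simp [e, e']

lemma IsSeparated.mul (h : IsSeparated k) (h' : IsSeparated k') :
    IsSeparated (fun x y => k x y * k' x y) := by
  obtain ⟨n, A, B, hA, hB, e⟩ := h
  obtain ⟨n', A', B', hA', hB', e'⟩ := h'
  refine isSeparated_of_fintype (ι := Fin n × Fin n') (A := fun l x => A l.1 x * A' l.2 x)
    (B := fun l x => B l.1 x * B' l.2 x) (fun l => (hA _).mul (hA' _)) (fun l => (hB _).mul (hB' _))
    (fun x y => ?_)
  rw [e, e', Finset.sum_mul_sum, Fintype.sum_prod_type]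
  refine Finset.sum_congr rfl fun a _ => Finset.sum_congr rfl fun b _ => by ring

lemma IsSeparated.pow (h : IsSeparated k) (n : ℕ) : IsSeparated (fun x y => k x y ^ n) := by
  induction n with
  | zero => simpa using isSeparated_const (d := d) 1
  | succ n ih => simpa [pow_succ] using ih.mul h

lemma IsSeparated.const_mul (h : IsSeparated k) (c : ℝ) : IsSeparated (fun x y => c * k x y) :=
  (isSeparated_const c).mul h

lemma IsSeparated.prod {ι : Type*} {s : Finset ι} {k : ι → Space d → Space d → ℝ}
    (h : ∀ j, IsSeparated (k j)) : IsSeparated (fun x y => ∏ j ∈ s, k j x y) := by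
  classical
  induction s using Finset.induction_on with
  | empty => simpa using isSeparated_const (d := d) 1
  | insert a s ha ih => simpa [Finset.prod_insert ha] using (h a).mul ih

end Separated

/-! ### The kernels on the box -/

namespace Setting

variable {d : ℕ} (S : Setting d) (N : ℕ) (o : Option (Fin d)) (i : Fin d)

/-- The factor of `kernel` in the coordinate `j`. -/
noncomputable def kernelFactor (j : Fin d) (s t : ℝ) : ℝ :=
  if o = some j then dirichlet1 (S.lo j) (S.hi j) N s t else neumann1 (S.lo j) (S.hi j) N s t

/-- The product of the Neumann kernels in all coordinates, except that the factor in the coordinate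
`i` is the Dirichlet kernel if `o = some i`. -/
noncomputable def kernel (x y : Space d) : ℝ := ∏ j, S.kernelFactor N o j (x j) (y j)

lemma kernel_comm (x y : Space d) : S.kernel N o x y = S.kernel N o y x := by
  unfold kernel kernelFactor
  refine Finset.prod_congr rfl fun j _ => ?_
  split_ifs
  · exact dirichlet1_comm _ _ _
  · exact neumann1_comm _ _ _

lemma kernelFactor_none (j : Fin d) (s t : ℝ) :
    S.kernelFactor N none j s t = neumann1 (S.lo j) (S.hi j) N s t := by
  simp [kernelFactor]

lemma kernel_none_nonneg (x y : Space d) : 0 ≤ S.kernel N none x y :=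
  Finset.prod_nonneg fun j _ => by
    rw [kernelFactor_none]
    exact neumann1_nonneg (S.lo_lt_hi j) _ _ _

lemma abs_kernel_le (x y : Space d) : |S.kernel N o x y| ≤ S.kernel N none x y := by
  unfold kernel
  rw [Finset.abs_prod]
  refine Finset.prod_le_prod (fun _ _ => abs_nonneg _) fun j _ => ?_
  rw [kernelFactor_none, kernelFactor]
  split_ifs
  · exact abs_dirichlet1_le (S.lo_lt_hi j) _ _ _
  · rw [abs_of_nonneg (neumann1_nonneg (S.lo_lt_hi j) _ _ _)]

lemma contDiff_kernelFactor (j : Fin d) (s : ℝ) : ContDiff ℝ ∞ (S.kernelFactor N o j s) := by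
  unfold kernelFactor
  split_ifs
  · exact contDiff_dirichlet1 _ _
  · exact contDiff_neumann1 _ _

lemma contDiff_kernel (x : Space d) : ContDiff ℝ ∞ (S.kernel N o x) :=
  contDiff_tensor fun j => S.contDiff_kernelFactor N o j (x j)

/-- By the addition formulas `1 + cos (s ∓ t)` is a finite sum of products, and this property is
stable under sums, powers and products. The finite rank reduces the mollified evolution to finitely
many moments and makes interchanging derivatives and integrals a matter of finite sums. -/
lemma isSeparated_kernel : IsSeparated (S.kernel N o) := by
  have hcos : ∀ j, ContDiff ℝ ∞ (fun x : Space d => Real.cos (angle (S.lo j) (S.hi j) (x j))) :=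
    fun j => Real.contDiff_cos.comp ((contDiff_angle _ _).comp (by fun_prop))
  have hsin : ∀ j, ContDiff ℝ ∞ (fun x : Space d => Real.sin (angle (S.lo j) (S.hi j) (x j))) :=
    fun j => Real.contDiff_sin.comp ((contDiff_angle _ _).comp (by fun_prop))
  have hs : ∀ (j : Fin d) (ε : ℝ), IsSeparated (fun x y : Space d =>
      1 + (Real.cos (angle (S.lo j) (S.hi j) (x j)) * Real.cos (angle (S.lo j) (S.hi j) (y j)) +
        ε * (Real.sin (angle (S.lo j) (S.hi j) (x j)) *
          Real.sin (angle (S.lo j) (S.hi j) (y j))))) := fun j ε =>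
    (isSeparated_const 1).add ((isSeparated_mul_of_contDiff (hcos j) (hcos j)).add
      ((isSeparated_mul_of_contDiff (hsin j) (hsin j)).const_mul ε))
  refine IsSeparated.prod fun j => ?_
  -- Here `ε` selects the reflection: `1` for the Neumann and `-1` for the Dirichlet kernel. In `hs`
  -- it selected the sign of the second angle.
  have e : ∀ ε : ℝ, IsSeparated (fun x y : Space d => Real.pi / (S.hi j - S.lo j) *
      (cosKernel N (angle (S.lo j) (S.hi j) (x j) - angle (S.lo j) (S.hi j) (y j)) +
      ε * cosKernel N (angle (S.lo j) (S.hi j) (x j) + angle (S.lo j) (S.hi j) (y j)))) := by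
    intro ε
    have := (((((hs j 1).pow N).const_mul (∫ τ in (-Real.pi)..Real.pi, (1 + Real.cos τ) ^ N)⁻¹)).add
      ((((hs j (-1)).pow N).const_mul
        (∫ τ in (-Real.pi)..Real.pi, (1 + Real.cos τ) ^ N)⁻¹).const_mul ε)).const_mul
        (Real.pi / (S.hi j - S.lo j))
    convert! this using 5
    · rw [cosKernel, Real.cos_sub]; ring_nf
    · rw [cosKernel, Real.cos_add]; ring_nf
  unfold kernelFactor
  split_ifs
  · simpa [dirichlet1, sub_eq_add_neg] using e (-1)
  · simpa [neumann1] using e 1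

lemma continuous_kernel : Continuous (fun p : Space d × Space d => S.kernel N o p.1 p.2) := by
  unfold kernel
  refine continuous_finsetProd _ fun j _ => ?_
  unfold kernelFactor
  split_ifs
  · exact (continuous_dirichlet1 (l := S.lo j) (h := S.hi j) N).comp
      (f := fun p : Space d × Space d => (p.1 j, p.2 j)) (by fun_prop)
  · exact (continuous_neumann1 (l := S.lo j) (h := S.hi j) N).comp
      (f := fun p : Space d × Space d => (p.1 j, p.2 j)) (by fun_prop)

lemma continuous_kernel_right (x : Space d) : Continuous (S.kernel N o x) :=
  (S.contDiff_kernel N o x).continuous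

/-- The gradient of the Neumann kernel in one variable is, up to the sign, the divergence of the
Dirichlet kernels in the other one. -/
lemma fderiv_kernel_none (x y : Space d) :
    fderiv ℝ (S.kernel N none x) y (EuclideanSpace.single i 1) =
      - fderiv ℝ (S.kernel N (some i) y) x (EuclideanSpace.single i 1) := by
  unfold kernel
  rw [fderiv_tensor (fun j => S.contDiff_kernelFactor N none j (x j)),
    fderiv_tensor (fun j => S.contDiff_kernelFactor N (some i) j (y j)),
    ← Finset.mul_prod_erase _ _ (Finset.mem_univ i),
    ← Finset.mul_prod_erase (s := Finset.univ) (a := i)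
      (f := fun j => (if j = i then deriv (S.kernelFactor N (some i) j (y j))
        else S.kernelFactor N (some i) j (y j)) (x j)) (Finset.mem_univ i), ← neg_mul]
  congr 1
  · have e1 : S.kernelFactor N none i (x i) = neumann1 (S.lo i) (S.hi i) N (x i) := by
      ext; simp [kernelFactor]
    have e2 : S.kernelFactor N (some i) i (y i) = dirichlet1 (S.lo i) (S.hi i) N (y i) := by
      ext; simp [kernelFactor]
    simp only [if_true]
    rw [e1, e2]
    exact deriv_neumann1_eq N _ _
  · refine Finset.prod_congr rfl fun j hj => ?_
    have hj' := Finset.ne_of_mem_erase hj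
    simp only [hj', if_false, kernelFactor, Option.some.injEq, hj'.symm]
    exact neumann1_comm _ _ _

lemma integral_kernel_none (x : Space d) : ∫ y in S.Ω, S.kernel N none x y = 1 := by
  unfold kernel
  rw [S.integral_Ω_prod fun j t => S.kernelFactor N none j (x j) t]
  refine Finset.prod_eq_one fun j _ => ?_
  simp only [kernelFactor_none]
  exact integral_neumann1 (S.lo_lt_hi j) N (x j)

/-- A continuous substitute for the squared distance on the box. -/
noncomputable def cosDist (x y : Space d) : ℝ :=
  ∑ j, (Real.cos (angle (S.lo j) (S.hi j) (x j)) - Real.cos (angle (S.lo j) (S.hi j) (y j))) ^ 2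

lemma continuous_cosDist : Continuous (fun p : Space d × Space d => S.cosDist p.1 p.2) := by
  unfold cosDist
  fun_prop

lemma cosDist_pos {x y : Space d} (hx : x ∈ S.Ω) (hy : y ∈ S.Ω) (hxy : x ≠ y) :
    0 < S.cosDist x y := by
  obtain ⟨j, hj⟩ : ∃ j, x j ≠ y j := by
    by_contra! h
    exact hxy (by ext j; exact h j)
  refine Finset.sum_pos' (fun j _ => sq_nonneg _) ⟨j, Finset.mem_univ j, ?_⟩
  have : Real.cos (angle (S.lo j) (S.hi j) (x j)) ≠ Real.cos (angle (S.lo j) (S.hi j) (y j)) :=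
    fun h => hj ((strictMono_angle (S.lo_lt_hi j)).injective
      (Real.injOn_cos (angle_mem_Icc (S.lo_lt_hi j) (hx j)) (angle_mem_Icc (S.lo_lt_hi j) (hy j)) h))
  exact pow_pos (abs_pos.2 (sub_ne_zero.2 this)) 2 |>.trans_eq (sq_abs _)

lemma integrableOn_of_continuous {f : Space d → ℝ} (hf : Continuous f) : IntegrableOn f S.Ω :=
  hf.continuousOn.integrableOn_compact S.isCompact_Ω

/-- Each summand of the distance involves a single coordinate; the remaining factors of the kernel
integrate to one, which leaves the one-dimensional bound. -/
lemma integral_kernel_mul_cosDist_le (x : Space d) :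
    ∫ y in S.Ω, S.kernel N none x y * S.cosDist x y ≤ d * (2 * cosKernelSpread N) := by
  have hc := S.continuous_kernel_right N none x
  simp only [cosDist, Finset.mul_sum]
  rw [integral_finsetSum]
  · calc _ ≤ ∑ _j : Fin d, 2 * cosKernelSpread N := Finset.sum_le_sum fun j _ => ?_
      _ = _ := by simp
    have e : ∀ y : Space d, S.kernel N none x y * (Real.cos (angle (S.lo j) (S.hi j) (x j)) -
        Real.cos (angle (S.lo j) (S.hi j) (y j))) ^ 2 =
        ∏ m, (if m = j then fun t => S.kernelFactor N none m (x m) t *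
          (Real.cos (angle (S.lo m) (S.hi m) (x m)) - Real.cos (angle (S.lo m) (S.hi m) t)) ^ 2
          else S.kernelFactor N none m (x m)) (y m) := by
      intro y
      unfold kernel
      rw [← Finset.mul_prod_erase _ _ (Finset.mem_univ j),
        ← Finset.mul_prod_erase (s := Finset.univ) (a := j) (f := fun m =>
          (if m = j then fun t => S.kernelFactor N none m (x m) t *
          (Real.cos (angle (S.lo m) (S.hi m) (x m)) - Real.cos (angle (S.lo m) (S.hi m) t)) ^ 2
          else S.kernelFactor N none m (x m)) (y m)) (Finset.mem_univ j), mul_right_comm]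
      congr 1
      · simp
      · refine Finset.prod_congr rfl fun m hm => ?_
        simp [Finset.ne_of_mem_erase hm]
    simp only [e]
    rw [S.integral_Ω_prod, ← Finset.mul_prod_erase _ _ (Finset.mem_univ j), Finset.prod_eq_one]
    · simp only [if_true, kernelFactor_none, mul_one]
      exact integral_neumann1_mul_sq_le (S.lo_lt_hi j) N (x j)
    · intro m hm
      simp only [Finset.ne_of_mem_erase hm, if_false, kernelFactor_none]
      exact integral_neumann1 (S.lo_lt_hi m) N (x m)
  · intro j _
    apply S.integrableOn_of_continuous
    fun_prop

/-- The two kernels share all factors but the one in the coordinate `i`, and the common factors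
integrate to one. -/
lemma tendsto_integral_kernel_sub {x : Space d} (hx : x ∈ interior S.Ω) :
    Tendsto (fun N => ∫ y in S.Ω, (S.kernel N none x y - S.kernel N (some i) x y)) atTop (𝓝 0) := by
  rw [interior_Ω] at hx
  refine (tendsto_integral_neumann1_sub_dirichlet1 (S.lo_lt_hi i) (hx i)).congr fun N => ?_
  have e : ∀ y : Space d, S.kernel N none x y - S.kernel N (some i) x y =
      ∏ m, (if m = i then fun t => neumann1 (S.lo m) (S.hi m) N (x m) t -
        dirichlet1 (S.lo m) (S.hi m) N (x m) t
        else S.kernelFactor N none m (x m)) (y m) := by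
    intro y
    unfold kernel
    rw [← Finset.mul_prod_erase _ _ (Finset.mem_univ i),
      ← Finset.mul_prod_erase (s := Finset.univ) (a := i)
        (f := fun j => S.kernelFactor N (some i) j (x j) (y j)) (Finset.mem_univ i),
      ← Finset.mul_prod_erase (s := Finset.univ) (a := i) (f := fun m =>
        (if m = i then fun t => neumann1 (S.lo m) (S.hi m) N (x m) t -
        dirichlet1 (S.lo m) (S.hi m) N (x m) t
        else S.kernelFactor N none m (x m)) (y m)) (Finset.mem_univ i)]
    have h1 : ∏ j ∈ Finset.univ.erase i, S.kernelFactor N (some i) j (x j) (y j) =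
        ∏ j ∈ Finset.univ.erase i, S.kernelFactor N none j (x j) (y j) :=
      Finset.prod_congr rfl fun m hm => by
        simp [kernelFactor, (Finset.ne_of_mem_erase hm).symm]
    have h2 : ∏ m ∈ Finset.univ.erase i, (if m = i then fun t =>
        neumann1 (S.lo m) (S.hi m) N (x m) t - dirichlet1 (S.lo m) (S.hi m) N (x m) t
        else S.kernelFactor N none m (x m)) (y m) =
        ∏ j ∈ Finset.univ.erase i, S.kernelFactor N none j (x j) (y j) :=
      Finset.prod_congr rfl fun m hm => by
        simp [Finset.ne_of_mem_erase hm]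
    rw [h1, h2, ← sub_mul]
    simp [kernelFactor]
  simp only [e]
  rw [S.integral_Ω_prod, ← Finset.mul_prod_erase _ _ (Finset.mem_univ i), Finset.prod_eq_one]
  · simp
  · intro m hm
    simp only [Finset.ne_of_mem_erase hm, if_false, kernelFactor_none]
    exact integral_neumann1 (S.lo_lt_hi m) N (x m)

end Setting


/-- A version of the dominated convergence theorem along sequences: the convergence is controlled by
an error `Z n` that tends to `0` in `L¹`. -/
lemma tendsto_integral_of_error {α : Type*} [MeasurableSpace α] {μ : Measure α}
    {f : ℕ → α → ℝ} {F g : α → ℝ} {Z : ℕ → α → ℝ} (hZ : ∀ n, Integrable (Z n) μ)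
    (hZ0 : ∀ n x, 0 ≤ Z n x) (hZt : Tendsto (fun n => ∫ x, Z n x ∂μ) atTop (𝓝 0))
    (hf : ∀ n, AEStronglyMeasurable (f n) μ) (hg : Integrable g μ)
    (hb : ∀ n, ∀ᵐ x ∂μ, |f n x| ≤ g x + Z n x)
    (hlim : ∀ᵐ x ∂μ, ∀ ns : ℕ → ℕ, Tendsto ns atTop atTop →
      Tendsto (fun k => Z (ns k) x) atTop (𝓝 0) → Tendsto (fun k => f (ns k) x) atTop (𝓝 (F x))) :
    Tendsto (fun n => ∫ x, f n x ∂μ) atTop (𝓝 (∫ x, F x ∂μ)) := by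
  -- Every subsequence has a further one along which `Z` tends to zero almost everywhere, since
  -- convergence in `L¹` implies convergence in measure.
  refine tendsto_of_subseq_tendsto fun ns hns => ?_
  have hm : TendstoInMeasure μ (fun k => Z (ns k)) atTop (fun _ => 0) := by
    refine tendstoInMeasure_of_tendsto_eLpNorm one_ne_zero (fun k => (hZ _).aestronglyMeasurable)
      aestronglyMeasurable_const ?_
    have h1 : ∀ k, eLpNorm (Z (ns k) - fun _ => 0) 1 μ = ENNReal.ofReal (∫ x, Z (ns k) x ∂μ) := by
      intro k
      rw [eLpNorm_one_eq_lintegral_enorm,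
        ofReal_integral_eq_lintegral_ofReal (hZ _) (Eventually.of_forall (hZ0 _))]
      refine lintegral_congr fun x => ?_
      simp only [Pi.sub_apply, sub_zero]
      exact Real.enorm_of_nonneg (hZ0 _ _)
    simp only [h1]
    have h2 := (ENNReal.tendsto_ofReal hZt).comp hns
    rw [ENNReal.ofReal_zero] at h2
    exact h2
  obtain ⟨ms, hms, hae⟩ := hm.exists_seq_tendsto_ae
  refine ⟨ms, ?_⟩
  set ks : ℕ → ℕ := fun k => ns (ms k) with hks
  have hks' : Tendsto ks atTop atTop := hns.comp hms.tendsto_atTop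
  have hFl : ∀ᵐ x ∂μ, Tendsto (fun k => f (ks k) x) atTop (𝓝 (F x)) := by
    filter_upwards [hlim, hae] with x h1 h2
    exact h1 ks hks' h2
  -- pass to the functions truncated by `g`
  have hZk : Tendsto (fun k => ∫ x, Z (ks k) x ∂μ) atTop (𝓝 0) := hZt.comp hks'
  set c : ℕ → α → ℝ := fun k x => max (min (f (ks k) x) (g x)) (-g x) with hc
  have hcm : ∀ k, AEStronglyMeasurable (c k) μ := fun k =>
    ((hf _).inf hg.aestronglyMeasurable).sup hg.aestronglyMeasurable.neg
  have hbF : ∀ᵐ x ∂μ, |F x| ≤ g x := by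
    filter_upwards [hFl, hae, ae_all_iff.2 hb] with x h1 h2 h3
    have h4 : Tendsto (fun k => g x + Z (ks k) x) atTop (𝓝 (g x + 0)) := tendsto_const_nhds.add h2
    rw [add_zero] at h4
    exact le_of_tendsto_of_tendsto' h1.abs h4 fun k => h3 _
  have hclim : ∀ᵐ x ∂μ, Tendsto (fun k => c k x) atTop (𝓝 (F x)) := by
    filter_upwards [hFl, hbF] with x h1 h2
    have := (h1.min (tendsto_const_nhds (x := g x))).max (tendsto_const_nhds (x := -g x))
    rw [min_eq_left (abs_le.1 h2).2, max_eq_left (abs_le.1 h2).1] at this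
    exact this
  have hcb : ∀ k, ∀ᵐ x ∂μ, ‖c k x‖ ≤ g x := fun k => by
    filter_upwards [hbF] with x h2
    have hg0 : 0 ≤ g x := (abs_nonneg _).trans h2
    rw [Real.norm_eq_abs, abs_le]
    exact ⟨le_max_right _ _, max_le (min_le_right _ _) (by linarith)⟩
  have hcI : Tendsto (fun k => ∫ x, c k x ∂μ) atTop (𝓝 (∫ x, F x ∂μ)) :=
    tendsto_integral_of_dominated_convergence g hcm hg hcb hclim
  have hfi : ∀ k, Integrable (f k) μ := fun k =>
    (hg.add (hZ k)).mono' (hf k) (by filter_upwards [hb k] with x hx using hx)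
  have hci : ∀ k, Integrable (c k) μ := fun k => hg.mono' (hcm k) (hcb k)
  -- As `|f| ≤ g + Z`, truncation to `[-g, g]` moves `f` by at most `Z`, whose integral tends to
  -- zero.
  have hdiff : Tendsto (fun k => ∫ x, f (ks k) x ∂μ - ∫ x, c k x ∂μ) atTop (𝓝 0) := by
    refine squeeze_zero_norm (fun k => ?_) hZk
    rw [← integral_sub (hfi _) (hci _)]
    refine norm_integral_le_of_norm_le (hZ _) ?_
    filter_upwards [hb (ks k), hbF] with x h1 h2
    have hg0 : 0 ≤ g x := (abs_nonneg _).trans h2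
    have hz := hZ0 (ks k) x
    have h3 := abs_le.1 h1
    simp only [Real.norm_eq_abs, hc]
    rcases max_cases (min (f (ks k) x) (g x)) (-g x) with ⟨e, _⟩ | ⟨e, _⟩ <;>
      rcases min_cases (f (ks k) x) (g x) with ⟨e', _⟩ | ⟨e', _⟩ <;>
      rw [e, abs_le] <;> constructor <;> linarith
  simpa using hdiff.add hcI

/-! ### The regularizing integral operators -/

namespace Setting

variable {d : ℕ} (S : Setting d)

/-- The integral operator on functions on `Ω` with kernel `kernel`. -/
noncomputable def op (N : ℕ) (o : Option (Fin d)) (f : Space d → ℝ) (x : Space d) : ℝ :=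
  ∫ y in S.Ω, S.kernel N o x y * f y

section

variable {S} {N : ℕ} {o : Option (Fin d)} {f g : Space d → ℝ}

lemma integrableOn_mul_of_continuous {a : Space d → ℝ} (ha : Continuous a)
    (hf : IntegrableOn f S.Ω) : IntegrableOn (fun y => a y * f y) S.Ω :=
  hf.continuousOn_mul ha.continuousOn S.isCompact_Ω

lemma integrableOn_kernel_mul (hf : IntegrableOn f S.Ω) (x : Space d) :
    IntegrableOn (fun y => S.kernel N o x y * f y) S.Ω :=
  integrableOn_mul_of_continuous (S.continuous_kernel_right N o x) hf

lemma contDiff_op (hf : IntegrableOn f S.Ω) : ContDiff ℝ ∞ (S.op N o f) := by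
  obtain ⟨n, A, B, hA, hB, e⟩ := S.isSeparated_kernel N o
  have : S.op N o f = fun x => ∑ l, A l x * ∫ y in S.Ω, B l y * f y := by
    ext x
    simp only [op, e, Finset.sum_mul, mul_assoc]
    rw [integral_finsetSum _ fun l _ =>
      (integrableOn_mul_of_continuous (hB l).continuous hf).const_mul _]
    simp only [integral_const_mul]
  rw [this]
  exact ContDiff.sum fun l _ => (hA l).mul contDiff_const

lemma continuous_op (hf : IntegrableOn f S.Ω) : Continuous (S.op N o f) :=
  (contDiff_op hf).continuous

lemma integrableOn_op (hf : IntegrableOn f S.Ω) : IntegrableOn (S.op N o f) S.Ω :=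
  S.integrableOn_of_continuous (continuous_op hf)

lemma op_congr (h : ∀ᵐ x ∂volume.restrict S.Ω, f x = g x) : S.op N o f = S.op N o g := by
  ext x
  refine integral_congr_ae ?_
  filter_upwards [h] with y hy
  rw [hy]

lemma op_add (hf : IntegrableOn f S.Ω) (hg : IntegrableOn g S.Ω) (x : Space d) :
    S.op N o (fun y => f y + g y) x = S.op N o f x + S.op N o g x := by
  simp only [op, mul_add]
  exact integral_add (integrableOn_kernel_mul hf x) (integrableOn_kernel_mul hg x)

lemma op_sub (hf : IntegrableOn f S.Ω) (hg : IntegrableOn g S.Ω) (x : Space d) :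
    S.op N o (fun y => f y - g y) x = S.op N o f x - S.op N o g x := by
  simp only [op, mul_sub]
  exact integral_sub (integrableOn_kernel_mul hf x) (integrableOn_kernel_mul hg x)

lemma op_const_mul (c : ℝ) (x : Space d) :
    S.op N o (fun y => c * f y) x = c * S.op N o f x := by
  simp only [op, mul_left_comm _ c]
  exact integral_const_mul _ _

lemma op_none_const (c : ℝ) (x : Space d) : S.op N none (fun _ => c) x = c := by
  simp only [op]
  rw [integral_mul_const, S.integral_kernel_none, one_mul]

lemma op_none_nonneg (hf : ∀ᵐ y ∂volume.restrict S.Ω, 0 ≤ f y) (x : Space d) :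
    0 ≤ S.op N none f x := by
  refine integral_nonneg_of_ae ?_
  filter_upwards [hf] with y hy using mul_nonneg (S.kernel_none_nonneg N x y) hy

lemma op_none_mono (hf : IntegrableOn f S.Ω) (hg : IntegrableOn g S.Ω)
    (h : ∀ᵐ y ∂volume.restrict S.Ω, f y ≤ g y) (x : Space d) :
    S.op N none f x ≤ S.op N none g x := by
  refine integral_mono_ae (integrableOn_kernel_mul hf x) (integrableOn_kernel_mul hg x) ?_
  filter_upwards [h] with y hy
  exact mul_le_mul_of_nonneg_left hy (S.kernel_none_nonneg N x y)

lemma abs_op_le (hf : IntegrableOn f S.Ω) (x : Space d) :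
    |S.op N o f x| ≤ S.op N none (fun y => |f y|) x := by
  refine norm_integral_le_of_norm_le (f := fun y => S.kernel N o x y * f y)
    (integrableOn_kernel_mul hf.abs x) ?_
  refine Eventually.of_forall fun y => ?_
  rw [norm_mul, Real.norm_eq_abs, Real.norm_eq_abs]
  exact mul_le_mul_of_nonneg_right (S.abs_kernel_le N o x y) (abs_nonneg _)

lemma integrable_prod_of_continuous {k : Space d × Space d → ℝ} (hk : Continuous k)
    (hf : IntegrableOn f S.Ω) :
    Integrable (fun p : Space d × Space d => k p * f p.2)
      ((volume.restrict S.Ω).prod (volume.restrict S.Ω)) := by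
  obtain ⟨C, hC⟩ := (S.isCompact_Ω.prod S.isCompact_Ω).exists_bound_of_continuousOn hk.continuousOn
  have h1 : Integrable (fun p : Space d × Space d => f p.2)
      ((volume.restrict S.Ω).prod (volume.restrict S.Ω)) := Integrable.comp_snd hf _
  refine h1.bdd_mul (c := C) hk.aestronglyMeasurable ?_
  rw [Measure.prod_restrict]
  filter_upwards [ae_restrict_mem (S.measurableSet_Ω.prod S.measurableSet_Ω)] with p hp
  exact hC p hp

/-- Self-adjointness, from Fubini and the symmetry of the kernel. The bound on `g` provides
integrability on the product space. -/
lemma integral_mul_op (ho : IntegrableOn f S.Ω) {g : Space d → ℝ} (hg : IntegrableOn g S.Ω) 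
    (hgb : ∃ C, ∀ x ∈ S.Ω, |g x| ≤ C) :
    ∫ x in S.Ω, g x * S.op N o f x = ∫ y in S.Ω, S.op N o g y * f y := by
  obtain ⟨C, hC⟩ := hgb
  have hi : Integrable (fun p : Space d × Space d => g p.1 * (S.kernel N o p.1 p.2 * f p.2))
      ((volume.restrict S.Ω).prod (volume.restrict S.Ω)) := by
    refine (integrable_prod_of_continuous (S.continuous_kernel N o) ho).bdd_mul (c := C)
      hg.aestronglyMeasurable.comp_fst ?_
    rw [Measure.prod_restrict]
    filter_upwards [ae_restrict_mem (S.measurableSet_Ω.prod S.measurableSet_Ω)] with p hp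
    exact hC _ hp.1
  simp only [op, ← integral_const_mul, ← integral_mul_const]
  rw [integral_integral_swap hi]
  refine integral_congr_ae (Eventually.of_forall fun y => integral_congr_ae
    (Eventually.of_forall fun x => ?_))
  simp only
  rw [S.kernel_comm N o x y]
  ring

lemma integral_op_none (hf : IntegrableOn f S.Ω) :
    ∫ x in S.Ω, S.op N none f x = ∫ x in S.Ω, f x := by
  have := integral_mul_op (N := N) (o := none) hf (g := fun _ => 1)
    (S.integrableOn_of_continuous continuous_const)
    ⟨1, by simp⟩
  simpa [op_none_const] using this

lemma integral_abs_op_le (hf : IntegrableOn f S.Ω) :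
    ∫ x in S.Ω, |S.op N o f x| ≤ ∫ x in S.Ω, |f x| := by
  rw [← integral_op_none (N := N) hf.abs]
  exact integral_mono (integrableOn_op hf).abs (integrableOn_op hf.abs) fun x => abs_op_le hf x

/-- The Cauchy–Schwarz inequality for `op`. -/
lemma op_sq_le {a b : Space d → ℝ} (hf : IntegrableOn f S.Ω) (ha : IntegrableOn a S.Ω)
    (hb : IntegrableOn b S.Ω) (ha0 : ∀ᵐ x ∂volume.restrict S.Ω, 0 ≤ a x)
    (hb0 : ∀ᵐ x ∂volume.restrict S.Ω, 0 ≤ b x)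
    (h : ∀ᵐ x ∂volume.restrict S.Ω, f x ^ 2 ≤ a x * b x) (x : Space d) :
    S.op N o f x ^ 2 ≤ S.op N none a x * S.op N none b x := by
  have h1 : (S.op N none (fun y => |f y|) x) ^ 2 ≤ S.op N none a x * S.op N none b x := by
    -- The quadratic polynomial in `t` is the Neumann average of `t² a + 2 t |f| + b`, nonnegative
    -- because `f² ≤ a b`. Its discriminant is therefore nonpositive.
    have key : ∀ t : ℝ, 0 ≤ S.op N none a x * (t * t) + (2 * S.op N none (fun y => |f y|) x) * t +
        S.op N none b x := by
      intro t
      have i1 := ha.const_mul (t * t)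
      have i2 := hf.abs.const_mul (2 * t)
      have e : S.op N none a x * (t * t) + (2 * S.op N none (fun y => |f y|) x) * t +
          S.op N none b x =
          S.op N none (fun y => (t * t * a y + 2 * t * |f y|) + b y) x := by
        rw [op_add (f := fun y => t * t * a y + 2 * t * |f y|) (i1.add i2) hb, op_add i1 i2,
          op_const_mul, op_const_mul]
        ring
      rw [e]
      refine op_none_nonneg ?_ x
      filter_upwards [ha0, hb0, h] with y h2 h3 h4
      rw [← sq_abs] at h4
      have h5 : 0 ≤ |f y| := abs_nonneg _
      by_cases hay : a y = 0
      · have : |f y| = 0 := by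
          rw [hay, zero_mul] at h4
          nlinarith
        rw [hay, this]
        simpa using h3
      · have hpos : 0 < a y := lt_of_le_of_ne h2 (Ne.symm hay)
        have : 0 ≤ a y * (t * t * a y + 2 * t * |f y| + b y) := by
          nlinarith [sq_nonneg (a y * t + |f y|)]
        exact nonneg_of_mul_nonneg_right this hpos
    have := discrim_le_zero key
    rw [discrim] at this
    nlinarith
  refine le_trans ?_ h1
  rw [← sq_abs (S.op N o f x)]
  exact pow_le_pow_left₀ (abs_nonneg _) (abs_op_le hf x) 2

end

/-! ### Convergence of the operators to the identity -/

/-- On the compact set of pairs with oscillation at least `ε` the points are distinct, so `cosDist`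
has a positive minimum there and a large multiple of it absorbs the oscillation. This is a modulus
of continuity in a form that can be integrated against the kernel. -/
lemma exists_modulus {f : Space d → ℝ} (hf : ContinuousOn f S.Ω) {ε : ℝ} (hε : 0 < ε) :
    ∃ C, 0 ≤ C ∧ ∀ x ∈ S.Ω, ∀ y ∈ S.Ω, |f y - f x| ≤ ε + C * S.cosDist x y := by
  set T : Set (Space d × Space d) := (S.Ω ×ˢ S.Ω) ∩ {p | ε ≤ |f p.2 - f p.1|} with hT
  have hfc : ContinuousOn (fun p : Space d × Space d => |f p.2 - f p.1|) (S.Ω ×ˢ S.Ω) :=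
    ((hf.comp continuousOn_snd fun p hp => hp.2).sub
      (hf.comp continuousOn_fst fun p hp => hp.1)).abs
  have hTc : IsCompact T := by
    have hcl : IsClosed T :=
      hfc.preimage_isClosed_of_isClosed (S.isClosed_Ω.prod S.isClosed_Ω) isClosed_Ici
    exact (S.isCompact_Ω.prod S.isCompact_Ω).of_isClosed_subset hcl inter_subset_left
  have hd0 : ∀ x y, 0 ≤ S.cosDist x y := fun x y => Finset.sum_nonneg fun j _ => sq_nonneg _
  obtain ⟨M, hM⟩ := (S.isCompact_Ω.prod S.isCompact_Ω).exists_bound_of_continuousOn hfc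
  rcases T.eq_empty_or_nonempty with h0 | hne
  · refine ⟨0, le_rfl, fun x hx y hy => ?_⟩
    by_contra! hlt
    have : (x, y) ∈ T := ⟨⟨hx, hy⟩, by simp only [mem_ofPred_eq]; linarith⟩
    rw [h0] at this
    exact this
  · obtain ⟨p, hp, hmin⟩ := hTc.exists_isMinOn (f := fun p : Space d × Space d => S.cosDist p.1 p.2)
      hne S.continuous_cosDist.continuousOn
    simp only [isMinOn_iff] at hmin
    have hc : 0 < S.cosDist p.1 p.2 := by
      refine S.cosDist_pos hp.1.1 hp.1.2 fun h => ?_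
      have := hp.2
      simp only [mem_ofPred_eq, h, sub_self, abs_zero] at this
      linarith
    refine ⟨max M 0 / S.cosDist p.1 p.2, by positivity, fun x hx y hy => ?_⟩
    by_cases h : ε ≤ |f y - f x|
    · have hxy : (x, y) ∈ T := ⟨⟨hx, hy⟩, h⟩
      have h1 : S.cosDist p.1 p.2 ≤ S.cosDist x y := hmin (x, y) hxy
      have h2 : |f y - f x| ≤ M := by
        have := hM (x, y) ⟨hx, hy⟩
        simpa using this
      have h3 : max M 0 ≤ max M 0 / S.cosDist p.1 p.2 * S.cosDist x y := by
        rw [div_mul_eq_mul_div, le_div_iff₀ hc]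
        exact mul_le_mul_of_nonneg_left h1 (le_max_right _ _)
      linarith [le_max_left M 0]
    · push Not at h
      have := mul_nonneg (by positivity : 0 ≤ max M 0 / S.cosDist p.1 p.2) (hd0 x y)
      linarith

/-- The Neumann operators converge uniformly to the identity on continuous functions. -/
lemma eventually_abs_op_none_sub_le {f : Space d → ℝ} (hf : ContinuousOn f S.Ω) {ε : ℝ}
    (hε : 0 < ε) : ∀ᶠ N in atTop, ∀ x ∈ S.Ω, |S.op N none f x - f x| ≤ ε := by
  obtain ⟨C, hC0, hC⟩ := S.exists_modulus hf (half_pos hε)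
  have hfi : IntegrableOn f S.Ω := hf.integrableOn_compact S.isCompact_Ω
  -- Integrating the modulus against the kernel gives `ε / 2` from the unit mass and `C` times the
  -- spread bound, uniformly in `x`.
  have ht : Tendsto (fun N => ε / 2 + C * (d * (2 * cosKernelSpread N))) atTop (𝓝 (ε / 2 + 0)) := by
    refine tendsto_const_nhds.add ?_
    simpa using ((tendsto_cosKernelSpread.const_mul 2).const_mul (d : ℝ)).const_mul C
  have hev := ht.eventually (gt_mem_nhds (show ε / 2 + 0 < ε by linarith))
  filter_upwards [hev] with N hN x hx
  have hdc : Continuous (fun y => S.cosDist x y) := by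
    unfold cosDist
    fun_prop
  have e1 : S.op N none f x - f x = ∫ y in S.Ω, S.kernel N none x y * (f y - f x) := by
    simp only [mul_sub]
    rw [integral_sub (integrableOn_kernel_mul hfi x)
      (integrableOn_kernel_mul (f := fun _ => f x)
        (S.integrableOn_of_continuous continuous_const) x),
      integral_mul_const, S.integral_kernel_none, one_mul]
    rfl
  rw [e1]
  have i1 : IntegrableOn (fun y => ε / 2 * S.kernel N none x y) S.Ω :=
    S.integrableOn_of_continuous (continuous_const.mul (S.continuous_kernel_right N none x))
  have i2 : IntegrableOn (fun y => C * (S.kernel N none x y * S.cosDist x y)) S.Ω :=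
    S.integrableOn_of_continuous
      (continuous_const.mul ((S.continuous_kernel_right N none x).mul hdc))
  have h2 : |∫ y in S.Ω, S.kernel N none x y * (f y - f x)| ≤
      ∫ y in S.Ω, (ε / 2 * S.kernel N none x y + C * (S.kernel N none x y * S.cosDist x y)) := by
    refine norm_integral_le_of_norm_le (f := fun y => S.kernel N none x y * (f y - f x)) (i1.add i2) ?_
    filter_upwards [ae_restrict_mem S.measurableSet_Ω] with y hy
    have hk := S.kernel_none_nonneg N x y
    rw [norm_mul, Real.norm_eq_abs, Real.norm_eq_abs, abs_of_nonneg hk]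
    nlinarith [mul_le_mul_of_nonneg_left (hC x hx y hy) hk]
  rw [integral_add i1 i2, integral_const_mul, integral_const_mul, S.integral_kernel_none] at h2
  have h3 := mul_le_mul_of_nonneg_left (S.integral_kernel_mul_cosDist_le N x) hC0
  linarith

/-- The Neumann case is uniform convergence. For a Dirichlet kernel the difference to the Neumann
one is nonnegative, and at an interior point its mass tends to zero, so the boundedness of `f`
suffices. -/
lemma tendsto_op_of_continuousOn (o : Option (Fin d)) {f : Space d → ℝ} (hf : ContinuousOn f S.Ω)
    {x : Space d} (hx : x ∈ interior S.Ω) : Tendsto (fun N => S.op N o f x) atTop (𝓝 (f x)) := by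
  have h0 : Tendsto (fun N => S.op N none f x) atTop (𝓝 (f x)) := by
    rw [Metric.tendsto_atTop']
    intro ε hε
    obtain ⟨n, hn⟩ := eventually_atTop.1 (S.eventually_abs_op_none_sub_le hf (half_pos hε))
    refine ⟨n, fun N hN => ?_⟩
    have := hn N hN.le x (interior_subset hx)
    rw [Real.dist_eq]
    linarith
  rcases o with _ | i
  · exact h0
  · have hfi : IntegrableOn f S.Ω := hf.integrableOn_compact S.isCompact_Ω
    obtain ⟨M, hM⟩ := S.isCompact_Ω.exists_bound_of_continuousOn hf
    have h1 : Tendsto (fun N => S.op N none f x - S.op N (some i) f x) atTop (𝓝 0) := by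
      refine squeeze_zero_norm (fun N => ?_)
        (by simpa using (S.tendsto_integral_kernel_sub i hx).const_mul M)
      have e : S.op N none f x - S.op N (some i) f x =
          ∫ y in S.Ω, (S.kernel N none x y - S.kernel N (some i) x y) * f y := by
        simp only [sub_mul]
        exact (integral_sub (integrableOn_kernel_mul hfi x) (integrableOn_kernel_mul hfi x)).symm
      rw [e, ← integral_const_mul]
      refine norm_integral_le_of_norm_le
        (f := fun y => (S.kernel N none x y - S.kernel N (some i) x y) * f y)
        (g := fun y => M * (S.kernel N none x y - S.kernel N (some i) x y)) ?_ ?_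
      · exact S.integrableOn_of_continuous (continuous_const.mul
          ((S.continuous_kernel_right N none x).sub (S.continuous_kernel_right N _ x)))
      · filter_upwards [ae_restrict_mem S.measurableSet_Ω] with y hy
        have hk := (abs_le.1 (S.abs_kernel_le N (some i) x y)).2
        rw [norm_mul, Real.norm_eq_abs, abs_of_nonneg (by linarith), mul_comm]
        exact mul_le_mul_of_nonneg_right (hM y hy) (by linarith)
    simpa using h0.sub h1

/-- The operators converge to the identity in `L¹(Ω)`. -/
lemma tendsto_integral_abs_op_sub (o : Option (Fin d)) {f : Space d → ℝ}
    (hf : IntegrableOn f S.Ω) :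
    Tendsto (fun N => ∫ x in S.Ω, |S.op N o f x - f x|) atTop (𝓝 0) := by
  have hcont : ∀ g : Space d → ℝ, Continuous g →
      Tendsto (fun N => ∫ x in S.Ω, |S.op N o g x - g x|) atTop (𝓝 0) := by
    intro g hg
    have hgi := S.integrableOn_of_continuous hg
    obtain ⟨M, hM⟩ := S.isCompact_Ω.exists_bound_of_continuousOn hg.continuousOn
    have : Tendsto (fun N => ∫ x in S.Ω, |S.op N o g x - g x|) atTop (𝓝 (∫ x in S.Ω, (0:ℝ))) := by
      refine tendsto_integral_of_dominated_convergence (fun _ => 2 * M)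
        (fun N => ((continuous_op hgi).sub hg).abs.aestronglyMeasurable)
        (S.integrableOn_of_continuous continuous_const) ?_ ?_
      · intro N
        filter_upwards [ae_restrict_mem S.measurableSet_Ω] with x hx
        have h1 : |S.op N o g x| ≤ M := by
          refine (abs_op_le hgi x).trans ?_
          refine (op_none_mono (g := fun _ => M) hgi.abs
            (S.integrableOn_of_continuous continuous_const) ?_ x).trans_eq
            (op_none_const M x)
          filter_upwards [ae_restrict_mem S.measurableSet_Ω] with y hy using hM y hy
        have h2 : |g x| ≤ M := hM x hx
        rw [Real.norm_eq_abs, abs_abs]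
        exact (abs_sub _ _).trans (by linarith)
      · filter_upwards [S.ae_mem_interior_Ω] with x hx
        have := (S.tendsto_op_of_continuousOn o hg.continuousOn hx).sub_const (g x)
        simpa using this.abs
    simpa using this
  rw [Metric.tendsto_atTop']
  intro ε hε
  -- Continuous functions are dense in `L¹`, and the contraction property of the operators makes the
  -- error of the approximation uniform in `N`.
  obtain ⟨g, -, hgε, hg, -⟩ := (Integrable.exists_hasCompactSupport_integral_sub_le hf
    (show 0 < ε / 4 by linarith))
  obtain ⟨n, hn⟩ := eventually_atTop.1
    ((hcont g hg).eventually (gt_mem_nhds (show 0 < ε / 4 by linarith)))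
  refine ⟨n, fun N hN => ?_⟩
  have hgi := S.integrableOn_of_continuous hg
  have hd : IntegrableOn (fun x => f x - g x) S.Ω := hf.sub hgi
  have hle : ∫ x in S.Ω, |S.op N o f x - f x| ≤ ∫ x in S.Ω,
      ((|S.op N o (fun y => f y - g y) x| + |S.op N o g x - g x|) + |f x - g x|) := by
    refine integral_mono ((integrableOn_op hf).sub hf).abs
      (((integrableOn_op hd).abs.add ((integrableOn_op hgi).sub hgi).abs).add hd.abs) fun x => ?_
    rw [op_sub hf hgi]
    have h1 := abs_add_le (S.op N o f x - S.op N o g x + (S.op N o g x - g x)) (g x - f x)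
    have h2 := abs_add_le (S.op N o f x - S.op N o g x) (S.op N o g x - g x)
    rw [abs_sub_comm (g x)] at h1
    have e : S.op N o f x - S.op N o g x + (S.op N o g x - g x) + (g x - f x) =
      S.op N o f x - f x := by ring
    rw [e] at h1
    linarith
  have i1 : IntegrableOn (fun x => |S.op N o (fun y => f y - g y) x|) S.Ω := (integrableOn_op hd).abs
  have i2 : IntegrableOn (fun x => |S.op N o g x - g x|) S.Ω := ((integrableOn_op hgi).sub hgi).abs
  have i3 : IntegrableOn (fun x => |f x - g x|) S.Ω := hd.abs
  have i12 : IntegrableOn (fun x => |S.op N o (fun y => f y - g y) x| + |S.op N o g x - g x|) S.Ω :=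
    i1.add i2
  rw [integral_add i12 i3, integral_add i1 i2] at hle
  have h3 := integral_abs_op_le (S := S) (N := N) (o := o) hd
  have h4 := hn N hN.le
  simp only [Real.norm_eq_abs] at hgε
  rw [Real.dist_eq, sub_zero, abs_of_nonneg (integral_nonneg fun x => abs_nonneg _)]
  linarith

end Setting


/-! ### Cutoff functions on an interval -/

lemma exists_deriv_smoothTransition_le :
    ∃ c, 0 ≤ c ∧ (∀ u, |deriv Real.smoothTransition u| ≤ c) ∧
      ∀ u, 1 < u → deriv Real.smoothTransition u = 0 := by
  have hc : Continuous (deriv Real.smoothTransition) :=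
    (Real.smoothTransition.contDiff (n := 1)).continuous_deriv (by simp)
  obtain ⟨c, hc⟩ := (isCompact_Icc (a := (0:ℝ)) (b := 1)).exists_bound_of_continuousOn
    hc.continuousOn
  have h1 : ∀ u, 1 < u → deriv Real.smoothTransition u = 0 := fun u hu => by
    have : Real.smoothTransition =ᶠ[𝓝 u] fun _ => 1 := by
      filter_upwards [lt_mem_nhds hu] with v hv using Real.smoothTransition.one_of_one_le hv.le
    rw [this.deriv_eq]; simp
  have h0 : ∀ u, u < 0 → deriv Real.smoothTransition u = 0 := fun u hu => by
    have : Real.smoothTransition =ᶠ[𝓝 u] fun _ => 0 := by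
      filter_upwards [gt_mem_nhds hu] with v hv using Real.smoothTransition.zero_of_nonpos hv.le
    rw [this.deriv_eq]; simp
  refine ⟨max c 0, le_max_right _ _, fun u => ?_, h1⟩
  rcases lt_or_ge u 0 with hu | hu
  · rw [h0 u hu]; simp
  · rcases lt_or_ge 1 u with hu' | hu'
    · rw [h1 u hu']; simp
    · exact (hc u ⟨hu, hu'⟩).trans (le_max_left _ _)

/-- A smooth cutoff function that vanishes near the end points of `[l, h]`. -/
noncomputable def cutoff (l h : ℝ) (n : ℕ) (s : ℝ) : ℝ :=
  Real.smoothTransition (n * (s - l) - 1) * Real.smoothTransition (n * (h - s) - 1)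

section Cutoff

variable (l h : ℝ) (n : ℕ)

lemma contDiff_cutoff : ContDiff ℝ ∞ (cutoff l h n) := by
  unfold cutoff
  exact (Real.smoothTransition.contDiff.comp (by fun_prop)).mul
    (Real.smoothTransition.contDiff.comp (by fun_prop))

lemma cutoff_nonneg (s : ℝ) : 0 ≤ cutoff l h n s :=
  mul_nonneg (Real.smoothTransition.nonneg _) (Real.smoothTransition.nonneg _)

lemma cutoff_le_one (s : ℝ) : cutoff l h n s ≤ 1 :=
  mul_le_one₀ (Real.smoothTransition.le_one _) (Real.smoothTransition.nonneg _)
    (Real.smoothTransition.le_one _)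

variable {l h n}

lemma mem_of_cutoff_ne_zero {s : ℝ} (hs : cutoff l h n s ≠ 0) :
    1 ≤ n * (s - l) ∧ 1 ≤ n * (h - s) := by
  have h1 : Real.smoothTransition (n * (s - l) - 1) ≠ 0 := left_ne_zero_of_mul hs
  have h2 : Real.smoothTransition (n * (h - s) - 1) ≠ 0 := right_ne_zero_of_mul hs
  rw [Ne, Real.smoothTransition.zero_iff_nonpos, not_le] at h1 h2
  constructor <;> linarith

lemma eventually_cutoff_eventuallyEq {s : ℝ} (hs : s ∈ Ioo l h) :
    ∀ᶠ n in atTop, cutoff l h n =ᶠ[𝓝 s] fun _ => 1 := by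
  have h1 : 0 < (s - l) / 2 := by linarith [hs.1]
  have h2 : 0 < (h - s) / 2 := by linarith [hs.2]
  have t1 := (tendsto_natCast_atTop_atTop (R := ℝ)).atTop_mul_const h1
  have t2 := (tendsto_natCast_atTop_atTop (R := ℝ)).atTop_mul_const h2
  filter_upwards [t1.eventually_ge_atTop 2, t2.eventually_ge_atTop 2] with n e1 e2
  have hn : (0:ℝ) ≤ n := Nat.cast_nonneg n
  filter_upwards [Ioo_mem_nhds (show s - (s - l) / 2 < s by linarith)
    (show s < s + (h - s) / 2 by linarith)] with t ht
  rw [cutoff, Real.smoothTransition.one_of_one_le, Real.smoothTransition.one_of_one_le, one_mul]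
  · nlinarith [ht.2]
  · nlinarith [ht.1]

lemma tendsto_cutoff_mul {ψ : ℝ → ℝ} {s : ℝ} (hs : s ∈ Ioo l h) :
    Tendsto (fun n => cutoff l h n s * ψ s) atTop (𝓝 (ψ s)) := by
  refine tendsto_const_nhds.congr' ?_
  filter_upwards [eventually_cutoff_eventuallyEq hs] with n hn
  rw [hn.eq_of_nhds, one_mul]

lemma tendsto_deriv_cutoff_mul {ψ : ℝ → ℝ} {s : ℝ} (hs : s ∈ Ioo l h) :
    Tendsto (fun n => deriv (fun t => cutoff l h n t * ψ t) s) atTop (𝓝 (deriv ψ s)) := by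
  refine tendsto_const_nhds.congr' ?_
  filter_upwards [eventually_cutoff_eventuallyEq hs] with n hn
  refine (Filter.EventuallyEq.deriv_eq ?_).symm
  filter_upwards [hn] with t ht
  rw [ht, one_mul]

/-- The cutoff has a derivative of order `n` only within distance `2 / n` of the end points. There
the vanishing boundary values give `|ψ| ≤ 2 M / n`, so the factors `n` cancel. -/
lemma exists_deriv_cutoff_mul_le {ψ : ℝ → ℝ} (hψ : ContDiff ℝ ∞ ψ) (hl : ψ l = 0) (hh : ψ h = 0) :
    ∃ C, ∀ n, ∀ s ∈ Icc l h, |deriv (fun t => cutoff l h n t * ψ t) s| ≤ C := by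
  obtain ⟨c, hc0, hc, hc1⟩ := exists_deriv_smoothTransition_le
  have hψ' : Continuous (deriv ψ) := hψ.continuous_deriv (by simp)
  obtain ⟨M, hM⟩ := (isCompact_Icc (a := l) (b := h)).exists_bound_of_continuousOn hψ'.continuousOn
  have hd : Differentiable ℝ ψ := hψ.differentiable (by simp)
  have hlip : ∀ x ∈ Icc l h, ∀ y ∈ Icc l h, |ψ y - ψ x| ≤ M * |y - x| := fun x hx y hy =>
    (convex_Icc l h).norm_image_sub_le_of_norm_deriv_le (fun z _ => hd z) (fun z hz => hM z hz) hx hy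
  have hT : ∀ u, HasDerivAt Real.smoothTransition (deriv Real.smoothTransition u) u := fun u =>
    ((Real.smoothTransition.contDiff (n := 1)).differentiable (by simp) u).hasDerivAt
  -- Each of the two boundary layers contributes `2 c M`, and the derivative of `ψ` itself
  -- contributes `M`.
  refine ⟨4 * c * M + M, fun n s hs => ?_⟩
  have hM0 : 0 ≤ M := (norm_nonneg _).trans (hM s hs)
  have e1 : HasDerivAt (fun t : ℝ => (n:ℝ) * (t - l) - 1) n s := by
    simpa using (((hasDerivAt_id s).sub_const l).const_mul (n:ℝ)).sub_const 1
  have e2 : HasDerivAt (fun t : ℝ => (n:ℝ) * (h - t) - 1) (-n) s := by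
    simpa using (((hasDerivAt_id s).const_sub h).const_mul (n:ℝ)).sub_const 1
  have hder := (((hT _).comp s e1).mul ((hT _).comp s e2)).mul (hd s).hasDerivAt
  have hn : (0:ℝ) ≤ n := Nat.cast_nonneg n
  have b1 : |deriv Real.smoothTransition (n * (s - l) - 1) * n * ψ s| ≤ 2 * c * M := by
    rw [abs_mul, abs_mul, abs_of_nonneg hn]
    by_cases h1 : 1 < n * (s - l) - 1
    · rw [hc1 _ h1]; simp; positivity
    · have h2 := hlip l ⟨le_rfl, hs.1.trans hs.2⟩ s hs
      rw [hl, sub_zero, abs_of_nonneg (by linarith [hs.1] : 0 ≤ s - l)] at h2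
      have h3 := hc (n * (s - l) - 1)
      have h4 : n * |ψ s| ≤ 2 * M := by nlinarith [mul_le_mul_of_nonneg_left h2 hn]
      calc _ = |deriv Real.smoothTransition (n * (s - l) - 1)| * (n * |ψ s|) := by ring
        _ ≤ c * (2 * M) := by gcongr
        _ = _ := by ring
  have b2 : |deriv Real.smoothTransition (n * (h - s) - 1) * n * ψ s| ≤ 2 * c * M := by
    rw [abs_mul, abs_mul, abs_of_nonneg hn]
    by_cases h1 : 1 < n * (h - s) - 1
    · rw [hc1 _ h1]; simp; positivity
    · have h2 := hlip s hs h ⟨hs.1.trans hs.2, le_rfl⟩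
      rw [hh, zero_sub, abs_neg, abs_of_nonneg (by linarith [hs.2] : 0 ≤ h - s)] at h2
      have h3 := hc (n * (h - s) - 1)
      have h4 : n * |ψ s| ≤ 2 * M := by nlinarith [mul_le_mul_of_nonneg_left h2 hn]
      calc _ = |deriv Real.smoothTransition (n * (h - s) - 1)| * (n * |ψ s|) := by ring
        _ ≤ c * (2 * M) := by gcongr
        _ = _ := by ring
  have hT1 : ∀ u a : ℝ, |Real.smoothTransition u * a| ≤ |a| := fun u a => by
    rw [abs_mul, abs_of_nonneg (Real.smoothTransition.nonneg _)]
    exact mul_le_of_le_one_left (abs_nonneg _) (Real.smoothTransition.le_one _)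
  have hfin := hder.deriv
  change deriv (fun t => cutoff l h n t * ψ t) s = _ at hfin
  rw [hfin]
  simp only [Pi.mul_apply, Function.comp_apply]
  have b3 := (hT1 (n * (h - s) - 1)
    (deriv Real.smoothTransition (n * (s - l) - 1) * n * ψ s)).trans b1
  have b4 := (hT1 (n * (s - l) - 1)
    (deriv Real.smoothTransition (n * (h - s) - 1) * n * ψ s)).trans b2
  have b5 := (hT1 (n * (s - l) - 1) (Real.smoothTransition (n * (h - s) - 1) * deriv ψ s)).trans
    ((hT1 _ _).trans (hM s hs))
  rw [abs_le] at *
  constructor <;> nlinarith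

end Cutoff

/-! ### Weak derivatives on the box -/

namespace Setting

variable {d : ℕ} (S : Setting d)

/-- `g` is the weak derivative of `f` in the direction `i` in the interior of `Ω`. -/
def HasWeakDeriv (i : Fin d) (f g : Space d → ℝ) : Prop :=
  ∀ φ : Space d → ℝ, ContDiff ℝ ∞ φ → HasCompactSupport φ → tsupport φ ⊆ interior S.Ω →
    ∫ x in S.Ω, f x * fderiv ℝ φ x (EuclideanSpace.single i 1) = - ∫ x in S.Ω, g x * φ x

variable {S} {i : Fin d} {f g : Space d → ℝ}

/-- Integration by parts against a product of functions of one variable of which only the `i`-th one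
vanishes at the boundary. -/
lemma HasWeakDeriv.integral_mul_fderiv_tensor (h : S.HasWeakDeriv i f g) (hf : IntegrableOn f S.Ω)
    (hg : IntegrableOn g S.Ω) {ψ : Fin d → ℝ → ℝ} (hψ : ∀ j, ContDiff ℝ ∞ (ψ j))
    (hlo : ψ i (S.lo i) = 0) (hhi : ψ i (S.hi i) = 0) :
    ∫ x in S.Ω, f x * fderiv ℝ (fun x : Space d => ∏ j, ψ j (x j)) x (EuclideanSpace.single i 1) =
      - ∫ x in S.Ω, g x * ∏ j, ψ j (x j) := by
  -- All factors are cut off to obtain an admissible test function. Only the factor `i` is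
  -- differentiated, so only this one has to vanish at the faces for the derivatives to stay
  -- bounded.
  set η : ℕ → Fin d → ℝ → ℝ := fun n j t => cutoff (S.lo j) (S.hi j) n t * ψ j t with hη
  have hηs : ∀ n j, ContDiff ℝ ∞ (η n j) := fun n j => (contDiff_cutoff _ _ n).mul (hψ j)
  -- The index `n + 1` keeps the scale of the cutoff positive, which places the closed set `K`
  -- inside the interior of the box.
  have hn : ∀ n, ∫ x in S.Ω, f x * fderiv ℝ (fun x : Space d => ∏ j, η (n + 1) j (x j)) x
      (EuclideanSpace.single i 1) = - ∫ x in S.Ω, g x * ∏ j, η (n + 1) j (x j) := by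
    intro n
    set K : Set (Space d) := ⋂ j, {x : Space d | 1 ≤ ((n + 1 : ℕ) : ℝ) * (x j - S.lo j) ∧
      1 ≤ ((n + 1 : ℕ) : ℝ) * (S.hi j - x j)} with hK
    have hKc : IsClosed K := by
      refine isClosed_iInter fun j => ?_
      have c1 : Continuous fun x : Space d => ((n + 1 : ℕ) : ℝ) * (x j - S.lo j) := by fun_prop
      have c2 : Continuous fun x : Space d => ((n + 1 : ℕ) : ℝ) * (S.hi j - x j) := by fun_prop
      exact (isClosed_le continuous_const c1).inter (isClosed_le continuous_const c2)
    have hKi : K ⊆ interior S.Ω := by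
      intro x hx
      rw [interior_Ω]
      intro j
      have := mem_iInter.1 hx j
      have hp : (0:ℝ) < ((n + 1 : ℕ) : ℝ) := by positivity
      constructor
      · have := this.1; by_contra! hc; nlinarith
      · have := this.2; by_contra! hc; nlinarith
    have hsupp : tsupport (fun x : Space d => ∏ j, η (n + 1) j (x j)) ⊆ K := by
      refine closure_minimal (fun x hx => mem_iInter.2 fun j => ?_) hKc
      exact mem_of_cutoff_ne_zero (left_ne_zero_of_mul
        (Finset.prod_ne_zero_iff.1 hx j (Finset.mem_univ j)))
    refine h _ (contDiff_tensor (hηs _)) ?_ (hsupp.trans hKi)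
    exact (S.isCompact_Ω.of_isClosed_subset hKc (hKi.trans interior_subset)).of_isClosed_subset
      (isClosed_tsupport _) hsupp
  have hB : ∀ j, ∃ B, ∀ n, ∀ s ∈ Icc (S.lo j) (S.hi j), |η n j s| ≤ B := fun j => by
    obtain ⟨B, hB⟩ := (isCompact_Icc (a := S.lo j) (b := S.hi j)).exists_bound_of_continuousOn
      (hψ j).continuous.continuousOn
    refine ⟨B, fun n s hs => ?_⟩
    rw [hη]
    simp only
    rw [abs_mul, abs_of_nonneg (cutoff_nonneg _ _ _ _)]
    exact (mul_le_of_le_one_left (abs_nonneg _) (cutoff_le_one _ _ _ _)).trans (hB s hs)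
  choose B hB using hB
  obtain ⟨C, hC⟩ := exists_deriv_cutoff_mul_le (hψ i) hlo hhi
  have key : ∀ (p : Space d → ℝ) (a : ℕ → Fin d → ℝ → ℝ) (b : Fin d → ℝ → ℝ) (D : Fin d → ℝ),
      IntegrableOn p S.Ω → (∀ n, Continuous fun x : Space d => ∏ j, a n j (x j)) →
      (∀ n j, ∀ s ∈ Icc (S.lo j) (S.hi j), |a n j s| ≤ D j) →
      (∀ j, ∀ s ∈ Ioo (S.lo j) (S.hi j), Tendsto (fun n => a n j s) atTop (𝓝 (b j s))) →
      Tendsto (fun n => ∫ x in S.Ω, p x * ∏ j, a n j (x j)) atTop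
        (𝓝 (∫ x in S.Ω, p x * ∏ j, b j (x j))) := by
    intro p a b D hp hac haD hab
    refine tendsto_integral_of_dominated_convergence (fun x => |p x| * ∏ j, D j)
      (fun n => hp.aestronglyMeasurable.mul (hac n).aestronglyMeasurable)
      (hp.abs.mul_const _) (fun n => ?_) ?_
    · filter_upwards [ae_restrict_mem S.measurableSet_Ω] with x hx
      rw [norm_mul, Real.norm_eq_abs, Real.norm_eq_abs, Finset.abs_prod]
      exact mul_le_mul_of_nonneg_left (Finset.prod_le_prod (fun _ _ => abs_nonneg _)
        fun j _ => haD n j _ (hx j)) (abs_nonneg _)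
    · filter_upwards [S.ae_mem_interior_Ω] with x hx
      rw [interior_Ω] at hx
      exact (tendsto_finsetProd _ fun j _ => hab j _ (hx j)).const_mul _
  have hcd : ∀ n, Continuous fun x : Space d =>
      ∏ j, (if j = i then deriv (η n j) else η n j) (x j) := fun n => by
    refine continuous_finsetProd _ fun j _ => ?_
    split_ifs
    · exact ((hηs n j).continuous_deriv (by simp)).comp (by fun_prop)
    · exact (hηs n j).continuous.comp (by fun_prop)
  have l1 := key f (fun n j => if j = i then deriv (η n j) else η n j)
    (fun j => if j = i then deriv (ψ j) else ψ j) (fun j => if j = i then C else B j) hf hcd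
    (by
      intro n j s hs
      by_cases hj : j = i
      · subst hj; simpa using hC n s hs
      · simpa [hj] using hB j n s hs)
    (by
      intro j s hs
      by_cases hj : j = i
      · subst hj; simpa using tendsto_deriv_cutoff_mul (ψ := ψ j) hs
      · simpa [hj] using tendsto_cutoff_mul (ψ := ψ j) hs)
  have l2 := key g η ψ B hg (fun n => (contDiff_tensor (hηs n)).continuous)
    (fun n j => hB j n) (fun j s hs => tendsto_cutoff_mul (ψ := ψ j) hs)
  simp only [fderiv_tensor hψ]
  refine tendsto_nhds_unique (l1.comp (tendsto_add_atTop_nat 1))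
    ((l2.comp (tendsto_add_atTop_nat 1)).neg.congr fun n => ?_)
  simp only [Function.comp_apply]
  rw [← hn n]
  simp only [fderiv_tensor (hηs (n + 1))]

lemma kernelFactor_some_lo (N : ℕ) (i : Fin d) (s : ℝ) :
    S.kernelFactor N (some i) i s (S.lo i) = 0 := by
  simp [kernelFactor, dirichlet1_left]

lemma kernelFactor_some_hi (N : ℕ) (i : Fin d) (s : ℝ) :
    S.kernelFactor N (some i) i s (S.hi i) = 0 := by
  simp [kernelFactor, dirichlet1_right (S.lo_lt_hi i)]

lemma HasWeakDeriv.integral_mul_fderiv_kernel (h : S.HasWeakDeriv i f g) (hf : IntegrableOn f S.Ω)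
    (hg : IntegrableOn g S.Ω) (N : ℕ) (y : Space d) :
    ∫ x in S.Ω, f x * fderiv ℝ (S.kernel N (some i) y) x (EuclideanSpace.single i 1) =
      - ∫ x in S.Ω, g x * S.kernel N (some i) y x :=
  h.integral_mul_fderiv_tensor hf hg (fun j => S.contDiff_kernelFactor N (some i) j (y j))
    (kernelFactor_some_lo N i _) (kernelFactor_some_hi N i _)

lemma fderiv_op (N : ℕ) (o : Option (Fin d)) (hf : IntegrableOn f S.Ω) (x v : Space d) :
    fderiv ℝ (S.op N o f) x v = ∫ y in S.Ω, fderiv ℝ (S.kernel N o y) x v * f y := by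
  obtain ⟨n, A, B, hA, hB, e⟩ := S.isSeparated_kernel N o
  have hAd : ∀ l, DifferentiableAt ℝ (A l) x := fun l => (hA l).differentiable (by simp) x
  have e1 : S.op N o f = fun x => ∑ l, A l x * ∫ y in S.Ω, B l y * f y := by
    ext x
    simp only [op, e, Finset.sum_mul, mul_assoc]
    rw [integral_finsetSum _ fun l _ =>
      (integrableOn_mul_of_continuous (hB l).continuous hf).const_mul _]
    simp only [integral_const_mul]
  have e2 : ∀ y, S.kernel N o y = fun x => ∑ l, A l x * B l y := fun y => by
    ext x
    rw [S.kernel_comm, e]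
  have e3 : ∀ c : Fin n → ℝ, fderiv ℝ (fun x => ∑ l, A l x * c l) x v =
      ∑ l, fderiv ℝ (A l) x v * c l := fun c => by
    have : HasFDerivAt (fun x => ∑ l, A l x * c l) (∑ l, c l • fderiv ℝ (A l) x) x :=
      HasFDerivAt.fun_sum fun l _ => (hAd l).hasFDerivAt.mul_const (c l)
    rw [this.fderiv]
    simp [mul_comm]
  simp only [e1, e2, e3, Finset.sum_mul, mul_assoc]
  rw [integral_finsetSum _ fun l _ =>
    (integrableOn_mul_of_continuous (hB l).continuous hf).const_mul _]
  simp only [integral_const_mul]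

/-- The gradient of the Neumann regularization is the Dirichlet regularization of the gradient. -/
lemma HasWeakDeriv.fderiv_op (h : S.HasWeakDeriv i f g) (hf : IntegrableOn f S.Ω)
    (hg : IntegrableOn g S.Ω) (N : ℕ) (x : Space d) :
    fderiv ℝ (S.op N none f) x (EuclideanSpace.single i 1) = S.op N (some i) g x := by
  rw [Setting.fderiv_op N none hf]
  have := h.integral_mul_fderiv_kernel hf hg N x
  simp only [S.fderiv_kernel_none, neg_mul]
  rw [integral_neg]
  simp only [mul_comm _ (f _)]
  rw [this, neg_neg, op]
  simp only [mul_comm (g _)]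

lemma setIntegral_Ω_eq_integral {F : Space d → ℝ} (h : ∀ x ∉ S.Ω, F x = 0) :
    ∫ x in S.Ω, F x = ∫ x, F x :=
  setIntegral_eq_integral_of_forall_compl_eq_zero h

/-- A Lipschitz extension to the whole space admits integration by parts with its almost everywhere
derivative (Rademacher), and it agrees with `f` near every interior point of the box. -/
lemma hasWeakDeriv_of_lipschitzOnWith {L : NNReal} (hf : LipschitzOnWith L f S.Ω) (i : Fin d) :
    S.HasWeakDeriv i f (fun x => fderiv ℝ f x (EuclideanSpace.single i 1)) := by
  intro φ hφ hφc hφs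
  obtain ⟨F, hF, hfF⟩ := hf.extend_real
  obtain ⟨D, hD⟩ := (hφ.of_le (mod_cast le_top) : ContDiff ℝ 1 φ).lipschitzWith_of_hasCompactSupport
    hφc one_ne_zero
  have h1 := hF.integral_lineDeriv_mul_eq (μ := (volume : Measure (Space d))) hD hφc
    (EuclideanSpace.single i 1)
  have h0 : ∀ x ∉ S.Ω, x ∉ tsupport φ := fun x hx hx' => hx (interior_subset (hφs hx'))
  have e1 : ∫ x in S.Ω, f x * fderiv ℝ φ x (EuclideanSpace.single i 1) =
      ∫ x, F x * fderiv ℝ φ x (EuclideanSpace.single i 1) := by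
    rw [← setIntegral_Ω_eq_integral (S := S)]
    · refine setIntegral_congr_fun S.measurableSet_Ω fun x hx => ?_
      simp only [hfF hx]
    · intro x hx
      have : fderiv ℝ φ x = 0 := by
        by_contra hne
        exact h0 x hx (support_fderiv_subset ℝ hne)
      simp [this]
  have e2 : ∫ x in S.Ω, fderiv ℝ f x (EuclideanSpace.single i 1) * φ x =
      ∫ x, lineDeriv ℝ F x (EuclideanSpace.single i 1) * φ x := by
    rw [← setIntegral_Ω_eq_integral (S := S)]
    · refine integral_congr_ae ?_
      filter_upwards [S.ae_mem_interior_Ω, ae_restrict_of_ae hF.ae_differentiableAt] with x hx hx'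
      have : f =ᶠ[𝓝 x] F := by
        filter_upwards [mem_interior_iff_mem_nhds.1 hx] with y hy using hfF hy
      rw [this.fderiv_eq, hx'.lineDeriv_eq_fderiv]
    · intro x hx
      rw [image_eq_zero_of_notMem_tsupport (h0 x hx), mul_zero]
  rw [e1, e2, h1, ← integral_neg]
  refine integral_congr_ae (Eventually.of_forall fun x => ?_)
  have hd : DifferentiableAt ℝ φ x := hφ.differentiable (by simp) x
  simp only [hd.lineDeriv_eq_fderiv, map_neg]
  ring

/-- The product `p φ` is again an admissible test function for `f`. -/
lemma HasWeakDeriv.mul_contDiff (h : S.HasWeakDeriv i f g) (hf : IntegrableOn f S.Ω)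
    (hg : IntegrableOn g S.Ω) {p : Space d → ℝ} (hp : ContDiff ℝ ∞ p) :
    S.HasWeakDeriv i (fun x => f x * p x)
      (fun x => g x * p x + f x * fderiv ℝ p x (EuclideanSpace.single i 1)) := by
  intro φ hφ hφc hφs
  have hs : tsupport (fun x => p x * φ x) ⊆ tsupport φ := tsupport_mul_subset_right
  have h1 := h (fun x => p x * φ x) (hp.mul hφ) hφc.mul_left (hs.trans hφs)
  have hpd : Continuous fun x => fderiv ℝ p x (EuclideanSpace.single i 1) :=
    (hp.continuous_fderiv (by simp)).clm_apply continuous_const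
  have hφd : Continuous fun x => fderiv ℝ φ x (EuclideanSpace.single i 1) :=
    (hφ.continuous_fderiv (by simp)).clm_apply continuous_const
  have e : ∀ x, fderiv ℝ (fun x => p x * φ x) x (EuclideanSpace.single i 1) =
      p x * fderiv ℝ φ x (EuclideanSpace.single i 1) +
        fderiv ℝ p x (EuclideanSpace.single i 1) * φ x := fun x => by
    rw [fderiv_fun_mul (hp.differentiable (by simp) x) (hφ.differentiable (by simp) x)]
    simp [mul_comm]
  simp only [e, mul_add] at h1
  have i1 : IntegrableOn (fun x => f x * (p x * fderiv ℝ φ x (EuclideanSpace.single i 1))) S.Ω := by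
    simpa only [mul_comm (f _)] using integrableOn_mul_of_continuous (hp.continuous.fun_mul hφd) hf
  have i2 : IntegrableOn (fun x => f x * (fderiv ℝ p x (EuclideanSpace.single i 1) * φ x)) S.Ω := by
    simpa only [mul_comm (f _)] using integrableOn_mul_of_continuous (hpd.fun_mul hφ.continuous) hf
  have i3 : IntegrableOn (fun x => g x * (p x * φ x)) S.Ω := by
    simpa only [mul_comm (g _)] using integrableOn_mul_of_continuous (hp.continuous.fun_mul hφ.continuous) hg
  rw [integral_add i1 i2] at h1
  simp only [add_mul, mul_assoc]
  rw [integral_add i3 i2]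
  linarith

end Setting


/-! ### The cosh-type dissipation function -/

/-- Fenchel-Young duality. With `s = 2 sinh τ` one has `C(s) = 4 τ sinh τ - 4 cosh τ + 4`, and the
inequality becomes the tangent bound `cosh τ + sinh τ (ξ/2 - τ) ≤ cosh (ξ/2)`, derived from `1 + x ≤
e^x` for `x = ±(ξ/2 - τ)`. -/
lemma mul_le_coshC_add (s ξ : ℝ) : s * ξ ≤ coshC s + 4 * (Real.cosh (ξ / 2) - 1) := by
  set τ := Real.arsinh (s / 2) with hτ
  have hs : s = 2 * Real.sinh τ := by rw [hτ, Real.sinh_arsinh]; ring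
  have hsq : Real.sqrt (s ^ 2 + 4) = 2 * Real.cosh τ := by
    rw [show s ^ 2 + 4 = (2 * Real.cosh τ) ^ 2 by
      rw [hs]; nlinarith [Real.cosh_sq τ]]
    exact Real.sqrt_sq (by positivity)
  have hlog : Real.log ((s + Real.sqrt (s ^ 2 + 4)) / 2) = τ := by
    rw [hsq, hs, show (2 * Real.sinh τ + 2 * Real.cosh τ) / 2 = Real.exp τ by
      rw [← Real.sinh_add_cosh]; ring, Real.log_exp]
  rw [coshC, hlog, hsq, hs]
  have e1 : Real.cosh (ξ / 2) = Real.cosh τ * Real.cosh (ξ / 2 - τ) +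
      Real.sinh τ * Real.sinh (ξ / 2 - τ) := by
    rw [← Real.cosh_add]; ring_nf
  have h1 := Real.add_one_le_exp (ξ / 2 - τ)
  have h2 := Real.add_one_le_exp (-(ξ / 2 - τ))
  have e2 : Real.cosh (ξ / 2) = (Real.exp τ * Real.exp (ξ / 2 - τ) +
      Real.exp (-τ) * Real.exp (-(ξ / 2 - τ))) / 2 := by
    rw [← Real.exp_add, ← Real.exp_add, Real.cosh_eq]; ring_nf
  have h3 := mul_le_mul_of_nonneg_left h1 (Real.exp_pos τ).le
  have h4 := mul_le_mul_of_nonneg_left h2 (Real.exp_pos (-τ)).le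
  have h5 : Real.cosh τ + Real.sinh τ * (ξ / 2 - τ) ≤ Real.cosh (ξ / 2) := by
    rw [e2, Real.cosh_eq, Real.sinh_eq]; nlinarith
  nlinarith

lemma abs_mul_le_coshC_add (s ξ : ℝ) : |s * ξ| ≤ coshC s + 4 * (Real.cosh (ξ / 2) - 1) := by
  refine abs_le.2 ⟨?_, mul_le_coshC_add s ξ⟩
  have := mul_le_coshC_add s (-ξ)
  rw [neg_div, Real.cosh_neg] at this
  linarith

lemma coshC_nonneg (s : ℝ) : 0 ≤ coshC s := by
  have := mul_le_coshC_add s 0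
  simpa using this

/-- Duality rescaled by `σ`; where `σ = 0`, a finite cost forces `j = 0`. -/
lemma abs_mul_le_perspC_add {j σ : ℝ} (hσ : 0 ≤ σ) (h : perspC j σ ≠ ⊤) (ξ : ℝ) :
    |j * ξ| ≤ (perspC j σ).toReal + σ * (4 * (Real.cosh (ξ / 2) - 1)) := by
  unfold perspC at h ⊢
  split_ifs at h ⊢ with h1 h2
  · rw [ENNReal.toReal_ofReal (mul_nonneg h1.le (coshC_nonneg _))]
    have := mul_le_mul_of_nonneg_left (abs_mul_le_coshC_add (j / σ) ξ) h1.le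
    rw [mul_add] at this
    refine le_trans (le_of_eq ?_) this
    rw [div_mul_eq_mul_div, abs_div, abs_of_pos h1]
    field_simp
  · have : σ = 0 := le_antisymm (not_lt.1 h1) hσ
    simp [h2, this]
  · exact absurd rfl h

/-- From `2 cosh (½ log (q/p)) = √(q/p) + √(p/q)`. The identity turns the dual cost of a jump, at
the difference of the logarithmic densities, into the squared difference of the square roots in the
dissipation. -/
lemma sqrt_mul_cosh_log_sub {p q : ℝ} (hp : 0 < p) (hq : 0 < q) :
    Real.sqrt (p * q) * (4 * (Real.cosh ((Real.log q - Real.log p) / 2) - 1)) =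
      2 * (Real.sqrt q - Real.sqrt p) ^ 2 := by
  have hlp : Real.log p = 2 * Real.log (Real.sqrt p) := by rw [Real.log_sqrt hp.le]; ring
  have hlq : Real.log q = 2 * Real.log (Real.sqrt q) := by rw [Real.log_sqrt hq.le]; ring
  have hsp := Real.sqrt_pos.2 hp
  have hsq := Real.sqrt_pos.2 hq
  rw [hlp, hlq, show (2 * Real.log (Real.sqrt q) - 2 * Real.log (Real.sqrt p)) / 2 =
    Real.log (Real.sqrt q) - Real.log (Real.sqrt p) by ring, ← Real.log_div hsq.ne' hsp.ne',
    Real.cosh_log (div_pos hsq hsp), Real.sqrt_mul hp.le]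
  field_simp
  ring

lemma cosh_sub_one_nonneg (ξ : ℝ) : 0 ≤ 4 * (Real.cosh (ξ / 2) - 1) := by
  have := Real.one_le_cosh (ξ / 2)
  linarith

namespace Setting

variable {d : ℕ} {S : Setting d}

/-- Dominated convergence for expressions in finitely many regularized functions. -/
lemma tendsto_integral_of_op {ι : Type*} [Fintype ι] (o : ι → Option (Fin d))
    {h : ι → Space d → ℝ} (hh : ∀ k, IntegrableOn (h k) S.Ω) {f : ℕ → Space d → ℝ}
    {F g : Space d → ℝ} {C : ℝ} (hC : 0 ≤ C)
    (hf : ∀ N, AEStronglyMeasurable (f N) (volume.restrict S.Ω)) (hg : IntegrableOn g S.Ω)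
    (hb : ∀ N, ∀ᵐ x ∂volume.restrict S.Ω, |f N x| ≤ g x + C * ∑ k, |S.op N (o k) (h k) x|)
    (hlim : ∀ᵐ x ∂volume.restrict S.Ω, ∀ ns : ℕ → ℕ, Tendsto ns atTop atTop →
      (∀ k, Tendsto (fun n => S.op (ns n) (o k) (h k) x) atTop (𝓝 (h k x))) →
      Tendsto (fun n => f (ns n) x) atTop (𝓝 (F x))) :
    Tendsto (fun N => ∫ x in S.Ω, f N x) atTop (𝓝 (∫ x in S.Ω, F x)) := by
  have hi : ∀ N k, IntegrableOn (fun x => |S.op N (o k) (h k) x - h k x|) S.Ω := fun N k =>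
    ((integrableOn_op (hh k)).sub (hh k)).abs
  -- The factor `C + 1` instead of `C` keeps the error above each of the distances even for `C = 0`:
  -- the pointwise convergence of the regularized functions is read off from it.
  refine tendsto_integral_of_error
    (Z := fun N x => (C + 1) * ∑ k, |S.op N (o k) (h k) x - h k x|)
    (g := fun x => g x + C * ∑ k, |h k x|) (fun N => ?_) (fun N x => ?_) ?_ hf ?_ (fun N => ?_) ?_
  · exact (integrable_finsetSum _ fun k _ => hi N k).const_mul _
  · positivity
  · simp only [integral_const_mul]
    have : ∀ N, ∫ x in S.Ω, ∑ k, |S.op N (o k) (h k) x - h k x| =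
        ∑ k, ∫ x in S.Ω, |S.op N (o k) (h k) x - h k x| := fun N =>
      integral_finsetSum _ fun k _ => hi N k
    simp only [this]
    simpa using (tendsto_finsetSum Finset.univ fun k _ =>
      S.tendsto_integral_abs_op_sub (o k) (hh k)).const_mul (C + 1)
  · exact hg.add ((integrable_finsetSum _ fun k _ => (hh k).abs).const_mul _)
  · filter_upwards [hb N] with x hx
    have h1 : ∑ k, |S.op N (o k) (h k) x| ≤
        ∑ k, |h k x| + ∑ k, |S.op N (o k) (h k) x - h k x| := by
      rw [← Finset.sum_add_distrib]
      refine Finset.sum_le_sum fun k _ => ?_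
      have := abs_add_le (h k x) (S.op N (o k) (h k) x - h k x)
      simpa using this
    have h2 := mul_le_mul_of_nonneg_left h1 hC
    have h3 : 0 ≤ ∑ k, |S.op N (o k) (h k) x - h k x| := by positivity
    linarith
  · filter_upwards [hlim] with x hx ns hns hZ
    refine hx ns hns fun k => ?_
    rw [tendsto_iff_norm_sub_tendsto_zero]
    refine squeeze_zero (fun n => norm_nonneg _) (fun n => ?_) hZ
    have h1 : |S.op (ns n) (o k) (h k) x - h k x| ≤
        ∑ k, |S.op (ns n) (o k) (h k) x - h k x| :=
      Finset.single_le_sum (f := fun k => |S.op (ns n) (o k) (h k) x - h k x|)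
        (fun k _ => abs_nonneg _) (Finset.mem_univ k)
    have h3 : 0 ≤ ∑ k, |S.op (ns n) (o k) (h k) x - h k x| := by positivity
    rw [Real.norm_eq_abs]
    nlinarith

/-! ### A product rule -/

lemma exists_bound_of_lipschitzOnWith {f : Space d → ℝ} {L : NNReal}
    (hf : LipschitzOnWith L f S.Ω) : ∃ M, 0 ≤ M ∧ ∀ x ∈ S.Ω, |f x| ≤ M := by
  obtain ⟨M, hM⟩ := S.isCompact_Ω.exists_bound_of_continuousOn hf.continuousOn
  exact ⟨max M 0, le_max_right _ _, fun x hx => (hM x hx).trans (le_max_left _ _)⟩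

lemma exp_neg_lipschitzOnWith {f : Space d → ℝ} {L : NNReal} (hf : LipschitzOnWith L f S.Ω) :
    ∃ L' : NNReal, LipschitzOnWith L' (fun x => Real.exp (-f x)) S.Ω := by
  obtain ⟨M, hM0, hM⟩ := exists_bound_of_lipschitzOnWith hf
  have h1 : LipschitzOnWith (Real.toNNReal (Real.exp M)) Real.exp (Iic M) := by
    refine (convex_Iic M).lipschitzOnWith_of_nnnorm_deriv_le (fun x _ => Real.differentiableAt_exp)
      fun x hx => ?_
    rw [Real.deriv_exp, ← NNReal.coe_le_coe, coe_nnnorm, Real.norm_of_nonneg (Real.exp_pos _).le,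
      Real.coe_toNNReal _ (Real.exp_pos _).le]
    exact Real.exp_le_exp.2 hx
  have h2 : LipschitzOnWith L (fun x => -f x) S.Ω := by
    intro x hx y hy
    rw [edist_neg_neg]
    exact hf hx hy
  exact ⟨_, h1.comp h2 fun x hx => (abs_le.1 (hM x hx)).1 |> fun h => by
    simp only [mem_Iic]; linarith⟩

lemma ae_differentiableAt_of_lipschitzOnWith {f : Space d → ℝ} {L : NNReal}
    (hf : LipschitzOnWith L f S.Ω) : ∀ᵐ x ∂volume.restrict S.Ω, DifferentiableAt ℝ f x := by
  have h1 := hf.ae_differentiableWithinAt_of_mem (μ := (volume : Measure (Space d)))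
  filter_upwards [ae_restrict_of_ae h1, S.ae_mem_interior_Ω] with x hx hx'
  exact (hx (interior_subset hx')).differentiableAt (mem_interior_iff_mem_nhds.1 hx')

lemma norm_fderiv_le_of_mem_interior {f : Space d → ℝ} {L : NNReal}
    (hf : LipschitzOnWith L f S.Ω) {x : Space d} (hx : x ∈ interior S.Ω) :
    ‖fderiv ℝ f x‖ ≤ L :=
  norm_fderiv_le_of_lipschitzOn ℝ (mem_interior_iff_mem_nhds.1 hx) hf

lemma abs_fderiv_single_le {f : Space d → ℝ} {L : NNReal}
    (hf : LipschitzOnWith L f S.Ω) {x : Space d} (hx : x ∈ interior S.Ω) (i : Fin d) :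
    |fderiv ℝ f x (EuclideanSpace.single i 1)| ≤ L := by
  refine ((fderiv ℝ f x).le_opNorm _).trans ?_
  simpa using norm_fderiv_le_of_mem_interior hf hx

lemma measurable_fderiv_single (f : Space d → ℝ) (i : Fin d) :
    Measurable (fun x => fderiv ℝ f x (EuclideanSpace.single i 1)) :=
  measurable_fderiv_apply_const ℝ f _

lemma integrableOn_fderiv_single {f : Space d → ℝ} {L : NNReal}
    (hf : LipschitzOnWith L f S.Ω) (i : Fin d) :
    IntegrableOn (fun x => fderiv ℝ f x (EuclideanSpace.single i 1)) S.Ω := by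
  refine (S.integrableOn_of_continuous (continuous_const (y := (L:ℝ)))).mono'
    (measurable_fderiv_single f i).aestronglyMeasurable ?_
  filter_upwards [S.ae_mem_interior_Ω] with x hx using abs_fderiv_single_le hf hx i

lemma HasWeakDeriv.congr {i : Fin d} {f f' g g' : Space d → ℝ} (h : S.HasWeakDeriv i f g)
    (hf : ∀ᵐ x ∂volume.restrict S.Ω, f x = f' x) (hg : ∀ᵐ x ∂volume.restrict S.Ω, g x = g' x) :
    S.HasWeakDeriv i f' g' := by
  intro φ h1 h2 h3
  have e1 : ∫ x in S.Ω, f' x * fderiv ℝ φ x (EuclideanSpace.single i 1) =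
      ∫ x in S.Ω, f x * fderiv ℝ φ x (EuclideanSpace.single i 1) :=
    integral_congr_ae (by filter_upwards [hf] with x hx; rw [hx])
  have e2 : ∫ x in S.Ω, g' x * φ x = ∫ x in S.Ω, g x * φ x :=
    integral_congr_ae (by filter_upwards [hg] with x hx; rw [hx])
  rw [e1, e2]
  exact h φ h1 h2 h3

lemma ae_fderiv_exp_neg {f : Space d → ℝ} {L : NNReal} (hf : LipschitzOnWith L f S.Ω) (i : Fin d) :
    ∀ᵐ x ∂volume.restrict S.Ω,
      fderiv ℝ (fun x => Real.exp (-f x)) x (EuclideanSpace.single i 1) =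
        -Real.exp (-f x) * fderiv ℝ f x (EuclideanSpace.single i 1) := by
  filter_upwards [ae_differentiableAt_of_lipschitzOnWith hf] with x hx
  have := (hx.hasFDerivAt.neg).exp
  change HasFDerivAt (fun x => Real.exp (-f x)) _ x at this
  rw [this.fderiv]
  simp

lemma integrableOn_mul_of_sq {s g : Space d → ℝ} (hs : IntegrableOn s S.Ω)
    (hg : IntegrableOn g S.Ω) (hs2 : IntegrableOn (fun x => s x ^ 2) S.Ω)
    (hg2 : IntegrableOn (fun x => g x ^ 2) S.Ω) : IntegrableOn (fun x => s x * g x) S.Ω := by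
  refine (hs2.add hg2).mono' (hs.aestronglyMeasurable.mul hg.aestronglyMeasurable)
    (Eventually.of_forall fun x => ?_)
  rw [Real.norm_eq_abs, abs_le]
  simp only [Pi.add_apply]
  constructor <;> nlinarith [sq_nonneg (s x - g x), sq_nonneg (s x + g x)]

/-- Neither `s` nor `g` is bounded, so the product rule is first used for the smooth Neumann
regularization of `s`, whose derivative is the Dirichlet regularization of `g`. Cauchy-Schwarz
against the constant one bounds squares of regularizations by regularizations of squares, which
provides the domination for the limit. -/
lemma HasWeakDeriv.sq_mul_exp_neg {i : Fin d} {s g f : Space d → ℝ} {L : NNReal}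
    (h : S.HasWeakDeriv i s g) (hs : IntegrableOn s S.Ω) (hg : IntegrableOn g S.Ω)
    (hs2 : IntegrableOn (fun x => s x ^ 2) S.Ω) (hg2 : IntegrableOn (fun x => g x ^ 2) S.Ω)
    (hf : LipschitzOnWith L f S.Ω) :
    S.HasWeakDeriv i (fun x => s x ^ 2 * Real.exp (-f x))
      (fun x => 2 * s x * g x * Real.exp (-f x) -
        s x ^ 2 * Real.exp (-f x) * fderiv ℝ f x (EuclideanSpace.single i 1)) := by
  obtain ⟨L', hm⟩ := exp_neg_lipschitzOnWith hf
  set m : Space d → ℝ := fun x => Real.exp (-f x) with hmdef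
  set Dm : Space d → ℝ := fun x => fderiv ℝ m x (EuclideanSpace.single i 1) with hDm
  have hmi : IntegrableOn m S.Ω := hm.continuousOn.integrableOn_compact S.isCompact_Ω
  have hDmi : IntegrableOn Dm S.Ω := integrableOn_fderiv_single hm i
  obtain ⟨M, hM0, hM⟩ := exists_bound_of_lipschitzOnWith hm
  have hmw : S.HasWeakDeriv i m Dm := hasWeakDeriv_of_lipschitzOnWith hm i
  suffices H : S.HasWeakDeriv i (fun x => m x * s x ^ 2)
      (fun x => Dm x * s x ^ 2 + m x * (2 * s x * g x)) by
    refine H.congr (Eventually.of_forall fun x => mul_comm _ _) ?_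
    filter_upwards [ae_fderiv_exp_neg hf i] with x hx
    simp only [hDm, hmdef, hx]
    ring
  intro φ hφ hφc hφs
  set e := EuclideanSpace.single i (1:ℝ) with he
  have hφd : Continuous fun x => fderiv ℝ φ x e :=
    (hφ.continuous_fderiv (by simp)).clm_apply continuous_const
  obtain ⟨A, hA⟩ := S.isCompact_Ω.exists_bound_of_continuousOn hφ.continuous.continuousOn
  obtain ⟨B, hB⟩ := S.isCompact_Ω.exists_bound_of_continuousOn hφd.continuousOn
  -- The list contains `s` and `g` for the pointwise limit, and their squares to dominate the
  -- quadratic expressions.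
  set o : Fin 4 → Option (Fin d) := ![none, some i, none, none] with ho
  set hv : Fin 4 → Space d → ℝ := ![s, g, fun x => s x ^ 2, fun x => g x ^ 2] with hhv
  have hvi : ∀ k, IntegrableOn (hv k) S.Ω := by
    intro k; fin_cases k <;> simpa [hhv]
  have h1i : IntegrableOn (fun _ : Space d => (1:ℝ)) S.Ω := S.integrableOn_of_continuous continuous_const
  have hsN : ∀ N x, S.op N none s x ^ 2 ≤ S.op N none (fun x => s x ^ 2) x := fun N x => by
    have := op_sq_le (N := N) (o := none) hs hs2 h1i (Eventually.of_forall fun _ => sq_nonneg _)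
      (Eventually.of_forall fun _ => zero_le_one) (Eventually.of_forall fun x => by simp) x
    rwa [op_none_const, mul_one] at this
  have hgN : ∀ N x, S.op N (some i) g x ^ 2 ≤ S.op N none (fun x => g x ^ 2) x := fun N x => by
    have := op_sq_le (N := N) (o := some i) hg hg2 h1i (Eventually.of_forall fun _ => sq_nonneg _)
      (Eventually.of_forall fun _ => zero_le_one) (Eventually.of_forall fun x => by simp) x
    rwa [op_none_const, mul_one] at this
  have hsum : ∀ N x, S.op N none (fun x => s x ^ 2) x ≤ ∑ k, |S.op N (o k) (hv k) x| ∧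
      S.op N none (fun x => g x ^ 2) x ≤ ∑ k, |S.op N (o k) (hv k) x| ∧
      S.op N none (fun x => s x ^ 2) x + S.op N none (fun x => g x ^ 2) x ≤
        ∑ k, |S.op N (o k) (hv k) x| := by
    intro N x
    simp only [ho, hhv, Fin.sum_univ_four]
    simp only [Matrix.cons_val]
    have := abs_nonneg (S.op N none s x)
    have := abs_nonneg (S.op N (some i) g x)
    have := le_abs_self (S.op N none (fun x => s x ^ 2) x)
    have := le_abs_self (S.op N none (fun x => g x ^ 2) x)
    have := abs_nonneg (S.op N none (fun x => s x ^ 2) x)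
    have := abs_nonneg (S.op N none (fun x => g x ^ 2) x)
    refine ⟨by linarith, by linarith, by linarith⟩
  have hN : ∀ N, ∫ x in S.Ω, m x * S.op N none s x ^ 2 * fderiv ℝ φ x e =
      - ∫ x in S.Ω, (Dm x * S.op N none s x ^ 2 +
        m x * (2 * S.op N none s x * S.op N (some i) g x)) * φ x := by
    intro N
    have hp : ContDiff ℝ ∞ (fun x => S.op N none s x ^ 2) := (contDiff_op hs).pow 2
    have := hmw.mul_contDiff hmi hDmi hp φ hφ hφc hφs
    rw [this]
    congr 1
    refine integral_congr_ae (Eventually.of_forall fun x => ?_)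
    simp only
    have hd : DifferentiableAt ℝ (S.op N none s) x := (contDiff_op hs).differentiable (by simp) x
    have : HasFDerivAt (fun x => S.op N none s x ^ 2)
        ((2 * S.op N none s x ^ 1) • fderiv ℝ (S.op N none s) x) x := by
      simpa using hd.hasFDerivAt.pow 2
    rw [this.fderiv]
    simp only [pow_one, _root_.smul_apply, smul_eq_mul]
    rw [h.fderiv_op hs hg]
  have l1 : Tendsto (fun N => ∫ x in S.Ω, m x * S.op N none s x ^ 2 * fderiv ℝ φ x e) atTop
      (𝓝 (∫ x in S.Ω, m x * s x ^ 2 * fderiv ℝ φ x e)) := by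
    refine tendsto_integral_of_op o hvi (g := fun _ => 0) (C := M * |B|) (by positivity)
      (fun N => (hmi.aestronglyMeasurable.mul
        ((continuous_op hs).pow 2).aestronglyMeasurable).mul hφd.aestronglyMeasurable)
      (S.integrableOn_of_continuous continuous_const) (fun N => ?_) ?_
    · filter_upwards [ae_restrict_mem S.measurableSet_Ω] with x hx
      have h1 := hM x hx
      have h2 : |fderiv ℝ φ x e| ≤ |B| := (hB x hx).trans (le_abs_self B)
      have h3 := (hsN N x).trans (hsum N x).1
      rw [zero_add, abs_mul, abs_mul, abs_of_nonneg (sq_nonneg (S.op N none s x)), mul_assoc, mul_assoc]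
      refine mul_le_mul h1 ?_ (by positivity) hM0
      rw [mul_comm]
      exact mul_le_mul h2 h3 (by positivity) (by positivity)
    · refine Eventually.of_forall fun x ns _ hk => ?_
      exact ((hk 0).pow 2).const_mul (m x) |>.mul_const _
  have l2 : Tendsto (fun N => ∫ x in S.Ω, (Dm x * S.op N none s x ^ 2 +
        m x * (2 * S.op N none s x * S.op N (some i) g x)) * φ x) atTop
      (𝓝 (∫ x in S.Ω, (Dm x * s x ^ 2 + m x * (2 * s x * g x)) * φ x)) := by
    refine tendsto_integral_of_op o hvi (g := fun _ => 0) (C := (L' + M) * |A|) (by positivity)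
      (fun N => ((hDmi.aestronglyMeasurable.mul
        ((continuous_op hs).pow 2).aestronglyMeasurable).add (hmi.aestronglyMeasurable.mul
        (((continuous_op hs).const_mul 2).mul (continuous_op hg)).aestronglyMeasurable)).mul
        hφ.continuous.aestronglyMeasurable)
      (S.integrableOn_of_continuous continuous_const) (fun N => ?_) ?_
    · filter_upwards [S.ae_mem_interior_Ω] with x hx
      have h1 := hM x (interior_subset hx)
      have h2 : |φ x| ≤ |A| := (hA x (interior_subset hx)).trans (le_abs_self A)
      have h3 := (hsN N x).trans (hsum N x).1
      have h4 : |Dm x| ≤ L' := abs_fderiv_single_le hm hx i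
      have h5 : |2 * S.op N none s x * S.op N (some i) g x| ≤ ∑ k, |S.op N (o k) (hv k) x| := by
        refine le_trans ?_ (hsum N x).2.2
        refine le_trans ?_ (add_le_add (hsN N x) (hgN N x))
        rw [abs_le]
        constructor <;> nlinarith [sq_nonneg (S.op N none s x - S.op N (some i) g x),
          sq_nonneg (S.op N none s x + S.op N (some i) g x)]
      set Q := ∑ k, |S.op N (o k) (hv k) x| with hQ
      have hQ0 : 0 ≤ Q := by positivity
      rw [zero_add, abs_mul, mul_right_comm ((L' : ℝ) + M)]
      refine mul_le_mul ?_ h2 (abs_nonneg _) (by positivity)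
      refine (abs_add_le _ _).trans ?_
      rw [abs_mul, abs_mul (m x), abs_of_nonneg (sq_nonneg (S.op N none s x)), add_mul]
      exact add_le_add (mul_le_mul h4 h3 (sq_nonneg _) L'.2) (mul_le_mul h1 h5 (abs_nonneg _) hM0)
    · refine Eventually.of_forall fun x ns _ hk => ?_
      have k0 := hk 0
      have k1 := hk 1
      exact (((k0.pow 2).const_mul (Dm x)).add
        (((k0.const_mul 2).mul k1).const_mul (m x))).mul_const _
  exact tendsto_nhds_unique l1 (l2.neg.congr fun N => (hN N).symm)

end Setting


/-! ### Absolutely continuous curves -/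

lemma integral_mul_eq_neg_integral_deriv_mul {T : ℝ} {g η : ℝ → ℝ}
    (hg : IntervalIntegrable g volume 0 T) (hη : ContDiff ℝ ∞ η) (h0 : η 0 = 0) (hηT : η T = 0) :
    ∫ t in (0:ℝ)..T, η t * g t = - ∫ t in (0:ℝ)..T, deriv η t * ∫ τ in (0:ℝ)..t, g τ := by
  have hG := hg.absolutelyContinuousOnInterval_intervalIntegral (c := 0) (by simp)
  have hηd : Continuous (deriv η) := hη.continuous_deriv (by simp)
  obtain ⟨C, hC⟩ := (isCompact_uIcc (a := 0) (b := T)).exists_bound_of_continuousOn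
    hηd.continuousOn
  have hηac : AbsolutelyContinuousOnInterval η 0 T := by
    refine LipschitzOnWith.absolutelyContinuousOnInterval (K := C.toNNReal) ?_
    refine (convex_uIcc 0 T).lipschitzOnWith_of_nnnorm_deriv_le
      (fun x _ => hη.differentiable (by simp) x) fun x hx => ?_
    rw [← NNReal.coe_le_coe, coe_nnnorm]
    exact (hC x hx).trans (Real.le_coe_toNNReal C)
  have := hηac.integral_mul_deriv_eq_deriv_mul hG
  rw [h0, hηT, zero_mul, zero_mul, sub_zero, zero_sub] at this
  rw [← this]
  refine intervalIntegral.integral_congr_ae ?_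
  filter_upwards [hg.ae_hasDerivAt_integral] with t ht ht'
  rw [(ht (uIoc_subset_uIcc ht') 0 (by simp)).deriv]

/-- A continuous function with vanishing weak derivative is constant. -/
lemma eq_of_weak_deriv_zero {T : ℝ} (hT : 0 < T) {p : ℝ → ℝ} (hp : ContinuousOn p (Icc 0 T))
    (h : ∀ η : ℝ → ℝ, ContDiff ℝ ∞ η → HasCompactSupport η → tsupport η ⊆ Ioo 0 T →
      ∫ t in (0:ℝ)..T, deriv η t * p t = 0) : ∀ t ∈ Icc 0 T, p t = p 0 := by
  -- A fixed bump of mass one: any test function minus its mass times the bump has mean zero, hence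
  -- is the derivative of another test function (du Bois-Reymond).
  let f : ContDiffBump (T / 2) := ⟨T / 8, T / 4, by positivity, by linarith⟩
  set ζ₀ : ℝ → ℝ := f.normed volume with hζ₀
  have hζ₀s : ContDiff ℝ ∞ ζ₀ := f.contDiff_normed
  have hζ₀c : HasCompactSupport ζ₀ := f.hasCompactSupport_normed
  have hζ₀t : tsupport ζ₀ ⊆ Ioo 0 T := by
    rw [hζ₀, f.tsupport_normed_eq]
    intro x hx
    rw [Metric.mem_closedBall, Real.dist_eq, abs_le] at hx
    have : f.rOut = T / 4 := rfl
    constructor <;> linarith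
  have hζ₀i : ∫ t, ζ₀ t = 1 := f.integral_normed
  have hIi : ∀ q : ℝ → ℝ, tsupport q ⊆ Ioo 0 T → ∀ r : ℝ → ℝ,
      ∫ t in (0:ℝ)..T, q t * r t = ∫ t, q t * r t := by
    intro q hq r
    rw [intervalIntegral.integral_of_le hT.le]
    refine setIntegral_eq_integral_of_forall_compl_eq_zero fun x hx => ?_
    rw [image_eq_zero_of_notMem_tsupport fun hx' => hx ⟨(hq hx').1, (hq hx').2.le⟩, zero_mul]
  have hpi : ∀ q : ℝ → ℝ, Continuous q → IntervalIntegrable (fun t => q t * p t) volume 0 T := by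
    intro q hq
    refine ContinuousOn.intervalIntegrable ?_
    rw [uIcc_of_le hT.le]
    exact hq.continuousOn.mul hp
  set c : ℝ := ∫ t in (0:ℝ)..T, ζ₀ t * p t with hc
  have key : ∀ ζ : ℝ → ℝ, ContDiff ℝ ∞ ζ → HasCompactSupport ζ → tsupport ζ ⊆ Ioo 0 T →
      ∫ t, ζ t • (p t - c) = 0 := by
    intro ζ hζ hζc hζt
    set I := ∫ t, ζ t with hI
    set ψ : ℝ → ℝ := fun t => ζ t - I * ζ₀ t with hψ
    have hψs : ContDiff ℝ ∞ ψ := hζ.sub (contDiff_const.mul hζ₀s)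
    set η : ℝ → ℝ := fun x => ∫ t in (0:ℝ)..x, ψ t with hη
    have hηd : ∀ x, HasDerivAt η (ψ x) x := fun x =>
      intervalIntegral.integral_hasDerivAt_right (hψs.continuous.intervalIntegrable _ _)
        (hψs.continuous.stronglyMeasurableAtFilter _ _) hψs.continuous.continuousAt
    have hηd' : deriv η = ψ := by ext x; exact (hηd x).deriv
    have hηs : ContDiff ℝ ∞ η := by
      rw [contDiff_infty_iff_deriv]
      exact ⟨fun x => (hηd x).differentiableAt, hηd' ▸ hψs⟩
    set K := tsupport ζ ∪ tsupport ζ₀ with hK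
    have hKc : IsCompact K := hζc.isCompact.union hζ₀c.isCompact
    have hKne : K.Nonempty := by
      by_contra hne
      rw [not_nonempty_iff_eq_empty] at hne
      have : ∀ x, ζ₀ x = 0 := fun x => image_eq_zero_of_notMem_tsupport fun hx => by
        have : x ∈ K := Or.inr hx
        rw [hne] at this
        exact this
      simp [this] at hζ₀i
    have hKs : K ⊆ Ioo 0 T := union_subset hζt hζ₀t
    obtain ⟨α, hα, hαl⟩ := hKc.exists_isLeast hKne
    obtain ⟨β, hβ, hβl⟩ := hKc.exists_isGreatest hKne
    have hψ0 : ∀ x ∉ K, ψ x = 0 := fun x hx => by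
      rw [hψ]
      simp only
      rw [image_eq_zero_of_notMem_tsupport fun h => hx (Or.inl h),
        image_eq_zero_of_notMem_tsupport fun h => hx (Or.inr h)]
      simp
    have hζi : Integrable ζ := hζ.continuous.integrable_of_hasCompactSupport hζc
    have hζ₀i' : Integrable ζ₀ := hζ₀s.continuous.integrable_of_hasCompactSupport hζ₀c
    have hψi : ∫ t, ψ t = 0 := by
      rw [hψ, integral_sub hζi (hζ₀i'.const_mul _), integral_const_mul, hζ₀i]
      simp [hI]
    -- To the left of `K` the primitive integrates zero; to the right it equals the whole integral
    -- of `ψ`, which vanishes.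
    have hη0 : ∀ x ∉ Icc α β, η x = 0 := by
      intro x hx
      rcases lt_or_ge x α with hxα | hxα
      · rw [hη]
        simp only
        rw [intervalIntegral.integral_congr (g := fun _ => 0)]
        · simp
        · intro t ht
          refine hψ0 t fun htK => ?_
          have h1 := hαl htK
          have h2 := (hKs hα).1
          rcases le_total 0 x with h3 | h3
          · rw [uIcc_of_le h3] at ht; linarith [ht.2]
          · rw [uIcc_of_ge h3] at ht; linarith [ht.2]
      · have hxβ : β < x := by
          by_contra! hc
          exact hx ⟨hxα, hc⟩
        have hx0 : 0 ≤ x := (hKs hα).1.le.trans hxα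
        rw [hη]
        simp only
        rw [intervalIntegral.integral_of_le hx0, setIntegral_eq_integral_of_forall_compl_eq_zero,
          hψi]
        intro t ht
        refine hψ0 t fun htK => ht ⟨(hKs htK).1, ?_⟩
        exact (hβl htK).trans hxβ.le
    have hηsub : tsupport η ⊆ Icc α β := by
      refine closure_minimal (fun x hx => ?_) isClosed_Icc
      by_contra hc
      exact hx (hη0 x hc)
    have hηc : HasCompactSupport η := isCompact_Icc.of_isClosed_subset (isClosed_tsupport _) hηsub
    have h1 := h η hηs hηc (hηsub.trans fun x hx =>
      ⟨(hKs hα).1.trans_le hx.1, hx.2.trans_lt (hKs hβ).2⟩)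
    rw [hηd'] at h1
    have h2 : ∫ t in (0:ℝ)..T, ψ t * p t = (∫ t in (0:ℝ)..T, ζ t * p t) - I * c := by
      rw [hc, ← intervalIntegral.integral_const_mul, ← intervalIntegral.integral_sub
        (hpi ζ hζ.continuous) ((hpi ζ₀ hζ₀s.continuous).const_mul I)]
      congr 1
      ext t
      simp only [hψ]
      ring
    have h3 : ∫ t in (0:ℝ)..T, ζ t * (p t - c) = (∫ t in (0:ℝ)..T, ζ t * p t) - I * c := by
      simp only [mul_sub]
      rw [intervalIntegral.integral_sub (hpi ζ hζ.continuous)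
        ((hζ.continuous.intervalIntegrable _ _).mul_const c), intervalIntegral.integral_mul_const]
      congr 2
      have := hIi ζ hζt (fun _ => 1)
      simpa using this
    simp only [smul_eq_mul]
    rw [← hIi ζ hζt, h3, ← h2, h1]
  have hae : ∀ᵐ x, x ∈ Ioo 0 T → p x - c = 0 :=
    isOpen_Ioo.ae_eq_zero_of_integral_contDiff_smul_eq_zero
      (((hp.mono Ioo_subset_Icc_self).sub continuousOn_const).locallyIntegrableOn
        measurableSet_Ioo) key
  have hoo : EqOn p (fun _ => c) (Icc 0 T) := by
    have h1 : p =ᵐ[volume.restrict (Ioo 0 T)] fun _ => c := by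
      rw [Filter.EventuallyEq, ae_restrict_iff' measurableSet_Ioo]
      filter_upwards [hae] with x hx hx' using sub_eq_zero.1 (hx hx')
    have h2 : EqOn p (fun _ => c) (Ioo 0 T) :=
      Measure.eqOn_of_ae_eq h1 (hp.mono Ioo_subset_Icc_self) continuousOn_const
        (by rw [isOpen_Ioo.interior_eq]; exact subset_closure)
    refine h2.of_subset_closure hp continuousOn_const Ioo_subset_Icc_self ?_
    rw [closure_Ioo hT.ne]
  intro t ht
  rw [hoo ht, hoo ⟨le_rfl, hT.le⟩]

/-- A continuous function with integrable weak derivative is absolutely continuous. -/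
lemma sub_eq_integral_of_weak_deriv {T : ℝ} (hT : 0 < T) {m g : ℝ → ℝ}
    (hm : ContinuousOn m (Icc 0 T)) (hg : IntegrableOn g (Icc 0 T))
    (h : ∀ η : ℝ → ℝ, ContDiff ℝ ∞ η → HasCompactSupport η → tsupport η ⊆ Ioo 0 T →
      (∫ t in Icc 0 T, (deriv η t * m t + η t * g t)) = 0) :
    ∀ t ∈ Icc 0 T, m t - m 0 = ∫ τ in (0:ℝ)..t, g τ := by
  have hgi : IntervalIntegrable g volume 0 T := by
    rw [intervalIntegrable_iff_integrableOn_Icc_of_le hT.le]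
    exact hg
  have hG : ContinuousOn (fun t => ∫ τ in (0:ℝ)..t, g τ) (Icc 0 T) := by
    have := intervalIntegral.continuousOn_primitive_interval' hgi (a := 0) (by simp)
    rwa [uIcc_of_le hT.le] at this
  have hc := eq_of_weak_deriv_zero hT (hm.sub hG) ?_
  · intro t ht
    have := hc t ht
    simp only [Pi.sub_apply, intervalIntegral.integral_same] at this
    linarith
  · intro η hη hηc hηt
    have h1 := h η hη hηc hηt
    have hη0 : ∀ x, x ∉ Ioo 0 T → η x = 0 := fun x hx =>
      image_eq_zero_of_notMem_tsupport fun hx' => hx (hηt hx')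
    have h2 := integral_mul_eq_neg_integral_deriv_mul hgi hη (hη0 0 (by simp)) (hη0 T (by simp))
    have hd : Continuous (deriv η) := hη.continuous_deriv (by simp)
    have i1 : IntervalIntegrable (fun t => deriv η t * m t) volume 0 T := by
      refine ContinuousOn.intervalIntegrable ?_
      rw [uIcc_of_le hT.le]
      exact hd.continuousOn.mul hm
    have i2 : IntervalIntegrable (fun t => deriv η t * ∫ τ in (0:ℝ)..t, g τ) volume 0 T := by
      refine ContinuousOn.intervalIntegrable ?_
      rw [uIcc_of_le hT.le]
      exact hd.continuousOn.mul hG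
    have i3 : IntervalIntegrable (fun t => η t * g t) volume 0 T :=
      hgi.continuousOn_mul hη.continuous.continuousOn
    rw [integral_Icc_eq_integral_Ioc, ← intervalIntegral.integral_of_le hT.le,
      intervalIntegral.integral_add i1 i3, h2] at h1
    simp only [Pi.sub_apply, mul_sub]
    rw [intervalIntegral.integral_sub i1 i2]
    linarith

/-- The chain rule for a functional of finitely many absolutely continuous functions. -/
lemma sub_eq_integral_of_local {ι : Type*} [Fintype ι] {T : ℝ} (hT : 0 < T)
    {m v c : ι → ℝ → ℝ} {Φ : ℝ → ℝ} (hv : ∀ k, IntegrableOn (v k) (Icc 0 T))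
    (hm : ∀ k, ∀ t ∈ Icc 0 T, m k t - m k 0 = ∫ τ in (0:ℝ)..t, v k τ)
    (hc : ∀ k, ContinuousOn (c k) (Icc 0 T))
    (hΦ : ∀ t ∈ Icc 0 T, ∀ ε > 0, ∃ δ > 0, ∀ s ∈ Icc 0 T, |s - t| < δ →
      |Φ s - Φ t - ∑ k, c k t * (m k s - m k t)| ≤ ε * ∑ k, |m k s - m k t|) :
    Φ T - Φ 0 = ∫ t in (0:ℝ)..T, ∑ k, c k t * v k t := by
  have hvi : ∀ k, ∀ a ∈ Icc 0 T, ∀ b ∈ Icc 0 T, IntervalIntegrable (v k) volume a b := by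
    intro k a ha b hb
    rw [intervalIntegrable_iff]
    refine (hv k).mono_set fun x hx => ?_
    have := uIoc_subset_uIcc hx
    exact (convex_Icc 0 T).ordConnected.uIcc_subset ha hb this
  have hsub : ∀ a ∈ Icc 0 T, ∀ b ∈ Icc 0 T, uIcc a b ⊆ Icc 0 T := fun a ha b hb =>
    (convex_Icc 0 T).ordConnected.uIcc_subset ha hb
  have h0 : (0:ℝ) ∈ Icc 0 T := ⟨le_rfl, hT.le⟩
  have hTm : T ∈ Icc 0 T := ⟨hT.le, le_rfl⟩
  have hcvi : ∀ k, ∀ a ∈ Icc 0 T, ∀ b ∈ Icc 0 T,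
      IntervalIntegrable (fun t => c k t * v k t) volume a b := fun k a ha b hb =>
    (hvi k a ha b hb).continuousOn_mul ((hc k).mono (hsub a ha b hb))
  have hdm : ∀ k, ∀ t ∈ Icc 0 T, ∀ s ∈ Icc 0 T, m k s - m k t = ∫ τ in t..s, v k τ := by
    intro k t ht s hs
    have e1 := hm k t ht
    have e2 := hm k s hs
    have e3 := intervalIntegral.integral_add_adjacent_intervals (hvi k 0 h0 t ht) (hvi k t ht s hs)
    linarith
  set b : ℝ → ℝ := fun t => ∑ k, |v k t| with hb
  have hbi : ∀ a ∈ Icc 0 T, ∀ a' ∈ Icc 0 T, IntervalIntegrable b volume a a' := by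
    intro a ha a' ha'
    have := IntervalIntegrable.sum Finset.univ (fun k _ => (hvi k a ha a' ha').abs)
    convert! this using 1
    ext t
    simp [hb]
  set w : ℝ → ℝ := fun t => ∑ k, c k t * v k t with hw
  have hwi : ∀ a ∈ Icc 0 T, ∀ a' ∈ Icc 0 T, IntervalIntegrable w volume a a' := by
    intro a ha a' ha'
    have := IntervalIntegrable.sum Finset.univ (fun k _ => (hcvi k a ha a' ha'))
    convert! this using 1
    ext t
    simp [hw]
  -- `D` is the defect of the claimed formula, and `B` is a clock measuring the total variation of
  -- all `m k`. Locally the increments of `D` are smaller than any multiple of those of `B`, which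
  -- forces `D = 0`. No absolute continuity of `Φ` is presupposed.
  set D : ℝ → ℝ := fun t => Φ t - Φ 0 - ∫ τ in (0:ℝ)..t, w τ with hD
  set B : ℝ → ℝ := fun t => ∫ τ in (0:ℝ)..t, b τ with hB
  have hBd : ∀ t ∈ Icc 0 T, ∀ s ∈ Icc 0 T, B s - B t = ∫ τ in t..s, b τ := by
    intro t ht s hs
    have e3 := intervalIntegral.integral_add_adjacent_intervals (hbi 0 h0 t ht) (hbi t ht s hs)
    simp only [hB]
    linarith
  have hBc : ContinuousOn B (Icc 0 T) := by
    have := intervalIntegral.continuousOn_primitive_interval' (hbi 0 h0 T hTm) (a := 0) (by simp)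
    rwa [uIcc_of_le hT.le] at this
  have hb0 : ∀ t, 0 ≤ b t := fun t => Finset.sum_nonneg fun k _ => abs_nonneg _
  -- the local estimate
  have hloc : ∀ t ∈ Icc 0 T, ∀ ε > 0, ∃ δ > 0, ∀ s ∈ Icc 0 T, |s - t| < δ →
      |D s - D t| ≤ ε * |B s - B t| := by
    intro t ht ε hε
    obtain ⟨δ₁, hδ₁, h1⟩ := hΦ t ht (ε / 2) (half_pos hε)
    have h2 : ∃ δ₂ > 0, ∀ s ∈ Icc 0 T, |s - t| < δ₂ → ∀ k, |c k t - c k s| ≤ ε / 2 := by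
      have : ∀ᶠ s in 𝓝[Icc 0 T] t, ∀ k, |c k t - c k s| ≤ ε / 2 := by
        rw [eventually_all]
        intro k
        have := (hc k t ht).eventually (Metric.ball_mem_nhds (c k t) (half_pos hε))
        filter_upwards [this] with s hs
        have hs' : |c k s - c k t| < ε / 2 := hs
        rw [abs_sub_comm] at hs'
        exact hs'.le
      rw [eventually_nhdsWithin_iff, Metric.eventually_nhds_iff] at this
      obtain ⟨δ₂, hδ₂, h3⟩ := this
      exact ⟨δ₂, hδ₂, fun s hs hst => h3 (by rwa [Real.dist_eq]) hs⟩
    obtain ⟨δ₂, hδ₂, h2⟩ := h2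
    refine ⟨min δ₁ δ₂, lt_min hδ₁ hδ₂, fun s hs hst => ?_⟩
    have h3 := h1 s hs (hst.trans_le (min_le_left _ _))
    have hBle : ∑ k, |m k s - m k t| ≤ |B s - B t| := by
      have e1 : |B s - B t| = ∑ k, abs (∫ τ in t..s, |v k τ|) := by
        rw [hBd t ht s hs, hb, intervalIntegral.integral_finsetSum
          fun k _ => (hvi k t ht s hs).abs]
        rcases le_total t s with hts | hts
        · rw [abs_of_nonneg]
          · refine Finset.sum_congr rfl fun k _ => (abs_of_nonneg ?_).symm
            exact intervalIntegral.integral_nonneg hts fun _ _ => abs_nonneg _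
          · exact Finset.sum_nonneg fun k _ =>
              intervalIntegral.integral_nonneg hts fun _ _ => abs_nonneg _
        · have hneg : ∀ k, ∫ τ in t..s, |v k τ| ≤ 0 := fun k => by
            rw [intervalIntegral.integral_symm]
            have := intervalIntegral.integral_nonneg (μ := volume) hts
              (fun τ _ => abs_nonneg (v k τ))
            linarith
          rw [abs_of_nonpos (Finset.sum_nonpos fun k _ => hneg k), ← Finset.sum_neg_distrib]
          exact Finset.sum_congr rfl fun k _ => (abs_of_nonpos (hneg k)).symm
      rw [e1]
      refine Finset.sum_le_sum fun k _ => ?_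
      rw [hdm k t ht s hs]
      exact intervalIntegral.norm_integral_le_abs_integral_norm (f := v k) (μ := volume)
    have h4 : |∑ k, c k t * (m k s - m k t) - ∫ τ in t..s, w τ| ≤ ε / 2 * |B s - B t| := by
      have e1 : ∑ k, c k t * (m k s - m k t) - ∫ τ in t..s, w τ =
          ∫ τ in t..s, ∑ k, (c k t - c k τ) * v k τ := by
        simp only [hw, sub_mul, Finset.sum_sub_distrib]
        rw [intervalIntegral.integral_sub]
        · congr 1
          rw [intervalIntegral.integral_finsetSum fun k _ => (hvi k t ht s hs).const_mul _]
          refine Finset.sum_congr rfl fun k _ => ?_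
          rw [intervalIntegral.integral_const_mul, hdm k t ht s hs]
        · have := IntervalIntegrable.sum Finset.univ
            (fun k _ => (hvi k t ht s hs).const_mul (c k t))
          convert! this using 1
          ext τ
          simp
        · exact hwi t ht s hs
      rw [e1, hBd t ht s hs, ← Real.norm_eq_abs, ← abs_of_pos (half_pos hε), ← abs_mul,
        ← intervalIntegral.integral_const_mul]
      refine intervalIntegral.norm_integral_le_abs_of_norm_le ?_ ((hbi t ht s hs).const_mul _)
      rw [ae_restrict_iff' measurableSet_uIoc]
      refine Eventually.of_forall fun τ hτ => ?_
      have hτ' := uIoc_subset_uIcc hτ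
      have hτm := hsub t ht s hs hτ'
      have hτd : |τ - t| < δ₂ := by
        refine lt_of_le_of_lt ?_ (hst.trans_le (min_le_right _ _))
        exact abs_sub_left_of_mem_uIcc hτ'
      rw [Real.norm_eq_abs, hb]
      simp only
      rw [Finset.mul_sum]
      refine (Finset.abs_sum_le_sum_abs _ _).trans (Finset.sum_le_sum fun k _ => ?_)
      rw [abs_mul]
      exact mul_le_mul_of_nonneg_right (h2 τ hτm hτd k) (abs_nonneg _)
    have e2 : D s - D t = (Φ s - Φ t - ∑ k, c k t * (m k s - m k t)) +
        (∑ k, c k t * (m k s - m k t) - ∫ τ in t..s, w τ) := by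
      have e3 := intervalIntegral.integral_add_adjacent_intervals (hwi 0 h0 t ht) (hwi t ht s hs)
      simp only [hD]
      linarith
    rw [e2]
    refine (abs_add_le _ _).trans ?_
    have := mul_le_mul_of_nonneg_left hBle (half_pos hε).le
    linarith
  have hDc : ContinuousOn D (Icc 0 T) := by
    intro t ht
    obtain ⟨δ, hδ, h1⟩ := hloc t ht 1 one_pos
    rw [ContinuousWithinAt, tendsto_iff_norm_sub_tendsto_zero]
    have h2 : Tendsto (fun s => |B s - B t|) (𝓝[Icc 0 T] t) (𝓝 0) := by
      have := ((hBc t ht).sub_const (B t)).abs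
      simpa using this
    refine squeeze_zero' (Eventually.of_forall fun s => norm_nonneg _) ?_ h2
    filter_upwards [self_mem_nhdsWithin,
      mem_nhdsWithin_of_mem_nhds (Metric.ball_mem_nhds t hδ)] with s hs hs'
    rw [Metric.mem_ball, Real.dist_eq] at hs'
    simpa using h1 s hs hs'
  -- Continuous induction on `[0, T]`: the set where `|D| ≤ ε B` is closed, contains `0`, and
  -- extends to the right by the local estimate.
  have hfin : ∀ ε > 0, |D T| ≤ ε * B T := by
    intro ε hε
    have hcl : IsClosed ({t | |D t| ≤ ε * B t} ∩ Icc 0 T) := by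
      rw [inter_comm]
      have : ContinuousOn (fun t => ε * B t - |D t|) (Icc 0 T) :=
        (continuousOn_const.mul hBc).sub hDc.abs
      convert! this.preimage_isClosed_of_isClosed isClosed_Icc (isClosed_Ici (a := (0:ℝ))) using 2
      ext t
      simp
    refine hcl.Icc_subset_of_forall_mem_nhdsWithin ?_ (fun t ht => ?_) hTm
    · simp [hD, hB]
    · have htm : t ∈ Icc 0 T := ⟨ht.2.1, ht.2.2.le⟩
      obtain ⟨δ, hδ, h1⟩ := hloc t htm ε hε
      have hmem : Ioo t (min (t + δ) T) ∈ 𝓝[>] t :=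
        Ioo_mem_nhdsGT (lt_min (by linarith) ht.2.2)
      filter_upwards [hmem] with s hs
      have hs1 : s < t + δ := hs.2.trans_le (min_le_left _ _)
      have hs2 : s < T := hs.2.trans_le (min_le_right _ _)
      have hsm : s ∈ Icc 0 T := ⟨htm.1.trans hs.1.le, hs2.le⟩
      have h2 := h1 s hsm (by rw [abs_of_pos (by linarith [hs.1])]; linarith)
      have hBm : 0 ≤ B s - B t := by
        rw [hBd t htm s hsm]
        exact intervalIntegral.integral_nonneg hs.1.le fun τ _ => hb0 τ
      rw [abs_of_nonneg hBm] at h2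
      have h3 : |D t| ≤ ε * B t := ht.1
      have h4 := abs_add_le (D t) (D s - D t)
      rw [add_sub_cancel] at h4
      change |D s| ≤ ε * B s
      nlinarith
  have hD0 : D T = 0 := by
    by_contra hne
    have hpos := abs_pos.2 hne
    have hB0 : 0 ≤ B T := intervalIntegral.integral_nonneg hT.le fun τ _ => hb0 τ
    -- With this `ε` the bound would read `|D T| ≤ |D T| B T / (2 (B T + 1))`, impossible for `D T ≠
    -- 0`.
    have := hfin (|D T| / (2 * (B T + 1))) (by positivity)
    rw [div_mul_eq_mul_div, le_div_iff₀ (by positivity)] at this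
    nlinarith
  simp only [hD] at hD0
  linarith


/-! ### Measures on the wells with densities -/

namespace Setting

variable {d : ℕ} (S : Setting d)

/-- The two wells: `false` is the well at `a`, `true` the one at `b`. -/
def well (w : Bool) : ℝ := cond w S.b S.a

/-- The weights of the wells. -/
def γ (w : Bool) : ℝ := cond w S.γb S.γa

lemma γ_pos (w : Bool) : 0 < S.γ w := by
  cases w
  · exact S.γa_pos
  · exact S.γb_pos

lemma well_mem_Υ (w : Bool) : S.well w ∈ S.Υ := by
  have h1 := S.y₀_lt_a
  have h2 := S.a_lt_c
  have h3 := S.c_lt_b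
  have h4 := S.b_lt_y₁
  cases w
  · exact ⟨h1.le, ((h2.trans h3).trans h4).le⟩
  · exact ⟨((h1.trans h2).trans h3).le, h4.le⟩

lemma c_mem_Υ : S.c ∈ S.Υ :=
  ⟨(S.y₀_lt_a.trans S.a_lt_c).le, (S.c_lt_b.trans S.b_lt_y₁).le⟩

lemma well_injective : Function.Injective S.well := by
  have h : S.a < S.b := S.a_lt_c.trans S.c_lt_b
  rintro (_ | _) (_ | _) hw
  · rfl
  · exact absurd hw h.ne
  · exact absurd hw h.ne'
  · rfl

lemma volΩ_pos : 0 < S.volΩ := by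
  have h : 0 < 1 / S.volΩ := by
    rw [volΩ, Ω, ← S.γ_add]
    exact add_pos S.γa_pos S.γb_pos
  exact one_div_pos.1 h

lemma isClosed_nodes : IsClosed S.nodes := S.isClosed_Ω.prod isClosed_Icc

lemma measurableSet_nodes : MeasurableSet S.nodes := S.isClosed_nodes.measurableSet

lemma mem_nodes {x : Space d} (hx : x ∈ S.Ω) (w : Bool) : (x, S.well w) ∈ S.nodes :=
  ⟨hx, S.well_mem_Υ w⟩

lemma measurableEmbedding_well (w : Bool) :
    MeasurableEmbedding (fun x : Space d => (x, S.well w)) :=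
  MeasurableEmbedding.prodMk_right MeasurableEmbedding.id (S.well w)

lemma π₀_eq : S.π₀ = ∑ w, ENNReal.ofReal (S.γ w) •
    ((volume : Measure (Space d)).restrict S.Ω).map (fun x => (x, S.well w)) := by
  rw [Fintype.sum_bool, π₀, Measure.prod_dirac, Measure.prod_dirac, add_comm]
  rfl

lemma lintegral_π₀ (f : Space d × ℝ → ℝ≥0∞) :
    ∫⁻ z, f z ∂S.π₀ = ∑ w, ENNReal.ofReal (S.γ w) * ∫⁻ x in S.Ω, f (x, S.well w) := by
  rw [π₀_eq, lintegral_finsetSum_measure]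
  refine Finset.sum_congr rfl fun w _ => ?_
  rw [lintegral_smul_measure, (S.measurableEmbedding_well w).lintegral_map, smul_eq_mul]

instance isFiniteMeasure_π₀ : IsFiniteMeasure S.π₀ := by
  refine ⟨?_⟩
  have := S.lintegral_π₀ 1
  simp only [Pi.one_apply, lintegral_one] at this
  rw [this]
  exact ENNReal.sum_lt_top.2 fun w _ => ENNReal.mul_lt_top ENNReal.ofReal_lt_top
    (measure_lt_top _ _)

lemma ae_of_ae_π₀ {p : Space d × ℝ → Prop} (h : ∀ᵐ z ∂S.π₀, p z) (w : Bool) :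
    ∀ᵐ x ∂(volume : Measure (Space d)).restrict S.Ω, p (x, S.well w) := by
  rw [π₀_eq, Fintype.sum_bool, ae_add_measure_iff] at h
  have h' : ∀ᵐ z ∂(ENNReal.ofReal (S.γ w) •
      ((volume : Measure (Space d)).restrict S.Ω).map (fun x => (x, S.well w))), p z := by
    cases w
    · exact h.2
    · exact h.1
  rw [Measure.ae_ennreal_smul_measure_iff (by simpa using S.γ_pos w)] at h'
  exact (S.measurableEmbedding_well w).ae_map_iff.1 h'

/-- The measure with density `u` with respect to `π₀`. -/
noncomputable def stateMeasure (u : Bool → Space d → ℝ) : Measure (Space d × ℝ) :=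
  ∑ w, (((volume : Measure (Space d)).restrict S.Ω).withDensity
    (fun x => ENNReal.ofReal (S.γ w * u w x))).map (fun x => (x, S.well w))

/-- `u` is the density of a probability measure with respect to `π₀`. -/
structure IsDensity (u : Bool → Space d → ℝ) : Prop where
  integrable : ∀ w, IntegrableOn (u w) S.Ω
  nonneg : ∀ w, ∀ᵐ x ∂volume.restrict S.Ω, 0 ≤ u w x
  total : ∑ w, S.γ w * ∫ x in S.Ω, u w x = 1

/-- The density of a measure with respect to `π₀`. -/
noncomputable def density (ρ : Measure (Space d × ℝ)) (w : Bool) (x : Space d) : ℝ :=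
  (ρ.rnDeriv S.π₀ (x, S.well w)).toReal

lemma stateMeasure_apply (u : Bool → Space d → ℝ) {A : Set (Space d × ℝ)} (hA : MeasurableSet A) :
    S.stateMeasure u A = ∑ w, ∫⁻ x in S.Ω,
      A.indicator 1 (x, S.well w) * ENNReal.ofReal (S.γ w * u w x) := by
  rw [stateMeasure, Measure.finsetSum_apply]
  refine Finset.sum_congr rfl fun w _ => ?_
  have hm : MeasurableSet ((fun x : Space d => (x, S.well w)) ⁻¹' A) :=
    (S.measurableEmbedding_well w).measurable hA
  rw [Measure.map_apply (S.measurableEmbedding_well w).measurable hA, withDensity_apply _ hm,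
    ← lintegral_indicator hm]
  refine lintegral_congr fun x => ?_
  by_cases hx : (x, S.well w) ∈ A
  · rw [indicator_of_mem (by exact hx), indicator_of_mem hx, Pi.one_apply, one_mul]
  · rw [indicator_of_notMem (by exact hx), indicator_of_notMem hx, zero_mul]

variable {S} {u v : Bool → Space d → ℝ}

lemma IsDensity.isNodeProb (hu : S.IsDensity u) : S.IsNodeProb (S.stateMeasure u) := by
  have h1 : ∀ w, ∫⁻ x in S.Ω, ENNReal.ofReal (S.γ w * u w x) =
      ENNReal.ofReal (S.γ w * ∫ x in S.Ω, u w x) := fun w => by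
    rw [← integral_const_mul, ofReal_integral_eq_lintegral_ofReal ((hu.integrable w).const_mul _)]
    filter_upwards [hu.nonneg w] with x hx using mul_nonneg (S.γ_pos w).le hx
  refine ⟨⟨?_⟩, ?_⟩
  · rw [S.stateMeasure_apply u MeasurableSet.univ]
    simp only [indicator_univ, Pi.one_apply, one_mul, h1]
    rw [← ENNReal.ofReal_sum_of_nonneg, hu.total, ENNReal.ofReal_one]
    exact fun w _ => mul_nonneg (S.γ_pos w).le (integral_nonneg_of_ae (hu.nonneg w))
  · rw [S.stateMeasure_apply u S.measurableSet_nodes.compl]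
    refine Finset.sum_eq_zero fun w _ => ?_
    rw [setLIntegral_congr_fun S.measurableSet_Ω (g := fun _ => 0), lintegral_zero]
    intro x hx
    simp only
    rw [indicator_of_notMem (by simpa using S.mem_nodes hx w), zero_mul]

lemma integral_stateMeasure (hu : S.IsDensity u) {f : Space d × ℝ → ℝ}
    (hf : ∀ w, IntegrableOn (fun x => f (x, S.well w) * u w x) S.Ω) :
    ∫ z, f z ∂S.stateMeasure u = ∑ w, S.γ w * ∫ x in S.Ω, f (x, S.well w) * u w x := by
  have hm : ∀ w, AEMeasurable (fun x => ENNReal.ofReal (S.γ w * u w x))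
      (volume.restrict S.Ω) := fun w =>
    ((hu.integrable w).aestronglyMeasurable.aemeasurable.const_mul _).ennreal_ofReal
  have he : ∀ w, ∀ᵐ x ∂volume.restrict S.Ω,
      (ENNReal.ofReal (S.γ w * u w x)).toReal • f (x, S.well w) =
        S.γ w * (f (x, S.well w) * u w x) := fun w => by
    filter_upwards [hu.nonneg w] with x hx
    rw [ENNReal.toReal_ofReal (mul_nonneg (S.γ_pos w).le hx), smul_eq_mul]
    ring
  rw [stateMeasure, integral_finsetSum_measure]
  · refine Finset.sum_congr rfl fun w _ => ?_
    rw [(S.measurableEmbedding_well w).integral_map,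
      integral_withDensity_eq_integral_toReal_smul₀ (hm w)
        (Eventually.of_forall fun _ => ENNReal.ofReal_lt_top), integral_congr_ae (he w),
      integral_const_mul]
  · intro w _
    rw [(S.measurableEmbedding_well w).integrable_map_iff,
      integrable_withDensity_iff_integrable_smul₀' (hm w)
        (Eventually.of_forall fun _ => ENNReal.ofReal_lt_top)]
    exact ((hf w).const_mul (S.γ w)).congr ((he w).mono fun x hx => hx.symm)

lemma measurable_density (ρ : Measure (Space d × ℝ)) (w : Bool) : Measurable (S.density ρ w) :=
  ((Measure.measurable_rnDeriv ρ S.π₀).comp (S.measurableEmbedding_well w).measurable).ennreal_toReal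

lemma density_nonneg (ρ : Measure (Space d × ℝ)) (w : Bool) (x : Space d) :
    0 ≤ S.density ρ w x := ENNReal.toReal_nonneg

lemma lintegral_density {ρ : Measure (Space d × ℝ)} [IsFiniteMeasure ρ] (hρ : ρ ≪ S.π₀)
    {A : Set (Space d × ℝ)} (hA : MeasurableSet A) :
    ρ A = ∑ w, ∫⁻ x in S.Ω,
      A.indicator 1 (x, S.well w) * ENNReal.ofReal (S.γ w * S.density ρ w x) := by
  have h0 : IsFiniteMeasure S.π₀ := S.isFiniteMeasure_π₀
  have h1 : SigmaFinite S.π₀ := inferInstance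
  have h2 : SFinite ρ := inferInstance
  have h3 : ρ.HaveLebesgueDecomposition S.π₀ := Measure.haveLebesgueDecomposition_of_sigmaFinite _ _
  conv_lhs => rw [← Measure.withDensity_rnDeriv_eq ρ S.π₀ hρ]
  rw [withDensity_apply _ hA, ← lintegral_indicator hA, lintegral_π₀]
  refine Finset.sum_congr rfl fun w _ => ?_
  rw [← lintegral_const_mul' _ _ ENNReal.ofReal_ne_top]
  refine lintegral_congr_ae ?_
  filter_upwards [S.ae_of_ae_π₀ (Measure.rnDeriv_lt_top ρ S.π₀) w] with x hx
  rw [density, ENNReal.ofReal_mul (S.γ_pos w).le, ENNReal.ofReal_toReal hx.ne]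
  by_cases h : (x, S.well w) ∈ A
  · rw [indicator_of_mem h, indicator_of_mem h, Pi.one_apply, one_mul]
  · rw [indicator_of_notMem h, indicator_of_notMem h, zero_mul, mul_zero]

lemma stateMeasure_density {ρ : Measure (Space d × ℝ)} [IsFiniteMeasure ρ] (hρ : ρ ≪ S.π₀) :
    S.stateMeasure (S.density ρ) = ρ := by
  ext A hA
  rw [S.stateMeasure_apply _ hA, lintegral_density hρ hA]

lemma isDensity_density {ρ : Measure (Space d × ℝ)} (hp : S.IsNodeProb ρ) (hρ : ρ ≪ S.π₀) :
    S.IsDensity (S.density ρ) := by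
  have := hp.1
  have h1 := lintegral_density hρ MeasurableSet.univ
  simp only [indicator_univ, Pi.one_apply, one_mul, measure_univ] at h1
  have hfin : ∀ w, ∫⁻ x in S.Ω, ENNReal.ofReal (S.γ w * S.density ρ w x) ≠ ⊤ := fun w =>
    ((ENNReal.sum_lt_top.1 (h1 ▸ ENNReal.one_lt_top)) w (Finset.mem_univ w)).ne
  have hnn : ∀ w, ∀ x, 0 ≤ S.γ w * S.density ρ w x := fun w x =>
    mul_nonneg (S.γ_pos w).le (density_nonneg ρ w x)
  have hi : ∀ w, IntegrableOn (fun x => S.γ w * S.density ρ w x) S.Ω := fun w => by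
    refine (lintegral_ofReal_ne_top_iff_integrable
      ((measurable_density ρ w).const_mul _).aestronglyMeasurable
      (Eventually.of_forall (hnn w))).1 (hfin w)
  have hi' : ∀ w, IntegrableOn (S.density ρ w) S.Ω := fun w => by
    have := (hi w).const_mul (S.γ w)⁻¹
    refine this.congr (Eventually.of_forall fun x => ?_)
    simp only
    rw [← mul_assoc, inv_mul_cancel₀ (S.γ_pos w).ne', one_mul]
  refine ⟨hi', fun w => Eventually.of_forall (density_nonneg ρ w), ?_⟩
  have h2 : ∀ w, ∫⁻ x in S.Ω, ENNReal.ofReal (S.γ w * S.density ρ w x) =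
      ENNReal.ofReal (S.γ w * ∫ x in S.Ω, S.density ρ w x) := fun w => by
    rw [← integral_const_mul, ofReal_integral_eq_lintegral_ofReal (hi w)
      (Eventually.of_forall (hnn w))]
  simp only [h2] at h1
  rw [← ENNReal.ofReal_sum_of_nonneg (fun w _ => mul_nonneg (S.γ_pos w).le
    (integral_nonneg (density_nonneg ρ w))), eq_comm, ENNReal.ofReal_eq_one] at h1
  exact h1

/-- The `L¹` distance of two densities. -/
noncomputable def l1Dist (S : Setting d) (u v : Bool → Space d → ℝ) : ℝ :=
  ∑ w, S.γ w * ∫ x in S.Ω, |u w x - v w x|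

lemma l1Dist_nonneg : 0 ≤ S.l1Dist u v :=
  Finset.sum_nonneg fun w _ => mul_nonneg (S.γ_pos w).le (integral_nonneg fun _ => abs_nonneg _)

lemma real_stateMeasure (hu : S.IsDensity u) {A : Set (Space d × ℝ)} (hA : MeasurableSet A) :
    (S.stateMeasure u).real A =
      ∑ w, S.γ w * ∫ x in S.Ω, A.indicator (fun _ => (1:ℝ)) (x, S.well w) * u w x := by
  rw [← integral_stateMeasure hu (f := A.indicator fun _ => (1:ℝ)), integral_indicator hA]
  · simp
  · intro w
    have := (hu.integrable w).indicator ((S.measurableEmbedding_well w).measurable hA)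
    refine this.congr (Eventually.of_forall fun x => ?_)
    by_cases h : (x, S.well w) ∈ A
    · simp only
      rw [indicator_of_mem h, indicator_of_mem (by exact h), one_mul]
    · simp only
      rw [indicator_of_notMem h, indicator_of_notMem (by exact h), zero_mul]

lemma abs_sum_integral_mul_sub_le {f : Bool → Space d → ℝ} {M : ℝ}
    (hu : ∀ w, IntegrableOn (u w) S.Ω) (hv : ∀ w, IntegrableOn (v w) S.Ω)
    (hf : ∀ w, ∀ x ∈ S.Ω, |f w x| ≤ M) :
    |∑ w, S.γ w * ∫ x in S.Ω, f w x * (u w x - v w x)| ≤ M * S.l1Dist u v := by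
  rw [l1Dist, Finset.mul_sum]
  refine (Finset.abs_sum_le_sum_abs _ _).trans (Finset.sum_le_sum fun w _ => ?_)
  rw [abs_mul, abs_of_pos (S.γ_pos w), mul_left_comm]
  refine mul_le_mul_of_nonneg_left ?_ (S.γ_pos w).le
  rw [← integral_const_mul]
  refine norm_integral_le_of_norm_le (f := fun x => f w x * (u w x - v w x)) (((hu w).sub (hv w)).abs.const_mul M) ?_
  filter_upwards [ae_restrict_mem S.measurableSet_Ω] with x hx
  rw [Real.norm_eq_abs, abs_mul]
  exact mul_le_mul_of_nonneg_right (hf w x hx) (abs_nonneg _)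

lemma integrableOn_bdd_mul {f g : Space d → ℝ} {M : ℝ} (hg : IntegrableOn g S.Ω)
    (hf : AEStronglyMeasurable f (volume.restrict S.Ω)) (hM : ∀ x ∈ S.Ω, |f x| ≤ M) :
    IntegrableOn (fun x => f x * g x) S.Ω :=
  Integrable.bdd_mul hg hf (c := M)
    ((ae_restrict_mem S.measurableSet_Ω).mono fun x hx => hM x hx)

/-- Each set is tested by its indicator, which is bounded by one. Hence smallness in `L¹` may
replace smallness in total variation in the regularity assumptions on the tilt. -/
lemma tvDist_stateMeasure_le (hu : S.IsDensity u) (hv : S.IsDensity v) :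
    tvDist (S.stateMeasure u) (S.stateMeasure v) ≤ S.l1Dist u v := by
  refine Real.sSup_le ?_ l1Dist_nonneg
  rintro r ⟨A, hA, rfl⟩
  have hm : ∀ w, AEStronglyMeasurable (fun x : Space d =>
      A.indicator (fun _ => (1:ℝ)) (x, S.well w)) (volume.restrict S.Ω) := fun w =>
    ((measurable_const.indicator hA).comp
      (S.measurableEmbedding_well w).measurable).aestronglyMeasurable
  have hb : ∀ w, ∀ x ∈ S.Ω, |A.indicator (fun _ => (1:ℝ)) (x, S.well w)| ≤ 1 := fun w x _ => by
    by_cases h : (x, S.well w) ∈ A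
    · rw [indicator_of_mem h]; simp
    · rw [indicator_of_notMem h]; simp
  rw [real_stateMeasure hu hA, real_stateMeasure hv hA, ← Finset.sum_sub_distrib]
  have := abs_sum_integral_mul_sub_le (u := u) (v := v) hu.integrable hv.integrable hb
  rw [one_mul] at this
  convert! this using 3 with w _
  rw [← mul_sub, ← integral_sub (integrableOn_bdd_mul (hu.integrable w) (hm w) (hb w))
    (integrableOn_bdd_mul (hv.integrable w) (hm w) (hb w))]
  simp only [mul_sub]

/-! ### The tilt along densities -/

lemma continuousOn_deriv_well (F : S.Tilt) {ρ : Measure (Space d × ℝ)} (hρ : S.IsNodeProb ρ)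
    (w : Bool) : ContinuousOn (fun x => F.deriv ρ (x, S.well w)) S.Ω :=
  (F.continuousOn_deriv ρ hρ).comp (Continuous.continuousOn (by fun_prop))
    fun _ hx => S.mem_nodes hx w

lemma aestronglyMeasurable_deriv_well (F : S.Tilt) {ρ : Measure (Space d × ℝ)}
    (hρ : S.IsNodeProb ρ) (w : Bool) :
    AEStronglyMeasurable (fun x => F.deriv ρ (x, S.well w)) (volume.restrict S.Ω) :=
  (continuousOn_deriv_well F hρ w).aestronglyMeasurable S.measurableSet_Ω

/-- Differentiability of the tilt along densities. -/
lemma exists_abs_toFun_sub_le (F : S.Tilt) (hu : S.IsDensity u) {ε : ℝ} (hε : 0 < ε) :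
    ∃ δ > 0, ∀ v, S.IsDensity v → S.l1Dist u v < δ →
      |F.toFun (S.stateMeasure v) - F.toFun (S.stateMeasure u) -
        ∑ w, S.γ w * ∫ x in S.Ω, F.deriv (S.stateMeasure u) (x, S.well w) * (v w x - u w x)|
          ≤ ε * S.l1Dist u v := by
  obtain ⟨M, hM⟩ := F.bounded_deriv
  obtain ⟨δ, hδ, h⟩ := F.hasDeriv _ hu.isNodeProb ε hε
  refine ⟨δ, hδ, fun v hv hd => ?_⟩
  have htv := tvDist_stateMeasure_le hu hv
  have h1 := h _ hv.isNodeProb (htv.trans_lt hd)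
  have hi : ∀ u' : Bool → Space d → ℝ, S.IsDensity u' → ∀ w, IntegrableOn
      (fun x => F.deriv (S.stateMeasure u) (x, S.well w) * u' w x) S.Ω := fun u' hu' w =>
    integrableOn_bdd_mul (hu'.integrable w) (aestronglyMeasurable_deriv_well F hu.isNodeProb w)
      fun x hx => hM _ hu.isNodeProb _ (S.mem_nodes hx w)
  rw [integral_stateMeasure hu (hi u hu), integral_stateMeasure hv (hi v hv),
    ← Finset.sum_sub_distrib] at h1
  refine (le_of_eq ?_).trans (h1.trans (mul_le_mul_of_nonneg_left htv hε.le))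
  congr 2
  refine Finset.sum_congr rfl fun w _ => ?_
  rw [← mul_sub, ← integral_sub (hi v hv w) (hi u hu w)]
  simp only [mul_sub]

/-- The tilt is Lipschitz continuous along densities. -/
lemma exists_abs_toFun_sub_le_l1Dist (F : S.Tilt) : ∃ M, 0 ≤ M ∧ ∀ u v, S.IsDensity u →
    S.IsDensity v → |F.toFun (S.stateMeasure v) - F.toFun (S.stateMeasure u)| ≤
      M * S.l1Dist u v := by
  obtain ⟨M, hM⟩ := F.bounded_deriv
  refine ⟨|M|, abs_nonneg _, fun u v hu hv => ?_⟩
  -- Differentiability at a point is only local. A global bound comes from the mean value inequality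
  -- along the segment from `u` to `v`, which stays in the convex set of densities, where the
  -- derivative is uniformly bounded.
  set p : ℝ → Bool → Space d → ℝ := fun s w x => (1 - s) * u w x + s * v w x with hp
  have hpd : ∀ s ∈ Icc (0:ℝ) 1, S.IsDensity (p s) := fun s hs => by
    refine ⟨fun w => ((hu.integrable w).const_mul _).add ((hv.integrable w).const_mul s),
      fun w => ?_, ?_⟩
    · filter_upwards [hu.nonneg w, hv.nonneg w] with x h1 h2
      exact add_nonneg (mul_nonneg (sub_nonneg.2 hs.2) h1) (mul_nonneg hs.1 h2)
    · have : ∀ w, S.γ w * ∫ x in S.Ω, p s w x = (1 - s) * (S.γ w * ∫ x in S.Ω, u w x) +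
          s * (S.γ w * ∫ x in S.Ω, v w x) := fun w => by
        simp only [hp]
        rw [integral_add ((hu.integrable w).const_mul _) ((hv.integrable w).const_mul s),
          integral_const_mul, integral_const_mul]
        ring
      simp only [this]
      rw [Finset.sum_add_distrib, ← Finset.mul_sum, ← Finset.mul_sum, hu.total, hv.total]
      ring
  have hdist : ∀ s s', S.l1Dist (p s) (p s') = |s' - s| * S.l1Dist u v := fun s s' => by
    simp only [l1Dist, Finset.mul_sum]
    refine Finset.sum_congr rfl fun w _ => ?_
    have : ∫ x in S.Ω, |p s w x - p s' w x| = |s' - s| * ∫ x in S.Ω, |u w x - v w x| := by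
      rw [← integral_const_mul]
      refine integral_congr_ae (Eventually.of_forall fun x => ?_)
      simp only [hp]
      rw [← abs_mul]
      congr 1
      ring
    rw [this, mul_left_comm]
  set g' : ℝ → ℝ := fun s => ∑ w, S.γ w * ∫ x in S.Ω,
    F.deriv (S.stateMeasure (p s)) (x, S.well w) * (v w x - u w x) with hg'
  have hder : ∀ s ∈ Icc (0:ℝ) 1, HasDerivWithinAt (fun s => F.toFun (S.stateMeasure (p s)))
      (g' s) (Icc 0 1) s := fun s hs => by
    rw [hasDerivWithinAt_iff_isLittleO, Asymptotics.isLittleO_iff]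
    intro c hc
    -- Adding one avoids a division by zero when the two densities coincide.
    have hD : 0 < S.l1Dist u v + 1 := add_pos_of_nonneg_of_pos l1Dist_nonneg one_pos
    obtain ⟨δ, hδ, h⟩ := exists_abs_toFun_sub_le F (hpd s hs) (div_pos hc hD)
    filter_upwards [self_mem_nhdsWithin,
      mem_nhdsWithin_of_mem_nhds (Metric.ball_mem_nhds s (div_pos hδ hD))] with s' hs' hsd
    rw [Metric.mem_ball, Real.dist_eq, lt_div_iff₀ hD] at hsd
    have h0 := abs_nonneg (s' - s)
    have h1 := h (p s') (hpd s' hs') (by rw [hdist]; nlinarith)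
    have h2 : ∑ w, S.γ w * ∫ x in S.Ω,
        F.deriv (S.stateMeasure (p s)) (x, S.well w) * (p s' w x - p s w x) =
          (s' - s) • g' s := by
      rw [smul_eq_mul, hg', Finset.mul_sum]
      refine Finset.sum_congr rfl fun w _ => ?_
      rw [mul_left_comm]
      congr 1
      rw [← integral_const_mul]
      refine integral_congr_ae (Eventually.of_forall fun x => ?_)
      simp only [hp]
      ring
    rw [h2, hdist, div_mul_eq_mul_div, le_div_iff₀ hD] at h1
    rw [Real.norm_eq_abs, Real.norm_eq_abs]
    have h3 : c * (|s' - s| * S.l1Dist u v) ≤ c * |s' - s| * (S.l1Dist u v + 1) := by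
      have : 0 ≤ c * |s' - s| := mul_nonneg hc.le h0
      nlinarith
    exact le_of_mul_le_mul_right (h1.trans h3) hD
  have hbd : ∀ s ∈ Ico (0:ℝ) 1, ‖g' s‖ ≤ |M| * S.l1Dist u v := fun s hs => by
    have := abs_sum_integral_mul_sub_le hv.integrable hu.integrable (M := |M|)
      (f := fun w x => F.deriv (S.stateMeasure (p s)) (x, S.well w)) fun w x hx =>
        (hM _ (hpd s ⟨hs.1, hs.2.le⟩).isNodeProb _ (S.mem_nodes hx w)).trans (le_abs_self M)
    rw [Real.norm_eq_abs]
    refine this.trans (le_of_eq ?_)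
    simp only [l1Dist, abs_sub_comm]
  have := norm_image_sub_le_of_norm_deriv_le_segment_01' hder hbd
  have e0 : p 0 = u := by ext w x; simp [hp]
  have e1 : p 1 = v := by ext w x; simp [hp]
  rwa [e0, e1] at this

end Setting


/-! ### Quantitative estimates for the shifted entropy density and logarithm -/

open InformationTheory in
-- The left side is a Bregman distance, hence nonnegative. Together with the one for exchanged
-- arguments it adds up to `(log (p + δ) - log (q + δ)) (p - q)`, and the logarithm has slope at
-- most `1 / δ` on `[δ, ∞)`.
lemma abs_klFun_add_sub_le {p q δ : ℝ} (hp : 0 ≤ p) (hq : 0 ≤ q) (hδ : 0 < δ) :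
    |klFun (p + δ) - klFun (q + δ) - Real.log (q + δ) * (p - q)| ≤ (p - q) ^ 2 / δ := by
  have key : ∀ x y : ℝ, 0 < x → 0 < y → 0 ≤ klFun x - klFun y - Real.log y * (x - y) := by
    intro x y hx hy
    have h := Real.log_le_sub_one_of_pos (div_pos hy hx)
    rw [Real.log_div hy.ne' hx.ne'] at h
    have h2 := mul_le_mul_of_nonneg_left h hx.le
    rw [mul_sub, mul_sub, mul_div_cancel₀ _ hx.ne'] at h2
    simp only [klFun]
    linarith
  have hp' : 0 < p + δ := by linarith
  have hq' : 0 < q + δ := by linarith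
  have h1 := key _ _ hp' hq'
  have h2 := key _ _ hq' hp'
  have h3 : (Real.log (p + δ) - Real.log (q + δ)) * (p - q) ≤ (p - q) ^ 2 / δ := by
    rw [le_div_iff₀ hδ]
    rcases le_total q p with h | h
    · have := Real.log_le_sub_one_of_pos (div_pos hp' hq')
      rw [Real.log_div hp'.ne' hq'.ne', div_sub_one hq'.ne', le_div_iff₀ hq'] at this
      have h5 : 0 ≤ Real.log (p + δ) - Real.log (q + δ) :=
        sub_nonneg.2 (Real.log_le_log hq' (by linarith))
      nlinarith [mul_nonneg h5 hq, mul_nonneg h5 (sub_nonneg.2 h)]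
    · have := Real.log_le_sub_one_of_pos (div_pos hq' hp')
      rw [Real.log_div hq'.ne' hp'.ne', div_sub_one hp'.ne', le_div_iff₀ hp'] at this
      have h5 : 0 ≤ Real.log (q + δ) - Real.log (p + δ) :=
        sub_nonneg.2 (Real.log_le_log hp' (by linarith))
      nlinarith [mul_nonneg h5 hp, mul_nonneg h5 (sub_nonneg.2 h)]
  rw [abs_of_nonneg (by simpa using h1)]
  have e1 : q + δ - (p + δ) = q - p := by ring
  have e2 : p + δ - (q + δ) = p - q := by ring
  rw [e1] at h2
  nlinarith

lemma abs_log_add_sub_le {p q δ : ℝ} (hp : 0 ≤ p) (hq : 0 ≤ q) (hδ : 0 < δ) :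
    |Real.log (p + δ) - Real.log (q + δ)| ≤ |p - q| / δ := by
  wlog h : q ≤ p generalizing p q
  · rw [abs_sub_comm, abs_sub_comm p]
    exact this hq hp (le_of_not_ge h)
  have hp' : 0 < p + δ := by linarith
  have hq' : 0 < q + δ := by linarith
  rw [abs_of_nonneg (sub_nonneg.2 (Real.log_le_log hq' (by linarith))),
    abs_of_nonneg (sub_nonneg.2 h), le_div_iff₀ hδ]
  have := Real.log_le_sub_one_of_pos (div_pos hp' hq')
  rw [Real.log_div hp'.ne' hq'.ne', div_sub_one hq'.ne', le_div_iff₀ hq'] at this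
  have h5 : 0 ≤ Real.log (p + δ) - Real.log (q + δ) :=
    sub_nonneg.2 (Real.log_le_log hq' (by linarith))
  nlinarith [mul_nonneg h5 hq]

/-! ### The chain rule for the regularized free energy -/

namespace Setting

variable {d : ℕ} {S : Setting d}

/-- The tilted energy of a density, with regularized entropy. -/
noncomputable def freeEnergy (S : Setting d) (F : S.Tilt) (δ : ℝ) (u : Bool → Space d → ℝ) : ℝ :=
  (∑ w, S.γ w * ∫ x in S.Ω, InformationTheory.klFun (u w x + δ)) + F.toFun (S.stateMeasure u)

/-- The derivative of `freeEnergy`. -/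
noncomputable def potential (S : Setting d) (F : S.Tilt) (δ : ℝ) (u : Bool → Space d → ℝ)
    (w : Bool) (x : Space d) : ℝ :=
  Real.log (u w x + δ) + F.deriv (S.stateMeasure u) (x, S.well w)

lemma continuousOn_log_add {u : Space d → ℝ} (hu : Continuous u) (hu0 : ∀ x, 0 ≤ u x) {δ : ℝ}
    (hδ : 0 < δ) : Continuous fun x => Real.log (u x + δ) :=
  (hu.add continuous_const).log fun x => (add_pos_of_nonneg_of_pos (hu0 x) hδ).ne'

lemma continuousOn_potential (F : S.Tilt) {δ : ℝ} (hδ : 0 < δ) {u : Bool → Space d → ℝ}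
    (hu : S.IsDensity u) (hc : ∀ w, Continuous (u w)) (h0 : ∀ w x, 0 ≤ u w x) (w : Bool) :
    ContinuousOn (S.potential F δ u w) S.Ω :=
  (continuousOn_log_add (hc w) (h0 w) hδ).continuousOn.add
    (continuousOn_deriv_well F hu.isNodeProb w)

set_option maxHeartbeats 1000000 in
/-- The chain rule for `freeEnergy` along an absolutely continuous curve of densities in a
finite-dimensional space. -/
lemma freeEnergy_sub_eq_integral (F : S.Tilt) {T δ : ℝ} (hT : 0 < T) (hδ : 0 < δ) {n : ℕ}
    {A : Fin n → Space d → ℝ} (hA : ∀ k, Continuous (A k)) {m v : Bool × Fin n → ℝ → ℝ}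
    (hv : ∀ k, IntegrableOn (v k) (Icc 0 T)) (hmc : ∀ k, ContinuousOn (m k) (Icc 0 T))
    (hm : ∀ k, ∀ t ∈ Icc 0 T, m k t - m k 0 = ∫ τ in (0:ℝ)..t, v k τ)
    {U : ℝ → Bool → Space d → ℝ} (hU : ∀ t w x, S.γ w * U t w x = ∑ k, A k x * m (w, k) t)
    (hU0 : ∀ t ∈ Icc 0 T, ∀ w x, 0 ≤ U t w x) (hd : ∀ t ∈ Icc 0 T, S.IsDensity (U t)) :
    S.freeEnergy F δ (U T) - S.freeEnergy F δ (U 0) =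
      ∫ t in (0:ℝ)..T, ∑ k, (∫ x in S.Ω, S.potential F δ (U t) k.1 x * A k.2 x) * v k t := by
  have hUc : ∀ t w, Continuous (U t w) := fun t w => by
    have : U t w = fun x => (S.γ w)⁻¹ * ∑ k, A k x * m (w, k) t := by
      ext x
      rw [← hU, ← mul_assoc, inv_mul_cancel₀ (S.γ_pos w).ne', one_mul]
    rw [this]
    exact continuous_const.mul (continuous_finsetSum _ fun k _ => (hA k).mul continuous_const)
  obtain ⟨C, hC0, hC⟩ : ∃ C, 0 ≤ C ∧ ∀ k, ∀ x ∈ S.Ω, |A k x| ≤ C := by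
    choose C hC using fun k => S.isCompact_Ω.exists_bound_of_continuousOn (hA k).continuousOn
    refine ⟨∑ k, |C k|, Finset.sum_nonneg fun _ _ => abs_nonneg _, fun k x hx => ?_⟩
    exact ((hC k x hx).trans (le_abs_self _)).trans
      (Finset.single_le_sum (f := fun k => |C k|) (fun _ _ => abs_nonneg _) (Finset.mem_univ k))
  set R : ℝ → ℝ → ℝ := fun t s => ∑ k, |m k s - m k t| with hR
  have hR0 : ∀ t s, 0 ≤ R t s := fun t s => Finset.sum_nonneg fun _ _ => abs_nonneg _
  have hRt : ∀ t ∈ Icc 0 T, Tendsto (R t) (𝓝[Icc 0 T] t) (𝓝 0) := fun t ht => by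
    have : Tendsto (R t) (𝓝[Icc 0 T] t) (𝓝 (∑ k, |m k t - m k t|)) :=
      tendsto_finsetSum _ fun k _ => ((hmc k t ht).sub_const _).abs
    simpa using this
  -- One constant for both the uniform distance (coefficients `C / γ`) and the `L¹` distance
  -- (coefficient `2 C |Ω|`) of two states in terms of the distance `R` of their moments; the
  -- summand `1` makes it positive.
  set K : ℝ := C * ((S.γ true)⁻¹ + (S.γ false)⁻¹) + 2 * C * S.volΩ + 1 with hK
  have hγi : ∀ w, 0 < (S.γ w)⁻¹ := fun w => inv_pos.2 (S.γ_pos w)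
  have hK0 : 0 < K := by
    have := hγi true
    have := hγi false
    have := S.volΩ_pos
    positivity
  have hγU : ∀ t s w, ∀ x ∈ S.Ω, S.γ w * |U t w x - U s w x| ≤ C * R t s := fun t s w x hx => by
    rw [← abs_of_pos (S.γ_pos w), ← abs_mul, mul_sub, hU, hU,
      ← Finset.sum_sub_distrib]
    refine (Finset.abs_sum_le_sum_abs _ _).trans ?_
    rw [hR]
    simp only
    rw [Fintype.sum_prod_type, Finset.mul_sum]
    refine le_trans ?_ (Finset.single_le_sum
      (f := fun w => C * ∑ k, |m (w, k) s - m (w, k) t|)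
      (fun w _ => mul_nonneg hC0 (Finset.sum_nonneg fun _ _ => abs_nonneg _)) (Finset.mem_univ w))
    rw [Finset.mul_sum]
    refine Finset.sum_le_sum fun k _ => ?_
    rw [← mul_sub, abs_mul, abs_sub_comm (m (w, k) t)]
    exact mul_le_mul_of_nonneg_right (hC k x hx) (abs_nonneg _)
  have hUs : ∀ t s w, ∀ x ∈ S.Ω, |U t w x - U s w x| ≤ K * R t s := fun t s w x hx => by
    have h1 := mul_le_mul_of_nonneg_left (hγU t s w x hx) (hγi w).le
    rw [← mul_assoc, inv_mul_cancel₀ (S.γ_pos w).ne', one_mul, ← mul_assoc] at h1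
    refine h1.trans (mul_le_mul_of_nonneg_right ?_ (hR0 t s))
    have h2 := mul_nonneg hC0 (hγi true).le
    have h3 := mul_nonneg hC0 (hγi false).le
    have h4 := mul_nonneg hC0 S.volΩ_pos.le
    cases w <;> rw [hK] <;> nlinarith
  have hUd : ∀ t s, S.l1Dist (U t) (U s) ≤ K * R t s := fun t s => by
    have h1 : ∀ w, S.γ w * ∫ x in S.Ω, |U t w x - U s w x| ≤ C * S.volΩ * R t s := fun w => by
      rw [← integral_const_mul]
      have : ∫ x in S.Ω, C * R t s = C * S.volΩ * R t s := by
        rw [setIntegral_const, smul_eq_mul]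
        change S.volΩ * _ = _
        ring
      rw [← this]
      refine setIntegral_mono_on ?_ (S.integrableOn_of_continuous continuous_const)
        S.measurableSet_Ω (hγU t s w)
      exact S.integrableOn_of_continuous (continuous_const.mul ((hUc t w).sub (hUc s w)).abs)
    rw [l1Dist, Fintype.sum_bool]
    have h2 := h1 true
    have h3 := h1 false
    have h4 := mul_nonneg hC0 (add_pos (hγi true) (hγi false)).le
    have h5 := hR0 t s
    rw [hK]
    nlinarith [mul_nonneg h4 h5]
  have hev : ∀ t ∈ Icc 0 T, ∀ η > 0, ∀ᶠ s in 𝓝[Icc 0 T] t, K * R t s < η := fun t ht η hη => by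
    have := (hRt t ht).const_mul K
    rw [mul_zero] at this
    exact this.eventually (gt_mem_nhds hη)
  have hpc := fun t ht w => continuousOn_potential F hδ (hd t ht) (hUc t) (hU0 t ht) w
  have hint : ∀ f : Space d → ℝ, ContinuousOn f S.Ω → IntegrableOn f S.Ω := fun f hf =>
    hf.integrableOn_compact S.isCompact_Ω
  refine sub_eq_integral_of_local (Φ := fun t => S.freeEnergy F δ (U t))
    (c := fun k t => ∫ x in S.Ω, S.potential F δ (U t) k.1 x * A k.2 x) hT hv hm ?_ ?_
  -- Continuity in time of the coefficients: the logarithm of the shifted density is controlled by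
  -- uniform convergence, the tilt by the continuity of its derivative in total variation.
  · intro k t ht
    rw [ContinuousWithinAt, Metric.tendsto_nhds]
    intro ε hε
    obtain ⟨δ₁, hδ₁, h1⟩ := F.continuous_deriv _ (hd t ht).isNodeProb
      (ε / (4 * (C * S.volΩ + 1))) (by have := S.volΩ_pos; positivity)
    have hv0 := S.volΩ_pos
    -- Since the logarithm has Lipschitz constant `1 / δ` here, this allows it the same deviation as
    -- the derivative of the tilt.
    have hη : 0 < δ * (ε / (4 * (C * S.volΩ + 1))) := by positivity
    filter_upwards [hev t ht δ₁ hδ₁, hev t ht _ hη, self_mem_nhdsWithin] with s hs1 hs2 hs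
    have hp : ∀ x ∈ S.Ω, |S.potential F δ (U s) k.1 x - S.potential F δ (U t) k.1 x| ≤
        ε / (2 * (C * S.volΩ + 1)) := fun x hx => by
      have e1 := abs_log_add_sub_le (hU0 s hs k.1 x) (hU0 t ht k.1 x) hδ
      have e2 := h1 _ (hd s hs).isNodeProb (((tvDist_stateMeasure_le (hd t ht) (hd s hs)).trans
        (hUd t s)).trans_lt hs1) _ (S.mem_nodes hx k.1)
      have e3 := hUs t s k.1 x hx
      rw [abs_sub_comm] at e3
      have e4 : |U s k.1 x - U t k.1 x| / δ ≤ ε / (4 * (C * S.volΩ + 1)) := by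
        rw [div_le_iff₀' hδ]
        linarith
      have e5 : ε / (2 * (C * S.volΩ + 1)) =
          ε / (4 * (C * S.volΩ + 1)) + ε / (4 * (C * S.volΩ + 1)) := by
        field_simp
        ring
      have e6 := abs_add_le (Real.log (U s k.1 x + δ) - Real.log (U t k.1 x + δ))
        (F.deriv (S.stateMeasure (U s)) (x, S.well k.1) -
          F.deriv (S.stateMeasure (U t)) (x, S.well k.1))
      have e7 : S.potential F δ (U s) k.1 x - S.potential F δ (U t) k.1 x =
        (Real.log (U s k.1 x + δ) - Real.log (U t k.1 x + δ)) +
        (F.deriv (S.stateMeasure (U s)) (x, S.well k.1) -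
          F.deriv (S.stateMeasure (U t)) (x, S.well k.1)) := by
        simp only [potential]
        ring
      rw [e7, e5]
      linarith
    rw [Real.dist_eq, ← integral_sub (hint _ ((hpc s hs k.1).fun_mul (hA k.2).continuousOn))
      (hint _ ((hpc t ht k.1).fun_mul (hA k.2).continuousOn))]
    have h2 : |∫ x in S.Ω, (S.potential F δ (U s) k.1 x * A k.2 x -
        S.potential F δ (U t) k.1 x * A k.2 x)| ≤ ε / (2 * (C * S.volΩ + 1)) * C * S.volΩ := by
      rw [← Real.norm_eq_abs]
      refine norm_setIntegral_le_of_norm_le_const S.isCompact_Ω.measure_lt_top fun x hx => ?_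
      rw [← sub_mul, norm_mul, Real.norm_eq_abs, Real.norm_eq_abs]
      exact mul_le_mul (hp x hx) (hC k.2 x hx) (abs_nonneg _) (by positivity)
    refine h2.trans_lt ?_
    rw [mul_assoc, div_mul_eq_mul_div, div_lt_iff₀ (by positivity)]
    nlinarith [mul_nonneg hC0 hv0.le, mul_nonneg hε.le (mul_nonneg hC0 hv0.le)]
  · intro t ht ε hε
    obtain ⟨δ₁, hδ₁, h1⟩ := exists_abs_toFun_sub_le F (hd t ht) (ε := ε / (2 * K)) (by positivity)
    -- Chosen such that `K R / δ ≤ ε / (2 K)`: the quadratic remainder of the entropy is then at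
    -- most half of the allowed error, and the remainder of the tilt takes the other half.
    have hη : 0 < ε * δ / (2 * K) := by positivity
    have hex := (hev t ht δ₁ hδ₁).and (hev t ht _ hη)
    rw [eventually_nhdsWithin_iff, Metric.eventually_nhds_iff] at hex
    obtain ⟨r, hr, h2⟩ := hex
    refine ⟨r, hr, fun s hs hst => ?_⟩
    obtain ⟨hs1, hs2⟩ := h2 (by rwa [Real.dist_eq]) hs
    have hd1 := hUd t s
    have h3 := h1 _ (hd s hs) (hd1.trans_lt hs1)
    -- Pairing the coefficients with increments of the moments amounts to pairing the potential with
    -- the increment of the density.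
    have e1 : ∑ k : Bool × Fin n, (∫ x in S.Ω, S.potential F δ (U t) k.1 x * A k.2 x) *
        (m k s - m k t) = ∑ w, S.γ w * ∫ x in S.Ω, S.potential F δ (U t) w x *
          (U s w x - U t w x) := by
      rw [Fintype.sum_prod_type]
      refine Finset.sum_congr rfl fun w _ => ?_
      rw [← integral_const_mul]
      simp only [← integral_mul_const]
      rw [← integral_finsetSum _ fun k _ => Integrable.mul_const
        (hint _ ((hpc t ht w).fun_mul (hA k).continuousOn)) _]
      refine integral_congr_ae (Eventually.of_forall fun x => ?_)
      simp only
      rw [mul_left_comm, mul_sub, hU, hU, ← Finset.sum_sub_distrib, Finset.mul_sum]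
      refine Finset.sum_congr rfl fun k _ => ?_
      ring
    have hkc : ∀ s w, Continuous fun x => InformationTheory.klFun (U s w x + δ) := fun s w =>
      InformationTheory.continuous_klFun.comp ((hUc s w).add continuous_const)
    have hlc : ∀ w, Continuous fun x => Real.log (U t w x + δ) * (U s w x - U t w x) := fun w =>
      (continuousOn_log_add (hUc t w) (hU0 t ht w) hδ).mul ((hUc s w).sub (hUc t w))
    have hDc : ∀ w, ContinuousOn (fun x => F.deriv (S.stateMeasure (U t)) (x, S.well w) *
        (U s w x - U t w x)) S.Ω := fun w =>
      (continuousOn_deriv_well F (hd t ht).isNodeProb w).mul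
        ((hUc s w).sub (hUc t w)).continuousOn
    have e2 : S.freeEnergy F δ (U s) - S.freeEnergy F δ (U t) -
        ∑ k : Bool × Fin n, (∫ x in S.Ω, S.potential F δ (U t) k.1 x * A k.2 x) *
        (m k s - m k t) = (∑ w, S.γ w * ∫ x in S.Ω, (InformationTheory.klFun (U s w x + δ) -
          InformationTheory.klFun (U t w x + δ) -
            Real.log (U t w x + δ) * (U s w x - U t w x))) +
        (F.toFun (S.stateMeasure (U s)) - F.toFun (S.stateMeasure (U t)) -
        ∑ w, S.γ w * ∫ x in S.Ω, F.deriv (S.stateMeasure (U t)) (x, S.well w) *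
          (U s w x - U t w x)) := by
      have e3 : ∀ w, ∫ x in S.Ω, S.potential F δ (U t) w x * (U s w x - U t w x) =
          (∫ x in S.Ω, Real.log (U t w x + δ) * (U s w x - U t w x)) +
          ∫ x in S.Ω, F.deriv (S.stateMeasure (U t)) (x, S.well w) * (U s w x - U t w x) :=
        fun w => by
          rw [← integral_add (S.integrableOn_of_continuous (hlc w)) (hint _ (hDc w))]
          simp only [potential, add_mul]
      have e4 : ∀ w, ∫ x in S.Ω, (InformationTheory.klFun (U s w x + δ) -
          InformationTheory.klFun (U t w x + δ) -
            Real.log (U t w x + δ) * (U s w x - U t w x)) =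
          (∫ x in S.Ω, InformationTheory.klFun (U s w x + δ)) -
          (∫ x in S.Ω, InformationTheory.klFun (U t w x + δ)) -
          ∫ x in S.Ω, Real.log (U t w x + δ) * (U s w x - U t w x) := fun w => by
        rw [integral_sub (S.integrableOn_of_continuous ((hkc s w).fun_sub (hkc t w))) (S.integrableOn_of_continuous (hlc w)),
          integral_sub (S.integrableOn_of_continuous (hkc s w))
            (S.integrableOn_of_continuous (hkc t w))]
      have e5 : ∑ w, S.γ w * ∫ x in S.Ω, S.potential F δ (U t) w x * (U s w x - U t w x) =
          (∑ w, S.γ w * ∫ x in S.Ω, Real.log (U t w x + δ) * (U s w x - U t w x)) +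
          ∑ w, S.γ w * ∫ x in S.Ω, F.deriv (S.stateMeasure (U t)) (x, S.well w) *
            (U s w x - U t w x) := by
        rw [← Finset.sum_add_distrib]
        exact Finset.sum_congr rfl fun w _ => by rw [e3, mul_add]
      have e6 : ∑ w, S.γ w * ∫ x in S.Ω, (InformationTheory.klFun (U s w x + δ) -
          InformationTheory.klFun (U t w x + δ) -
            Real.log (U t w x + δ) * (U s w x - U t w x)) =
          (∑ w, S.γ w * ∫ x in S.Ω, InformationTheory.klFun (U s w x + δ)) -
          (∑ w, S.γ w * ∫ x in S.Ω, InformationTheory.klFun (U t w x + δ)) -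
          ∑ w, S.γ w * ∫ x in S.Ω, Real.log (U t w x + δ) * (U s w x - U t w x) := by
        rw [← Finset.sum_sub_distrib, ← Finset.sum_sub_distrib]
        exact Finset.sum_congr rfl fun w _ => by rw [e4, mul_sub, mul_sub]
      rw [e1, e5, e6, freeEnergy, freeEnergy]
      ring
    have h4 : |∑ w, S.γ w * ∫ x in S.Ω, (InformationTheory.klFun (U s w x + δ) -
          InformationTheory.klFun (U t w x + δ) -
            Real.log (U t w x + δ) * (U s w x - U t w x))| ≤
        K * R t s / δ * S.l1Dist (U t) (U s) := by
      rw [l1Dist, Finset.mul_sum]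
      refine (Finset.abs_sum_le_sum_abs _ _).trans (Finset.sum_le_sum fun w _ => ?_)
      rw [abs_mul, abs_of_pos (S.γ_pos w), mul_left_comm]
      refine mul_le_mul_of_nonneg_left ?_ (S.γ_pos w).le
      rw [← integral_const_mul, ← Real.norm_eq_abs]
      refine norm_integral_le_of_norm_le (f := fun x => InformationTheory.klFun (U s w x + δ) -
          InformationTheory.klFun (U t w x + δ) - Real.log (U t w x + δ) * (U s w x - U t w x))
        (S.integrableOn_of_continuous
        (continuous_const.mul ((hUc t w).sub (hUc s w)).abs)) ?_
      filter_upwards [ae_restrict_mem S.measurableSet_Ω] with x hx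
      refine (abs_klFun_add_sub_le (hU0 s hs w x) (hU0 t ht w x) hδ).trans ?_
      rw [div_mul_eq_mul_div]
      refine div_le_div_of_nonneg_right ?_ hδ.le
      rw [← sq_abs, sq, abs_sub_comm]
      exact mul_le_mul_of_nonneg_right (hUs t s w x hx) (abs_nonneg _)
    rw [e2]
    refine (abs_add_le _ _).trans ?_
    have h5 : K * R t s / δ * S.l1Dist (U t) (U s) ≤ ε / 2 * R t s := by
      have e5 : K * R t s / δ ≤ ε / (2 * K) := by
        rw [div_le_iff₀ hδ, div_mul_eq_mul_div]
        exact hs2.le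
      refine (mul_le_mul e5 hd1 l1Dist_nonneg (by positivity)).trans (le_of_eq ?_)
      field_simp
    have h6 : ε / (2 * K) * S.l1Dist (U t) (U s) ≤ ε / 2 * R t s := by
      refine (mul_le_mul_of_nonneg_left hd1 (by positivity)).trans (le_of_eq ?_)
      field_simp
    have h7 : ε * R t s = ε / 2 * R t s + ε / 2 * R t s := by ring
    change _ ≤ ε * R t s
    linarith

end Setting


/-! ### Integrals against signed measures -/

section SignedMeasure

variable {α : Type*} [MeasurableSpace α] {μ : SignedMeasure α} {f : α → ℝ} {C : ℝ}

lemma integrable_of_measurable_of_bdd {ν : Measure α} [IsFiniteMeasure ν] (hf : Measurable f)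
    (hC : ∀ᵐ x ∂ν, |f x| ≤ C) : Integrable f ν :=
  Integrable.of_bound hf.aestronglyMeasurable C hC

/-- The Jordan parts may differ from `ν₁` and `ν₂`, but the crosswise sums, positive part plus `ν₂`
and `ν₁` plus negative part, are equal as measures. -/
lemma sintegral_eq_sub {ν₁ ν₂ : Measure α} [IsFiniteMeasure ν₁] [IsFiniteMeasure ν₂]
    (h : μ = ν₁.toSignedMeasure - ν₂.toSignedMeasure) (hf : Measurable f)
    (hC : ∀ x, |f x| ≤ C) : sintegral μ f = (∫ x, f x ∂ν₁) - ∫ x, f x ∂ν₂ := by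
  have hi : ∀ ν : Measure α, IsFiniteMeasure ν → Integrable f ν := fun ν _ =>
    integrable_of_measurable_of_bdd hf (Eventually.of_forall hC)
  have h1 : μ.toJordanDecomposition.posPart + ν₂ = ν₁ + μ.toJordanDecomposition.negPart := by
    have h2 := μ.toSignedMeasure_toJordanDecomposition
    rw [JordanDecomposition.toSignedMeasure, h] at h2
    rw [← Measure.toSignedMeasure_eq_toSignedMeasure_iff, Measure.toSignedMeasure_add,
      Measure.toSignedMeasure_add]
    rw [sub_eq_sub_iff_add_eq_add] at h2
    rw [h]
    exact h2
  have h2 : ∫ x, f x ∂(μ.toJordanDecomposition.posPart + ν₂) =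
      ∫ x, f x ∂(ν₁ + μ.toJordanDecomposition.negPart) := by rw [h1]
  rw [integral_add_measure (hi _ inferInstance) (hi _ inferInstance),
    integral_add_measure (hi _ inferInstance) (hi _ inferInstance)] at h2
  rw [sintegral]
  linarith

lemma sintegral_restrict {A : Set α} (hA : MeasurableSet A) (hf : Measurable f)
    (hC : ∀ x, |f x| ≤ C) : sintegral (μ.restrict A) f =
      (∫ x in A, f x ∂μ.toJordanDecomposition.posPart) -
        ∫ x in A, f x ∂μ.toJordanDecomposition.negPart := by
  refine sintegral_eq_sub ?_ hf hC
  conv_lhs => rw [← μ.toSignedMeasure_toJordanDecomposition, JordanDecomposition.toSignedMeasure]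
  ext B hB
  rw [VectorMeasure.restrict_apply _ hA hB, Measure.toSignedMeasure_sub_apply (hB.inter hA),
    Measure.toSignedMeasure_sub_apply hB, measureReal_restrict_apply hB,
    measureReal_restrict_apply hB]

lemma totalVariation_eq (μ : SignedMeasure α) : μ.totalVariation =
    μ.toJordanDecomposition.posPart + μ.toJordanDecomposition.negPart := rfl

instance : IsFiniteMeasure μ.totalVariation := by
  rw [totalVariation_eq]
  infer_instance

lemma posPart_absolutelyContinuous (μ : SignedMeasure α) :
    μ.toJordanDecomposition.posPart ≪ μ.totalVariation :=
  Measure.AbsolutelyContinuous.rfl.add_right _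

lemma negPart_absolutelyContinuous (μ : SignedMeasure α) :
    μ.toJordanDecomposition.negPart ≪ μ.totalVariation := by
  rw [totalVariation_eq, add_comm]
  exact Measure.AbsolutelyContinuous.rfl.add_right _

lemma abs_sintegral_restrict_le {A : Set α} (hA : MeasurableSet A) (hf : Measurable f)
    (hC : ∀ x, |f x| ≤ C) :
    |sintegral (μ.restrict A) f| ≤ C * (μ.totalVariation univ).toReal := by
  rw [sintegral_restrict hA hf hC]
  have h : ∀ ν : Measure α, IsFiniteMeasure ν → |∫ x in A, f x ∂ν| ≤ C * ν.real univ := by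
    intro ν _
    have h1 := norm_setIntegral_le_of_norm_le_const (μ := ν) (s := A) (f := f) (C := C)
      (measure_lt_top _ _) fun x _ => hC x
    -- The nonnegativity of `C` is read off at a point; on an empty space all integrals vanish.
    rcases isEmpty_or_nonempty α with hα | ⟨⟨x⟩⟩
    · simp [Measure.eq_zero_of_isEmpty ν]
    · exact h1.trans (mul_le_mul_of_nonneg_left (measureReal_mono (subset_univ _))
        ((abs_nonneg _).trans (hC x)))
  have h1 := h μ.toJordanDecomposition.posPart inferInstance
  have h2 := h μ.toJordanDecomposition.negPart inferInstance
  rw [totalVariation_eq, Measure.add_apply, ENNReal.toReal_add (measure_ne_top _ _)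
    (measure_ne_top _ _), mul_add]
  exact (abs_sub _ _).trans (add_le_add h1 h2)

lemma sintegral_const_mul (c : ℝ) (f : α → ℝ) :
    sintegral μ (fun x => c * f x) = c * sintegral μ f := by
  rw [sintegral, sintegral, integral_const_mul, integral_const_mul, mul_sub]

/-- Used to replace the indicator of a well by a continuous function, because measurability in time
of the flux is assumed for continuous test functions only. -/
lemma sintegral_restrict_eq {A : Set α} (hA : MeasurableSet A) (hf : Measurable f)
    (hC : ∀ x, |f x| ≤ C) {g : α → ℝ}
    (h : ∀ᵐ x ∂μ.totalVariation, g x = A.indicator f x) :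
    sintegral (μ.restrict A) f = sintegral μ g := by
  rw [sintegral_restrict hA hf hC, sintegral, ← integral_indicator hA, ← integral_indicator hA,
    integral_congr_ae ((posPart_absolutelyContinuous μ).ae_le h),
    integral_congr_ae ((negPart_absolutelyContinuous μ).ae_le h)]

lemma integrable_rnDeriv_mul {ρ : Measure α} [SigmaFinite ρ] (hf : Measurable f)
    (hC : ∀ x, |f x| ≤ C) : Integrable (fun x => f x * μ.rnDeriv ρ x) ρ :=
  (SignedMeasure.integrable_rnDeriv μ ρ).bdd_mul hf.aestronglyMeasurable
    (Eventually.of_forall hC)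

lemma sintegral_restrict_eq_integral {ρ : Measure α} [IsFiniteMeasure ρ]
    (hμ : μ.totalVariation ≪ ρ) {A : Set α} (hA : MeasurableSet A) (hf : Measurable f)
    (hC : ∀ x, |f x| ≤ C) :
    sintegral (μ.restrict A) f = ∫ x in A, f x * μ.rnDeriv ρ x ∂ρ := by
  rw [sintegral_restrict hA hf hC, ← integral_indicator hA, ← integral_indicator hA,
    ← integral_indicator hA,
    ← integral_rnDeriv_smul ((posPart_absolutelyContinuous μ).trans hμ),
    ← integral_rnDeriv_smul ((negPart_absolutelyContinuous μ).trans hμ), ← integral_sub]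
  · refine integral_congr_ae (Eventually.of_forall fun x => ?_)
    by_cases hx : x ∈ A
    · simp only [indicator_of_mem hx, SignedMeasure.rnDeriv, smul_eq_mul]
      ring
    · simp [indicator_of_notMem hx]
  · simp only [smul_eq_mul]
    refine Measure.integrable_toReal_rnDeriv.mul_bdd (c := |C|)
      (hf.indicator hA).aestronglyMeasurable (Eventually.of_forall fun x => ?_)
    by_cases hx : x ∈ A
    · rw [indicator_of_mem hx]; exact (hC x).trans (le_abs_self C)
    · rw [indicator_of_notMem hx]; simp
  · simp only [smul_eq_mul]
    refine Measure.integrable_toReal_rnDeriv.mul_bdd (c := |C|)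
      (hf.indicator hA).aestronglyMeasurable (Eventually.of_forall fun x => ?_)
    by_cases hx : x ∈ A
    · rw [indicator_of_mem hx]; exact (hC x).trans (le_abs_self C)
    · rw [indicator_of_notMem hx]; simp

end SignedMeasure

namespace Setting

variable {d : ℕ} {S : Setting d}

/-- The set of all states in the wells. -/
def wellSet (S : Setting d) (w : Bool) : Set (Space d × ℝ) := univ ×ˢ {S.well w}

lemma measurableSet_wellSet (w : Bool) : MeasurableSet (S.wellSet w) :=
  MeasurableSet.univ.prod (measurableSet_singleton _)

/-- A continuous function that is `1` in the well `w` and `0` in the other one. -/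
noncomputable def wellFun (S : Setting d) (w : Bool) (y : ℝ) : ℝ :=
  max 0 (min 1 ((y - S.well (!w)) / (S.well w - S.well (!w))))

lemma continuous_wellFun (w : Bool) : Continuous (S.wellFun w) := by
  unfold wellFun
  fun_prop

lemma wellFun_nonneg (w : Bool) (y : ℝ) : 0 ≤ S.wellFun w y := le_max_left _ _

lemma abs_wellFun_le (w : Bool) (y : ℝ) : |S.wellFun w y| ≤ 1 := by
  rw [abs_of_nonneg (wellFun_nonneg w y)]
  exact max_le zero_le_one (min_le_left _ _)

lemma wellFun_well (w w' : Bool) : S.wellFun w (S.well w') = if w' = w then 1 else 0 := by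
  have h : S.well w - S.well (!w) ≠ 0 := by
    rw [sub_ne_zero]
    exact fun h => by simpa using S.well_injective h
  by_cases hw : w' = w
  · rw [hw, wellFun, div_self h]; simp
  · have : w' = !w := by cases w <;> cases w' <;> simp_all
    rw [this, wellFun, sub_self, zero_div]; simp

/-- Almost every state is in a well. -/
def InWells (S : Setting d) (μ : Measure (Space d × ℝ)) : Prop :=
  ∀ᵐ z ∂μ, z.2 = S.well true ∨ z.2 = S.well false

lemma inWells_π₀ : S.InWells S.π₀ := by
  rw [InWells, π₀_eq, Fintype.sum_bool, ae_add_measure_iff]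
  constructor
  · refine Measure.ae_smul_measure ?_ _
    exact (S.measurableEmbedding_well true).ae_map_iff.2 (Eventually.of_forall fun x => Or.inl rfl)
  · refine Measure.ae_smul_measure ?_ _
    exact (S.measurableEmbedding_well false).ae_map_iff.2 (Eventually.of_forall fun x => Or.inr rfl)

lemma indicator_wellSet_eq {f : Space d × ℝ → ℝ} {z : Space d × ℝ}
    (hz : z.2 = S.well true ∨ z.2 = S.well false) (w : Bool) :
    (S.wellSet w).indicator f z = S.wellFun w z.2 * f z := by
  have key : ∀ w', z.2 = S.well w' → (S.wellSet w).indicator f z = S.wellFun w z.2 * f z := by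
    intro w' hw'
    rw [hw', wellFun_well]
    by_cases h : w' = w
    · rw [indicator_of_mem (by simp [wellSet, hw', h]), if_pos h, one_mul]
    · rw [indicator_of_notMem, if_neg h, zero_mul]
      simp only [wellSet, mem_prod, mem_univ, mem_singleton_iff, true_and, hw']
      exact fun h' => h (S.well_injective h')
  exact hz.elim (key true) (key false)

lemma integral_wellSet_eq {ρ : Measure (Space d × ℝ)} (hρ : S.InWells ρ) (w : Bool)
    (f : Space d × ℝ → ℝ) :
    ∫ z in S.wellSet w, f z ∂ρ = ∫ z, S.wellFun w z.2 * f z ∂ρ := by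
  rw [← integral_indicator (measurableSet_wellSet w)]
  exact integral_congr_ae (hρ.mono fun z hz => indicator_wellSet_eq hz w)

/-- The absolute continuity required for finite dissipation. -/
def IsAC (S : Setting d) (T : ℝ) (ρ : ℝ → Measure (Space d × ℝ)) (j : Flux d) : Prop :=
  ∀ᵐ t ∂(volume.restrict (Icc 0 T)),
    ρ t ≪ S.π₀ ∧ (∀ i, (j.jx t i).totalVariation ≪ ρ t) ∧
      (j.jbar t).totalVariation ≪ volume.restrict S.Ω

variable {T : ℝ} {ρ : ℝ → Measure (Space d × ℝ)} {j : Flux d}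

/-- Absolute continuity is known at almost every time only. Concentration on the wells means that
the integral of one bounded continuous function vanishes, so narrow continuity extends it to all
times, including the end points. -/
lemma ContractedCE.inWells (h : S.ContractedCE T ρ j) (hT : 0 < T) (hac : S.IsAC T ρ j) :
    ∀ t ∈ Icc 0 T, S.InWells (ρ t) := by
  set f : Space d × ℝ → ℝ := fun z => min 1 |(z.2 - S.well true) * (z.2 - S.well false)| with hf
  have hfc : Continuous f := by fun_prop
  have hf0 : ∀ z, 0 ≤ f z := fun z => le_min zero_le_one (abs_nonneg _)
  have hf1 : ∀ z, ‖f z‖ ≤ 1 := fun z => by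
    rw [Real.norm_of_nonneg (hf0 z)]; exact min_le_left _ _
  have hfz : ∀ z, f z = 0 ↔ (z.2 = S.well true ∨ z.2 = S.well false) := fun z => by
    rw [hf]
    simp only
    constructor
    · intro h
      have : |(z.2 - S.well true) * (z.2 - S.well false)| = 0 := by
        rcases min_choice 1 |(z.2 - S.well true) * (z.2 - S.well false)| with h' | h'
        · rw [h'] at h; norm_num at h
        · rw [h'] at h; exact h
      rwa [abs_eq_zero, mul_eq_zero, sub_eq_zero, sub_eq_zero] at this
    · rintro (h | h) <;> simp [h]
  have hc := h.narrow (BoundedContinuousFunction.ofNormedAddCommGroup f hfc 1 hf1)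
  have hz : EqOn (fun t => ∫ z, f z ∂ρ t) (fun _ => 0) (Icc 0 T) := by
    refine Measure.eqOn_Icc_of_ae_eq (μ := volume) hT.ne ?_ hc continuousOn_const
    filter_upwards [hac] with t ht
    rw [integral_eq_zero_of_ae]
    have h1 : S.InWells (ρ t) := ht.1.ae_le inWells_π₀
    exact Eventually.mono h1 fun z hz => (hfz z).2 hz
  intro t ht
  have := (h.prob t ht).1
  have h1 := hz ht
  simp only at h1
  rw [integral_eq_zero_iff_of_nonneg hf0 (integrable_of_measurable_of_bdd hfc.measurable
    (Eventually.of_forall hf1))] at h1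
  exact h1.mono fun z hz => (hfz z).1 hz

/-- The sign of the jump into a well. -/
def sgn (w : Bool) : ℝ := cond w 1 (-1)

/-- The mass in a well, weighted by `B`. -/
noncomputable def moment (S : Setting d) (w : Bool) (B : Space d → ℝ)
    (ρ : Measure (Space d × ℝ)) : ℝ := ∫ z in S.wellSet w, B z.1 ∂ρ

/-- The rate of change of `moment`. -/
noncomputable def momentRate (S : Setting d) (w : Bool) (B : Space d → ℝ)
    (jx : Fin d → SignedMeasure (Space d × ℝ)) (jbar : SignedMeasure (Space d)) : ℝ :=
  (∑ i, sintegral ((jx i).restrict (S.wellSet w))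
    (fun z => fderiv ℝ B z.1 (EuclideanSpace.single i 1))) + sgn w * sintegral jbar B

section Dynamics

variable (hCE : S.ContractedCE T ρ j) (hT : 0 < T) (hac : S.IsAC T ρ j) (w : Bool)
  {B : Space d → ℝ} (hB : ContDiff ℝ ∞ B) (hBc : HasCompactSupport B)

include hB hBc in
lemma exists_bound_fderiv_single (i : Fin d) :
    ∃ C, ∀ x, |fderiv ℝ B x (EuclideanSpace.single i 1)| ≤ C := by
  obtain ⟨C, hC⟩ := (hBc.fderiv_apply (𝕜 := ℝ) (EuclideanSpace.single i (1:ℝ))).exists_bound_of_continuous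
    ((hB.continuous_fderiv (by simp)).clm_apply continuous_const)
  exact ⟨C, hC⟩

include hB in
lemma continuous_fderiv_single (i : Fin d) :
    Continuous fun x => fderiv ℝ B x (EuclideanSpace.single i 1) :=
  (hB.continuous_fderiv (by simp)).clm_apply continuous_const

include hCE hT hac hB hBc in
-- On the wells the indicator coincides with the continuous `wellFun`, to which narrow continuity
-- applies.
lemma continuousOn_moment : ContinuousOn (fun t => S.moment w B (ρ t)) (Icc 0 T) := by
  obtain ⟨C, hC⟩ := hBc.exists_bound_of_continuous hB.continuous
  have hc : Continuous fun z : Space d × ℝ => S.wellFun w z.2 * B z.1 :=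
    ((continuous_wellFun w).comp continuous_snd).mul (hB.continuous.comp continuous_fst)
  have h1 := hCE.narrow (BoundedContinuousFunction.ofNormedAddCommGroup _ hc C fun z => by
    rw [norm_mul, Real.norm_eq_abs]
    exact (mul_le_of_le_one_left (norm_nonneg _) (abs_wellFun_le w z.2)).trans (hC z.1))
  exact h1.congr fun t ht => integral_wellSet_eq (hCE.inWells hT hac t ht) w _

lemma integrableOn_of_abs_le_totalVariation {α : Type*} [MeasurableSpace α]
    {μ : ℝ → SignedMeasure α} {g : ℝ → ℝ} {C : ℝ} (hg : AEMeasurable g (volume.restrict (Icc 0 T)))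
    (hb : ∀ t, |g t| ≤ C * ((μ t).totalVariation univ).toReal)
    (hμ : ∫⁻ t in Icc 0 T, (μ t).totalVariation univ < ⊤) : IntegrableOn g (Icc 0 T) := by
  refine ⟨hg.aestronglyMeasurable, ?_⟩
  refine lt_of_le_of_lt (lintegral_mono (g := fun t => ENNReal.ofReal C *
    (μ t).totalVariation univ) fun t => ?_) ?_
  · rw [Real.enorm_eq_ofReal_abs]
    refine (ENNReal.ofReal_le_ofReal (hb t)).trans ?_
    rw [ENNReal.ofReal_mul' ENNReal.toReal_nonneg, ENNReal.ofReal_toReal (measure_ne_top _ _)]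
  · rw [lintegral_const_mul' _ _ ENNReal.ofReal_ne_top]
    exact ENNReal.mul_lt_top ENNReal.ofReal_lt_top hμ

include hCE hac hB hBc in
lemma integrableOn_sum_sintegral : IntegrableOn (fun t => ∑ i, sintegral
    ((j.jx t i).restrict (S.wellSet w)) (fun z => fderiv ℝ B z.1 (EuclideanSpace.single i 1)))
    (Icc 0 T) := by
  refine integrable_finsetSum _ fun i _ => ?_
  obtain ⟨C, hC⟩ := exists_bound_fderiv_single hB hBc i
  have hcd := continuous_fderiv_single hB i
  have hm : Measurable fun z : Space d × ℝ => fderiv ℝ B z.1 (EuclideanSpace.single i 1) :=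
    (hcd.comp continuous_fst).measurable
  have hc : Continuous fun z : Space d × ℝ =>
      S.wellFun w z.2 * fderiv ℝ B z.1 (EuclideanSpace.single i 1) :=
    ((continuous_wellFun w).comp continuous_snd).mul (hcd.comp continuous_fst)
  refine integrableOn_of_abs_le_totalVariation ?_ (fun t => abs_sintegral_restrict_le
    (measurableSet_wellSet w) hm fun z => hC z.1) (hCE.finite_jx i)
  refine (hCE.meas_jx i (BoundedContinuousFunction.ofNormedAddCommGroup _ hc C fun z => by
    rw [norm_mul, Real.norm_eq_abs]
    exact (mul_le_of_le_one_left (norm_nonneg _) (abs_wellFun_le w z.2)).trans (hC z.1))).congr ?_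
  filter_upwards [hac] with t ht
  refine (sintegral_restrict_eq (measurableSet_wellSet w) hm (fun z => hC z.1) ?_).symm
  have h1 : S.InWells (j.jx t i).totalVariation := ((ht.2.1 i).trans ht.1).ae_le inWells_π₀
  exact Eventually.mono h1 fun z hz => (indicator_wellSet_eq
    (f := fun z => fderiv ℝ B z.1 (EuclideanSpace.single i 1)) hz w).symm

omit w in
include hCE hB hBc in
lemma integrableOn_sintegral_jbar : IntegrableOn (fun t => sintegral (j.jbar t) B) (Icc 0 T) := by
  obtain ⟨C, hC⟩ := hBc.exists_bound_of_continuous hB.continuous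
  refine integrableOn_of_abs_le_totalVariation (C := C) (hCE.meas_jbar
    (BoundedContinuousFunction.ofNormedAddCommGroup B hB.continuous C hC))
    (fun t => ?_) hCE.finite_jbar
  have := abs_sintegral_restrict_le (μ := j.jbar t) MeasurableSet.univ hB.continuous.measurable hC
  rwa [VectorMeasure.restrict_univ] at this

include hCE hac hB hBc in
lemma integrableOn_momentRate :
    IntegrableOn (fun t => S.momentRate w B (j.jx t) (j.jbar t)) (Icc 0 T) :=
  (integrableOn_sum_sintegral hCE hac w hB hBc).add
    ((integrableOn_sintegral_jbar hCE hB hBc).const_mul _)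

omit w in
include hB hBc in
lemma isTest_mul {η : ℝ → ℝ} (hη : ContDiff ℝ ∞ η) (hηc : HasCompactSupport η)
    (hηt : tsupport η ⊆ Ioo 0 T) : IsTest T (fun p : ℝ × Space d => η p.1 * B p.2) := by
  have hsub : tsupport (fun p : ℝ × Space d => η p.1 * B p.2) ⊆ tsupport η ×ˢ tsupport B := by
    refine closure_minimal (fun p hp => ?_) ((isClosed_tsupport _).prod (isClosed_tsupport _))
    have h1 := left_ne_zero_of_mul hp
    have h2 := right_ne_zero_of_mul hp
    exact ⟨subset_tsupport _ h1, subset_tsupport _ h2⟩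
  refine ⟨?_, (hηc.isCompact.prod hBc.isCompact).of_isClosed_subset (isClosed_tsupport _) hsub,
    hsub.trans fun p hp => ⟨hηt hp.1, mem_univ _⟩⟩
  exact ((hη.of_le (mod_cast le_top)).comp contDiff_fst).mul
    ((hB.of_le (mod_cast le_top)).comp contDiff_snd)

omit w in
include hB in
lemma fderiv_mul_apply {η : ℝ → ℝ} (hη : ContDiff ℝ ∞ η) (t : ℝ) (x : Space d)
    (v : ℝ × Space d) : fderiv ℝ (fun p : ℝ × Space d => η p.1 * B p.2) (t, x) v =
      deriv η t * v.1 * B x + η t * fderiv ℝ B x v.2 := by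
  have h1 : HasFDerivAt (fun p : ℝ × Space d => η p.1)
      ((fderiv ℝ η t).comp (ContinuousLinearMap.fst ℝ ℝ (Space d))) (t, x) :=
    ((hη.differentiable (by simp)) t).hasFDerivAt.comp (t, x) hasFDerivAt_fst
  have h2 : HasFDerivAt (fun p : ℝ × Space d => B p.2)
      ((fderiv ℝ B x).comp (ContinuousLinearMap.snd ℝ ℝ (Space d))) (t, x) :=
    ((hB.differentiable (by simp)) x).hasFDerivAt.comp (t, x) hasFDerivAt_snd
  rw [(h1.fun_mul h2).fderiv]
  simp only [_root_.add_apply, _root_.smul_apply, ContinuousLinearMap.comp_apply,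
    ContinuousLinearMap.coe_fst', ContinuousLinearMap.coe_snd', smul_eq_mul,
    fderiv_eq_smul_deriv]
  ring

omit w in
lemma wellTerm_zero (y t : ℝ) : wellTerm ρ j y (fun _ => 0) t = 0 := by
  simp [wellTerm, sintegral]

include hB in
lemma wellTerm_mul {η : ℝ → ℝ} (hη : ContDiff ℝ ∞ η) (t : ℝ) :
    wellTerm ρ j (S.well w) (fun p => η p.1 * B p.2) t = deriv η t * S.moment w B (ρ t) +
      η t * ∑ i, sintegral ((j.jx t i).restrict (S.wellSet w))
        (fun z => fderiv ℝ B z.1 (EuclideanSpace.single i 1)) := by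
  simp only [wellTerm, fderiv_mul_apply hB hη, mul_one, map_zero, mul_zero, add_zero, zero_mul,
    zero_add]
  rw [integral_const_mul, Finset.mul_sum]
  simp only [sintegral_const_mul]
  rfl

include hCE hT hac hB hBc in
/-- The weak form of the continuity equation, tested with functions of the spatial variable. -/
lemma moment_sub_eq_integral : ∀ t ∈ Icc 0 T, S.moment w B (ρ t) - S.moment w B (ρ 0) =
    ∫ τ in (0:ℝ)..t, S.momentRate w B (j.jx τ) (j.jbar τ) := by
  refine sub_eq_integral_of_weak_deriv hT (continuousOn_moment hCE hT hac w hB hBc)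
    (integrableOn_momentRate hCE hac w hB hBc) fun η hη hηc hηt => ?_
  have hφ := isTest_mul hB hBc hη hηc hηt
  have h0 : IsTest T (fun _ : ℝ × Space d => (0:ℝ)) :=
    ⟨contDiff_const, HasCompactSupport.zero, by simp [tsupport]⟩
  have hbd : ∀ {g : ℝ → ℝ}, IntegrableOn g (Icc 0 T) →
      IntegrableOn (fun t => η t * g t) (Icc 0 T) := fun hg =>
    hg.continuousOn_mul hη.continuous.continuousOn isCompact_Icc
  have i1 : IntegrableOn (fun t => deriv η t * S.moment w B (ρ t)) (Icc 0 T) :=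
    ((hη.continuous_deriv (by simp)).continuousOn.mul
      (continuousOn_moment hCE hT hac w hB hBc)).integrableOn_compact isCompact_Icc
  have i2 := hbd (integrableOn_sum_sintegral hCE hac w hB hBc)
  have i3 := (hbd (integrableOn_sintegral_jbar hCE hB hBc)).const_mul (sgn w)
  have key : (∫ t in Icc 0 T, wellTerm ρ j (S.well w) (fun p => η p.1 * B p.2) t) +
      ∫ t in Icc 0 T, sgn w * (η t * sintegral (j.jbar t) B) = 0 := by
    -- Only one of the two test functions is nonzero, and the jump term sees it with the sign `-1`
    -- in the well `a` and `+1` in the well `b`.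
    cases w
    · have h1 := hCE.weak _ _ hφ h0
      simp only [wellTerm_zero, add_zero, zero_sub] at h1
      refine Eq.trans ?_ h1
      congr 1
      refine integral_congr_ae (Eventually.of_forall fun t => ?_)
      simp only
      have := sintegral_const_mul (μ := j.jbar t) (-η t) B
      simp only [neg_mul] at this
      rw [this]
      simp [sgn]
    · have h1 := hCE.weak _ _ h0 hφ
      simp only [wellTerm_zero, zero_add, sub_zero] at h1
      refine Eq.trans ?_ h1
      congr 1
      refine integral_congr_ae (Eventually.of_forall fun t => ?_)
      simp only
      rw [sintegral_const_mul]
      simp [sgn]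
  have i4 : IntegrableOn (fun t => wellTerm ρ j (S.well w) (fun p => η p.1 * B p.2) t) (Icc 0 T) :=
    (i1.add i2).congr (Eventually.of_forall fun t => (wellTerm_mul w hB hη t).symm)
  rw [← integral_add i4 i3] at key
  refine Eq.trans ?_ key
  refine integral_congr_ae (Eventually.of_forall fun t => ?_)
  simp only [wellTerm_mul w hB hη, momentRate]
  ring

end Dynamics

end Setting


namespace Setting

variable {d : ℕ} {S : Setting d}

/-! ### Mollified measures -/

/-- The density of the mollification of `ρ`. -/
noncomputable def mollify (S : Setting d) (N : ℕ) (ρ : Measure (Space d × ℝ)) (w : Bool)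
    (x : Space d) : ℝ :=
  (S.γ w)⁻¹ * ∫ z in S.wellSet w, S.kernel N none x z.1 ∂ρ

lemma mollify_nonneg (N : ℕ) (ρ : Measure (Space d × ℝ)) (w : Bool) (x : Space d) :
    0 ≤ S.mollify N ρ w x :=
  mul_nonneg (inv_pos.2 (S.γ_pos w)).le (integral_nonneg fun z => S.kernel_none_nonneg N x z.1)

lemma γ_mul_mollify (N : ℕ) (ρ : Measure (Space d × ℝ)) (w : Bool) (x : Space d) :
    S.γ w * S.mollify N ρ w x = ∫ z in S.wellSet w, S.kernel N none x z.1 ∂ρ := by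
  rw [mollify, ← mul_assoc, mul_inv_cancel₀ (S.γ_pos w).ne', one_mul]

section

variable {ρ : Measure (Space d × ℝ)} (hp : S.IsNodeProb ρ)

include hp

lemma IsNodeProb.ae_mem : ∀ᵐ z ∂ρ, z ∈ S.nodes := by
  rw [ae_iff]
  exact hp.2

lemma IsNodeProb.integrable_comp_fst {f : Space d → ℝ} (hf : Continuous f) :
    Integrable (fun z => f z.1) ρ := by
  have := hp.1
  obtain ⟨C, hC⟩ := S.isCompact_Ω.exists_bound_of_continuousOn hf.continuousOn
  exact Integrable.of_bound (hf.comp continuous_fst).aestronglyMeasurable C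
    (hp.ae_mem.mono fun z hz => hC z.1 hz.1)

/-- The symmetry of the kernel moves the mollification from `ρ` to `f`. As the kernel is a finite
sum of products, the interchange of integrals is linearity; no density of `ρ` is needed. -/
lemma integral_mul_mollify (N : ℕ) (w : Bool) {f : Space d → ℝ} (hf : IntegrableOn f S.Ω) :
    S.γ w * ∫ x in S.Ω, f x * S.mollify N ρ w x = ∫ z in S.wellSet w, S.op N none f z.1 ∂ρ := by
  obtain ⟨n, A, B, hA, hB, e⟩ := S.isSeparated_kernel N none
  have hB' : ∀ l, Integrable (fun z => B l z.1) (ρ.restrict (S.wellSet w)) := fun l =>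
    (hp.integrable_comp_fst (hB l).continuous).restrict
  have h1 : ∀ x, f x * (S.γ w * S.mollify N ρ w x) =
      ∑ l, A l x * f x * ∫ z in S.wellSet w, B l z.1 ∂ρ := fun x => by
    rw [γ_mul_mollify]
    simp only [e]
    rw [integral_finsetSum _ fun l _ => (hB' l).const_mul _, Finset.mul_sum]
    refine Finset.sum_congr rfl fun l _ => ?_
    rw [integral_const_mul]
    ring
  have h2 : ∀ y, S.op N none f y = ∑ l, (∫ x in S.Ω, A l x * f x) * B l y := fun y => by
    have : ∀ x, S.kernel N none y x * f x = ∑ l, A l x * f x * B l y := fun x => by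
      rw [S.kernel_comm, e, Finset.sum_mul]
      exact Finset.sum_congr rfl fun l _ => by ring
    simp only [op, this]
    rw [integral_finsetSum _ fun l _ =>
      (integrableOn_mul_of_continuous (hA l).continuous hf).mul_const _]
    simp only [integral_mul_const]
  simp only [h2]
  rw [integral_finsetSum _ fun l _ => (hB' l).const_mul _, ← integral_const_mul]
  have h3 : ∀ x, S.γ w * (f x * S.mollify N ρ w x) =
      ∑ l, A l x * f x * ∫ z in S.wellSet w, B l z.1 ∂ρ := fun x => by
    rw [← h1]; ring
  simp only [h3]
  rw [integral_finsetSum _ fun l _ =>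
    (integrableOn_mul_of_continuous (hA l).continuous hf).mul_const _]
  simp only [integral_mul_const, integral_const_mul]

omit hp in
lemma sum_real_wellSet [IsProbabilityMeasure ρ] (h : S.InWells ρ) :
    ∑ w, ρ.real (S.wellSet w) = 1 := by
  have hd : Disjoint (S.wellSet true) (S.wellSet false) := by
    rw [Set.disjoint_left]
    rintro z ⟨-, h1⟩ ⟨-, h2⟩
    rw [mem_singleton_iff] at h1 h2
    have := S.well_injective (h1.symm.trans h2)
    simp at this
  have hu : ρ.real (S.wellSet true ∪ S.wellSet false) = 1 := by
    have : ρ (S.wellSet true ∪ S.wellSet false) = ρ univ := by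
      refine measure_congr ?_
      filter_upwards [h] with z hz
      refine propext ⟨fun _ => trivial, fun _ => ?_⟩
      rcases hz with hz | hz
      · exact Or.inl ⟨mem_univ _, hz⟩
      · exact Or.inr ⟨mem_univ _, hz⟩
    rw [measureReal_def, this, measure_univ, ENNReal.toReal_one]
  rw [Fintype.sum_bool, ← hu, measureReal_union hd (measurableSet_wellSet false)]

lemma continuous_mollify (N : ℕ) (w : Bool) : Continuous (S.mollify N ρ w) := by
  obtain ⟨n, A, B, hA, hB, e⟩ := S.isSeparated_kernel N none
  have : S.mollify N ρ w = fun x => (S.γ w)⁻¹ * ∑ l, A l x * ∫ z in S.wellSet w, B l z.1 ∂ρ := by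
    ext x
    rw [mollify]
    simp only [e]
    rw [integral_finsetSum _ fun l _ =>
      (hp.integrable_comp_fst (hB l).continuous).restrict.const_mul _]
    simp only [integral_const_mul]
  rw [this]
  exact continuous_const.mul (continuous_finsetSum _ fun l _ =>
    (hA l).continuous.mul continuous_const)

lemma isDensity_mollify (h : S.InWells ρ) (N : ℕ) : S.IsDensity (S.mollify N ρ) := by
  have := hp.1
  refine ⟨fun w => S.integrableOn_of_continuous (continuous_mollify hp N w),
    fun w => Eventually.of_forall (mollify_nonneg N ρ w), ?_⟩
  rw [← sum_real_wellSet h]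
  refine Finset.sum_congr rfl fun w _ => ?_
  have h1 := integral_mul_mollify hp N w (f := fun _ => (1:ℝ))
    (S.integrableOn_of_continuous continuous_const)
  simp only [one_mul, op_none_const] at h1
  rw [h1]
  simp

lemma integrableOn_mul_density (hρ : ρ ≪ S.π₀) {f : Space d × ℝ → ℝ} (hf : Integrable f ρ)
    (w : Bool) : IntegrableOn (fun x => f (x, S.well w) * S.density ρ w x) S.Ω := by
  have := hp.1
  have h1 : SigmaFinite S.π₀ := inferInstance
  have h3 : ρ.HaveLebesgueDecomposition S.π₀ := Measure.haveLebesgueDecomposition_of_sigmaFinite _ _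
  have h2 := (integrable_rnDeriv_smul_iff hρ).2 hf
  have h4 : Integrable (fun z => (ρ.rnDeriv S.π₀ z).toReal • f z)
      (ENNReal.ofReal (S.γ w) •
        ((volume : Measure (Space d)).restrict S.Ω).map (fun x => (x, S.well w))) := by
    rw [π₀_eq] at h2 ⊢
    exact integrable_finsetSum_measure.1 h2 w (Finset.mem_univ w)
  rw [integrable_smul_measure (by simpa using S.γ_pos w) ENNReal.ofReal_ne_top,
    (S.measurableEmbedding_well w).integrable_map_iff] at h4
  refine h4.congr (Eventually.of_forall fun x => ?_)
  simp only [Function.comp_apply, smul_eq_mul, density]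
  ring

lemma setIntegral_wellSet_eq (hρ : ρ ≪ S.π₀) {f : Space d × ℝ → ℝ} (hf : Integrable f ρ)
    (w : Bool) : ∫ z in S.wellSet w, f z ∂ρ =
      S.γ w * ∫ x in S.Ω, f (x, S.well w) * S.density ρ w x := by
  have := hp.1
  have h1 : ∀ w' x, (S.wellSet w).indicator f (x, S.well w') =
      if w' = w then f (x, S.well w') else 0 := fun w' x => by
    by_cases h : w' = w
    · rw [indicator_of_mem (by simp [wellSet, h]), if_pos h]
    · rw [indicator_of_notMem, if_neg h]
      simp only [wellSet, mem_prod, mem_univ, mem_singleton_iff, true_and]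
      exact fun h' => h (S.well_injective h')
  rw [← integral_indicator (measurableSet_wellSet w)]
  conv_lhs => rw [← stateMeasure_density hρ]
  rw [integral_stateMeasure (isDensity_density hp hρ), Fintype.sum_eq_single w]
  · simp only [h1, if_true]
  · intro w' hw'
    simp [h1, hw']
  · intro w'
    simp only [h1]
    by_cases h : w' = w
    · simpa [h] using integrableOn_mul_density hp hρ hf w
    · simp [h]

lemma mollify_eq_op (hρ : ρ ≪ S.π₀) (N : ℕ) (w : Bool) :
    S.mollify N ρ w = S.op N none (S.density ρ w) := by
  ext x
  rw [mollify, setIntegral_wellSet_eq hp hρ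
    (hp.integrable_comp_fst (S.continuous_kernel_right N none x)), ← mul_assoc,
    inv_mul_cancel₀ (S.γ_pos w).ne', one_mul, op]

end

/-! ### The evolution of the mollified energy -/

/-- The density of `jˣ` in a well. -/
noncomputable def fluxDensity (S : Setting d) (ρ : Measure (Space d × ℝ))
    (jx : Fin d → SignedMeasure (Space d × ℝ)) (w : Bool) (i : Fin d) (x : Space d) : ℝ :=
  (jx i).rnDeriv ρ (x, S.well w) * S.density ρ w x

/-- The density of `j̄`. -/
noncomputable def jumpDensity (S : Setting d) (jbar : SignedMeasure (Space d)) : Space d → ℝ :=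
  jbar.rnDeriv (volume.restrict S.Ω)

/-- The mollified potential. -/
noncomputable def mollPotential (S : Setting d) (F : S.Tilt) (δ : ℝ) (N : ℕ)
    (ρ : Measure (Space d × ℝ)) : Bool → Space d → ℝ :=
  S.potential F δ (S.mollify N ρ)

/-- The rate of change of the mollified energy. -/
noncomputable def mollRate (S : Setting d) (F : S.Tilt) (δ : ℝ) (N : ℕ)
    (ρ : Measure (Space d × ℝ)) (jx : Fin d → SignedMeasure (Space d × ℝ))
    (jbar : SignedMeasure (Space d)) : ℝ :=
  ∑ w, ((S.γ w * ∑ i, ∫ y in S.Ω, S.op N (some i) (fun x =>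
      fderiv ℝ (S.mollPotential F δ N ρ w) x (EuclideanSpace.single i 1)) y *
        S.fluxDensity ρ jx w i y) +
    sgn w * ∫ y in S.Ω, S.op N none (S.mollPotential F δ N ρ w) y * S.jumpDensity jbar y)

lemma integrableOn_fluxDensity {ρ : Measure (Space d × ℝ)} (hp : S.IsNodeProb ρ)
    (hρ : ρ ≪ S.π₀) (jx : Fin d → SignedMeasure (Space d × ℝ)) (w : Bool) (i : Fin d) :
    IntegrableOn (S.fluxDensity ρ jx w i) S.Ω :=
  have := hp.1
  integrableOn_mul_density hp hρ (SignedMeasure.integrable_rnDeriv (jx i) ρ) w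

lemma integrableOn_jumpDensity (jbar : SignedMeasure (Space d)) :
    IntegrableOn (S.jumpDensity jbar) S.Ω :=
  SignedMeasure.integrable_rnDeriv jbar _

lemma momentRate_eq {ρ : Measure (Space d × ℝ)} (hp : S.IsNodeProb ρ) (hρ : ρ ≪ S.π₀)
    {jx : Fin d → SignedMeasure (Space d × ℝ)} (hjx : ∀ i, (jx i).totalVariation ≪ ρ)
    {jbar : SignedMeasure (Space d)} (hjbar : jbar.totalVariation ≪ volume.restrict S.Ω)
    (w : Bool) {B : Space d → ℝ} (hB : ContDiff ℝ ∞ B) (hBc : HasCompactSupport B) :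
    S.momentRate w B jx jbar = S.γ w * (∑ i, ∫ x in S.Ω,
      fderiv ℝ B x (EuclideanSpace.single i 1) * S.fluxDensity ρ jx w i x) +
      sgn w * ∫ x in S.Ω, B x * S.jumpDensity jbar x := by
  have := hp.1
  rw [momentRate, Finset.mul_sum]
  congr 1
  · refine Finset.sum_congr rfl fun i _ => ?_
    obtain ⟨C, hC⟩ := exists_bound_fderiv_single hB hBc i
    have hm : Measurable fun z : Space d × ℝ => fderiv ℝ B z.1 (EuclideanSpace.single i 1) :=
      ((continuous_fderiv_single hB i).comp continuous_fst).measurable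
    rw [sintegral_restrict_eq_integral (hjx i) (measurableSet_wellSet w) hm fun z => hC z.1,
      setIntegral_wellSet_eq hp hρ (integrable_rnDeriv_mul hm fun z => hC z.1)]
    simp only [fluxDensity, mul_assoc]
  · obtain ⟨C, hC⟩ := hBc.exists_bound_of_continuous hB.continuous
    have := sintegral_restrict_eq_integral hjbar MeasurableSet.univ hB.continuous.measurable hC
    rw [VectorMeasure.restrict_univ, Measure.restrict_univ] at this
    rw [this]
    rfl

lemma exists_lipschitzOnWith_deriv (F : S.Tilt) : ∃ L : NNReal, ∀ ρ, S.IsNodeProb ρ → ∀ w,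
    LipschitzOnWith L (fun x => F.deriv ρ (x, S.well w)) S.Ω := by
  obtain ⟨L, hL⟩ := F.lipschitz_deriv
  refine ⟨L.toNNReal, fun ρ hρ w => LipschitzOnWith.of_dist_le_mul fun x hx y hy => ?_⟩
  rw [Real.dist_eq, dist_eq_norm]
  exact (hL ρ hρ x hx y hy _ (S.well_mem_Υ w)).trans
    (mul_le_mul_of_nonneg_right (Real.le_coe_toNNReal L) (norm_nonneg _))

lemma contDiff_log_op_add {u : Space d → ℝ} (hu : IntegrableOn u S.Ω)
    (hu0 : ∀ᵐ x ∂volume.restrict S.Ω, 0 ≤ u x) {δ : ℝ} (hδ : 0 < δ) (N : ℕ) :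
    ContDiff ℝ ∞ fun x => Real.log (S.op N none u x + δ) :=
  ((contDiff_op hu).add contDiff_const).log fun x =>
    (add_pos_of_nonneg_of_pos (op_none_nonneg hu0 x) hδ).ne'

lemma exists_lipschitzOnWith_mollPotential (F : S.Tilt) {δ : ℝ} (hδ : 0 < δ) (N : ℕ)
    {ρ : Measure (Space d × ℝ)} (hp : S.IsNodeProb ρ) (hρ : ρ ≪ S.π₀) (w : Bool) :
    ∃ L, LipschitzOnWith L (S.mollPotential F δ N ρ w) S.Ω := by
  obtain ⟨L, hL⟩ := exists_lipschitzOnWith_deriv F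
  have hu := isDensity_density hp hρ
  have hd := isDensity_mollify hp (hρ.ae_le inWells_π₀) N
  obtain ⟨K, hK⟩ := ((contDiff_log_op_add (hu.integrable w) (hu.nonneg w) hδ N).contDiffOn
    (s := S.Ω)).exists_lipschitzOnWith (by simp) S.convex_Ω S.isCompact_Ω
  refine ⟨K + L, ?_⟩
  have h1 := hK.add (hL _ hd.isNodeProb w)
  have e : S.mollPotential F δ N ρ w = fun x => Real.log (S.op N none (S.density ρ w) x + δ) +
      F.deriv (S.stateMeasure (S.mollify N ρ)) (x, S.well w) := by
    ext x
    rw [mollPotential, potential, mollify_eq_op hp hρ N w]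
  rw [e]
  exact h1

lemma exists_cutoff_Ω (S : Setting d) : ∃ χ : Space d → ℝ, ContDiff ℝ ∞ χ ∧ HasCompactSupport χ ∧
    ∀ x ∈ S.Ω, ∀ᶠ y in 𝓝 x, χ y = 1 := by
  obtain ⟨R, hR⟩ := S.isCompact_Ω.isBounded.subset_closedBall (0 : Space d)
  let f : ContDiffBump (0 : Space d) := ⟨max R 0 + 1, max R 0 + 2, by positivity, by linarith⟩
  refine ⟨f, f.contDiff, f.hasCompactSupport, fun x hx => ?_⟩
  refine f.eventuallyEq_one_of_mem_ball ?_
  have := hR hx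
  rw [Metric.mem_closedBall] at this
  rw [Metric.mem_ball]
  exact (this.trans (le_max_left R 0)).trans_lt (lt_add_one _)

section

variable {T : ℝ} {ρ : ℝ → Measure (Space d × ℝ)} {j : Flux d}

/-- The evolution of the mollified energy. -/
lemma freeEnergy_mollify_sub_eq_integral (F : S.Tilt) {δ : ℝ} (hδ : 0 < δ) (N : ℕ)
    (hCE : S.ContractedCE T ρ j) (hT : 0 < T) (hac : S.IsAC T ρ j) :
    S.freeEnergy F δ (S.mollify N (ρ T)) - S.freeEnergy F δ (S.mollify N (ρ 0)) =
      ∫ t in (0:ℝ)..T, S.mollRate F δ N (ρ t) (j.jx t) (j.jbar t) := by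
  obtain ⟨n, A, B, hA, hB, e⟩ := S.isSeparated_kernel N none
  -- Test functions must have compact support in `ℝ^d` but need not vanish on the boundary of the
  -- box: this is where the no-flux condition enters. The cutoff equals one near the box, so values
  -- and derivatives there are unchanged.
  obtain ⟨χ, hχ, hχc, hχ1⟩ := S.exists_cutoff_Ω
  set B' : Fin n → Space d → ℝ := fun l x => χ x * B l x with hB'
  have hBs : ∀ l, ContDiff ℝ ∞ (B' l) := fun l => hχ.mul (hB l)
  have hBc : ∀ l, HasCompactSupport (B' l) := fun l => hχc.mul_right
  have hev : ∀ l, ∀ x ∈ S.Ω, B' l =ᶠ[𝓝 x] B l := fun l x hx => by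
    filter_upwards [hχ1 x hx] with y hy
    rw [hB']
    simp only
    rw [hy, one_mul]
  have hBeq : ∀ l, ∀ x ∈ S.Ω, B' l x = B l x := fun l x hx => (hev l x hx).eq_of_nhds
  have hBd : ∀ l, ∀ x ∈ S.Ω, fderiv ℝ (B' l) x = fderiv ℝ (B l) x := fun l x hx =>
    (hev l x hx).fderiv_eq
  set m : Bool × Fin n → ℝ → ℝ := fun k t => S.moment k.1 (B' k.2) (ρ t) with hm
  set v : Bool × Fin n → ℝ → ℝ := fun k t => S.momentRate k.1 (B' k.2) (j.jx t) (j.jbar t) with hv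
  -- The mollified state, written through the moments `m` so that it is defined and of
  -- finite-dimensional form at all times.
  set U : ℝ → Bool → Space d → ℝ := fun t w x => (S.γ w)⁻¹ * ∑ k, A k x * m (w, k) t with hU
  have hUm : ∀ t ∈ Icc 0 T, U t = S.mollify N (ρ t) := fun t ht => by
    have hp := hCE.prob t ht
    ext w x
    rw [hU, mollify]
    simp only [e]
    rw [integral_finsetSum _ fun l _ =>
      (hp.integrable_comp_fst (hB l).continuous).restrict.const_mul _]
    congr 1
    refine Finset.sum_congr rfl fun l _ => ?_
    rw [integral_const_mul, hm]
    congr 1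
    refine integral_congr_ae (ae_restrict_of_ae ?_)
    filter_upwards [hp.ae_mem] with z hz using hBeq l z.1 hz.1
  have hmain := freeEnergy_sub_eq_integral F hT hδ (fun k => (hA k).continuous) (m := m) (v := v)
    (fun k => integrableOn_momentRate hCE hac k.1 (hBs k.2) (hBc k.2))
    (fun k => continuousOn_moment hCE hT hac k.1 (hBs k.2) (hBc k.2))
    (fun k => moment_sub_eq_integral hCE hT hac k.1 (hBs k.2) (hBc k.2)) (U := U)
    (fun t w x => by
      rw [hU]
      simp only
      rw [← mul_assoc, mul_inv_cancel₀ (S.γ_pos w).ne', one_mul])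
    (fun t ht w x => by rw [hUm t ht]; exact mollify_nonneg N (ρ t) w x)
    (fun t ht => by
      rw [hUm t ht]
      exact isDensity_mollify (hCE.prob t ht) (hCE.inWells hT hac t ht) N)
  rw [hUm T ⟨hT.le, le_rfl⟩, hUm 0 ⟨le_rfl, hT.le⟩] at hmain
  rw [hmain, intervalIntegral.integral_of_le hT.le, intervalIntegral.integral_of_le hT.le,
    ← integral_Icc_eq_integral_Ioc, ← integral_Icc_eq_integral_Ioc]
  refine integral_congr_ae ?_
  filter_upwards [hac, ae_restrict_mem measurableSet_Icc] with t ⟨hρ, hjx, hjbar⟩ ht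
  have hp := hCE.prob t ht
  rw [hUm t ht, Fintype.sum_prod_type, mollRate]
  refine Finset.sum_congr rfl fun w _ => ?_
  obtain ⟨L, hL⟩ := exists_lipschitzOnWith_mollPotential F hδ N hp hρ w
  set G := S.mollPotential F δ N (ρ t) w with hG
  have hGi : IntegrableOn G S.Ω := hL.continuousOn.integrableOn_compact S.isCompact_Ω
  have hGA : ∀ l, IntegrableOn (fun x => G x * A l x) S.Ω := fun l =>
    (hL.continuousOn.fun_mul (hA l).continuous.continuousOn).integrableOn_compact S.isCompact_Ω
  -- Integration by parts in the first variable: the Dirichlet kernel vanishes at the faces, so the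
  -- gradient of the potential is transferred to the factors `B` without boundary terms.
  have h1 : ∀ i y, S.op N (some i) (fun x => fderiv ℝ G x (EuclideanSpace.single i 1)) y =
      ∑ l, (∫ x in S.Ω, G x * A l x) * fderiv ℝ (B l) y (EuclideanSpace.single i 1) := by
    intro i y
    have h2 := (hasWeakDeriv_of_lipschitzOnWith hL i).integral_mul_fderiv_kernel hGi
      (integrableOn_fderiv_single hL i) N y
    have h3 : ∀ x, fderiv ℝ (S.kernel N none x) y (EuclideanSpace.single i 1) =
        ∑ l, A l x * fderiv ℝ (B l) y (EuclideanSpace.single i 1) := fun x => by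
      have : S.kernel N none x = fun y => ∑ l, A l x * B l y := by ext y; exact e x y
      rw [this, (HasFDerivAt.fun_sum fun l _ =>
        (((hB l).differentiable (by simp)) y).hasFDerivAt.const_mul (A l x)).fderiv]
      simp
    have h4 : ∀ x, fderiv ℝ (S.kernel N (some i) y) x (EuclideanSpace.single i 1) =
        - ∑ l, A l x * fderiv ℝ (B l) y (EuclideanSpace.single i 1) := fun x => by
      rw [← h3, S.fderiv_kernel_none, neg_neg]
    simp only [h4, mul_neg] at h2
    rw [integral_neg, neg_inj] at h2
    simp only [op, mul_comm (S.kernel N (some i) y _)]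
    rw [← h2]
    simp only [Finset.mul_sum, ← mul_assoc]
    rw [integral_finsetSum _ fun l _ => (hGA l).mul_const _]
    simp only [integral_mul_const]
  have h5 : ∀ y, S.op N none G y = ∑ l, (∫ x in S.Ω, G x * A l x) * B l y := by
    intro y
    have : ∀ x, S.kernel N none y x * G x = ∑ l, G x * A l x * B l y := fun x => by
      rw [S.kernel_comm, e, Finset.sum_mul]
      exact Finset.sum_congr rfl fun l _ => by ring
    simp only [op, this]
    rw [integral_finsetSum _ fun l _ => (hGA l).mul_const _]
    simp only [integral_mul_const]
  have hJ := integrableOn_fluxDensity hp hρ (j.jx t) w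
  have hr := integrableOn_jumpDensity (S := S) (j.jbar t)
  have h6 : ∀ i, ∫ y in S.Ω, S.op N (some i)
      (fun x => fderiv ℝ G x (EuclideanSpace.single i 1)) y * S.fluxDensity (ρ t) (j.jx t) w i y =
      ∑ l, (∫ x in S.Ω, G x * A l x) * ∫ y in S.Ω,
        fderiv ℝ (B' l) y (EuclideanSpace.single i 1) * S.fluxDensity (ρ t) (j.jx t) w i y := by
    intro i
    simp only [h1, Finset.sum_mul, mul_assoc]
    rw [integral_finsetSum _ fun l _ => (integrableOn_mul_of_continuous
      (continuous_fderiv_single (hB l) i) (hJ i)).const_mul _]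
    refine Finset.sum_congr rfl fun l _ => ?_
    rw [integral_const_mul]
    congr 1
    refine setIntegral_congr_fun S.measurableSet_Ω fun y hy => ?_
    rw [hBd l y hy]
  have h7 : ∫ y in S.Ω, S.op N none G y * S.jumpDensity (j.jbar t) y =
      ∑ l, (∫ x in S.Ω, G x * A l x) * ∫ y in S.Ω, B' l y * S.jumpDensity (j.jbar t) y := by
    simp only [h5, Finset.sum_mul, mul_assoc]
    rw [integral_finsetSum _ fun l _ =>
      (integrableOn_mul_of_continuous (hB l).continuous hr).const_mul _]
    refine Finset.sum_congr rfl fun l _ => ?_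
    rw [integral_const_mul]
    congr 1
    refine setIntegral_congr_fun S.measurableSet_Ω fun y hy => ?_
    rw [hBeq l y hy]
  simp only [h6]
  rw [h7, Finset.sum_comm, Finset.mul_sum, Finset.mul_sum, ← Finset.sum_add_distrib]
  refine Finset.sum_congr rfl fun l _ => ?_
  simp only [hv]
  rw [momentRate_eq hp hρ hjx hjbar w (hBs l) (hBc l), ← Finset.mul_sum]
  change (∫ x in S.Ω, G x * A l x) * _ = _
  ring

end

end Setting


namespace Setting

variable {d : ℕ} {S : Setting d}

/-! ### The diffusive part of the energy balance -/

/-- The derivative of a Lipschitz function is controlled in the interior only, and may be set to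
zero on the null set that remains. -/
lemma integral_mul_op_of_ae {N : ℕ} {o : Option (Fin d)} {f g : Space d → ℝ} {C : ℝ}
    (hf : IntegrableOn f S.Ω) (hg : IntegrableOn g S.Ω)
    (hC : ∀ x ∈ interior S.Ω, |g x| ≤ C) :
    ∫ x in S.Ω, g x * S.op N o f x = ∫ y in S.Ω, S.op N o g y * f y := by
  have h1 : ∀ᵐ x ∂volume.restrict S.Ω, g x = (interior S.Ω).indicator g x := by
    filter_upwards [S.ae_mem_interior_Ω] with x hx
    rw [indicator_of_mem hx]
  have h2 : ∫ x in S.Ω, g x * S.op N o f x =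
      ∫ x in S.Ω, (interior S.Ω).indicator g x * S.op N o f x :=
    integral_congr_ae (h1.mono fun x hx => by simp only; rw [← hx])
  rw [h2, op_congr h1, integral_mul_op hf (hg.congr h1)]
  refine ⟨|C|, fun x _ => ?_⟩
  by_cases hx : x ∈ interior S.Ω
  · rw [indicator_of_mem hx]; exact (hC x hx).trans (le_abs_self C)
  · rw [indicator_of_notMem hx]; simp

/-- The hypotheses give `(D J)² ≤ u² P W`, the quotient `u² / (u + δ)²` is at most one, and the
means inequality finishes. The bound does not depend on `δ`. -/
lemma abs_div_mul_le {D J u P W δ : ℝ} (hu : 0 ≤ u) (hP : 0 ≤ P) (hW : 0 ≤ W)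
    (hD : D ^ 2 ≤ u * P) (hJ : J ^ 2 ≤ u * W) (hδ : 0 < δ) :
    |D / (u + δ) * J| ≤ (P + W) / 2 := by
  have h : 0 < u + δ := by linarith
  have h1 : (D / (u + δ) * J) ^ 2 ≤ P * W := by
    have e : (D / (u + δ) * J) ^ 2 = D ^ 2 * J ^ 2 / (u + δ) ^ 2 := by
      field_simp
    rw [e, div_le_iff₀ (by positivity)]
    have h2 := mul_le_mul hD hJ (sq_nonneg J) (mul_nonneg hu hP)
    have h3 : u ^ 2 ≤ (u + δ) ^ 2 := by nlinarith
    nlinarith [mul_le_mul_of_nonneg_left h3 (mul_nonneg hP hW)]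
  refine abs_le_of_sq_le_sq ?_ (by linarith)
  nlinarith [sq_nonneg (P - W)]

section Diffusive

variable {i : Fin d} {u D J P W : Space d → ℝ} {δ : ℝ}
  (hu : IntegrableOn u S.Ω) (hD : IntegrableOn D S.Ω) (hJ : IntegrableOn J S.Ω)
  (hP : IntegrableOn P S.Ω) (hW : IntegrableOn W S.Ω)
  (hu0 : ∀ᵐ x ∂volume.restrict S.Ω, 0 ≤ u x) (hP0 : ∀ᵐ x ∂volume.restrict S.Ω, 0 ≤ P x)
  (hW0 : ∀ᵐ x ∂volume.restrict S.Ω, 0 ≤ W x)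
  (hDP : ∀ᵐ x ∂volume.restrict S.Ω, D x ^ 2 ≤ u x * P x)
  (hJW : ∀ᵐ x ∂volume.restrict S.Ω, J x ^ 2 ≤ u x * W x) (hδ : 0 < δ)

include hu hD hJ hP hW hu0 hP0 hW0 hDP hJW hδ

/-- Here `P` plays the role of `D² / u` (Fisher information) and `W` that of `J² / u` (kinetic
energy). Both inequalities persist under regularization, also when `D` and `J` are regularized by
Dirichlet kernels. -/
lemma abs_op_div_mul_op_le (N : ℕ) (x : Space d) :
    |S.op N (some i) D x / (S.op N none u x + δ) * S.op N (some i) J x| ≤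
      (S.op N none P x + S.op N none W x) / 2 :=
  abs_div_mul_le (op_none_nonneg hu0 x) (op_none_nonneg hP0 x) (op_none_nonneg hW0 x)
    (op_sq_le hD hu hP hu0 hP0 hDP x) (op_sq_le hJ hu hW hu0 hW0 hJW x) hδ

lemma abs_integral_op_div_mul_op_le (N : ℕ) :
    |∫ x in S.Ω, S.op N (some i) D x / (S.op N none u x + δ) * S.op N (some i) J x| ≤
      ((∫ x in S.Ω, P x) + ∫ x in S.Ω, W x) / 2 := by
  rw [← integral_op_none (N := N) hP, ← integral_op_none (N := N) hW,
    ← integral_add (integrableOn_op hP) (integrableOn_op hW), ← integral_div]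
  exact norm_integral_le_of_norm_le
    (f := fun x => S.op N (some i) D x / (S.op N none u x + δ) * S.op N (some i) J x)
    (((integrableOn_op hP).add (integrableOn_op hW)).div_const 2)
    (Eventually.of_forall (abs_op_div_mul_op_le hu hD hJ hP hW hu0 hP0 hW0 hDP hJW hδ N))

lemma tendsto_integral_op_div_mul_op :
    Tendsto (fun N => ∫ x in S.Ω,
      S.op N (some i) D x / (S.op N none u x + δ) * S.op N (some i) J x) atTop
      (𝓝 (∫ x in S.Ω, D x / (u x + δ) * J x)) := by
  refine tendsto_integral_of_op (ι := Fin 5) ![none, some i, some i, none, none]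
    (h := ![u, D, J, P, W]) (g := fun _ => 0) (C := 1) ?_ zero_le_one (fun N => ?_)
    (S.integrableOn_of_continuous continuous_const) (fun N => ?_) ?_
  · intro k
    fin_cases k
    exacts [hu, hD, hJ, hP, hW]
  · refine Continuous.aestronglyMeasurable ?_
    exact ((continuous_op hD).div ((continuous_op hu).add continuous_const) fun x =>
      (add_pos_of_nonneg_of_pos (op_none_nonneg hu0 x) hδ).ne').mul (continuous_op hJ)
  · refine Eventually.of_forall fun x => ?_
    refine (abs_op_div_mul_op_le hu hD hJ hP hW hu0 hP0 hW0 hDP hJW hδ N x).trans ?_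
    rw [Fin.sum_univ_five]
    simp only [Matrix.cons_val, zero_add, one_mul]
    have h1 := le_abs_self (S.op N none P x)
    have h2 := le_abs_self (S.op N none W x)
    have h3 := abs_nonneg (S.op N none P x)
    have h4 := abs_nonneg (S.op N none W x)
    have h5 := abs_nonneg (S.op N none u x)
    have h6 := abs_nonneg (S.op N (some i) D x)
    have h7 := abs_nonneg (S.op N (some i) J x)
    linarith
  · filter_upwards [hu0] with x hx ns _ hns
    have h0 := hns 0
    have h1 := hns 1
    have h2 := hns 2
    simp only [Matrix.cons_val] at h0 h1 h2
    exact (h1.div (h0.add_const δ) (add_pos_of_nonneg_of_pos hx hδ).ne').mul h2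

omit hδ in
/-- Removal of the regularization in the diffusive part. -/
lemma tendsto_integral_div_add_mul {δ : ℕ → ℝ} (hδ : ∀ n, 0 < δ n)
    (hδ0 : Tendsto δ atTop (𝓝 0)) (hJ0 : ∀ᵐ x ∂volume.restrict S.Ω, u x = 0 → J x = 0) :
    Tendsto (fun n => ∫ x in S.Ω, D x / (u x + δ n) * J x) atTop
      (𝓝 (∫ x in S.Ω, D x / u x * J x)) := by
  refine tendsto_integral_of_dominated_convergence (fun x => (P x + W x) / 2) (fun n => ?_)
    ((hP.add hW).div_const 2) (fun n => ?_) ?_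
  · exact (hD.aestronglyMeasurable.aemeasurable.div
      (hu.aestronglyMeasurable.aemeasurable.add_const (δ n))).mul
      hJ.aestronglyMeasurable.aemeasurable |>.aestronglyMeasurable
  · filter_upwards [hu0, hP0, hW0, hDP, hJW] with x h1 h2 h3 h4 h5
    exact abs_div_mul_le h1 h2 h3 h4 h5 (hδ n)
  · filter_upwards [hJ0] with x hx
    by_cases h : u x = 0
    · simp [hx h]
    · have : Tendsto (fun n => u x + δ n) atTop (𝓝 (u x)) := by
        simpa using hδ0.const_add (u x)
      exact (tendsto_const_nhds.div this h).mul_const _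

end Diffusive

/-! ### Weak convergence of the derivatives of Lipschitz functions -/

/-- The gradients are bounded by `L`, but converge only weakly. With `J` replaced by a fixed
regularization, the derivative can be moved onto the kernel, and the pairing becomes a finite sum of
moments of `f N`, which converge. The replacement costs at most `L` times an `L¹` distance,
uniformly in `N`. -/
lemma tendsto_integral_fderiv_mul_op {i : Fin d} {L : NNReal} {f : ℕ → Space d → ℝ}
    {g J : Space d → ℝ} (hf : ∀ N, LipschitzOnWith L (f N) S.Ω) (hg : LipschitzOnWith L g S.Ω)
    (hfg : Tendsto (fun N => ∫ x in S.Ω, |f N x - g x|) atTop (𝓝 0)) (hJ : IntegrableOn J S.Ω) :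
    Tendsto (fun N => ∫ x in S.Ω, fderiv ℝ (f N) x (EuclideanSpace.single i 1) *
      S.op N (some i) J x) atTop
      (𝓝 (∫ x in S.Ω, fderiv ℝ g x (EuclideanSpace.single i 1) * J x)) := by
  set e : Space d := EuclideanSpace.single i 1 with he
  have hfi : ∀ N, IntegrableOn (f N) S.Ω := fun N =>
    (hf N).continuousOn.integrableOn_compact S.isCompact_Ω
  have hgi : IntegrableOn g S.Ω := hg.continuousOn.integrableOn_compact S.isCompact_Ω
  have hb : ∀ h : Space d → ℝ, LipschitzOnWith L h S.Ω → ∀ x ∈ interior S.Ω,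
      |fderiv ℝ h x e| ≤ L := fun h hh x hx => abs_fderiv_single_le hh hx i
  have hmi : ∀ h : Space d → ℝ, LipschitzOnWith L h S.Ω → ∀ K : Space d → ℝ,
      IntegrableOn K S.Ω → IntegrableOn (fun x => fderiv ℝ h x e * K x) S.Ω := fun h hh K hK =>
    Integrable.bdd_mul hK (measurable_fderiv_single h i).aestronglyMeasurable (c := L)
      (S.ae_mem_interior_Ω.mono fun x hx => hb h hh x hx)
  have hest : ∀ h : Space d → ℝ, LipschitzOnWith L h S.Ω → ∀ K : Space d → ℝ,
      IntegrableOn K S.Ω → |∫ x in S.Ω, fderiv ℝ h x e * K x| ≤ L * ∫ x in S.Ω, |K x| := by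
    intro h hh K hK
    rw [← integral_const_mul]
    refine norm_integral_le_of_norm_le (f := fun x => fderiv ℝ h x e * K x) (hK.abs.const_mul _) ?_
    filter_upwards [S.ae_mem_interior_Ω] with x hx
    rw [norm_mul]
    exact mul_le_mul_of_nonneg_right (hb h hh x hx) (abs_nonneg _)
  -- testing with a mollification of `J`
  have key : ∀ M, Tendsto (fun N => ∫ x in S.Ω, fderiv ℝ (f N) x e * S.op M (some i) J x) atTop
      (𝓝 (∫ x in S.Ω, fderiv ℝ g x e * S.op M (some i) J x)) := by
    intro M
    obtain ⟨n, A, B, hA, hB, hk⟩ := S.isSeparated_kernel M none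
    have hrep : ∀ h : Space d → ℝ, LipschitzOnWith L h S.Ω →
        ∫ x in S.Ω, fderiv ℝ h x e * S.op M (some i) J x =
          ∑ l, (∫ y in S.Ω, B l y * h y) * ∫ x in S.Ω, fderiv ℝ (A l) x e * J x := by
      intro h hh
      have hhi : IntegrableOn h S.Ω := hh.continuousOn.integrableOn_compact S.isCompact_Ω
      have hdi : IntegrableOn (fun x => fderiv ℝ h x e) S.Ω := integrableOn_fderiv_single hh i
      rw [integral_mul_op_of_ae hJ hdi (hb h hh)]
      have h1 : S.op M none h = fun x => ∑ l, A l x * ∫ y in S.Ω, B l y * h y := by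
        ext x
        simp only [op, hk, Finset.sum_mul, mul_assoc]
        rw [integral_finsetSum _ fun l _ =>
          (integrableOn_mul_of_continuous (hB l).continuous hhi).const_mul _]
        simp only [integral_const_mul]
      have h2 : ∀ x, S.op M (some i) (fun x => fderiv ℝ h x e) x =
          ∑ l, (∫ y in S.Ω, B l y * h y) * fderiv ℝ (A l) x e := by
        intro x
        rw [← (hasWeakDeriv_of_lipschitzOnWith hh i).fderiv_op hhi hdi M x, h1,
          (HasFDerivAt.fun_sum fun l _ =>
            (((hA l).differentiable (by simp)) x).hasFDerivAt.mul_const _).fderiv]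
        simp [he]
      simp only [h2, Finset.sum_mul, mul_assoc]
      rw [integral_finsetSum _ fun l _ => (integrableOn_mul_of_continuous
        (continuous_fderiv_single (hA l) i) hJ).const_mul _]
      simp only [integral_const_mul]
      rfl
    rw [hrep g hg]
    simp only [fun N => hrep (f N) (hf N)]
    refine tendsto_finsetSum _ fun l _ => Tendsto.mul_const _ ?_
    obtain ⟨C, hC⟩ := S.isCompact_Ω.exists_bound_of_continuousOn (hB l).continuous.continuousOn
    rw [tendsto_iff_norm_sub_tendsto_zero]
    have h3 := hfg.const_mul C
    rw [mul_zero] at h3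
    refine squeeze_zero (fun N => norm_nonneg _) (fun N => ?_) h3
    rw [← integral_sub (integrableOn_mul_of_continuous (hB l).continuous (hfi N))
      (integrableOn_mul_of_continuous (hB l).continuous hgi), ← integral_const_mul]
    refine norm_integral_le_of_norm_le (((hfi N).sub hgi).abs.const_mul C) ?_
    filter_upwards [ae_restrict_mem S.measurableSet_Ω] with x hx
    rw [← mul_sub, norm_mul]
    exact mul_le_mul_of_nonneg_right (hC x hx) (norm_nonneg _)
  rw [Metric.tendsto_atTop]
  intro ε hε
  have hJt := S.tendsto_integral_abs_op_sub (some i) hJ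
  -- The three replacements of the flux, each costing at most `ε / 8`, leave room for the `ε / 4`
  -- from the fixed regularization.
  have hη : 0 < ε / (8 * ((L:ℝ) + 1)) := by positivity
  rw [Metric.tendsto_atTop] at hJt
  obtain ⟨M, hM⟩ := hJt _ hη
  obtain ⟨N₀, hN₀⟩ := (Metric.tendsto_atTop.1 (key M)) (ε / 4) (by positivity)
  refine ⟨max M N₀, fun N hN => ?_⟩
  have hMM := hM M le_rfl
  have hMN := hM N ((le_max_left _ _).trans hN)
  have h4 := hN₀ N ((le_max_right _ _).trans hN)
  rw [Real.dist_eq, sub_zero, abs_of_nonneg (integral_nonneg fun x => abs_nonneg _)] at hMM hMN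
  rw [Real.dist_eq] at h4 ⊢
  have hop : ∀ N, IntegrableOn (S.op N (some i) J) S.Ω := fun N => integrableOn_op hJ
  have e1 : ∀ h : Space d → ℝ, LipschitzOnWith L h S.Ω → ∀ N,
      |(∫ x in S.Ω, fderiv ℝ h x e * S.op N (some i) J x) - ∫ x in S.Ω, fderiv ℝ h x e * J x| ≤
        L * ∫ x in S.Ω, |S.op N (some i) J x - J x| := fun h hh N => by
    rw [← integral_sub (hmi h hh _ (hop N)) (hmi h hh _ hJ)]
    simp only [← mul_sub]
    exact hest h hh _ ((hop N).sub hJ)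
  have a1 := e1 (f N) (hf N) N
  have a2 := e1 (f N) (hf N) M
  have a3 := e1 g hg M
  have hL : (0:ℝ) ≤ L := L.2
  have hLη : (L:ℝ) * (ε / (8 * ((L:ℝ) + 1))) ≤ ε / 8 := by
    rw [mul_div_assoc', div_le_div_iff₀ (by positivity) (by positivity)]
    nlinarith
  have b1 := a1.trans ((mul_le_mul_of_nonneg_left hMN.le hL).trans hLη)
  have b2 := a2.trans ((mul_le_mul_of_nonneg_left hMM.le hL).trans hLη)
  have b3 := a3.trans ((mul_le_mul_of_nonneg_left hMM.le hL).trans hLη)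
  rw [abs_lt] at h4 ⊢
  rw [abs_le] at b1 b2 b3
  constructor <;> linarith [h4.1, h4.2, b1.1, b1.2, b2.1, b2.2, b3.1, b3.2]

lemma abs_integral_fderiv_mul_op_le {i : Fin d} {L : NNReal} {f J : Space d → ℝ}
    (hf : LipschitzOnWith L f S.Ω) (hJ : IntegrableOn J S.Ω) (N : ℕ) :
    |∫ x in S.Ω, fderiv ℝ f x (EuclideanSpace.single i 1) * S.op N (some i) J x| ≤
      L * ∫ x in S.Ω, |J x| := by
  refine le_trans ?_ (mul_le_mul_of_nonneg_left (integral_abs_op_le (N := N) (o := some i) hJ) L.2)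
  rw [← integral_const_mul]
  refine norm_integral_le_of_norm_le
    (f := fun x => fderiv ℝ f x (EuclideanSpace.single i 1) * S.op N (some i) J x)
    ((integrableOn_op hJ).abs.const_mul _) ?_
  filter_upwards [S.ae_mem_interior_Ω] with x hx
  rw [norm_mul]
  exact mul_le_mul_of_nonneg_right (abs_fderiv_single_le hf hx i) (abs_nonneg _)

/-! ### The jump part of the energy balance -/

section Jump

variable {r c p q : Space d → ℝ} {δ K : ℝ}
  (hr : IntegrableOn r S.Ω) (hc : IntegrableOn c S.Ω) (hp : IntegrableOn p S.Ω)
  (hq : IntegrableOn q S.Ω) (hp0 : ∀ᵐ x ∂volume.restrict S.Ω, 0 ≤ p x)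
  (hq0 : ∀ᵐ x ∂volume.restrict S.Ω, 0 ≤ q x) (hK : 0 ≤ K)
  (hrc : ∀ᵐ x ∂volume.restrict S.Ω, ∀ ξ, |r x * ξ| ≤
    c x + K * Real.sqrt (p x * q x) * (4 * (Real.cosh (ξ / 2) - 1))) (hδ : 0 < δ)

/-- Adding `δ` also under the root makes the exact identity available, and `(√q - √p)² ≤ p + q`. -/
lemma sqrt_mul_cosh_log_add_le {p q δ : ℝ} (hp : 0 ≤ p) (hq : 0 ≤ q) (hδ : 0 < δ) :
    Real.sqrt (p * q) * (4 * (Real.cosh ((Real.log (q + δ) - Real.log (p + δ)) / 2) - 1)) ≤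
      2 * (p + q + 2 * δ) := by
  have hp' : 0 < p + δ := by linarith
  have hq' : 0 < q + δ := by linarith
  have h1 := sqrt_mul_cosh_log_sub hp' hq'
  have h2 : Real.sqrt (p * q) ≤ Real.sqrt ((p + δ) * (q + δ)) :=
    Real.sqrt_le_sqrt (by nlinarith)
  refine (mul_le_mul_of_nonneg_right h2 (cosh_sub_one_nonneg _)).trans ?_
  rw [h1]
  nlinarith [Real.sq_sqrt hp'.le, Real.sq_sqrt hq'.le, Real.sqrt_nonneg (p + δ),
    Real.sqrt_nonneg (q + δ), mul_nonneg (Real.sqrt_nonneg (p + δ)) (Real.sqrt_nonneg (q + δ))]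

include hK hδ in
-- The duality bound is evaluated at the difference of the shifted logarithms.
lemma abs_log_sub_log_mul_le {r c p q : ℝ} (hp : 0 ≤ p) (hq : 0 ≤ q)
    (h : ∀ ξ, |r * ξ| ≤ c + K * Real.sqrt (p * q) * (4 * (Real.cosh (ξ / 2) - 1))) :
    |(Real.log (q + δ) - Real.log (p + δ)) * r| ≤ c + 2 * K * (p + q + 2 * δ) := by
  have h1 := h (Real.log (q + δ) - Real.log (p + δ))
  have h2 := mul_le_mul_of_nonneg_left (sqrt_mul_cosh_log_add_le hp hq hδ) hK
  rw [mul_comm] at h1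
  rw [mul_assoc K] at h1
  linarith

include hr hc hp hq hp0 hq0 hK hrc hδ

/-- For each fixed `ξ` the hypothesis can be averaged by the positive kernel, and Cauchy-Schwarz
bounds the average of `√(p q)` by the geometric mean of the averages. The duality bound thus holds
for the regularized functions, where `ξ` may depend on the point. -/
lemma abs_log_op_sub_log_op_mul_op_le (N : ℕ) (x : Space d) :
    |(Real.log (S.op N none q x + δ) - Real.log (S.op N none p x + δ)) * S.op N none r x| ≤
      S.op N none c x + 2 * K * (S.op N none p x + S.op N none q x + 2 * δ) := by
  set s : Space d → ℝ := fun x => Real.sqrt (p x * q x) with hs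
  have hsi : IntegrableOn s S.Ω := by
    refine (hp.add hq).mono' (hp.aestronglyMeasurable.aemeasurable.mul
      hq.aestronglyMeasurable.aemeasurable).sqrt.aestronglyMeasurable ?_
    filter_upwards [hp0, hq0] with y h1 h2
    rw [Real.norm_of_nonneg (Real.sqrt_nonneg _)]
    refine Real.sqrt_le_iff.2 ⟨add_nonneg h1 h2, ?_⟩
    simp only [Pi.add_apply]
    nlinarith [mul_nonneg h1 h2]
  refine abs_log_sub_log_mul_le hK hδ (op_none_nonneg hp0 x) (op_none_nonneg hq0 x) fun ξ => ?_
  have h1 : |S.op N none r x * ξ| ≤ S.op N none (fun y => |r y * ξ|) x := by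
    have := abs_op_le (o := none) (N := N) (hr.mul_const ξ) x
    have e : S.op N none (fun y => r y * ξ) x = S.op N none r x * ξ := by
      simp only [mul_comm _ ξ]
      rw [op_const_mul]
    rwa [e] at this
  have h2 : S.op N none (fun y => |r y * ξ|) x ≤ S.op N none (fun y => c y +
      K * (4 * (Real.cosh (ξ / 2) - 1)) * s y) x := by
    have hadd : IntegrableOn (fun y => c y + K * (4 * (Real.cosh (ξ / 2) - 1)) * s y) S.Ω :=
      hc.add (hsi.const_mul _)
    refine op_none_mono (hr.mul_const ξ).abs hadd ?_ x
    filter_upwards [hrc] with y hy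
    refine (hy ξ).trans (le_of_eq ?_)
    rw [hs]
    ring
  rw [op_add hc (hsi.const_mul _), op_const_mul] at h2
  have h3 : S.op N none s x ≤ Real.sqrt (S.op N none p x * S.op N none q x) := by
    refine Real.le_sqrt_of_sq_le (op_sq_le hsi hp hq hp0 hq0 ?_ x)
    filter_upwards [hp0, hq0] with y h1 h2
    rw [hs]
    simp only
    rw [Real.sq_sqrt (mul_nonneg h1 h2)]
  have h4 := mul_le_mul_of_nonneg_left h3 (mul_nonneg hK (cosh_sub_one_nonneg ξ))
  nlinarith

lemma abs_integral_log_op_mul_op_le (N : ℕ) :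
    |∫ x in S.Ω, (Real.log (S.op N none q x + δ) - Real.log (S.op N none p x + δ)) *
      S.op N none r x| ≤ (∫ x in S.Ω, c x) +
        2 * K * ((∫ x in S.Ω, p x) + (∫ x in S.Ω, q x) + 2 * δ * S.volΩ) := by
  have i1 := integrableOn_op (N := N) (o := none) hc
  have i2 := integrableOn_op (N := N) (o := none) hp
  have i3 := integrableOn_op (N := N) (o := none) hq
  have i4 : IntegrableOn (fun _ : Space d => 2 * δ) S.Ω :=
    S.integrableOn_of_continuous continuous_const
  have e : (∫ x in S.Ω, c x) + 2 * K * ((∫ x in S.Ω, p x) + (∫ x in S.Ω, q x) +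
      2 * δ * S.volΩ) = ∫ x in S.Ω, (S.op N none c x + 2 * K *
        (S.op N none p x + S.op N none q x + 2 * δ)) := by
    have i5 : IntegrableOn (fun x => S.op N none p x + S.op N none q x) S.Ω := i2.add i3
    have i6 : IntegrableOn (fun x => S.op N none p x + S.op N none q x + 2 * δ) S.Ω := i5.add i4
    rw [integral_add i1 (i6.const_mul _), integral_const_mul,
      integral_add i5 i4, integral_add i2 i3, integral_op_none hc, integral_op_none hp,
      integral_op_none hq, setIntegral_const, smul_eq_mul]
    change _ = _ + 2 * K * (_ + S.volΩ * (2 * δ))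
    ring
  rw [e]
  exact norm_integral_le_of_norm_le (f := fun x => (Real.log (S.op N none q x + δ) -
    Real.log (S.op N none p x + δ)) * S.op N none r x) (i1.add (((i2.add i3).add i4).const_mul _))
    (Eventually.of_forall (abs_log_op_sub_log_op_mul_op_le hr hc hp hq hp0 hq0 hK hrc hδ N))

lemma tendsto_integral_log_op_mul_op :
    Tendsto (fun N => ∫ x in S.Ω, (Real.log (S.op N none q x + δ) -
      Real.log (S.op N none p x + δ)) * S.op N none r x) atTop
      (𝓝 (∫ x in S.Ω, (Real.log (q x + δ) - Real.log (p x + δ)) * r x)) := by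
  refine tendsto_integral_of_op (ι := Fin 4) ![none, none, none, none]
    (h := ![r, c, p, q]) (g := fun _ => 4 * K * δ) (C := 1 + 2 * K) ?_ (by positivity) (fun N => ?_)
    (S.integrableOn_of_continuous continuous_const) (fun N => ?_) ?_
  · intro k
    fin_cases k
    exacts [hr, hc, hp, hq]
  · refine Continuous.aestronglyMeasurable ?_
    exact ((contDiff_log_op_add hq hq0 hδ N).continuous.sub
      (contDiff_log_op_add hp hp0 hδ N).continuous).mul (continuous_op hr)
  · refine Eventually.of_forall fun x => ?_
    refine (abs_log_op_sub_log_op_mul_op_le hr hc hp hq hp0 hq0 hK hrc hδ N x).trans ?_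
    rw [Fin.sum_univ_four]
    simp only [Matrix.cons_val]
    have h1 := le_abs_self (S.op N none c x)
    have h2 := le_abs_self (S.op N none p x)
    have h3 := le_abs_self (S.op N none q x)
    have h4 := abs_nonneg (S.op N none c x)
    have h5 := abs_nonneg (S.op N none p x)
    have h6 := abs_nonneg (S.op N none q x)
    have h7 := abs_nonneg (S.op N none r x)
    nlinarith [mul_nonneg hK h4, mul_nonneg hK h7, mul_le_mul_of_nonneg_left h2 hK,
      mul_le_mul_of_nonneg_left h3 hK]
  · filter_upwards [hp0, hq0] with x hpx hqx ns _ hns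
    have h0 := hns 0
    have h2 := hns 2
    have h3 := hns 3
    simp only [Matrix.cons_val] at h0 h2 h3
    exact (((h3.add_const δ).log (add_pos_of_nonneg_of_pos hqx hδ).ne').sub
      ((h2.add_const δ).log (add_pos_of_nonneg_of_pos hpx hδ).ne')).mul h0

omit hδ in
/-- Removal of the regularization in the jump part. -/
lemma tendsto_integral_log_add_mul {δ : ℕ → ℝ} (hδ : ∀ n, 0 < δ n) (hδ1 : ∀ n, δ n ≤ 1)
    (hδ0 : Tendsto δ atTop (𝓝 0)) (hr0 : ∀ᵐ x ∂volume.restrict S.Ω, p x * q x = 0 → r x = 0) :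
    Tendsto (fun n => ∫ x in S.Ω, (Real.log (q x + δ n) - Real.log (p x + δ n)) * r x) atTop
      (𝓝 (∫ x in S.Ω, (Real.log (q x) - Real.log (p x)) * r x)) := by
  have i4 : IntegrableOn (fun _ : Space d => (2:ℝ)) S.Ω :=
    S.integrableOn_of_continuous continuous_const
  refine tendsto_integral_of_dominated_convergence (fun x => c x + 2 * K * (p x + q x + 2))
    (fun n => ?_) (hc.add (((hp.add hq).add i4).const_mul _)) (fun n => ?_) ?_
  · exact (((hq.aestronglyMeasurable.aemeasurable.add_const (δ n)).log.sub
      (hp.aestronglyMeasurable.aemeasurable.add_const (δ n)).log).mul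
      hr.aestronglyMeasurable.aemeasurable).aestronglyMeasurable
  · filter_upwards [hp0, hq0, hrc] with x h1 h2 h3
    refine (abs_log_sub_log_mul_le hK (hδ n) h1 h2 h3).trans ?_
    nlinarith [mul_le_mul_of_nonneg_left (hδ1 n) hK]
  · filter_upwards [hr0] with x hx
    by_cases h : p x * q x = 0
    · simp [hx h]
    · have h1 : Tendsto (fun n => p x + δ n) atTop (𝓝 (p x)) := by
        simpa using hδ0.const_add (p x)
      have h2 : Tendsto (fun n => q x + δ n) atTop (𝓝 (q x)) := by
        simpa using hδ0.const_add (q x)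
      exact ((h2.log (right_ne_zero_of_mul h)).sub (h1.log (left_ne_zero_of_mul h))).mul_const _

end Jump

end Setting


lemma measurable_perspC : Measurable fun p : ℝ × ℝ => perspC p.1 p.2 := by
  unfold perspC coshC
  refine Measurable.ite (measurableSet_lt measurable_const measurable_snd) (by fun_prop) ?_
  exact Measurable.ite (measurableSet_eq_fun measurable_fst measurable_const) measurable_const
    measurable_const

namespace Setting

variable {d : ℕ} {S : Setting d}

/-! ### Finite dissipation rate -/

lemma IsWeakGradient.ae_eq {f : Space d → ℝ} {g g' : Space d → Space d}
    (h : IsWeakGradient S.Ω f g) (h' : IsWeakGradient S.Ω f g') :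
    ∀ᵐ x ∂volume.restrict S.Ω, g x = g' x := by
  rw [← S.restrict_interior_Ω]
  have key : ∀ i, ∀ᵐ x, x ∈ interior S.Ω → g x i - g' x i = 0 := by
    intro i
    have hl : ∀ g : Space d → Space d, LocallyIntegrableOn g (interior S.Ω) →
        LocallyIntegrableOn (fun x => g x i) (interior S.Ω) := fun g hg x hx => by
      obtain ⟨s, hs, hs'⟩ := hg x hx
      exact ⟨s, hs, (EuclideanSpace.proj i : Space d →L[ℝ] ℝ).integrable_comp hs'⟩
    refine isOpen_interior.ae_eq_zero_of_integral_contDiff_smul_eq_zero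
      ((hl g h.2.1).sub (hl g' h'.2.1)) fun φ hφ hφc hφs => ?_
    have h1 := h.2.2 φ hφ hφc hφs i
    have h2 := h'.2.2 φ hφ hφc hφs i
    rw [h1, neg_inj] at h2
    have hz : ∀ x, x ∉ interior S.Ω → φ x = 0 := fun x hx =>
      image_eq_zero_of_notMem_tsupport fun hx' => hx (hφs hx')
    have hint : ∀ g : Space d → Space d, LocallyIntegrableOn g (interior S.Ω) →
        IntegrableOn (fun x => g x i * φ x) (interior S.Ω) := fun g hg => by
      have h3 : IntegrableOn (fun x => g x i) (tsupport φ) :=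
        (hl g hg).integrableOn_compact_subset hφs hφc
      have h4 : IntegrableOn (fun x => g x i * φ x) (tsupport φ) :=
        h3.mul_continuousOn hφ.continuous.continuousOn hφc
      have h5 : Function.support (fun x => g x i * φ x) ⊆ tsupport φ := fun x hx =>
        subset_tsupport _ (right_ne_zero_of_mul hx)
      exact ((integrableOn_iff_integrable_of_support_subset h5).1 h4).integrableOn
    have h5 : ∫ x, φ x • (g x i - g' x i) = ∫ x in interior S.Ω, φ x • (g x i - g' x i) := by
      refine (setIntegral_eq_integral_of_forall_compl_eq_zero fun x hx => ?_).symm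
      rw [hz x hx, zero_smul]
    rw [h5]
    have h6 : ∀ x, φ x • (g x i - g' x i) = g x i * φ x - g' x i * φ x := fun x => by
      rw [smul_eq_mul]; ring
    simp only [h6]
    rw [integral_sub (hint g h.2.1) (hint g' h'.2.1), h2, sub_self]
  rw [ae_restrict_iff' isOpen_interior.measurableSet]
  filter_upwards [ae_all_iff.2 key] with x hx hx'
  ext i
  exact sub_eq_zero.1 (hx i hx')

lemma fisher_eq (F : S.Tilt) (ρ : Measure (Space d × ℝ)) {y : ℝ} {g : Space d → Space d}
    (h : IsWeakGradient S.Ω (fun x => Real.sqrt (S.tiltedDensity F ρ x y)) g) :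
    S.fisher F ρ y = ∫⁻ x in S.Ω, ENNReal.ofReal (Real.exp (-F.deriv ρ (x, y)) * ‖g x‖ ^ 2) := by
  refine le_antisymm (iInf₂_le g h) (le_iInf₂ fun g' hg' => le_of_eq (lintegral_congr_ae ?_))
  filter_upwards [IsWeakGradient.ae_eq h hg'] with x hx
  rw [hx]

/-- The square root of the tilted density. -/
noncomputable def sqrtDensity (S : Setting d) (F : S.Tilt) (ρ : Measure (Space d × ℝ)) (w : Bool)
    (x : Space d) : ℝ := Real.sqrt (S.tiltedDensity F ρ x (S.well w))

/-- The kinetic energy density of the spatial flux. -/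
noncomputable def fluxEnergy (S : Setting d) (ρ : Measure (Space d × ℝ))
    (jx : Fin d → SignedMeasure (Space d × ℝ)) (w : Bool) (i : Fin d) (x : Space d) : ℝ :=
  (jx i).rnDeriv ρ (x, S.well w) ^ 2 * S.density ρ w x

/-- The slope of the energy in the direction of the jumps. -/
noncomputable def jumpGap (S : Setting d) (F : S.Tilt) (ρ : Measure (Space d × ℝ))
    (x : Space d) : ℝ :=
  Real.exp (-F.deriv ρ (x, S.c)) * (S.sqrtDensity F ρ true x - S.sqrtDensity F ρ false x) ^ 2

lemma sqrtDensity_sq (F : S.Tilt) (ρ : Measure (Space d × ℝ)) (w : Bool) (x : Space d) :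
    S.sqrtDensity F ρ w x ^ 2 = S.density ρ w x * Real.exp (F.deriv ρ (x, S.well w)) :=
  Real.sq_sqrt (mul_nonneg ENNReal.toReal_nonneg (Real.exp_pos _).le)

lemma sqrtDensity_sq_mul_exp (F : S.Tilt) (ρ : Measure (Space d × ℝ)) (w : Bool) (x : Space d) :
    S.sqrtDensity F ρ w x ^ 2 * Real.exp (-F.deriv ρ (x, S.well w)) = S.density ρ w x := by
  rw [sqrtDensity_sq, mul_assoc, ← Real.exp_add, add_neg_cancel, Real.exp_zero, mul_one]

/-- The data of a state and a flux with finite dissipation rate. -/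
structure Regular (S : Setting d) (F : S.Tilt) (ρ : Measure (Space d × ℝ))
    (jx : Fin d → SignedMeasure (Space d × ℝ)) (jbar : SignedMeasure (Space d)) (R : ℝ) where
  /-- the weak derivatives of `√u^𝓕` -/
  g : Bool → Fin d → Space d → ℝ
  /-- the weak derivatives of `u` -/
  D : Bool → Fin d → Space d → ℝ
  /-- the dissipation of the jumps -/
  c : Space d → ℝ
  D_eq : ∀ w i, ∀ᵐ x ∂volume.restrict S.Ω, D w i x =
    2 * S.sqrtDensity F ρ w x * g w i x * Real.exp (-F.deriv ρ (x, S.well w)) -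
      S.density ρ w x *
        fderiv ℝ (fun x => F.deriv ρ (x, S.well w)) x (EuclideanSpace.single i 1)
  hasWeakDeriv : ∀ w i, S.HasWeakDeriv i (S.density ρ w) (D w i)
  integrable_D : ∀ w i, IntegrableOn (D w i) S.Ω
  integrable_g : ∀ w i, IntegrableOn
    (fun x => Real.exp (-F.deriv ρ (x, S.well w)) * g w i x ^ 2) S.Ω
  integrable_flux : ∀ w i, IntegrableOn (S.fluxEnergy ρ jx w i) S.Ω
  integrable_c : IntegrableOn c S.Ω
  c_nonneg : ∀ x, 0 ≤ c x
  integrable_jumpGap : IntegrableOn (S.jumpGap F ρ) S.Ω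
  abs_jump_mul_le : ∀ᵐ x ∂volume.restrict S.Ω, ∀ ξ, |S.jumpDensity jbar x * ξ| ≤
    c x + S.sigma F ρ x * (4 * (Real.cosh (ξ / 2) - 1))
  total : (∑ w, S.γ w * ∑ i, (1 / (2 * S.mΩ) * ∫ x in S.Ω, S.fluxEnergy ρ jx w i x)) +
    (∑ w, S.γ w * ∑ i, (2 * S.mΩ *
      ∫ x in S.Ω, Real.exp (-F.deriv ρ (x, S.well w)) * g w i x ^ 2)) +
    ((∫ x in S.Ω, c x) + 2 * (S.mΥ / S.volΩ) * ∫ x in S.Ω, S.jumpGap F ρ x) = R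

section

variable (F : S.Tilt) {ρ : Measure (Space d × ℝ)} (hp : S.IsNodeProb ρ) (hρ : ρ ≪ S.π₀)

lemma continuousOn_deriv_apply (hp : S.IsNodeProb ρ) {y : ℝ} (hy : y ∈ S.Υ) :
    ContinuousOn (fun x => F.deriv ρ (x, y)) S.Ω :=
  (F.continuousOn_deriv ρ hp).comp (Continuous.continuousOn (by fun_prop))
    fun _ hx => ⟨hx, hy⟩

include hp in
lemma aemeasurable_deriv_apply {y : ℝ} (hy : y ∈ S.Υ) :
    AEMeasurable (fun x => F.deriv ρ (x, y)) (volume.restrict S.Ω) :=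
  (continuousOn_deriv_apply F hp hy).aemeasurable S.measurableSet_Ω

include hp in
lemma aemeasurable_tiltedDensity (w : Bool) :
    AEMeasurable (fun x => S.tiltedDensity F ρ x (S.well w)) (volume.restrict S.Ω) :=
  (measurable_density ρ w).aemeasurable.mul (aemeasurable_deriv_apply F hp (S.well_mem_Υ w)).exp

include hp in
lemma aemeasurable_sqrtDensity (w : Bool) :
    AEMeasurable (S.sqrtDensity F ρ w) (volume.restrict S.Ω) :=
  (aemeasurable_tiltedDensity F hp w).sqrt

include hp in
lemma aemeasurable_sigma : AEMeasurable (S.sigma F ρ) (volume.restrict S.Ω) :=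
  ((aemeasurable_deriv_apply F hp S.c_mem_Υ).neg.exp.const_mul _).mul
    ((aemeasurable_tiltedDensity F hp false).mul (aemeasurable_tiltedDensity F hp true)).sqrt

include hp hρ in
lemma integral_eq_sum_density {f : Space d × ℝ → ℝ} (hf : Integrable f ρ) :
    ∫ z, f z ∂ρ = ∑ w, S.γ w * ∫ x in S.Ω, f (x, S.well w) * S.density ρ w x := by
  have := hp.1
  conv_lhs => rw [← stateMeasure_density hρ]
  exact integral_stateMeasure (isDensity_density hp hρ) fun w => integrableOn_mul_density hp hρ hf w

include hp hρ in
-- A finite rate makes every one of its terms finite; in particular `√u^𝓕` has a weak gradient. As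
-- `D𝓕` is bounded, `√u^𝓕` and this gradient are square integrable, and the product rule for `u =
-- (√u^𝓕)² e^{-D𝓕}` gives the weak derivatives of `u` itself.
lemma nonempty_regular {jx : Fin d → SignedMeasure (Space d × ℝ)}
    {jbar : SignedMeasure (Space d)} (h : S.dissipationRate F ρ jx jbar ≠ ⊤) :
    Nonempty (S.Regular F ρ jx jbar (S.dissipationRate F ρ jx jbar).toReal) := by
  have hprob := hp.1
  have hdens := isDensity_density hp hρ
  obtain ⟨L, hL⟩ := exists_lipschitzOnWith_deriv F
  obtain ⟨M, hM⟩ := F.bounded_deriv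
  rw [dissipationRate] at h ⊢
  obtain ⟨h12, h3⟩ := ENNReal.add_ne_top.1 h
  obtain ⟨h1, h2⟩ := ENNReal.add_ne_top.1 h12
  have hmΩ := S.mΩ_pos
  have hm2 : (0:ℝ) < 2 * S.mΩ := by positivity
  -- the flux
  have hωm : ∀ i, Measurable ((jx i).rnDeriv ρ) := fun i => SignedMeasure.measurable_rnDeriv _ _
  have hkm : Measurable fun z => 1 / (2 * S.mΩ) * ∑ i, ((jx i).rnDeriv ρ z) ^ 2 :=
    (Finset.measurable_sum _ fun i _ => (hωm i).pow_const 2).const_mul _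
  have hk0 : ∀ z, 0 ≤ 1 / (2 * S.mΩ) * ∑ i, ((jx i).rnDeriv ρ z) ^ 2 := fun z => by positivity
  have hki : Integrable (fun z => 1 / (2 * S.mΩ) * ∑ i, ((jx i).rnDeriv ρ z) ^ 2) ρ :=
    (lintegral_ofReal_ne_top_iff_integrable hkm.aestronglyMeasurable
      (Eventually.of_forall hk0)).1 h1
  have hωi : ∀ i, Integrable (fun z => ((jx i).rnDeriv ρ z) ^ 2) ρ := fun i => by
    refine (hki.const_mul (2 * S.mΩ)).mono' ((hωm i).pow_const 2).aestronglyMeasurable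
      (Eventually.of_forall fun z => ?_)
    rw [← mul_assoc, mul_one_div_cancel hm2.ne', one_mul, Real.norm_of_nonneg (sq_nonneg _)]
    exact Finset.single_le_sum (f := fun i => ((jx i).rnDeriv ρ z) ^ 2)
      (fun i _ => sq_nonneg _) (Finset.mem_univ i)
  have hW : ∀ w i, IntegrableOn (S.fluxEnergy ρ jx w i) S.Ω := fun w i =>
    integrableOn_mul_density hp hρ (hωi i) w
  have e1 : (∫⁻ z, ENNReal.ofReal (1 / (2 * S.mΩ) * ∑ i, ((jx i).rnDeriv ρ z) ^ 2) ∂ρ).toReal =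
      ∑ w, S.γ w * ∑ i, (1 / (2 * S.mΩ) * ∫ x in S.Ω, S.fluxEnergy ρ jx w i x) := by
    rw [← integral_eq_lintegral_of_nonneg_ae (Eventually.of_forall hk0) hkm.aestronglyMeasurable,
      integral_const_mul, integral_finsetSum _ fun i _ => hωi i]
    have : ∀ i, ∫ z, ((jx i).rnDeriv ρ z) ^ 2 ∂ρ =
        ∑ w, S.γ w * ∫ x in S.Ω, S.fluxEnergy ρ jx w i x := fun i =>
      integral_eq_sum_density hp hρ (hωi i)
    simp only [this, Finset.mul_sum]
    rw [Finset.sum_comm]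
    exact Finset.sum_congr rfl fun w _ => Finset.sum_congr rfl fun i _ => by ring
  -- the Fisher information
  have hγ0 : ∀ w, ENNReal.ofReal (S.γ w) ≠ 0 := fun w => by simpa using S.γ_pos w
  have hF : ∀ w, S.fisher F ρ (S.well w) ≠ ⊤ := by
    -- The convention `0 * ⊤ = 0` makes positivity of the weights and of the mobility essential
    -- here.
    have hmul : ∀ p q : ℝ≥0∞, p ≠ 0 → p * q ≠ ⊤ → q ≠ ⊤ := fun p q hp hpq hq =>
      hpq (by rw [hq, ENNReal.mul_top hp])
    have h4 := hmul _ _ (by simpa using hmΩ) h2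
    obtain ⟨h5, h6⟩ := ENNReal.add_ne_top.1 h4
    rintro (_ | _)
    · exact hmul _ _ (hγ0 false) h5
    · exact hmul _ _ (hγ0 true) h6
  have hFa : S.fisher F ρ S.a ≠ ⊤ := hF false
  have hFb : S.fisher F ρ S.b ≠ ⊤ := hF true
  -- Without a weak gradient the infimum would run over an empty set and be infinite.
  have hG : ∀ w, ∃ g, IsWeakGradient S.Ω (S.sqrtDensity F ρ w) g := fun w => by
    by_contra hne
    push Not at hne
    refine hF w (iInf_eq_top.2 fun g => iInf_eq_top.2 fun hg => absurd hg (hne g))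
  choose G hG using hG
  have hFG := fun w => fisher_eq F ρ (hG w)
  have hGm : ∀ w, AEStronglyMeasurable (G w) (volume.restrict S.Ω) := fun w => by
    have := (hG w).2.1.aestronglyMeasurable
    rwa [S.restrict_interior_Ω] at this
  have hfm : ∀ w, AEMeasurable (fun x => Real.exp (-F.deriv ρ (x, S.well w)))
      (volume.restrict S.Ω) := fun w => (aemeasurable_deriv_apply F hp (S.well_mem_Υ w)).neg.exp
  have hGi : ∀ w, IntegrableOn (fun x => Real.exp (-F.deriv ρ (x, S.well w)) * ‖G w x‖ ^ 2) S.Ω :=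
    fun w => by
      refine (lintegral_ofReal_ne_top_iff_integrable
        ((hfm w).mul ((hGm w).norm.aemeasurable.pow_const 2)).aestronglyMeasurable
        (Eventually.of_forall fun x => ?_)).1 ((hFG w) ▸ hF w)
      exact mul_nonneg (Real.exp_pos _).le (sq_nonneg _)
  have hgm : ∀ w i, AEMeasurable (fun x => G w x i) (volume.restrict S.Ω) := fun w i =>
    ((EuclideanSpace.proj i : Space d →L[ℝ] ℝ).continuous.comp_aestronglyMeasurable
      (hGm w)).aemeasurable
  have hnorm : ∀ w x, ‖G w x‖ ^ 2 = ∑ i, G w x i ^ 2 := fun w x => by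
    rw [EuclideanSpace.norm_sq_eq]
    simp
  have hgi : ∀ w i, IntegrableOn
      (fun x => Real.exp (-F.deriv ρ (x, S.well w)) * G w x i ^ 2) S.Ω := fun w i => by
    refine (hGi w).mono' ((hfm w).mul ((hgm w i).pow_const 2)).aestronglyMeasurable
      (Eventually.of_forall fun x => ?_)
    rw [Real.norm_of_nonneg (mul_nonneg (Real.exp_pos _).le (sq_nonneg _)), hnorm]
    exact mul_le_mul_of_nonneg_left (Finset.single_le_sum (f := fun i => G w x i ^ 2)
      (fun i _ => sq_nonneg _) (Finset.mem_univ i)) (Real.exp_pos _).le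
  have hFr : ∀ w, (S.fisher F ρ (S.well w)).toReal =
      ∑ i, ∫ x in S.Ω, Real.exp (-F.deriv ρ (x, S.well w)) * G w x i ^ 2 := fun w => by
    rw [hFG w, ← integral_eq_lintegral_of_nonneg_ae (Eventually.of_forall fun x =>
      mul_nonneg (Real.exp_pos _).le (sq_nonneg _)) (hGi w).aestronglyMeasurable,
      ← integral_finsetSum _ fun i _ => hgi w i]
    simp only [hnorm, Finset.mul_sum]
  have e2 : (ENNReal.ofReal (2 * S.mΩ) * (ENNReal.ofReal S.γa * S.fisher F ρ S.a +
      ENNReal.ofReal S.γb * S.fisher F ρ S.b)).toReal = ∑ w, S.γ w * ∑ i, (2 * S.mΩ *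
      ∫ x in S.Ω, Real.exp (-F.deriv ρ (x, S.well w)) * G w x i ^ 2) := by
    rw [ENNReal.toReal_mul, ENNReal.toReal_add
      (ENNReal.mul_ne_top ENNReal.ofReal_ne_top hFa)
      (ENNReal.mul_ne_top ENNReal.ofReal_ne_top hFb), ENNReal.toReal_mul, ENNReal.toReal_mul,
      ENNReal.toReal_ofReal hm2.le, ENNReal.toReal_ofReal S.γa_pos.le,
      ENNReal.toReal_ofReal S.γb_pos.le]
    have h5 := hFr false
    have h6 := hFr true
    change (S.fisher F ρ S.a).toReal = _ at h5
    change (S.fisher F ρ S.b).toReal = _ at h6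
    rw [h5, h6, Fintype.sum_bool]
    simp only [← Finset.mul_sum]
    change _ = S.γb * _ + S.γa * _
    ring
  -- the weak derivative of the density
  have hs2 : ∀ w, IntegrableOn (fun x => S.sqrtDensity F ρ w x ^ 2) S.Ω := fun w => by
    refine ((hdens.integrable w).mul_const (Real.exp M)).mono'
      ((aemeasurable_sqrtDensity F hp w).pow_const 2).aestronglyMeasurable ?_
    filter_upwards [ae_restrict_mem S.measurableSet_Ω] with x hx
    rw [Real.norm_of_nonneg (sq_nonneg _), sqrtDensity_sq]
    exact mul_le_mul_of_nonneg_left (Real.exp_le_exp.2 ((le_abs_self _).trans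
      (hM ρ hp _ (S.mem_nodes hx w)))) (density_nonneg ρ w x)
  have hconst : IntegrableOn (fun _ : Space d => (1:ℝ)) S.Ω :=
    S.integrableOn_of_continuous continuous_const
  have hof2 : ∀ f : Space d → ℝ, AEStronglyMeasurable f (volume.restrict S.Ω) →
      IntegrableOn (fun x => f x ^ 2) S.Ω → IntegrableOn f S.Ω := fun f hf hf2 => by
    refine (hconst.add hf2).mono' hf (Eventually.of_forall fun x => ?_)
    rw [Real.norm_eq_abs, abs_le]
    simp only [Pi.add_apply]
    constructor <;> nlinarith [sq_nonneg (f x - 1), sq_nonneg (f x + 1)]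
  have hs : ∀ w, IntegrableOn (S.sqrtDensity F ρ w) S.Ω := fun w =>
    hof2 _ (aemeasurable_sqrtDensity F hp w).aestronglyMeasurable (hs2 w)
  have hg2 : ∀ w i, IntegrableOn (fun x => G w x i ^ 2) S.Ω := fun w i => by
    refine ((hgi w i).const_mul (Real.exp M)).mono'
      ((hgm w i).pow_const 2).aestronglyMeasurable ?_
    filter_upwards [ae_restrict_mem S.measurableSet_Ω] with x hx
    rw [Real.norm_of_nonneg (sq_nonneg _), ← mul_assoc, ← Real.exp_add]
    refine le_mul_of_one_le_left (sq_nonneg _) (Real.one_le_exp ?_)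
    linarith [(le_abs_self _).trans (hM ρ hp _ (S.mem_nodes hx w))]
  have hg1 : ∀ w i, IntegrableOn (fun x => G w x i) S.Ω := fun w i =>
    hof2 _ (hgm w i).aestronglyMeasurable (hg2 w i)
  have hgw : ∀ w i, S.HasWeakDeriv i (S.sqrtDensity F ρ w) (fun x => G w x i) :=
    fun w i φ hφ hφc hφs => by
      have := (hG w).2.2 φ hφ hφc hφs i
      rwa [S.restrict_interior_Ω] at this
  set D : Bool → Fin d → Space d → ℝ := fun w i x =>
    2 * S.sqrtDensity F ρ w x * G w x i * Real.exp (-F.deriv ρ (x, S.well w)) -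
      S.density ρ w x *
        fderiv ℝ (fun x => F.deriv ρ (x, S.well w)) x (EuclideanSpace.single i 1) with hD
  have hDw : ∀ w i, S.HasWeakDeriv i (S.density ρ w) (D w i) := fun w i => by
    have := (hgw w i).sq_mul_exp_neg (hs w) (hg1 w i) (hs2 w) (hg2 w i) (hL ρ hp w)
    refine this.congr (Eventually.of_forall fun x => sqrtDensity_sq_mul_exp F ρ w x)
      (Eventually.of_forall fun x => ?_)
    simp only [hD]
    rw [sqrtDensity_sq_mul_exp]
  have hDi : ∀ w i, IntegrableOn (D w i) S.Ω := fun w i => by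
    refine Integrable.sub ?_ ?_
    · have h5 := (integrableOn_mul_of_sq (hs w) (hg1 w i) (hs2 w) (hg2 w i)).const_mul 2
      refine (Integrable.bdd_mul h5 (hfm w).aestronglyMeasurable (c := Real.exp M) ?_).congr
        (Eventually.of_forall fun x => by simp only; ring)
      filter_upwards [ae_restrict_mem S.measurableSet_Ω] with x hx
      rw [Real.norm_of_nonneg (Real.exp_pos _).le]
      exact Real.exp_le_exp.2 ((neg_le_abs _).trans (hM ρ hp _ (S.mem_nodes hx w)))
    · refine Integrable.mul_bdd (c := L) (hdens.integrable w)
        (measurable_fderiv_single _ i).aestronglyMeasurable ?_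
      filter_upwards [S.ae_mem_interior_Ω] with x hx
      exact abs_fderiv_single_le (hL ρ hp w) hx i
  -- the jumps
  have hcm : AEMeasurable (fun x => perspC (jbar.rnDeriv (volume.restrict S.Ω) x)
      (S.sigma F ρ x)) (volume.restrict S.Ω) :=
    measurable_perspC.comp_aemeasurable ((SignedMeasure.measurable_rnDeriv _ _).aemeasurable.prodMk
      (aemeasurable_sigma F hp))
  rw [lintegral_add_left' hcm] at h3
  obtain ⟨h5, h6⟩ := ENNReal.add_ne_top.1 h3
  have hv := S.volΩ_pos
  have hmΥ := S.mΥ_pos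
  have hjm : AEMeasurable (S.jumpGap F ρ) (volume.restrict S.Ω) :=
    (aemeasurable_deriv_apply F hp S.c_mem_Υ).neg.exp.mul
      (((aemeasurable_sqrtDensity F hp true).sub (aemeasurable_sqrtDensity F hp false)).pow_const 2)
  have hj0 : ∀ x, 0 ≤ 2 * (S.mΥ / S.volΩ) * S.jumpGap F ρ x := fun x =>
    mul_nonneg (by positivity) (mul_nonneg (Real.exp_pos _).le (sq_nonneg _))
  have h6' : ∫⁻ x in S.Ω, ENNReal.ofReal (2 * (S.mΥ / S.volΩ) * S.jumpGap F ρ x) ≠ ⊤ := by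
    refine ne_of_eq_of_ne (lintegral_congr fun x => ?_) h6
    congr 1
    exact (mul_assoc _ _ _).symm
  have hji : IntegrableOn (fun x => 2 * (S.mΥ / S.volΩ) * S.jumpGap F ρ x) S.Ω :=
    (lintegral_ofReal_ne_top_iff_integrable (hjm.const_mul _).aestronglyMeasurable
      (Eventually.of_forall hj0)).1 h6'
  have hji' : IntegrableOn (S.jumpGap F ρ) S.Ω := by
    refine (hji.const_mul (2 * (S.mΥ / S.volΩ))⁻¹).congr (Eventually.of_forall fun x => ?_)
    simp only
    rw [← mul_assoc, inv_mul_cancel₀ (by positivity), one_mul]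
  have hci := integrable_toReal_of_lintegral_ne_top hcm h5
  have htop := ae_lt_top' hcm h5
  refine ⟨⟨fun w i x => G w x i, D, fun x => (perspC (jbar.rnDeriv (volume.restrict S.Ω) x)
    (S.sigma F ρ x)).toReal, fun w i => Eventually.of_forall fun x => rfl, hDw, hDi, hgi, hW, hci,
    fun x => ENNReal.toReal_nonneg, hji', ?_, ?_⟩⟩
  · filter_upwards [htop] with x hx ξ
    exact abs_mul_le_perspC_add (mul_nonneg (mul_nonneg (by positivity) (Real.exp_pos _).le)
      (Real.sqrt_nonneg _)) hx.ne ξ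
  · rw [lintegral_add_left' hcm, ENNReal.toReal_add h12 (ENNReal.add_ne_top.2 ⟨h5, h6⟩),
      ENNReal.toReal_add h1 h2, e1, e2, ENNReal.toReal_add h5 h6]
    congr 2
    · exact integral_toReal hcm htop
    · rw [← integral_const_mul, integral_eq_lintegral_of_nonneg_ae (Eventually.of_forall hj0)
        (hjm.const_mul _).aestronglyMeasurable]
      congr 1
      refine lintegral_congr fun x => ?_
      congr 1
      exact (mul_assoc _ _ _).symm

end

end Setting


namespace Setting

variable {d : ℕ} {S : Setting d}

/-! ### The energy balance at a fixed time -/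

lemma IsDensity.γ_mul_integral_le {u : Bool → Space d → ℝ} (hu : S.IsDensity u) (w : Bool) :
    S.γ w * ∫ x in S.Ω, u w x ≤ 1 := by
  rw [← hu.total]
  exact Finset.single_le_sum (f := fun w => S.γ w * ∫ x in S.Ω, u w x) (fun v _ =>
    mul_nonneg (S.γ_pos v).le (integral_nonneg_of_ae (hu.nonneg v))) (Finset.mem_univ w)

section

variable {F : S.Tilt} {ρ : Measure (Space d × ℝ)} {jx : Fin d → SignedMeasure (Space d × ℝ)}
  {jbar : SignedMeasure (Space d)} (hp : S.IsNodeProb ρ) (hρ : ρ ≪ S.π₀)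

/-- The tilt evaluated along the mollified state. -/
noncomputable def mollDeriv (S : Setting d) (F : S.Tilt) (N : ℕ) (ρ : Measure (Space d × ℝ))
    (w : Bool) (x : Space d) : ℝ :=
  F.deriv (S.stateMeasure (S.mollify N ρ)) (x, S.well w)

lemma fluxDensity_sq (w : Bool) (i : Fin d) (x : Space d) :
    S.fluxDensity ρ jx w i x ^ 2 = S.density ρ w x * S.fluxEnergy ρ jx w i x := by
  rw [fluxDensity, fluxEnergy]
  ring

lemma fluxEnergy_nonneg (w : Bool) (i : Fin d) (x : Space d) : 0 ≤ S.fluxEnergy ρ jx w i x :=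
  mul_nonneg (sq_nonneg _) (density_nonneg ρ w x)

include hp hρ

lemma isNodeProb_stateMeasure_mollify (N : ℕ) : S.IsNodeProb (S.stateMeasure (S.mollify N ρ)) :=
  (isDensity_mollify hp (hρ.ae_le inWells_π₀) N).isNodeProb

lemma integrableOn_density (w : Bool) : IntegrableOn (S.density ρ w) S.Ω :=
  (isDensity_density hp hρ).integrable w

lemma tendsto_l1Dist_mollify :
    Tendsto (fun N => S.l1Dist (S.density ρ) (S.mollify N ρ)) atTop (𝓝 0) := by
  have : ∀ w ∈ Finset.univ, Tendsto (fun N => S.γ w *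
      ∫ x in S.Ω, |S.density ρ w x - S.mollify N ρ w x|) atTop (𝓝 0) := fun w _ => by
    have h := (S.tendsto_integral_abs_op_sub none (integrableOn_density hp hρ w)).const_mul (S.γ w)
    rw [mul_zero] at h
    refine h.congr fun N => ?_
    rw [mollify_eq_op hp hρ]
    simp only [abs_sub_comm]
  simpa [l1Dist] using tendsto_finsetSum Finset.univ this

lemma eventually_abs_mollDeriv_sub_le (F : S.Tilt) {ε : ℝ} (hε : 0 < ε) :
    ∀ᶠ N in atTop, ∀ w, ∀ x ∈ S.Ω, |S.mollDeriv F N ρ w x - F.deriv ρ (x, S.well w)| ≤ ε := by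
  have := hp.1
  obtain ⟨η, hη, h⟩ := F.continuous_deriv ρ hp ε hε
  filter_upwards [(tendsto_l1Dist_mollify hp hρ).eventually_lt_const hη] with N hN w x hx
  refine h _ (isNodeProb_stateMeasure_mollify hp hρ N) ?_ _ (S.mem_nodes hx w)
  have h1 := tvDist_stateMeasure_le (isDensity_density hp hρ)
    (isDensity_mollify hp (hρ.ae_le inWells_π₀) N)
  rw [stateMeasure_density hρ] at h1
  exact h1.trans_lt hN

lemma tendsto_integral_abs_mollDeriv_sub (F : S.Tilt) (w : Bool) :
    Tendsto (fun N => ∫ x in S.Ω, |S.mollDeriv F N ρ w x - F.deriv ρ (x, S.well w)|)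
      atTop (𝓝 0) := by
  have hv := S.volΩ_pos
  rw [Metric.tendsto_atTop']
  intro ε hε
  obtain ⟨n, hn⟩ := eventually_atTop.1 (eventually_abs_mollDeriv_sub_le hp hρ F
    (ε := ε / (2 * S.volΩ)) (by positivity))
  refine ⟨n, fun N hN => ?_⟩
  rw [Real.dist_eq, sub_zero]
  have h := norm_setIntegral_le_of_norm_le_const (f := fun x =>
    |S.mollDeriv F N ρ w x - F.deriv ρ (x, S.well w)|) (C := ε / (2 * S.volΩ))
    (S.isCompact_Ω.measure_lt_top (μ := volume)) fun x hx => by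
      rw [Real.norm_of_nonneg (abs_nonneg _)]
      exact hn N hN.le w x hx
  refine h.trans_lt ?_
  change ε / (2 * S.volΩ) * S.volΩ < ε
  rw [div_mul_eq_mul_div, div_lt_iff₀ (by positivity)]
  nlinarith

namespace Regular

variable {R : ℝ} (h : S.Regular F ρ jx jbar R) {L : NNReal} {M : ℝ}
  (hL : ∀ ρ, S.IsNodeProb ρ → ∀ w, LipschitzOnWith L (fun x => F.deriv ρ (x, S.well w)) S.Ω)
  (hM : ∀ ρ, S.IsNodeProb ρ → ∀ z ∈ S.nodes, |F.deriv ρ z| ≤ M)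

/-- A bound for the Fisher information density of the state. -/
noncomputable def fisherBound (h : S.Regular F ρ jx jbar R) (L : NNReal) (w : Bool) (i : Fin d)
    (x : Space d) : ℝ :=
  8 * (Real.exp (-F.deriv ρ (x, S.well w)) * h.g w i x ^ 2) + 2 * L ^ 2 * S.density ρ w x

omit hp hρ in
lemma fisherBound_nonneg (w : Bool) (i : Fin d) (x : Space d) : 0 ≤ h.fisherBound L w i x := by
  have := density_nonneg (S := S) ρ w x
  unfold fisherBound
  positivity

lemma integrable_fisherBound (w : Bool) (i : Fin d) : IntegrableOn (h.fisherBound L w i) S.Ω :=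
  ((h.integrable_g w i).const_mul 8).add ((integrableOn_density hp hρ w).const_mul _)

include hL in
omit hρ in
-- The square of the difference is at most twice the sum of the squares, and `s² e^{-D𝓕} = u`
-- extracts a factor `u` from the first one; `8 = 2 · 2²`, and `|∂ᵢ D𝓕| ≤ L` yields `2 L²`.
lemma D_sq_le (w : Bool) (i : Fin d) : ∀ᵐ x ∂volume.restrict S.Ω,
    h.D w i x ^ 2 ≤ S.density ρ w x * h.fisherBound L w i x := by
  filter_upwards [h.D_eq w i, S.ae_mem_interior_Ω] with x hx hx'
  have h1 := abs_fderiv_single_le (hL ρ hp w) hx' i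
  have h2 := sqrtDensity_sq_mul_exp F ρ w x
  rw [hx, fisherBound]
  set s := S.sqrtDensity F ρ w x
  set u := S.density ρ w x
  set e := Real.exp (-F.deriv ρ (x, S.well w))
  set p := fderiv ℝ (fun x => F.deriv ρ (x, S.well w)) x (EuclideanSpace.single i 1)
  set g := h.g w i x
  have h3 : p ^ 2 ≤ (L:ℝ) ^ 2 := by
    rw [← sq_abs p]
    exact pow_le_pow_left₀ (abs_nonneg _) h1 2
  have h4 : (2 * s * g * e - u * p) ^ 2 ≤ 2 * (4 * (s ^ 2 * e) * (e * g ^ 2)) + 2 * u ^ 2 * p ^ 2 := by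
    nlinarith [sq_nonneg (2 * s * g * e + u * p)]
  rw [h2] at h4
  nlinarith [mul_le_mul_of_nonneg_left h3 (sq_nonneg u)]

include hM in
omit hρ in
-- One factor `e^M` bounds `e^{-D𝓕}` at the barrier, the other the geometric mean of `e^{D𝓕}` in the
-- wells. Expressed in the untilted densities with a constant prefactor, the bound can be averaged
-- by the kernels.
lemma abs_jump_mul_le_sqrt : ∀ᵐ x ∂volume.restrict S.Ω, ∀ ξ, |S.jumpDensity jbar x * ξ| ≤
    h.c x + S.mΥ / S.volΩ * Real.exp (2 * M) *
      Real.sqrt (S.density ρ false x * S.density ρ true x) * (4 * (Real.cosh (ξ / 2) - 1)) := by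
  have hk : 0 ≤ S.mΥ / S.volΩ := div_nonneg S.mΥ_pos.le S.volΩ_pos.le
  filter_upwards [h.abs_jump_mul_le, ae_restrict_mem S.measurableSet_Ω] with x hx hx' ξ
  refine (hx ξ).trans (add_le_add le_rfl (mul_le_mul_of_nonneg_right ?_ (cosh_sub_one_nonneg ξ)))
  have hw : ∀ w, |F.deriv ρ (x, S.well w)| ≤ M := fun w => hM ρ hp _ (S.mem_nodes hx' w)
  have hc : |F.deriv ρ (x, S.c)| ≤ M := hM ρ hp _ ⟨hx', S.c_mem_Υ⟩
  have e : S.tiltedDensity F ρ x S.a * S.tiltedDensity F ρ x S.b =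
      S.density ρ false x * S.density ρ true x *
        Real.exp (F.deriv ρ (x, S.well false) + F.deriv ρ (x, S.well true)) := by
    rw [Real.exp_add]
    change (S.density ρ false x * Real.exp (F.deriv ρ (x, S.well false))) *
      (S.density ρ true x * Real.exp (F.deriv ρ (x, S.well true))) = _
    ring
  have h2 : Real.exp (F.deriv ρ (x, S.well false) + F.deriv ρ (x, S.well true)) ≤
      Real.exp M ^ 2 := by
    rw [sq, ← Real.exp_add]
    exact Real.exp_le_exp.2 (add_le_add ((le_abs_self _).trans (hw _))
      ((le_abs_self _).trans (hw _)))
  have h3 : Real.sqrt (S.tiltedDensity F ρ x S.a * S.tiltedDensity F ρ x S.b) ≤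
      Real.sqrt (S.density ρ false x * S.density ρ true x) * Real.exp M := by
    rw [e, Real.sqrt_mul (mul_nonneg (density_nonneg ρ _ x) (density_nonneg ρ _ x))]
    exact mul_le_mul_of_nonneg_left (Real.sqrt_le_iff.2 ⟨(Real.exp_pos M).le, h2⟩)
      (Real.sqrt_nonneg _)
  have h4 : Real.exp (-F.deriv ρ (x, S.c)) ≤ Real.exp M :=
    Real.exp_le_exp.2 ((neg_le_abs _).trans hc)
  rw [sigma, two_mul M, Real.exp_add, mul_assoc, mul_assoc, mul_assoc]
  refine mul_le_mul_of_nonneg_left ?_ hk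
  refine (mul_le_mul h4 h3 (Real.sqrt_nonneg _) (Real.exp_pos M).le).trans (le_of_eq ?_)
  ring

include h in
omit hp hρ in
-- If one density vanishes then `σ = 0`, and the duality bound loses its dependence on `ξ`; the
-- choice `ξ = (c + 1) / r` then contradicts it unless `r = 0`.
lemma jumpDensity_eq_zero : ∀ᵐ x ∂volume.restrict S.Ω,
    S.density ρ false x * S.density ρ true x = 0 → S.jumpDensity jbar x = 0 := by
  filter_upwards [h.abs_jump_mul_le] with x hx h0
  have e : S.sigma F ρ x = 0 := by
    have : S.tiltedDensity F ρ x S.a * S.tiltedDensity F ρ x S.b = 0 := by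
      change (S.density ρ false x * Real.exp (F.deriv ρ (x, S.well false))) *
        (S.density ρ true x * Real.exp (F.deriv ρ (x, S.well true))) = _
      rw [mul_mul_mul_comm, h0, zero_mul]
    rw [sigma, this, Real.sqrt_zero, mul_zero]
  by_contra hr
  have h1 := hx ((h.c x + 1) / S.jumpDensity jbar x)
  rw [mul_div_cancel₀ _ hr, e, zero_mul, add_zero] at h1
  linarith [le_abs_self (h.c x + 1)]

include h in
/-- The rate of the mollified energy as a sum of diffusive parts and a jump part. -/
lemma mollRate_eq {δ : ℝ} (hδ : 0 < δ) (N : ℕ) : S.mollRate F δ N ρ jx jbar =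
    (∑ w, S.γ w * ∑ i, ((∫ x in S.Ω, S.op N (some i) (h.D w i) x /
        (S.op N none (S.density ρ w) x + δ) * S.op N (some i) (S.fluxDensity ρ jx w i) x) +
      ∫ x in S.Ω, fderiv ℝ (S.mollDeriv F N ρ w) x (EuclideanSpace.single i 1) *
        S.op N (some i) (S.fluxDensity ρ jx w i) x)) +
    ((∫ x in S.Ω, (Real.log (S.op N none (S.density ρ true) x + δ) -
        Real.log (S.op N none (S.density ρ false) x + δ)) *
          S.op N none (S.jumpDensity jbar) x) +
      ∫ x in S.Ω, (S.mollDeriv F N ρ true x - S.mollDeriv F N ρ false x) *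
        S.op N none (S.jumpDensity jbar) x) := by
  obtain ⟨L, hL⟩ := exists_lipschitzOnWith_deriv F
  have hfL : ∀ w, LipschitzOnWith L (S.mollDeriv F N ρ w) S.Ω :=
    hL _ (isNodeProb_stateMeasure_mollify hp hρ N)
  have hdens := isDensity_density hp hρ
  have hG : ∀ w, S.mollPotential F δ N ρ w = fun x =>
      Real.log (S.op N none (S.density ρ w) x + δ) + S.mollDeriv F N ρ w x := fun w => by
    ext x
    rw [mollPotential, potential, mollify_eq_op hp hρ N w, mollDeriv]
  have hr := integrableOn_jumpDensity (S := S) jbar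
  have hJ := integrableOn_fluxDensity hp hρ jx
  have hlog : ∀ w, ContDiff ℝ ∞ fun x => Real.log (S.op N none (S.density ρ w) x + δ) := fun w =>
    contDiff_log_op_add (hdens.integrable w) (hdens.nonneg w) hδ N
  -- Self-adjointness moves the Dirichlet regularization onto the flux. The gradient of `log (u_N +
  -- δ)` is then the regularized weak derivative of `u` divided by `u_N + δ`.
  have hdiff : ∀ w i, ∫ y in S.Ω, S.op N (some i) (fun x =>
      fderiv ℝ (S.mollPotential F δ N ρ w) x (EuclideanSpace.single i 1)) y *
        S.fluxDensity ρ jx w i y = (∫ x in S.Ω, S.op N (some i) (h.D w i) x /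
        (S.op N none (S.density ρ w) x + δ) * S.op N (some i) (S.fluxDensity ρ jx w i) x) +
      ∫ x in S.Ω, fderiv ℝ (S.mollDeriv F N ρ w) x (EuclideanSpace.single i 1) *
        S.op N (some i) (S.fluxDensity ρ jx w i) x := fun w i => by
    obtain ⟨K, hK⟩ := exists_lipschitzOnWith_mollPotential F hδ N hp hρ w
    have hpos : ∀ x, S.op N none (S.density ρ w) x + δ ≠ 0 := fun x =>
      (add_pos_of_nonneg_of_pos (op_none_nonneg (hdens.nonneg w) x) hδ).ne'
    rw [← integral_mul_op_of_ae (hJ w i) (integrableOn_fderiv_single hK i)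
      (fun x hx => abs_fderiv_single_le hK hx i), ← integral_add]
    · refine integral_congr_ae ?_
      filter_upwards [ae_differentiableAt_of_lipschitzOnWith (hfL w)] with x hx
      have h1 : DifferentiableAt ℝ (S.op N none (S.density ρ w)) x :=
        (contDiff_op (hdens.integrable w)).differentiable (by simp) x
      have h2 : HasFDerivAt (S.mollPotential F δ N ρ w)
          ((S.op N none (S.density ρ w) x + δ)⁻¹ • fderiv ℝ (S.op N none (S.density ρ w)) x +
            fderiv ℝ (S.mollDeriv F N ρ w) x) x := by
        rw [hG]
        exact ((h1.hasFDerivAt.add_const δ).log (hpos x)).add hx.hasFDerivAt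
      rw [h2.fderiv, _root_.add_apply, _root_.smul_apply, smul_eq_mul,
        (h.hasWeakDeriv w i).fderiv_op (hdens.integrable w) (h.integrable_D w i)]
      ring
    · refine S.integrableOn_of_continuous ?_
      exact ((continuous_op (h.integrable_D w i)).div
        ((continuous_op (hdens.integrable w)).add continuous_const) hpos).mul
        (continuous_op (hJ w i))
    · exact Integrable.bdd_mul (integrableOn_op (hJ w i))
        (measurable_fderiv_single _ i).aestronglyMeasurable (c := L)
        (S.ae_mem_interior_Ω.mono fun x hx => abs_fderiv_single_le (hfL w) hx i)
  have hop := continuous_op (N := N) (o := none) hr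
  have hjump : ∀ w, ∫ y in S.Ω, S.op N none (S.mollPotential F δ N ρ w) y *
      S.jumpDensity jbar y = (∫ x in S.Ω, Real.log (S.op N none (S.density ρ w) x + δ) *
        S.op N none (S.jumpDensity jbar) x) +
      ∫ x in S.Ω, S.mollDeriv F N ρ w x * S.op N none (S.jumpDensity jbar) x := fun w => by
    obtain ⟨K, hK⟩ := exists_lipschitzOnWith_mollPotential F hδ N hp hρ w
    obtain ⟨C, hC⟩ := S.isCompact_Ω.exists_bound_of_continuousOn hK.continuousOn
    rw [← integral_mul_op_of_ae hr (hK.continuousOn.integrableOn_compact S.isCompact_Ω)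
      (fun x hx => hC x (interior_subset hx)), hG, ← integral_add]
    · simp only [add_mul]
    · exact S.integrableOn_of_continuous ((hlog w).continuous.mul hop)
    · exact ((hfL w).continuousOn.mul hop.continuousOn).integrableOn_compact S.isCompact_Ω
  have h3 : ∀ w, IntegrableOn (fun x => Real.log (S.op N none (S.density ρ w) x + δ) *
        S.op N none (S.jumpDensity jbar) x) S.Ω := fun w =>
    S.integrableOn_of_continuous ((hlog w).continuous.mul hop)
  have h4 : ∀ w, IntegrableOn (fun x => S.mollDeriv F N ρ w x *
        S.op N none (S.jumpDensity jbar) x) S.Ω := fun w =>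
    ((hfL w).continuousOn.mul hop.continuousOn).integrableOn_compact S.isCompact_Ω
  rw [mollRate, Finset.sum_add_distrib]
  congr 1
  · simp only [hdiff]
  · rw [Fintype.sum_bool, hjump, hjump]
    simp only [sub_mul]
    rw [integral_sub (h3 true) (h3 false), integral_sub (h4 true) (h4 false)]
    simp only [sgn, cond_true, cond_false]
    ring

/-- The limit of the rate of the mollified energy. -/
noncomputable def limitRate (h : S.Regular F ρ jx jbar R) (δ : ℝ) : ℝ :=
  (∑ w, S.γ w * ∑ i, ((∫ x in S.Ω, h.D w i x / (S.density ρ w x + δ) * S.fluxDensity ρ jx w i x) +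
    ∫ x in S.Ω, fderiv ℝ (fun x => F.deriv ρ (x, S.well w)) x (EuclideanSpace.single i 1) *
      S.fluxDensity ρ jx w i x)) +
  ((∫ x in S.Ω, (Real.log (S.density ρ true x + δ) - Real.log (S.density ρ false x + δ)) *
      S.jumpDensity jbar x) +
    ∫ x in S.Ω, (F.deriv ρ (x, S.well true) - F.deriv ρ (x, S.well false)) *
      S.jumpDensity jbar x)

/-- The logarithmic terms converge by domination, using Fisher information, kinetic energy and jump
cost; the gradient of the tilt converges only weakly, against a flux that converges in `L¹`. -/
lemma tendsto_mollRate {δ : ℝ} (hδ : 0 < δ) :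
    Tendsto (fun N => S.mollRate F δ N ρ jx jbar) atTop (𝓝 (h.limitRate δ)) := by
  obtain ⟨L, hL⟩ := exists_lipschitzOnWith_deriv F
  obtain ⟨M, hM⟩ := F.bounded_deriv
  have hdens := isDensity_density hp hρ
  have hr := integrableOn_jumpDensity (S := S) jbar
  have hJ := integrableOn_fluxDensity hp hρ jx
  have hK : 0 ≤ S.mΥ / S.volΩ * Real.exp (2 * M) :=
    mul_nonneg (div_nonneg S.mΥ_pos.le S.volΩ_pos.le) (Real.exp_pos _).le
  simp only [h.mollRate_eq hp hρ hδ]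
  refine Tendsto.add (tendsto_finsetSum _ fun w _ => (tendsto_finsetSum _ fun i _ =>
    Tendsto.add ?_ ?_).const_mul _) (Tendsto.add ?_ ?_)
  · exact tendsto_integral_op_div_mul_op (hdens.integrable w) (h.integrable_D w i) (hJ w i)
      (h.integrable_fisherBound (L := L) hp hρ w i) (h.integrable_flux w i) (hdens.nonneg w)
      (Eventually.of_forall (h.fisherBound_nonneg w i))
      (Eventually.of_forall (fluxEnergy_nonneg w i)) (h.D_sq_le hp hL w i)
      (Eventually.of_forall fun x => (fluxDensity_sq w i x).le) hδ
  · exact tendsto_integral_fderiv_mul_op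
      (fun N => hL _ (isNodeProb_stateMeasure_mollify hp hρ N) w) (hL ρ hp w)
      (tendsto_integral_abs_mollDeriv_sub hp hρ F w) (hJ w i)
  · exact tendsto_integral_log_op_mul_op hr h.integrable_c (hdens.integrable false)
      (hdens.integrable true) (hdens.nonneg false) (hdens.nonneg true) hK
      (h.abs_jump_mul_le_sqrt hp hM) hδ
  -- The differences of the tilt converge uniformly, and the regularized jump density converges in
  -- `L¹`.
  · have hopen : ∀ N, IntegrableOn (S.op N none (S.jumpDensity jbar)) S.Ω := fun N =>
      integrableOn_op hr
    have hf : ∀ w, ContinuousOn (fun x => F.deriv ρ (x, S.well w)) S.Ω := fun w =>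
      (hL ρ hp w).continuousOn
    have hfN : ∀ N w, ContinuousOn (S.mollDeriv F N ρ w) S.Ω := fun N w =>
      (hL _ (isNodeProb_stateMeasure_mollify hp hρ N) w).continuousOn
    have hm : ∀ f : Space d → ℝ, ContinuousOn f S.Ω → ∀ g, IntegrableOn g S.Ω →
        IntegrableOn (fun x => f x * g x) S.Ω := fun f hf g hg => by
      obtain ⟨C, hC⟩ := S.isCompact_Ω.exists_bound_of_continuousOn hf
      exact integrableOn_bdd_mul hg (hf.aestronglyMeasurable S.measurableSet_Ω) hC
    have h0 : ∀ f : Bool → Space d → ℝ, (∀ w, ContinuousOn (f w) S.Ω) →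
        ContinuousOn (fun x => f true x - f false x) S.Ω := fun f hf => (hf true).sub (hf false)
    rw [tendsto_iff_norm_sub_tendsto_zero]
    rw [Metric.tendsto_atTop']
    intro ε hε
    set I := ∫ x in S.Ω, |S.jumpDensity jbar x| with hI
    have hI0 : 0 ≤ I := integral_nonneg fun x => abs_nonneg _
    have hop := (S.tendsto_integral_abs_op_sub none hr).eventually_lt_const
      (show 0 < ε / (2 * (2 * |M| + 1)) by positivity)
    obtain ⟨n, hn⟩ := eventually_atTop.1 (hop.and (eventually_abs_mollDeriv_sub_le hp hρ F
      (ε := ε / (8 * (I + 1))) (by positivity)))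
    refine ⟨n, fun N hN => ?_⟩
    obtain ⟨hN1, hN2⟩ := hn N hN.le
    rw [Real.dist_eq, sub_zero, abs_of_nonneg (norm_nonneg _), ← integral_sub
      (hm _ (h0 _ (hfN N)) _ (hopen N)) (hm _ (h0 _ hf) _ hr)]
    have hb : ∀ x ∈ S.Ω, ‖(S.mollDeriv F N ρ true x - S.mollDeriv F N ρ false x) *
        S.op N none (S.jumpDensity jbar) x - (F.deriv ρ (x, S.well true) -
          F.deriv ρ (x, S.well false)) * S.jumpDensity jbar x‖ ≤
        2 * (ε / (8 * (I + 1))) * |S.op N none (S.jumpDensity jbar) x| +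
          2 * |M| * |S.op N none (S.jumpDensity jbar) x - S.jumpDensity jbar x| := by
      intro x hx
      have h1 := hN2 true x hx
      have h2 := hN2 false x hx
      have h3 := (hM ρ hp _ (S.mem_nodes hx true)).trans (le_abs_self M)
      have h4 := (hM ρ hp _ (S.mem_nodes hx false)).trans (le_abs_self M)
      set f1 := S.mollDeriv F N ρ true x
      set f2 := S.mollDeriv F N ρ false x
      set g1 := F.deriv ρ (x, S.well true)
      set g2 := F.deriv ρ (x, S.well false)
      set a := S.op N none (S.jumpDensity jbar) x
      set b := S.jumpDensity jbar x
      have e : (f1 - f2) * a - (g1 - g2) * b = ((f1 - g1) - (f2 - g2)) * a + (g1 - g2) * (a - b) := by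
        ring
      rw [e, Real.norm_eq_abs]
      refine (abs_add_le _ _).trans (add_le_add ?_ ?_)
      · rw [abs_mul]
        refine mul_le_mul_of_nonneg_right ((abs_sub _ _).trans ?_) (abs_nonneg _)
        linarith
      · rw [abs_mul]
        refine mul_le_mul_of_nonneg_right ((abs_sub _ _).trans ?_) (abs_nonneg _)
        linarith
    have i1 : IntegrableOn (fun x => 2 * (ε / (8 * (I + 1))) *
        |S.op N none (S.jumpDensity jbar) x|) S.Ω := (hopen N).abs.const_mul _
    have i2 : IntegrableOn (fun x => 2 * |M| *
        |S.op N none (S.jumpDensity jbar) x - S.jumpDensity jbar x|) S.Ω :=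
      ((hopen N).sub hr).abs.const_mul _
    refine (norm_integral_le_of_norm_le (i1.add i2)
      ((ae_restrict_mem S.measurableSet_Ω).mono hb)).trans_lt ?_
    simp only [Pi.add_apply]
    rw [integral_add i1 i2, integral_const_mul, integral_const_mul]
    have h5 := integral_abs_op_le (N := N) (o := none) hr
    have h6 : 2 * (ε / (8 * (I + 1))) * ∫ x in S.Ω, |S.op N none (S.jumpDensity jbar) x| ≤
        ε / 4 := by
      refine (mul_le_mul_of_nonneg_left h5 (by positivity)).trans ?_
      rw [← hI, mul_div_assoc', div_mul_eq_mul_div, div_le_div_iff₀ (by positivity) (by positivity)]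
      nlinarith
    have h7 : 2 * |M| * ∫ x in S.Ω, |S.op N none (S.jumpDensity jbar) x - S.jumpDensity jbar x| ≤
        ε / 2 := by
      refine (mul_le_mul_of_nonneg_left hN1.le (by positivity)).trans ?_
      rw [mul_div_assoc', div_le_div_iff₀ (by positivity) (by positivity)]
      nlinarith [abs_nonneg M]
    linarith

lemma tendsto_limitRate {δ : ℕ → ℝ} (hδ : ∀ n, 0 < δ n) (hδ1 : ∀ n, δ n ≤ 1)
    (hδ0 : Tendsto δ atTop (𝓝 0)) :
    Tendsto (fun n => h.limitRate (δ n)) atTop (𝓝 (h.limitRate 0)) := by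
  obtain ⟨L, hL⟩ := exists_lipschitzOnWith_deriv F
  obtain ⟨M, hM⟩ := F.bounded_deriv
  have hdens := isDensity_density hp hρ
  have hr := integrableOn_jumpDensity (S := S) jbar
  have hJ := integrableOn_fluxDensity hp hρ jx
  have hK : 0 ≤ S.mΥ / S.volΩ * Real.exp (2 * M) :=
    mul_nonneg (div_nonneg S.mΥ_pos.le S.volΩ_pos.le) (Real.exp_pos _).le
  refine Tendsto.add (tendsto_finsetSum _ fun w _ => (tendsto_finsetSum _ fun i _ =>
    Tendsto.add_const _ ?_).const_mul _) (Tendsto.add_const _ ?_)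
  · simp only [add_zero]
    exact tendsto_integral_div_add_mul (hdens.integrable w) (h.integrable_D w i) (hJ w i)
      (h.integrable_fisherBound (L := L) hp hρ w i) (h.integrable_flux w i) (hdens.nonneg w)
      (Eventually.of_forall (h.fisherBound_nonneg w i))
      (Eventually.of_forall (fluxEnergy_nonneg w i)) (h.D_sq_le hp hL w i)
      (Eventually.of_forall fun x => (fluxDensity_sq w i x).le) hδ hδ0
      (Eventually.of_forall fun x hx => by rw [fluxDensity, hx, mul_zero])
  · simp only [add_zero]
    exact tendsto_integral_log_add_mul hr h.integrable_c (hdens.integrable false)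
      (hdens.integrable true) (hdens.nonneg false) (hdens.nonneg true) hK
      (h.abs_jump_mul_le_sqrt hp hM) hδ hδ1 hδ0 h.jumpDensity_eq_zero

end Regular

end

end Setting


/-! ### Bounds for the energy rate by the dissipation rate -/

namespace Setting

variable {d : ℕ} {S : Setting d}

section

variable {F : S.Tilt} {ρ : Measure (Space d × ℝ)} {jx : Fin d → SignedMeasure (Space d × ℝ)}
  {jbar : SignedMeasure (Space d)} (hp : S.IsNodeProb ρ) (hρ : ρ ≪ S.π₀)

include hp hρ

namespace Regular

variable {R : ℝ} (h : S.Regular F ρ jx jbar R)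

omit hp hρ in
-- Completing the squares `e / (2m) (s v ∓ 2 m g)²`. The weight `m` is the one for which the two
-- summands are exactly the diffusive terms of the dissipation.
lemma abs_two_mul_mul_le {m s v g e : ℝ} (hm : 0 < m) (he : 0 ≤ e) :
    |2 * s * g * e * v| ≤ 1 / (2 * m) * (v ^ 2 * (s ^ 2 * e)) + 2 * m * (e * g ^ 2) := by
  have h1 : 0 ≤ e / (2 * m) * (s * v - 2 * m * g) ^ 2 := by positivity
  have h2 : 0 ≤ e / (2 * m) * (s * v + 2 * m * g) ^ 2 := by positivity
  have e1 : e / (2 * m) * (s * v - 2 * m * g) ^ 2 =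
      1 / (2 * m) * (v ^ 2 * (s ^ 2 * e)) + 2 * m * (e * g ^ 2) - 2 * s * g * e * v := by
    field_simp; ring
  have e2 : e / (2 * m) * (s * v + 2 * m * g) ^ 2 =
      1 / (2 * m) * (v ^ 2 * (s ^ 2 * e)) + 2 * m * (e * g ^ 2) + 2 * s * g * e * v := by
    field_simp; ring
  rw [abs_le]
  constructor <;> linarith

/-- The chain rule inequality at a fixed time. -/
lemma abs_limitRate_zero_le : |h.limitRate 0| ≤ R := by
  obtain ⟨L, hL⟩ := exists_lipschitzOnWith_deriv F
  obtain ⟨M, hM⟩ := F.bounded_deriv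
  have hdens := isDensity_density hp hρ
  have hr := integrableOn_jumpDensity (S := S) jbar
  have hJ := integrableOn_fluxDensity hp hρ jx
  have hK : 0 ≤ S.mΥ / S.volΩ * Real.exp (2 * M) :=
    mul_nonneg (div_nonneg S.mΥ_pos.le S.volΩ_pos.le) (Real.exp_pos _).le
  have hmΩ := S.mΩ_pos
  have hdiff : ∀ w i, |(∫ x in S.Ω, h.D w i x / (S.density ρ w x + 0) *
      S.fluxDensity ρ jx w i x) + ∫ x in S.Ω, fderiv ℝ (fun x => F.deriv ρ (x, S.well w)) x
        (EuclideanSpace.single i 1) * S.fluxDensity ρ jx w i x| ≤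
      1 / (2 * S.mΩ) * (∫ x in S.Ω, S.fluxEnergy ρ jx w i x) +
        2 * S.mΩ * ∫ x in S.Ω, Real.exp (-F.deriv ρ (x, S.well w)) * h.g w i x ^ 2 := by
    intro w i
    have i1 : IntegrableOn (fun x => h.D w i x / (S.density ρ w x + 0) *
        S.fluxDensity ρ jx w i x) S.Ω := by
      refine (((h.integrable_fisherBound (L := L) hp hρ w i).add
        (h.integrable_flux w i)).div_const 2).mono' ?_ ?_
      · exact (((h.integrable_D w i).aestronglyMeasurable.aemeasurable.div
          ((hdens.integrable w).aestronglyMeasurable.aemeasurable.add_const 0)).mul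
          (hJ w i).aestronglyMeasurable.aemeasurable).aestronglyMeasurable
      · filter_upwards [h.D_sq_le hp hL w i] with x hx
        rw [Real.norm_eq_abs]
        have h0 := density_nonneg (S := S) ρ w x
        rcases h0.eq_or_lt with h1 | h1
        · rw [fluxDensity, ← h1, mul_zero, mul_zero, abs_zero]
          exact div_nonneg (add_nonneg (h.fisherBound_nonneg w i x) (fluxEnergy_nonneg w i x))
            zero_le_two
        · refine abs_le_of_sq_le_sq ?_ (div_nonneg (add_nonneg (h.fisherBound_nonneg w i x)
            (fluxEnergy_nonneg w i x)) zero_le_two)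
          rw [add_zero, mul_pow, div_pow, fluxDensity_sq]
          have h2 := fluxEnergy_nonneg (S := S) (ρ := ρ) (jx := jx) w i x
          have h3 : h.D w i x ^ 2 / S.density ρ w x ^ 2 *
              (S.density ρ w x * S.fluxEnergy ρ jx w i x) ≤
              h.fisherBound L w i x * S.fluxEnergy ρ jx w i x := by
            have e : h.D w i x ^ 2 / S.density ρ w x ^ 2 *
              (S.density ρ w x * S.fluxEnergy ρ jx w i x) =
              h.D w i x ^ 2 / S.density ρ w x * S.fluxEnergy ρ jx w i x := by field_simp
            rw [e]
            refine mul_le_mul_of_nonneg_right ?_ h2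
            rw [div_le_iff₀ h1, mul_comm]
            exact hx
          refine h3.trans ?_
          change _ ≤ ((h.fisherBound L w i x + S.fluxEnergy ρ jx w i x) / 2) ^ 2
          nlinarith [sq_nonneg (h.fisherBound L w i x - S.fluxEnergy ρ jx w i x)]
    have i2 : IntegrableOn (fun x => fderiv ℝ (fun x => F.deriv ρ (x, S.well w)) x
        (EuclideanSpace.single i 1) * S.fluxDensity ρ jx w i x) S.Ω :=
      Integrable.bdd_mul (hJ w i) (measurable_fderiv_single _ i).aestronglyMeasurable (c := L)
        (S.ae_mem_interior_Ω.mono fun x hx => abs_fderiv_single_le (hL ρ hp w) hx i)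
    have i3 : IntegrableOn (fun x => 1 / (2 * S.mΩ) * S.fluxEnergy ρ jx w i x) S.Ω :=
      (h.integrable_flux w i).const_mul _
    have i4 : IntegrableOn (fun x => 2 * S.mΩ *
        (Real.exp (-F.deriv ρ (x, S.well w)) * h.g w i x ^ 2)) S.Ω :=
      (h.integrable_g w i).const_mul _
    rw [← integral_add i1 i2, ← integral_const_mul, ← integral_const_mul, ← integral_add i3 i4]
    refine norm_integral_le_of_norm_le (f := fun x => h.D w i x / (S.density ρ w x + 0) *
      S.fluxDensity ρ jx w i x + fderiv ℝ (fun x => F.deriv ρ (x, S.well w)) x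
        (EuclideanSpace.single i 1) * S.fluxDensity ρ jx w i x) (i3.add i4) ?_
    -- The gradient of the tilt cancels: with `D = 2 s g e - u p` and `J = v u`, the sum `D / u · J
    -- + p J` equals `2 s g e v`. Where `u = 0`, also `s = 0`, and both sides vanish.
    filter_upwards [h.D_eq w i] with x hx
    have h1 := sqrtDensity_sq_mul_exp F ρ w x
    have h2 := abs_two_mul_mul_le (s := S.sqrtDensity F ρ w x) (v := (jx i).rnDeriv ρ (x, S.well w))
      (g := h.g w i x) hmΩ (Real.exp_pos (-F.deriv ρ (x, S.well w))).le
    rw [h1] at h2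
    refine le_trans (le_of_eq ?_) h2
    rw [Real.norm_eq_abs, fluxDensity, hx, add_zero]
    congr 1
    by_cases h0 : S.density ρ w x = 0
    · have : S.sqrtDensity F ρ w x = 0 := by
        have := sqrtDensity_sq F ρ w x
        rw [h0, zero_mul] at this
        exact pow_eq_zero_iff two_ne_zero |>.1 this
      rw [h0, this]
      ring
    · field_simp
      ring
  have hjump : |(∫ x in S.Ω, (Real.log (S.density ρ true x + 0) -
      Real.log (S.density ρ false x + 0)) * S.jumpDensity jbar x) +
      ∫ x in S.Ω, (F.deriv ρ (x, S.well true) - F.deriv ρ (x, S.well false)) *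
        S.jumpDensity jbar x| ≤
      (∫ x in S.Ω, h.c x) + 2 * (S.mΥ / S.volΩ) * ∫ x in S.Ω, S.jumpGap F ρ x := by
    have i3 : IntegrableOn (fun x => 2 * (S.mΥ / S.volΩ) * S.jumpGap F ρ x) S.Ω :=
      h.integrable_jumpGap.const_mul _
    have i2 : IntegrableOn (fun x => (F.deriv ρ (x, S.well true) - F.deriv ρ (x, S.well false)) *
        S.jumpDensity jbar x) S.Ω := by
      refine Integrable.bdd_mul hr ((aestronglyMeasurable_deriv_well F hp true).sub
        (aestronglyMeasurable_deriv_well F hp false)) (c := M + M) ?_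
      filter_upwards [ae_restrict_mem S.measurableSet_Ω] with x hx
      exact (norm_sub_le _ _).trans (add_le_add (hM ρ hp _ (S.mem_nodes hx _))
        (hM ρ hp _ (S.mem_nodes hx _)))
    have hpt : ∀ᵐ x ∂volume.restrict S.Ω,
        |(Real.log (S.density ρ true x + 0) - Real.log (S.density ρ false x + 0)) *
          S.jumpDensity jbar x + (F.deriv ρ (x, S.well true) - F.deriv ρ (x, S.well false)) *
            S.jumpDensity jbar x| ≤ h.c x + 2 * (S.mΥ / S.volΩ) * S.jumpGap F ρ x := by
      filter_upwards [h.abs_jump_mul_le, h.jumpDensity_eq_zero] with x hx hx0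
      by_cases h0 : S.density ρ false x * S.density ρ true x = 0
      · rw [hx0 h0, mul_zero, mul_zero, add_zero, abs_zero]
        exact add_nonneg (h.c_nonneg x) (mul_nonneg (mul_nonneg zero_le_two
          (div_nonneg S.mΥ_pos.le S.volΩ_pos.le)) (mul_nonneg (Real.exp_pos _).le (sq_nonneg _)))
      · have hpos : ∀ w, 0 < S.density ρ w x := fun w => by
          refine lt_of_le_of_ne (density_nonneg ρ w x) fun hw => h0 ?_
          cases w
          · rw [← hw, zero_mul]
          · rw [← hw, mul_zero]
        have htpos : ∀ w, 0 < S.density ρ w x * Real.exp (F.deriv ρ (x, S.well w)) := fun w =>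
          mul_pos (hpos w) (Real.exp_pos _)
        have hlog : ∀ w, Real.log (S.density ρ w x * Real.exp (F.deriv ρ (x, S.well w))) =
            Real.log (S.density ρ w x) + F.deriv ρ (x, S.well w) := fun w => by
          rw [Real.log_mul (hpos w).ne' (Real.exp_pos _).ne', Real.log_exp]
        -- The optimal `ξ` is the difference of the logarithms of the tilted densities. Its dual
        -- cost, weighted by `σ`, is exactly the jump part of the slope.
        have h1 := hx (Real.log (S.density ρ true x * Real.exp (F.deriv ρ (x, S.well true))) -
          Real.log (S.density ρ false x * Real.exp (F.deriv ρ (x, S.well false))))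
        have h2 := sqrt_mul_cosh_log_sub (htpos false) (htpos true)
        have h3 : S.sigma F ρ x * (4 * (Real.cosh ((Real.log (S.density ρ true x *
            Real.exp (F.deriv ρ (x, S.well true))) - Real.log (S.density ρ false x *
              Real.exp (F.deriv ρ (x, S.well false)))) / 2) - 1)) =
            2 * (S.mΥ / S.volΩ) * S.jumpGap F ρ x := by
          change S.mΥ / S.volΩ * Real.exp (-F.deriv ρ (x, S.c)) * Real.sqrt
            ((S.density ρ false x * Real.exp (F.deriv ρ (x, S.well false))) *
              (S.density ρ true x * Real.exp (F.deriv ρ (x, S.well true)))) * _ = _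
          rw [mul_assoc, h2, jumpGap]
          change _ = 2 * (S.mΥ / S.volΩ) * (Real.exp (-F.deriv ρ (x, S.c)) *
            (Real.sqrt (S.density ρ true x * Real.exp (F.deriv ρ (x, S.well true))) -
              Real.sqrt (S.density ρ false x * Real.exp (F.deriv ρ (x, S.well false)))) ^ 2)
          ring
        rw [h3, hlog, hlog] at h1
        refine le_trans (le_of_eq ?_) h1
        rw [add_zero, add_zero]
        congr 1
        ring
    have i1 : IntegrableOn (fun x => (Real.log (S.density ρ true x + 0) -
        Real.log (S.density ρ false x + 0)) * S.jumpDensity jbar x) S.Ω := by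
      -- The pointwise bound applies to the sum of both integrands; subtracting the integrable
      -- second one leaves the first.
      have i4 : IntegrableOn (fun x => (Real.log (S.density ρ true x + 0) -
          Real.log (S.density ρ false x + 0)) * S.jumpDensity jbar x +
          (F.deriv ρ (x, S.well true) - F.deriv ρ (x, S.well false)) *
            S.jumpDensity jbar x) S.Ω := by
        refine (h.integrable_c.add i3).mono' (AEStronglyMeasurable.add ?_
          i2.aestronglyMeasurable) hpt
        exact ((((measurable_density ρ true).add_const 0).log.sub
          ((measurable_density ρ false).add_const 0).log).aemeasurable.mul
          hr.aestronglyMeasurable.aemeasurable).aestronglyMeasurable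
      refine (i4.sub i2).congr (Eventually.of_forall fun x => ?_)
      simp
    rw [← integral_add i1 i2, ← integral_const_mul, ← integral_add h.integrable_c i3]
    exact norm_integral_le_of_norm_le (f := fun x => (Real.log (S.density ρ true x + 0) -
      Real.log (S.density ρ false x + 0)) * S.jumpDensity jbar x +
      (F.deriv ρ (x, S.well true) - F.deriv ρ (x, S.well false)) * S.jumpDensity jbar x)
      (h.integrable_c.add i3) hpt
  refine le_of_le_of_eq ?_ h.total
  rw [limitRate]
  refine (abs_add_le _ _).trans (add_le_add ?_ hjump)
  rw [← Finset.sum_add_distrib]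
  refine (Finset.abs_sum_le_sum_abs _ _).trans (Finset.sum_le_sum fun w _ => ?_)
  rw [← mul_add, ← Finset.sum_add_distrib, abs_mul, abs_of_pos (S.γ_pos w)]
  exact mul_le_mul_of_nonneg_left ((Finset.abs_sum_le_sum_abs _ _).trans
    (Finset.sum_le_sum fun i _ => hdiff w i)) (S.γ_pos w).le

end Regular

omit hp hρ in
set_option maxHeartbeats 1000000 in
/-- A bound for the rate of the mollified energy, uniformly in the regularization. -/
lemma exists_abs_mollRate_le (F : S.Tilt) : ∃ C, 0 ≤ C ∧
    ∀ ρ, S.IsNodeProb ρ → ρ ≪ S.π₀ → ∀ jx jbar R, S.Regular F ρ jx jbar R →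
    ∀ N, ∀ δ, 0 < δ → δ ≤ 1 → |S.mollRate F δ N ρ jx jbar| ≤ C * (R + 1) := by
  obtain ⟨L, hL⟩ := exists_lipschitzOnWith_deriv F
  obtain ⟨M, hM⟩ := F.bounded_deriv
  have hmΩ := S.mΩ_pos
  have hv := S.volΩ_pos
  set K := S.mΥ / S.volΩ * Real.exp (2 * M) with hKdef
  have hK : 0 ≤ K := mul_nonneg (div_nonneg S.mΥ_pos.le S.volΩ_pos.le) (Real.exp_pos _).le
  -- The dual cost at `ξ = 1`, by which the duality bound turns into an `L¹` bound for the jump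
  -- density.
  set κ := 4 * (Real.cosh (1 / 2) - 1) with hκdef
  have hκ : 0 ≤ κ := cosh_sub_one_nonneg 1
  -- A bound for the sum of the integrals of the two densities, since each weighted integral is at
  -- most one.
  set m := 1 / S.γ true + 1 / S.γ false with hmdef
  have hm : 0 ≤ m := by
    have := S.γ_pos true
    have := S.γ_pos false
    positivity
  refine ⟨(1 + L) * S.mΩ + 2 / S.mΩ + 2 * (L ^ 2 + L) * d + 1 +
    2 * K * (m + 2 * S.volΩ) + 2 * |M| * (1 + K * κ * m), by positivity,
    fun ρ hp hρ jx jbar R h N δ hδ hδ1 => ?_⟩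
  have hdens := isDensity_density hp hρ
  have hr := integrableOn_jumpDensity (S := S) jbar
  have hJ := integrableOn_fluxDensity hp hρ jx
  set A := ∑ w, S.γ w * ∑ i, ∫ x in S.Ω, S.fluxEnergy ρ jx w i x with hA
  set B := ∑ w, S.γ w * ∑ i, ∫ x in S.Ω,
    Real.exp (-F.deriv ρ (x, S.well w)) * h.g w i x ^ 2 with hB
  set Y := ∫ x in S.Ω, h.c x with hY
  set E := ∫ x in S.Ω, S.jumpGap F ρ x with hE
  have hA0 : 0 ≤ A := Finset.sum_nonneg fun w _ => mul_nonneg (S.γ_pos w).le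
    (Finset.sum_nonneg fun i _ => integral_nonneg (fluxEnergy_nonneg w i))
  have hB0 : 0 ≤ B := Finset.sum_nonneg fun w _ => mul_nonneg (S.γ_pos w).le
    (Finset.sum_nonneg fun i _ => integral_nonneg fun x =>
      mul_nonneg (Real.exp_pos _).le (sq_nonneg _))
  have hY0 : 0 ≤ Y := integral_nonneg h.c_nonneg
  have hE0 : 0 ≤ E := integral_nonneg fun x => mul_nonneg (Real.exp_pos _).le (sq_nonneg _)
  -- All terms of this decomposition of `R` are nonnegative, so `R` controls the kinetic energy, the
  -- Fisher information and the jump cost separately.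
  have htot : 1 / (2 * S.mΩ) * A + 2 * S.mΩ * B + (Y + 2 * (S.mΥ / S.volΩ) * E) = R := by
    rw [← h.total, hA, hB]
    simp only [Finset.mul_sum]
    congr 2
    · exact Finset.sum_congr rfl fun w _ => Finset.sum_congr rfl fun i _ => by ring
    · exact Finset.sum_congr rfl fun w _ => Finset.sum_congr rfl fun i _ => by ring
  have hE1 : 0 ≤ 2 * (S.mΥ / S.volΩ) * E :=
    mul_nonneg (mul_nonneg zero_le_two (div_nonneg S.mΥ_pos.le S.volΩ_pos.le)) hE0
  have hA2 : 0 ≤ 1 / (2 * S.mΩ) * A := by positivity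
  have hB2 : 0 ≤ 2 * S.mΩ * B := by positivity
  have hAR : A ≤ 2 * S.mΩ * R := by
    have : 1 / (2 * S.mΩ) * A ≤ R := by linarith
    rw [div_mul_eq_mul_div, one_mul, div_le_iff₀ (by positivity)] at this
    linarith
  have hBR : B ≤ R / (2 * S.mΩ) := by
    rw [le_div_iff₀ (by positivity)]
    linarith
  have hYR : Y ≤ R := by linarith
  have hR0 : 0 ≤ R := hY0.trans hYR
  have hmass : ∀ w, ∫ x in S.Ω, S.density ρ w x ≤ 1 / S.γ w := fun w => by
    rw [le_div_iff₀ (S.γ_pos w), mul_comm]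
    exact hdens.γ_mul_integral_le w
  have hmass' : (∫ x in S.Ω, S.density ρ false x) + ∫ x in S.Ω, S.density ρ true x ≤ m := by
    linarith [hmass true, hmass false]
  -- the flux
  have hJabs : ∀ w i, ∫ x in S.Ω, |S.fluxDensity ρ jx w i x| ≤
      ((∫ x in S.Ω, S.density ρ w x) + ∫ x in S.Ω, S.fluxEnergy ρ jx w i x) / 2 := fun w i => by
    rw [← integral_add (hdens.integrable w) (h.integrable_flux w i), ← integral_div]
    refine integral_mono (hJ w i).abs
      (((hdens.integrable w).add (h.integrable_flux w i)).div_const 2) fun x => ?_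
    refine abs_le_of_sq_le_sq ?_ (div_nonneg (add_nonneg (density_nonneg ρ w x)
      (fluxEnergy_nonneg w i x)) zero_le_two)
    rw [fluxDensity_sq]
    nlinarith [sq_nonneg (S.density ρ w x - S.fluxEnergy ρ jx w i x)]
  have hdiff : ∀ w i, |(∫ x in S.Ω, S.op N (some i) (h.D w i) x /
        (S.op N none (S.density ρ w) x + δ) * S.op N (some i) (S.fluxDensity ρ jx w i) x) +
      ∫ x in S.Ω, fderiv ℝ (S.mollDeriv F N ρ w) x (EuclideanSpace.single i 1) *
        S.op N (some i) (S.fluxDensity ρ jx w i) x| ≤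
      4 * (∫ x in S.Ω, Real.exp (-F.deriv ρ (x, S.well w)) * h.g w i x ^ 2) +
      (L ^ 2 + L) * (∫ x in S.Ω, S.density ρ w x) +
      (1 + L) / 2 * ∫ x in S.Ω, S.fluxEnergy ρ jx w i x := fun w i => by
    have h1 := abs_integral_op_div_mul_op_le (i := i) (hdens.integrable w) (h.integrable_D w i) (hJ w i)
      (h.integrable_fisherBound (L := L) hp hρ w i) (h.integrable_flux w i) (hdens.nonneg w)
      (Eventually.of_forall (h.fisherBound_nonneg w i))
      (Eventually.of_forall (fluxEnergy_nonneg w i)) (h.D_sq_le hp hL w i)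
      (Eventually.of_forall fun x => (fluxDensity_sq w i x).le) hδ N
    have h2 := abs_integral_fderiv_mul_op_le (i := i)
      (hL _ (isNodeProb_stateMeasure_mollify hp hρ N) w) (hJ w i) N
    have h3 : ∫ x in S.Ω, h.fisherBound L w i x =
        8 * (∫ x in S.Ω, Real.exp (-F.deriv ρ (x, S.well w)) * h.g w i x ^ 2) +
          2 * L ^ 2 * ∫ x in S.Ω, S.density ρ w x := by
      rw [← integral_const_mul, ← integral_const_mul]
      exact integral_add ((h.integrable_g w i).const_mul 8) ((hdens.integrable w).const_mul _)
    have h4 := mul_le_mul_of_nonneg_left (hJabs w i) L.2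
    rw [h3] at h1
    have hu0 : 0 ≤ ∫ x in S.Ω, S.density ρ w x := integral_nonneg (density_nonneg ρ w)
    have h5 : 0 ≤ (L:ℝ) * ∫ x in S.Ω, S.density ρ w x := mul_nonneg L.2 hu0
    refine (abs_add_le _ _).trans ((add_le_add h1 (h2.trans h4)).trans ?_)
    change _ + (L:ℝ) * _ ≤ _
    linarith
  have hdiffsum : |∑ w, S.γ w * ∑ i, ((∫ x in S.Ω, S.op N (some i) (h.D w i) x /
        (S.op N none (S.density ρ w) x + δ) * S.op N (some i) (S.fluxDensity ρ jx w i) x) +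
      ∫ x in S.Ω, fderiv ℝ (S.mollDeriv F N ρ w) x (EuclideanSpace.single i 1) *
        S.op N (some i) (S.fluxDensity ρ jx w i) x)| ≤
      4 * B + 2 * (L ^ 2 + L) * d + (1 + L) / 2 * A := by
    have h1 : ∀ w, |S.γ w * ∑ i, ((∫ x in S.Ω, S.op N (some i) (h.D w i) x /
        (S.op N none (S.density ρ w) x + δ) * S.op N (some i) (S.fluxDensity ρ jx w i) x) +
      ∫ x in S.Ω, fderiv ℝ (S.mollDeriv F N ρ w) x (EuclideanSpace.single i 1) *
        S.op N (some i) (S.fluxDensity ρ jx w i) x)| ≤ 4 * (S.γ w * ∑ i, ∫ x in S.Ω,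
          Real.exp (-F.deriv ρ (x, S.well w)) * h.g w i x ^ 2) + (L ^ 2 + L) * d +
          (1 + L) / 2 * (S.γ w * ∑ i, ∫ x in S.Ω, S.fluxEnergy ρ jx w i x) := fun w => by
      rw [abs_mul, abs_of_pos (S.γ_pos w)]
      refine (mul_le_mul_of_nonneg_left ((Finset.abs_sum_le_sum_abs _ _).trans
        (Finset.sum_le_sum fun i _ => hdiff w i)) (S.γ_pos w).le).trans ?_
      rw [Finset.sum_add_distrib, Finset.sum_add_distrib, Finset.sum_const, ← Finset.mul_sum,
        ← Finset.mul_sum, Finset.card_univ, Fintype.card_fin, nsmul_eq_mul]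
      have h2 := mul_le_mul_of_nonneg_left (hdens.γ_mul_integral_le w)
        (show 0 ≤ ((L:ℝ) ^ 2 + L) * d by positivity)
      nlinarith
    refine (Finset.abs_sum_le_sum_abs _ _).trans
      ((Finset.sum_le_sum fun w _ => h1 w).trans (le_of_eq ?_))
    rw [Finset.sum_add_distrib, Finset.sum_add_distrib, Finset.sum_const, Finset.card_univ,
      Fintype.card_bool, nsmul_eq_mul, ← Finset.mul_sum, ← Finset.mul_sum]
    push_cast
    ring
  -- the jumps
  have hrabs : ∫ x in S.Ω, |S.jumpDensity jbar x| ≤ Y + K * κ * m := by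
    have i2 : IntegrableOn (fun x => K * κ * (S.density ρ false x + S.density ρ true x)) S.Ω :=
      ((hdens.integrable false).add (hdens.integrable true)).const_mul _
    have h1 : ∫ x in S.Ω, |S.jumpDensity jbar x| ≤
        ∫ x in S.Ω, (h.c x + K * κ * (S.density ρ false x + S.density ρ true x)) := by
      refine integral_mono_ae hr.abs (h.integrable_c.add i2) ?_
      filter_upwards [h.abs_jump_mul_le_sqrt hp hM] with x hx
      have h2 : |S.jumpDensity jbar x * 1| ≤ h.c x + K *
        Real.sqrt (S.density ρ false x * S.density ρ true x) * κ := hx 1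
      rw [mul_one, mul_right_comm] at h2
      refine h2.trans (add_le_add le_rfl (mul_le_mul_of_nonneg_left ?_ (mul_nonneg hK hκ)))
      have h3 := density_nonneg (S := S) ρ false x
      have h4 := density_nonneg (S := S) ρ true x
      refine Real.sqrt_le_iff.2 ⟨add_nonneg h3 h4, ?_⟩
      nlinarith [mul_nonneg h3 h4]
    rw [integral_add h.integrable_c i2, integral_const_mul, integral_add (hdens.integrable false)
      (hdens.integrable true)] at h1
    exact h1.trans (add_le_add le_rfl (mul_le_mul_of_nonneg_left hmass' (mul_nonneg hK hκ)))
  have hj1 := abs_integral_log_op_mul_op_le hr h.integrable_c (hdens.integrable false)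
    (hdens.integrable true) (hdens.nonneg false) (hdens.nonneg true) hK
    (h.abs_jump_mul_le_sqrt hp hM) hδ N
  have hj2 : |∫ x in S.Ω, (S.mollDeriv F N ρ true x - S.mollDeriv F N ρ false x) *
        S.op N none (S.jumpDensity jbar) x| ≤ 2 * |M| * (Y + K * κ * m) := by
    refine le_trans ?_ (mul_le_mul_of_nonneg_left
      ((integral_abs_op_le (N := N) (o := none) hr).trans hrabs) (by positivity))
    rw [← integral_const_mul]
    refine norm_integral_le_of_norm_le (f := fun x => (S.mollDeriv F N ρ true x -
      S.mollDeriv F N ρ false x) * S.op N none (S.jumpDensity jbar) x)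
      ((integrableOn_op hr).abs.const_mul _) ?_
    filter_upwards [ae_restrict_mem S.measurableSet_Ω] with x hx
    rw [norm_mul]
    refine mul_le_mul_of_nonneg_right ((norm_sub_le _ _).trans ?_) (abs_nonneg _)
    have hn := isNodeProb_stateMeasure_mollify hp hρ N
    have h1 := (hM _ hn _ (S.mem_nodes hx true)).trans (le_abs_self M)
    have h2 := (hM _ hn _ (S.mem_nodes hx false)).trans (le_abs_self M)
    rw [two_mul]
    exact add_le_add h1 h2
  rw [h.mollRate_eq hp hρ hδ]
  refine (abs_add_le _ _).trans ((add_le_add hdiffsum ((abs_add_le _ _).trans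
    (add_le_add hj1 hj2))).trans ?_)
  have e1 : (1 + (L:ℝ)) / 2 * A ≤ (1 + L) * S.mΩ * R := by
    have := mul_le_mul_of_nonneg_left hAR (show 0 ≤ (1 + (L:ℝ)) / 2 by positivity)
    linarith
  have e2 : 4 * B ≤ 2 / S.mΩ * R := by
    have : R / (2 * S.mΩ) = 2 / S.mΩ * R / 4 := by field_simp; ring
    linarith
  have e3 : 2 * K * ((∫ x in S.Ω, S.density ρ false x) + (∫ x in S.Ω, S.density ρ true x) +
      2 * δ * S.volΩ) ≤ 2 * K * (m + 2 * S.volΩ) := by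
    refine mul_le_mul_of_nonneg_left (add_le_add hmass' ?_) (by positivity)
    nlinarith
  have e4 : 2 * |M| * (Y + K * κ * m) ≤ 2 * |M| * ((1 + K * κ * m) * (R + 1)) := by
    refine mul_le_mul_of_nonneg_left ?_ (by positivity)
    have : 0 ≤ K * κ * m * R := by positivity
    nlinarith
  have e5 : 0 ≤ (1 + (L:ℝ)) * S.mΩ := by positivity
  have e6 : 0 ≤ 2 / S.mΩ := by positivity
  have e7 : 0 ≤ 2 * ((L:ℝ) ^ 2 + L) * d * R := by positivity
  have e8 : 0 ≤ 2 * K * (m + 2 * S.volΩ) * R := by positivity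
  linarith

end

end Setting


/-! ### Elementary inequalities for the entropy density -/

section

open InformationTheory

/-- Convexity: the left side is the tangent at `x`, of slope `log x`. The end point `y = 0` is
separate because the proof divides by `y`. -/
lemma klFun_add_log_mul_sub_le {x y : ℝ} (hx : 0 < x) (hy : 0 ≤ y) :
    klFun x + Real.log x * (y - x) ≤ klFun y := by
  rcases hy.eq_or_lt with rfl | hy
  · simp only [klFun]
    linarith
  · have h := Real.log_le_sub_one_of_pos (div_pos hx hy)
    rw [Real.log_div hx.ne' hy.ne'] at h
    have h2 := mul_le_mul_of_nonneg_left h hy.le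
    rw [mul_sub, mul_sub, mul_div_cancel₀ _ hy.ne'] at h2
    simp only [klFun]
    linarith

/-- The tangent at `u + δ`, evaluated at `u`, combined with `log z ≤ z - 1`. -/
lemma klFun_add_le {u δ : ℝ} (hu : 0 ≤ u) (hδ : 0 < δ) :
    klFun (u + δ) ≤ klFun u + δ * (u + δ) := by
  have h0 : 0 < u + δ := by linarith
  have h1 := klFun_add_log_mul_sub_le h0 hu
  have h2 := Real.log_le_sub_one_of_pos h0
  nlinarith

/-- On `[0, 1]` the entropy density decreases but is at most one, and beyond it increases; the
summand `1` covers the first range. -/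
lemma klFun_le_klFun_add_one {u : ℝ} (hu : 0 ≤ u) : klFun u ≤ klFun (u + 1) + 1 := by
  have h3 := klFun_nonneg (show 0 ≤ u + 1 by linarith)
  rcases le_total u 1 with h | h
  · have h2 := Real.mul_log_nonpos hu h
    have : klFun u = u * Real.log u + 1 - u := rfl
    linarith
  · have h1 := klFun_add_log_mul_sub_le (x := u) (y := u + 1) (by linarith) (by linarith)
    have h2 := Real.log_nonneg h
    linarith

/-- The tangent at `e^b`, that is, Young's inequality with the conjugate function `e^b - 1`. Large
`b` will give uniform integrability. -/
lemma mul_le_klFun_add (b : ℝ) {x : ℝ} (hx : 0 ≤ x) : b * x ≤ klFun x + (Real.exp b - 1) := by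
  have h := klFun_add_log_mul_sub_le (Real.exp_pos b) hx
  rw [Real.log_exp, klFun_apply, Real.log_exp] at h
  linarith

end

namespace Setting

variable {d : ℕ} {S : Setting d}

/-! ### The entropy of mollified densities -/

section

open InformationTheory

variable {u : Space d → ℝ} (hu : IntegrableOn u S.Ω) (hu0 : ∀ x, 0 ≤ u x)

include hu hu0

lemma integrableOn_klFun_add (hk : IntegrableOn (fun x => klFun (u x)) S.Ω) {δ : ℝ}
    (hδ : 0 < δ) : IntegrableOn (fun x => klFun (u x + δ)) S.Ω := by
  have i1 : IntegrableOn (fun _ : Space d => δ) S.Ω := S.integrableOn_of_continuous continuous_const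
  refine (hk.add ((hu.add i1).const_mul δ)).mono'
    (measurable_klFun.comp_aemeasurable
      (hu.aestronglyMeasurable.aemeasurable.add_const δ)).aestronglyMeasurable
    (Eventually.of_forall fun x => ?_)
  rw [Real.norm_of_nonneg (klFun_nonneg (add_nonneg (hu0 x) hδ.le))]
  exact klFun_add_le (hu0 x) hδ

/-- Jensen's inequality: the tangent at the averaged value `X` lies below the function, and
averaging with a positive kernel of mass one turns the tangent into its value at `X`. -/
lemma klFun_op_add_le (hk : IntegrableOn (fun x => klFun (u x)) S.Ω) {δ : ℝ} (hδ : 0 < δ) (N : ℕ)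
    (x : Space d) :
    klFun (S.op N none u x + δ) ≤ S.op N none (fun y => klFun (u y + δ)) x := by
  set X := S.op N none u x + δ with hX
  have hX0 : 0 < X := add_pos_of_nonneg_of_pos (op_none_nonneg (Eventually.of_forall hu0) x) hδ
  have i0 : IntegrableOn (fun _ : Space d => klFun X + Real.log X * (δ - X)) S.Ω :=
    S.integrableOn_of_continuous continuous_const
  have i1 : IntegrableOn (fun y => Real.log X * u y) S.Ω := hu.const_mul _
  have i2 : IntegrableOn (fun y => klFun X + Real.log X * (δ - X) + Real.log X * u y) S.Ω :=
    i0.add i1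
  have h1 := op_none_mono (N := N) i2 (integrableOn_klFun_add hu hu0 hk hδ)
    (Eventually.of_forall fun y => by
      have := klFun_add_log_mul_sub_le hX0 (add_nonneg (hu0 y) hδ.le)
      linarith) x
  rw [op_add i0 i1, op_none_const, op_const_mul] at h1
  refine le_trans (le_of_eq ?_) h1
  rw [hX]
  ring

lemma tendsto_integral_klFun_op_add (hk : IntegrableOn (fun x => klFun (u x)) S.Ω) {δ : ℝ}
    (hδ : 0 < δ) : Tendsto (fun N => ∫ x in S.Ω, klFun (S.op N none u x + δ)) atTop
      (𝓝 (∫ x in S.Ω, klFun (u x + δ))) := by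
  refine tendsto_integral_of_op (ι := Fin 2) ![none, none]
    (h := ![u, fun y => klFun (u y + δ)]) (g := fun _ => 0) (C := 1) ?_ zero_le_one (fun N => ?_)
    (S.integrableOn_of_continuous continuous_const) (fun N => ?_) ?_
  · intro k
    fin_cases k
    exacts [hu, integrableOn_klFun_add hu hu0 hk hδ]
  · exact (continuous_klFun.comp ((continuous_op hu).add continuous_const)).aestronglyMeasurable
  · refine Eventually.of_forall fun x => ?_
    rw [Fin.sum_univ_two, abs_of_nonneg (klFun_nonneg
      (add_nonneg (op_none_nonneg (Eventually.of_forall hu0) x) hδ.le))]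
    simp only [Matrix.cons_val]
    linarith [klFun_op_add_le hu hu0 hk hδ N x, abs_nonneg (S.op N none u x),
      le_abs_self (S.op N none (fun y => klFun (u y + δ)) x)]
  · refine Eventually.of_forall fun x ns _ hns => ?_
    have h0 := hns 0
    simp only [Matrix.cons_val] at h0
    exact (continuous_klFun.tendsto _).comp (h0.add_const δ)

lemma tendsto_integral_klFun_add (hk : IntegrableOn (fun x => klFun (u x)) S.Ω) {δ : ℕ → ℝ}
    (hδ : ∀ n, 0 < δ n) (hδ1 : ∀ n, δ n ≤ 1) (hδ0 : Tendsto δ atTop (𝓝 0)) :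
    Tendsto (fun n => ∫ x in S.Ω, klFun (u x + δ n)) atTop (𝓝 (∫ x in S.Ω, klFun (u x))) := by
  have i1 : IntegrableOn (fun _ : Space d => (1:ℝ)) S.Ω :=
    S.integrableOn_of_continuous continuous_const
  refine tendsto_integral_of_dominated_convergence (fun x => klFun (u x) + (u x + 1))
    (fun n => (integrableOn_klFun_add hu hu0 hk (hδ n)).aestronglyMeasurable) (hk.add (hu.add i1))
    (fun n => Eventually.of_forall fun x => ?_) (Eventually.of_forall fun x => ?_)
  · rw [Real.norm_of_nonneg (klFun_nonneg (add_nonneg (hu0 x) (hδ n).le))]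
    have h1 := klFun_add_le (hu0 x) (hδ n)
    nlinarith [hu0 x, hδ n, hδ1 n]
  · have := (continuous_klFun.tendsto (u x + 0)).comp (hδ0.const_add (u x))
    rwa [add_zero] at this

/-- Truncated at height `k` the integrands are bounded, so the bound survives `N → ∞`; monotone
convergence then removes the truncation, and a crude comparison removes the shift by one. -/
lemma integrableOn_klFun_of_bound {B : ℝ} (hB : ∀ N, ∫ x in S.Ω, klFun (S.op N none u x + 1) ≤ B) :
    IntegrableOn (fun x => klFun (u x)) S.Ω := by
  have i1 : IntegrableOn (fun _ : Space d => (1:ℝ)) S.Ω :=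
    S.integrableOn_of_continuous continuous_const
  have hm : AEMeasurable (fun x => klFun (u x + 1)) (volume.restrict S.Ω) :=
    measurable_klFun.comp_aemeasurable (hu.aestronglyMeasurable.aemeasurable.add_const 1)
  have h0 : ∀ x, 0 ≤ klFun (u x + 1) := fun x => klFun_nonneg (add_nonneg (hu0 x) zero_le_one)
  have hop0 : ∀ N x, 0 ≤ klFun (S.op N none u x + 1) := fun N x =>
    klFun_nonneg (add_nonneg (op_none_nonneg (Eventually.of_forall hu0) x) zero_le_one)
  have hopc : ∀ N, Continuous fun x => klFun (S.op N none u x + 1) := fun N =>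
    continuous_klFun.comp ((continuous_op hu).add continuous_const)
  have hmin0 : ∀ k : ℕ, ∀ y, 0 ≤ y → 0 ≤ min y (k:ℝ) := fun k y hy => le_min hy k.cast_nonneg
  have hk : ∀ k : ℕ, ∫⁻ x in S.Ω, ENNReal.ofReal (min (klFun (u x + 1)) k) ≤ ENNReal.ofReal B := by
    intro k
    have ik : IntegrableOn (fun _ : Space d => (k:ℝ)) S.Ω :=
      S.integrableOn_of_continuous continuous_const
    have ht : Tendsto (fun N => ∫ x in S.Ω, min (klFun (S.op N none u x + 1)) k) atTop
        (𝓝 (∫ x in S.Ω, min (klFun (u x + 1)) k)) := by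
      refine tendsto_integral_of_op (ι := Unit) (fun _ => none) (h := fun _ => u)
        (g := fun _ => (k:ℝ)) (C := 0) (fun _ => hu) le_rfl
        (fun N => ((hopc N).min continuous_const).aestronglyMeasurable) ik
        (fun N => Eventually.of_forall fun x => ?_) (Eventually.of_forall fun x ns _ hns => ?_)
      · rw [zero_mul, add_zero, abs_of_nonneg (hmin0 k _ (hop0 N x))]
        exact min_le_right _ _
      · exact ((continuous_klFun.tendsto _).comp ((hns ()).add_const 1)).min tendsto_const_nhds
    rw [← ofReal_integral_eq_lintegral_ofReal]
    · refine ENNReal.ofReal_le_ofReal (le_of_tendsto' ht fun N => le_trans ?_ (hB N))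
      exact integral_mono (S.integrableOn_of_continuous ((hopc N).min continuous_const))
        (S.integrableOn_of_continuous (hopc N)) fun x => min_le_left _ _
    · refine ik.mono' (hm.min aemeasurable_const).aestronglyMeasurable
        (Eventually.of_forall fun x => ?_)
      rw [Real.norm_of_nonneg (hmin0 k _ (h0 x))]
      exact min_le_right _ _
    · exact Eventually.of_forall fun x => hmin0 k _ (h0 x)
  have hfin : ∫⁻ x in S.Ω, ENNReal.ofReal (klFun (u x + 1)) ≤ ENNReal.ofReal B := by
    refine le_of_tendsto' (lintegral_tendsto_of_tendsto_of_monotone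
      (fun k => (hm.min (aemeasurable_const (b := (k:ℝ)))).ennreal_ofReal)
      (Eventually.of_forall fun x k l hkl => ?_) (Eventually.of_forall fun x => ?_)) hk
    · exact ENNReal.ofReal_le_ofReal (min_le_min_left _ (Nat.cast_le.2 hkl))
    · refine tendsto_const_nhds.congr' ?_
      filter_upwards [eventually_ge_atTop ⌈klFun (u x + 1)⌉₊] with k hk
      rw [min_eq_left ((Nat.le_ceil _).trans (Nat.cast_le.2 hk))]
  have hi : IntegrableOn (fun x => klFun (u x + 1)) S.Ω :=
    (lintegral_ofReal_ne_top_iff_integrable hm.aestronglyMeasurable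
      (Eventually.of_forall h0)).1 (ne_top_of_le_ne_top ENNReal.ofReal_ne_top hfin)
  refine (hi.add i1).mono' (measurable_klFun.comp_aemeasurable
    hu.aestronglyMeasurable.aemeasurable).aestronglyMeasurable (Eventually.of_forall fun x => ?_)
  rw [Real.norm_of_nonneg (klFun_nonneg (hu0 x))]
  exact klFun_le_klFun_add_one (hu0 x)

end

section

open InformationTheory

variable {ρ : Measure (Space d × ℝ)} (hp : S.IsNodeProb ρ)

include hp

/-- A bound for the entropy of the mollifications gives uniform integrability. -/
lemma measure_wellSet_inter_le (w : Bool) {B : ℝ}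
    (hB : ∀ N, S.γ w * ∫ x in S.Ω, klFun (S.mollify N ρ w x + 1) ≤ B) {G : Set (Space d)}
    (hG : IsOpen G) {b : ℝ} (hb : 0 < b) :
    ρ (S.wellSet w ∩ Prod.fst ⁻¹' G) ≤
      ENNReal.ofReal ((B + S.γ w * (Real.exp b - 1) * (volume.restrict S.Ω).real G) / b) := by
  have hprob := hp.1
  set ν : Measure (Space d) := (ρ.restrict (S.wellSet w)).map Prod.fst with hν
  have hνG : ν G = ρ (S.wellSet w ∩ Prod.fst ⁻¹' G) := by
    rw [hν, Measure.map_apply measurable_fst hG.measurableSet,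
      Measure.restrict_apply (measurable_fst hG.measurableSet), inter_comm]
  rw [← hνG]
  refine le_of_forall_lt fun r hr => ?_
  obtain ⟨K, hKG, hK, hrK⟩ := hG.exists_lt_isCompact hr
  refine hrK.trans_le ?_
  set X := (B + S.γ w * (Real.exp b - 1) * (volume.restrict S.Ω).real G) / b with hX
  -- By inner regularity it suffices to treat a compact subset `K` of `G`, and `φ` lies between the
  -- indicators of `K` and `G`.
  obtain ⟨φ, hφ0, hφ1, hφ⟩ := exists_continuous_zero_one_of_isClosed hG.isClosed_compl hK.isClosed
    (disjoint_left.2 fun x hx hx' => hx (hKG hx'))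
  have hφc : Continuous fun x => φ x := φ.continuous
  have hφG : ∀ x, φ x ≤ G.indicator (fun _ => (1:ℝ)) x := fun x => by
    by_cases hx : x ∈ G
    · rw [indicator_of_mem hx]; exact (hφ x).2
    · rw [indicator_of_notMem hx]; exact (hφ0 hx).le
  have hφi : Integrable (fun z : Space d × ℝ => φ z.1) (ρ.restrict (S.wellSet w)) :=
    (hp.integrable_comp_fst hφc).restrict
  have hφΩ : IntegrableOn (fun x => φ x) S.Ω := S.integrableOn_of_continuous hφc
  have hKm : MeasurableSet (S.wellSet w ∩ Prod.fst ⁻¹' K) :=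
    (measurableSet_wellSet w).inter (measurable_fst hK.measurableSet)
  have h1 : ρ.real (S.wellSet w ∩ Prod.fst ⁻¹' K) ≤ ∫ z in S.wellSet w, φ z.1 ∂ρ := by
    have e : ρ.real (S.wellSet w ∩ Prod.fst ⁻¹' K) =
        ∫ z in S.wellSet w, (Prod.fst ⁻¹' K).indicator (fun _ => (1:ℝ)) z ∂ρ := by
      rw [setIntegral_indicator (measurable_fst hK.measurableSet), setIntegral_const, smul_eq_mul,
        mul_one]
    rw [e]
    refine integral_mono ((integrable_const (1:ℝ)).indicator (measurable_fst hK.measurableSet))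
      hφi fun z => ?_
    by_cases hz : z.1 ∈ K
    · rw [indicator_of_mem (show z ∈ Prod.fst ⁻¹' K from hz)]; exact (hφ1 hz).ge
    · rw [indicator_of_notMem (show z ∉ Prod.fst ⁻¹' K from hz)]; exact (hφ z.1).1
  -- Young's inequality for the mollified density on `G`: the entropy costs at most `B` and the
  -- constant `e^b - 1` is integrated over `G` only.
  have h2 : ∀ N, S.γ w * ∫ x in S.Ω, φ x * S.mollify N ρ w x ≤ X := fun N => by
    have hU := continuous_mollify hp N w
    have i1 : IntegrableOn (fun x => klFun (S.mollify N ρ w x + 1)) S.Ω :=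
      S.integrableOn_of_continuous (continuous_klFun.comp (hU.add continuous_const))
    have i2 : IntegrableOn (fun x => (Real.exp b - 1) * G.indicator (fun _ => (1:ℝ)) x) S.Ω :=
      ((S.integrableOn_of_continuous continuous_const).indicator hG.measurableSet).const_mul _
    have h3 : ∫ x in S.Ω, φ x * S.mollify N ρ w x ≤
        ∫ x in S.Ω, (klFun (S.mollify N ρ w x + 1) +
          (Real.exp b - 1) * G.indicator (fun _ => (1:ℝ)) x) / b := by
      refine integral_mono (S.integrableOn_of_continuous (hφc.fun_mul hU))
        ((i1.add i2).div_const b) fun x => ?_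
      simp only
      rw [le_div_iff₀ hb]
      have hu := mollify_nonneg (S := S) N ρ w x
      have h4 := mul_le_klFun_add b (add_nonneg hu zero_le_one)
      have h5 := klFun_nonneg (add_nonneg hu zero_le_one)
      have h6 : 0 ≤ Real.exp b - 1 := by linarith [Real.add_one_le_exp b]
      have h7 := mul_le_mul_of_nonneg_left (hφG x) h6
      obtain ⟨h8, h9⟩ := hφ x
      have h10 := mul_le_mul_of_nonneg_left h4 h8
      have h11 : φ x * klFun (S.mollify N ρ w x + 1) ≤ klFun (S.mollify N ρ w x + 1) :=
        mul_le_of_le_one_left h5 h9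
      have h12 : 0 ≤ φ x * b := mul_nonneg h8 hb.le
      nlinarith
    rw [integral_div, integral_add i1 i2, integral_const_mul, integral_indicator hG.measurableSet,
      setIntegral_const, smul_eq_mul, mul_one] at h3
    refine (mul_le_mul_of_nonneg_left h3 (S.γ_pos w).le).trans ?_
    rw [hX, mul_div_assoc', mul_add, mul_assoc (S.γ w)]
    exact div_le_div_of_nonneg_right (add_le_add (hB N) le_rfl) hb.le
  -- The bound passes from the mollifications to `ρ`, because the mollifications of `φ` converge
  -- uniformly; this needs no density of `ρ`.
  have h3 : ∫ z in S.wellSet w, φ z.1 ∂ρ ≤ X := by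
    refine le_of_forall_pos_le_add fun ε hε => ?_
    obtain ⟨N, hN⟩ := (eventually_abs_op_none_sub_le (S := S) hφc.continuousOn hε).exists
    have h4 := integral_mul_mollify hp N w hφΩ
    have i3 : Integrable (fun z : Space d × ℝ => S.op N none (fun x => φ x) z.1)
        (ρ.restrict (S.wellSet w)) := (hp.integrable_comp_fst (continuous_op hφΩ)).restrict
    have h5 : ∫ z in S.wellSet w, φ z.1 ∂ρ ≤
        ∫ z in S.wellSet w, (S.op N none (fun x => φ x) z.1 + ε) ∂ρ := by
      refine integral_mono_ae hφi (i3.add (integrable_const ε)) ?_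
      filter_upwards [ae_restrict_of_ae hp.ae_mem] with z hz
      have := (abs_le.1 (hN z.1 hz.1)).1
      linarith
    rw [integral_add i3 (integrable_const ε), ← h4, setIntegral_const, smul_eq_mul] at h5
    have h6 : ρ.real (S.wellSet w) * ε ≤ ε := mul_le_of_le_one_left hε.le measureReal_le_one
    linarith [h2 N]
  rw [hν, Measure.map_apply measurable_fst hK.measurableSet,
    Measure.restrict_apply (measurable_fst hK.measurableSet), inter_comm]
  rw [← ofReal_measureReal]
  exact ENNReal.ofReal_le_ofReal (h1.trans h3)

/-- The argument of de la Vallée-Poussin: a large `b` makes the share of the entropy small, and for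
this `b` a null set has open neighbourhoods so small that the exponential term is harmless. -/
lemma absolutelyContinuous_of_klFun_mollify_le (hw : S.InWells ρ) {B : ℝ}
    (hB : ∀ w N, S.γ w * ∫ x in S.Ω, klFun (S.mollify N ρ w x + 1) ≤ B) : ρ ≪ S.π₀ := by
  have hprob := hp.1
  have hB0 : 0 ≤ B := (mul_nonneg (S.γ_pos true).le (integral_nonneg fun x => klFun_nonneg
    (add_nonneg (mollify_nonneg 0 ρ true x) zero_le_one))).trans (hB true 0)
  -- null sets in one well
  have hnull : ∀ w, ∀ A : Set (Space d), volume.restrict S.Ω A = 0 →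
      ρ (S.wellSet w ∩ Prod.fst ⁻¹' A) = 0 := by
    intro w A hA
    refine le_antisymm (ENNReal.le_of_forall_pos_le_add fun ε hε _ => ?_) zero_le
    rw [zero_add]
    -- With this `b` and `|G| ≤ 1 / (γ (e^b - 1))` the bound is at most `(B + 1) / b = ε / 2`.
    set b : ℝ := 2 * (B + 1) / ε with hb
    have hε' : (0:ℝ) < ε := hε
    have hb0 : 0 < b := by positivity
    have hexp : 0 < Real.exp b - 1 := by linarith [Real.add_one_le_exp b]
    have hη : 0 < 1 / (S.γ w * (Real.exp b - 1)) :=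
      one_div_pos.2 (mul_pos (S.γ_pos w) hexp)
    obtain ⟨G, hAG, hG, hGη⟩ := Set.exists_isOpen_lt_of_lt A (μ := volume.restrict S.Ω)
      (ENNReal.ofReal (1 / (S.γ w * (Real.exp b - 1)))) (by rw [hA]; simpa using hη)
    refine (measure_mono (inter_subset_inter_right _ (preimage_mono hAG))).trans
      ((measure_wellSet_inter_le hp w (hB w) hG hb0).trans ?_)
    rw [← ENNReal.ofReal_coe_nnreal]
    refine ENNReal.ofReal_le_ofReal ?_
    have h1 : (volume.restrict S.Ω).real G ≤ 1 / (S.γ w * (Real.exp b - 1)) :=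
      ENNReal.toReal_le_of_le_ofReal hη.le hGη.le
    have h2 : S.γ w * (Real.exp b - 1) * (volume.restrict S.Ω).real G ≤ 1 := by
      rw [le_div_iff₀ (mul_pos (S.γ_pos w) hexp)] at h1
      linarith
    rw [div_le_iff₀ hb0]
    have h3 : (ε:ℝ) * b = 2 * (B + 1) := by
      rw [hb]; field_simp
    rw [h3]
    linarith
  refine Measure.AbsolutelyContinuous.mk fun A hA h0 => ?_
  have h1 := S.lintegral_π₀ (A.indicator 1)
  rw [lintegral_indicator_one hA, h0] at h1
  have h2 : ∀ w, volume.restrict S.Ω ((fun x => (x, S.well w)) ⁻¹' A) = 0 := fun w => by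
    have h3 := (Finset.sum_eq_zero_iff.1 h1.symm) w (Finset.mem_univ w)
    have h4 : ∀ x : Space d, A.indicator (1 : Space d × ℝ → ℝ≥0∞) (x, S.well w) =
        ((fun x => (x, S.well w)) ⁻¹' A).indicator 1 x := fun x => rfl
    simp only [h4] at h3
    rw [lintegral_indicator_one ((S.measurableEmbedding_well w).measurable hA)] at h3
    exact (mul_eq_zero.1 h3).resolve_left (by simpa using S.γ_pos w)
  have h3 : ρ (⋃ w, S.wellSet w ∩ Prod.fst ⁻¹' ((fun x => (x, S.well w)) ⁻¹' A)) = 0 :=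
    measure_iUnion_null fun w => hnull w _ (h2 w)
  have hw' : ∀ᵐ z ∂ρ, z ∈ A → z ∈ ⋃ w, S.wellSet w ∩
      Prod.fst ⁻¹' ((fun x => (x, S.well w)) ⁻¹' A) := by
    refine Eventually.mono (show ∀ᵐ z ∂ρ, _ from hw) fun z hz hzA => ?_
    have key : ∀ w, z.2 = S.well w → z ∈ ⋃ w, S.wellSet w ∩
        Prod.fst ⁻¹' ((fun x => (x, S.well w)) ⁻¹' A) := fun w hzw => by
      refine mem_iUnion.2 ⟨w, ⟨mem_univ _, hzw⟩, ?_⟩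
      change (z.1, S.well w) ∈ A
      rw [← hzw]
      exact hzA
    exact hz.elim (key _) (key _)
  exact measure_mono_null_ae hw' h3

/-- The energy of a state with integrable entropy density. -/
lemma energy_eq_freeEnergy (F : S.Tilt) (hρ : ρ ≪ S.π₀)
    (hk : ∀ w, IntegrableOn (fun x => klFun (S.density ρ w x)) S.Ω) :
    S.energy F ρ = ((S.freeEnergy F 0 (S.density ρ) : ℝ) : EReal) := by
  have hprob := hp.1
  have h0 : ∀ w x, 0 ≤ klFun (S.density ρ w x) := fun w x => klFun_nonneg (density_nonneg ρ w x)
  have h1 : klDiv ρ S.π₀ =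
      ENNReal.ofReal (∑ w, S.γ w * ∫ x in S.Ω, klFun (S.density ρ w x)) := by
    rw [klDiv_eq_lintegral_klFun_of_ac hρ, lintegral_π₀, ENNReal.ofReal_sum_of_nonneg
      fun w _ => mul_nonneg (S.γ_pos w).le (integral_nonneg (h0 w))]
    refine Finset.sum_congr rfl fun w _ => ?_
    rw [ENNReal.ofReal_mul (S.γ_pos w).le, ofReal_integral_eq_lintegral_ofReal (hk w)
      (Eventually.of_forall (h0 w))]
    rfl
  rw [energy, h1, freeEnergy, stateMeasure_density hρ, EReal.coe_add]
  congr 1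
  rw [EReal.coe_ennreal_ofReal, max_eq_left
    (Finset.sum_nonneg fun w _ => mul_nonneg (S.γ_pos w).le (integral_nonneg (h0 w)))]
  simp only [add_zero]

lemma of_energy_lt_top (F : S.Tilt) (h : S.energy F ρ < ⊤) : ρ ≪ S.π₀ ∧
    ∀ w, IntegrableOn (fun x => klFun (S.density ρ w x)) S.Ω := by
  have hprob := hp.1
  have h1 : klDiv ρ S.π₀ ≠ ⊤ := fun h1 => by
    rw [energy, h1] at h
    simp at h
  have hac : ρ ≪ S.π₀ := (klDiv_ne_top_iff.1 h1).1
  refine ⟨hac, fun w => ?_⟩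
  rw [klDiv_eq_lintegral_klFun_of_ac hac, lintegral_π₀] at h1
  have h2 := (ENNReal.sum_lt_top.1 (lt_top_iff_ne_top.2 h1)) w (Finset.mem_univ w)
  refine (lintegral_ofReal_ne_top_iff_integrable
    (measurable_klFun.comp (measurable_density ρ w)).aestronglyMeasurable
    (Eventually.of_forall fun x => klFun_nonneg (density_nonneg ρ w x))).1 fun h3 => ?_
  change ENNReal.ofReal (S.γ w) * ∫⁻ x in S.Ω, ENNReal.ofReal (klFun (S.density ρ w x)) < ⊤ at h2
  have h4 : ∫⁻ x in S.Ω, ENNReal.ofReal (klFun (S.density ρ w x)) = ⊤ := h3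
  rw [h4, ENNReal.mul_top (by simpa using S.γ_pos w)] at h2
  exact lt_irrefl _ h2

lemma tendsto_toFun_mollify (F : S.Tilt) (hρ : ρ ≪ S.π₀) :
    Tendsto (fun N => F.toFun (S.stateMeasure (S.mollify N ρ))) atTop
      (𝓝 (F.toFun (S.stateMeasure (S.density ρ)))) := by
  obtain ⟨M, -, hM⟩ := exists_abs_toFun_sub_le_l1Dist F
  have h := (tendsto_l1Dist_mollify hp hρ).const_mul M
  rw [mul_zero] at h
  rw [tendsto_iff_norm_sub_tendsto_zero]
  exact squeeze_zero (fun N => norm_nonneg _) (fun N => hM _ _ (isDensity_density hp hρ)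
    (isDensity_mollify hp (hρ.ae_le inWells_π₀) N)) h

lemma tendsto_freeEnergy_mollify (F : S.Tilt) (hρ : ρ ≪ S.π₀)
    (hk : ∀ w, IntegrableOn (fun x => klFun (S.density ρ w x)) S.Ω) {δ : ℝ} (hδ : 0 < δ) :
    Tendsto (fun N => S.freeEnergy F δ (S.mollify N ρ)) atTop
      (𝓝 (S.freeEnergy F δ (S.density ρ))) := by
  refine Tendsto.add (tendsto_finsetSum _ fun w _ => Tendsto.const_mul _ ?_)
    (tendsto_toFun_mollify hp F hρ)
  simp only [mollify_eq_op hp hρ]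
  exact tendsto_integral_klFun_op_add (integrableOn_density hp hρ w) (density_nonneg ρ w) (hk w) hδ

lemma tendsto_freeEnergy_zero (F : S.Tilt) (hρ : ρ ≪ S.π₀)
    (hk : ∀ w, IntegrableOn (fun x => klFun (S.density ρ w x)) S.Ω) {δ : ℕ → ℝ}
    (hδ : ∀ n, 0 < δ n) (hδ1 : ∀ n, δ n ≤ 1) (hδ0 : Tendsto δ atTop (𝓝 0)) :
    Tendsto (fun n => S.freeEnergy F (δ n) (S.density ρ)) atTop
      (𝓝 (S.freeEnergy F 0 (S.density ρ))) := by
  refine Tendsto.add_const _ (tendsto_finsetSum _ fun w _ => Tendsto.const_mul _ ?_)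
  simp only [add_zero]
  exact tendsto_integral_klFun_add (integrableOn_density hp hρ w) (density_nonneg ρ w) (hk w)
    hδ hδ1 hδ0

end

end Setting


/-- A reverse Fatou lemma for integrals of functions that need not be measurable. -/
lemma exists_measurable_limsup_enorm_integral_le {α : Type*} [MeasurableSpace α] {μ : Measure α}
    {r : ℕ → α → ℝ} {g : α → ℝ≥0∞} (hr : ∀ n, ∀ᵐ t ∂μ, ‖r n t‖ₑ ≤ g t) (hg : ∫⁻ t, g t ∂μ ≠ ⊤) :
    ∃ G : α → ℝ≥0∞, Measurable G ∧
      limsup (fun n => ‖∫ t, r n t ∂μ‖ₑ) atTop ≤ ∫⁻ t, G t ∂μ ∧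
      ∀ᵐ t ∂μ, G t ≤ limsup (fun n => ‖r n t‖ₑ) atTop := by
  have h1 : ∀ n, ∃ f : α → ℝ≥0∞, Measurable f ∧ ‖∫ t, r n t ∂μ‖ₑ ≤ ∫⁻ t, f t ∂μ ∧
      ∀ᵐ t ∂μ, f t ≤ ‖r n t‖ₑ := fun n => by
    -- If `r n` is not measurable, its Bochner integral is zero by convention and the zero function
    -- serves as the minorant.
    by_cases h : AEStronglyMeasurable (r n) μ
    · refine ⟨h.enorm.mk _, h.enorm.measurable_mk, ?_, ?_⟩
      · rw [← lintegral_congr_ae h.enorm.ae_eq_mk]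
        exact enorm_integral_le_lintegral_enorm _
      · filter_upwards [h.enorm.ae_eq_mk] with t ht
        exact ht.ge
    · refine ⟨0, measurable_const, ?_, Eventually.of_forall fun t => zero_le⟩
      rw [integral_undef fun hi => h hi.aestronglyMeasurable]
      simp
  choose f hf hfi hfr using h1
  refine ⟨fun t => limsup (fun n => f n t) atTop, Measurable.limsup hf, ?_, ?_⟩
  · refine le_trans (limsup_le_limsup (Eventually.of_forall hfi)) (limsup_lintegral_le g hf
      (fun n => ?_) hg)
    filter_upwards [hfr n, hr n] with t h2 h3 using h2.trans h3
  · filter_upwards [ae_all_iff.2 hfr] with t ht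
    exact limsup_le_limsup (Eventually.of_forall ht)

/-! ### Integration in time and removal of the regularization -/

namespace Setting

variable {d : ℕ} {S : Setting d}

/-- Together with the Lipschitz bound for the tilt, this bounds the oscillation of `𝓕` over all
densities. -/
lemma l1Dist_le_two {u v : Bool → Space d → ℝ} (hu : S.IsDensity u) (hv : S.IsDensity v) :
    S.l1Dist u v ≤ 2 := by
  have h : S.l1Dist u v ≤ ∑ w, S.γ w * ((∫ x in S.Ω, u w x) + ∫ x in S.Ω, v w x) := by
    refine Finset.sum_le_sum fun w _ => mul_le_mul_of_nonneg_left ?_ (S.γ_pos w).le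
    rw [← integral_add (hu.integrable w) (hv.integrable w)]
    refine integral_mono_ae ((hu.integrable w).sub (hv.integrable w)).abs
      ((hu.integrable w).add (hv.integrable w)) ?_
    filter_upwards [hu.nonneg w, hv.nonneg w] with x h1 h2
    rw [abs_le]
    constructor <;> linarith
  simp only [mul_add] at h
  rw [Finset.sum_add_distrib, hu.total, hv.total] at h
  linarith

section

open InformationTheory

variable (F : S.Tilt) {T : ℝ} (hT : 0 < T) {ρ : ℝ → Measure (Space d × ℝ)} {j : Flux d}
  (hCE : S.ContractedCE T ρ j) (hac : S.IsAC T ρ j)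
  (hD : ∫⁻ t in Icc 0 T, S.dissipationRate F (ρ t) (j.jx t) (j.jbar t) ≠ ⊤)

include hT hCE hac

lemma freeEnergy_mollify_sub_eq_setIntegral {δ : ℝ} (hδ : 0 < δ) (N : ℕ) :
    S.freeEnergy F δ (S.mollify N (ρ T)) - S.freeEnergy F δ (S.mollify N (ρ 0)) =
      ∫ t in Icc 0 T, S.mollRate F δ N (ρ t) (j.jx t) (j.jbar t) := by
  rw [freeEnergy_mollify_sub_eq_integral F hδ N hCE hT hac,
    intervalIntegral.integral_of_le hT.le, ← integral_Icc_eq_integral_Ioc]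

omit hT in
include hD in
-- A majorant in time, affine in the dissipation rate and independent of `N` and `δ`, for the
-- reverse Fatou lemma.
lemma exists_enorm_mollRate_le : ∃ g : ℝ → ℝ≥0∞, ∫⁻ t in Icc 0 T, g t ≠ ⊤ ∧
    ∀ N, ∀ δ, 0 < δ → δ ≤ 1 → ∀ᵐ t ∂volume.restrict (Icc 0 T),
      ‖S.mollRate F δ N (ρ t) (j.jx t) (j.jbar t)‖ₑ ≤ g t := by
  obtain ⟨C, hC, h⟩ := exists_abs_mollRate_le F
  -- The prefactor `C + 1` is positive, so the majorant is infinite wherever the dissipation rate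
  -- is; no bound is then needed at such times.
  refine ⟨fun t => ENNReal.ofReal (C + 1) *
    (S.dissipationRate F (ρ t) (j.jx t) (j.jbar t) + 1), ?_, fun N δ hδ hδ1 => ?_⟩
  · rw [lintegral_const_mul' _ _ ENNReal.ofReal_ne_top, lintegral_add_right _ measurable_const]
    refine ENNReal.mul_ne_top ENNReal.ofReal_ne_top (ENNReal.add_ne_top.2 ⟨hD, ?_⟩)
    simp
  · filter_upwards [hac, ae_restrict_mem measurableSet_Icc] with t ⟨hρ, _⟩ ht
    by_cases hR : S.dissipationRate F (ρ t) (j.jx t) (j.jbar t) = ⊤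
    · rw [hR, top_add, ENNReal.mul_top (by simpa using by linarith)]
      exact le_top
    · obtain ⟨hreg⟩ := nonempty_regular F (hCE.prob t ht) hρ hR
      have h1 := h (ρ t) (hCE.prob t ht) hρ _ _ _ hreg N δ hδ hδ1
      have hR0 : 0 ≤ (S.dissipationRate F (ρ t) (j.jx t) (j.jbar t)).toReal :=
        ENNReal.toReal_nonneg
      rw [← ENNReal.ofReal_toReal hR, ← ENNReal.ofReal_one, ← ENNReal.ofReal_add hR0 zero_le_one,
        ← ENNReal.ofReal_mul (by linarith), ← ofReal_norm, Real.norm_eq_abs]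
      refine ENNReal.ofReal_le_ofReal (h1.trans ?_)
      exact mul_le_mul_of_nonneg_right (by linarith) (by linarith)

include hD in
/-- Finiteness of the energy propagates along curves of finite dissipation. -/
lemma absolutelyContinuous_and_integrableOn_klFun (h0 : ρ 0 ≪ S.π₀)
    (hk0 : ∀ w, IntegrableOn (fun x => klFun (S.density (ρ 0) w x)) S.Ω) :
    ρ T ≪ S.π₀ ∧ ∀ w, IntegrableOn (fun x => klFun (S.density (ρ T) w x)) S.Ω := by
  have hpT := hCE.prob T ⟨hT.le, le_rfl⟩
  have hp0 := hCE.prob 0 ⟨le_rfl, hT.le⟩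
  have hwT := hCE.inWells hT hac T ⟨hT.le, le_rfl⟩
  obtain ⟨g, hg, hgb⟩ := exists_enorm_mollRate_le F hCE hac hD
  -- At `δ = 1` the mollified initial energies converge, hence are bounded. The balance transports
  -- this bound to time `T`, and the tilt is compared with its value at the mollification with index
  -- `0`.
  obtain ⟨A, hA⟩ := (tendsto_freeEnergy_mollify hp0 F h0 hk0 zero_lt_one).bddAbove_range
  obtain ⟨M, hM0, hM⟩ := exists_abs_toFun_sub_le_l1Dist F
  have hkl : ∀ w N, S.γ w * ∫ x in S.Ω, klFun (S.mollify N (ρ T) w x + 1) ≤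
      A + (∫⁻ t in Icc 0 T, g t).toReal -
        F.toFun (S.stateMeasure (S.mollify 0 (ρ T))) + M * 2 := fun w N => by
    have h1 := freeEnergy_mollify_sub_eq_setIntegral F hT hCE hac zero_lt_one N
    have h2 : |∫ t in Icc 0 T, S.mollRate F 1 N (ρ t) (j.jx t) (j.jbar t)| ≤
        (∫⁻ t in Icc 0 T, g t).toReal := by
      rw [← Real.norm_eq_abs, ← toReal_enorm]
      exact ENNReal.toReal_mono hg ((enorm_integral_le_lintegral_enorm _).trans
        (lintegral_mono_ae (hgb N 1 zero_lt_one le_rfl)))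
    have h3 : S.freeEnergy F 1 (S.mollify N (ρ 0)) ≤ A := hA ⟨N, rfl⟩
    have h4 := hM _ _ (isDensity_mollify hpT hwT 0) (isDensity_mollify hpT hwT N)
    have h5 := mul_le_mul_of_nonneg_left (l1Dist_le_two (isDensity_mollify hpT hwT 0)
      (isDensity_mollify hpT hwT N)) hM0
    have h6 : S.γ w * ∫ x in S.Ω, klFun (S.mollify N (ρ T) w x + 1) ≤
        ∑ w, S.γ w * ∫ x in S.Ω, klFun (S.mollify N (ρ T) w x + 1) :=
      Finset.single_le_sum (f := fun w => S.γ w * ∫ x in S.Ω, klFun (S.mollify N (ρ T) w x + 1))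
        (fun v _ => mul_nonneg (S.γ_pos v).le (integral_nonneg fun x => klFun_nonneg
          (add_nonneg (mollify_nonneg N (ρ T) v x) zero_le_one))) (Finset.mem_univ w)
    have h7 : S.freeEnergy F 1 (S.mollify N (ρ T)) =
        (∑ w, S.γ w * ∫ x in S.Ω, klFun (S.mollify N (ρ T) w x + 1)) +
          F.toFun (S.stateMeasure (S.mollify N (ρ T))) := rfl
    linarith [(abs_le.1 h2).2, (abs_le.1 h4).1]
  have hρT := absolutelyContinuous_of_klFun_mollify_le hpT hwT hkl
  refine ⟨hρT, fun w => ?_⟩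
  refine integrableOn_klFun_of_bound (integrableOn_density hpT hρT w) (density_nonneg _ w)
    (B := (A + (∫⁻ t in Icc 0 T, g t).toReal -
        F.toFun (S.stateMeasure (S.mollify 0 (ρ T))) + M * 2) / S.γ w) fun N => ?_
  rw [le_div_iff₀ (S.γ_pos w), mul_comm, ← mollify_eq_op hpT hρT]
  exact hkl w N

include hD in
/-- The chain rule inequality for densities of finite entropy. -/
lemma enorm_freeEnergy_sub_le (h0 : ρ 0 ≪ S.π₀)
    (hk0 : ∀ w, IntegrableOn (fun x => klFun (S.density (ρ 0) w x)) S.Ω) :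
    ‖S.freeEnergy F 0 (S.density (ρ T)) - S.freeEnergy F 0 (S.density (ρ 0))‖ₑ ≤
      ∫⁻ t in Icc 0 T, S.dissipationRate F (ρ t) (j.jx t) (j.jbar t) := by
  have hpT := hCE.prob T ⟨hT.le, le_rfl⟩
  have hp0 := hCE.prob 0 ⟨le_rfl, hT.le⟩
  obtain ⟨hρT, hkT⟩ := absolutelyContinuous_and_integrableOn_klFun F hT hCE hac hD h0 hk0
  obtain ⟨g, hg, hgb⟩ := exists_enorm_mollRate_le F hCE hac hD
  set δ : ℕ → ℝ := fun n => 1 / ((n:ℝ) + 1) with hδdef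
  have hδ : ∀ n, 0 < δ n := fun n => Nat.one_div_pos_of_nat
  have hδ1 : ∀ n, δ n ≤ 1 := fun n => by
    rw [hδdef]
    simp only
    rw [div_le_one (by positivity)]
    linarith [n.cast_nonneg (α := ℝ)]
  have hδ0 : Tendsto δ atTop (𝓝 0) := tendsto_one_div_add_atTop_nhds_zero_nat
  -- The limit `N → ∞` at fixed `δ`: the energies at both end points converge, and the rates are
  -- replaced by a measurable function below their upper limit.
  have hG : ∀ n, ∃ G : ℝ → ℝ≥0∞, Measurable G ∧
      ‖S.freeEnergy F (δ n) (S.density (ρ T)) - S.freeEnergy F (δ n) (S.density (ρ 0))‖ₑ ≤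
        ∫⁻ t in Icc 0 T, G t ∧ ∀ᵐ t ∂volume.restrict (Icc 0 T), G t ≤
          limsup (fun N => ‖S.mollRate F (δ n) N (ρ t) (j.jx t) (j.jbar t)‖ₑ) atTop := fun n => by
    obtain ⟨G, hGm, hG1, hG2⟩ := exists_measurable_limsup_enorm_integral_le
      (fun N => hgb N (δ n) (hδ n) (hδ1 n)) hg
    refine ⟨G, hGm, le_of_eq_of_le ?_ hG1, hG2⟩
    refine (Tendsto.limsup_eq ?_).symm
    simp only [← freeEnergy_mollify_sub_eq_setIntegral F hT hCE hac (hδ n)]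
    exact ((tendsto_freeEnergy_mollify hpT F hρT hkT (hδ n)).sub
      (tendsto_freeEnergy_mollify hp0 F h0 hk0 (hδ n))).enorm
  choose G hGm hG1 hG2 using hG
  have hlim : Tendsto (fun n => ‖S.freeEnergy F (δ n) (S.density (ρ T)) -
      S.freeEnergy F (δ n) (S.density (ρ 0))‖ₑ) atTop
      (𝓝 ‖S.freeEnergy F 0 (S.density (ρ T)) - S.freeEnergy F 0 (S.density (ρ 0))‖ₑ) :=
    ((tendsto_freeEnergy_zero hpT F hρT hkT hδ hδ1 hδ0).sub
      (tendsto_freeEnergy_zero hp0 F h0 hk0 hδ hδ1 hδ0)).enorm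
  rw [← hlim.limsup_eq]
  -- The limit `δ → 0`, by the reverse Fatou lemma with the same majorant.
  refine (limsup_le_limsup (Eventually.of_forall hG1)).trans
    ((limsup_lintegral_le g hGm (fun n => ?_) hg).trans (lintegral_mono_ae ?_))
  · filter_upwards [hG2 n, ae_all_iff.2 fun N => hgb N (δ n) (hδ n) (hδ1 n)] with t h1 h2
    exact h1.trans (limsup_le_of_le (h := Eventually.of_forall h2))
  · filter_upwards [ae_all_iff.2 hG2, hac, ae_restrict_mem measurableSet_Icc]
      with t h1 ⟨hρ, _⟩ ht
    -- Finiteness of the integral does not exclude infinite rates pointwise, as the integrand may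
    -- fail to be measurable; at such times the bound is trivial.
    by_cases hR : S.dissipationRate F (ρ t) (j.jx t) (j.jbar t) = ⊤
    · rw [hR]
      exact le_top
    · have hp := hCE.prob t ht
      obtain ⟨h⟩ := nonempty_regular F hp hρ hR
      have h2 : ∀ n, G n t ≤ ‖h.limitRate (δ n)‖ₑ := fun n =>
        (h1 n).trans_eq (h.tendsto_mollRate hp hρ (hδ n)).enorm.limsup_eq
      refine (limsup_le_limsup (Eventually.of_forall h2)).trans ?_
      rw [(h.tendsto_limitRate hp hρ hδ hδ1 hδ0).enorm.limsup_eq, ← ofReal_norm]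
      exact (ENNReal.ofReal_le_ofReal (h.abs_limitRate_zero_le hp hρ)).trans_eq
        (ENNReal.ofReal_toReal hR)

end

lemma energy_ne_bot (F : S.Tilt) (ρ : Measure (Space d × ℝ)) : S.energy F ρ ≠ ⊥ := by
  rw [energy, Ne, EReal.add_eq_bot_iff]
  simp

end Setting

end Kramers

theorem lemmal {d : ℕ} (S : Kramers.Setting d) (F : S.Tilt) {T : ℝ} (hT : 0 < T)
    (ρ : ℝ → MeasureTheory.Measure (Kramers.Space d × ℝ)) (j : Kramers.Flux d)
    (hCE : S.ContractedCE T ρ j) (hE : S.energy F (ρ 0) < ⊤) :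
    (S.energy F (ρ T) - S.energy F (ρ 0)).abs ≤ S.dissipation F T ρ j ∧
      0 ≤ S.edpFunctional F T ρ j := by
  rw [Kramers.Setting.edpFunctional]
  by_cases htop : S.dissipation F T ρ j = ⊤
  · rw [htop]
    refine ⟨le_top, ?_⟩
    -- Infinite dissipation yields the second claim only if the energy difference is not `⊥`, which
    -- holds because the energy is never `⊥` and the initial energy is finite.
    have h1 : S.energy F (ρ T) - S.energy F (ρ 0) ≠ ⊥ := by
      rw [sub_eq_add_neg, Ne, EReal.add_eq_bot_iff, EReal.neg_eq_bot_iff]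
      exact not_or.2 ⟨Kramers.Setting.energy_ne_bot F _, hE.ne⟩
    rw [EReal.coe_ennreal_top, EReal.add_top_of_ne_bot h1]
    exact le_top
  · rw [Kramers.Setting.dissipation] at htop ⊢
    split_ifs at htop ⊢ with hc
    · have hac : S.IsAC T ρ j := hc.2
      have hp0 := hCE.prob 0 ⟨le_rfl, hT.le⟩
      have hpT := hCE.prob T ⟨hT.le, le_rfl⟩
      obtain ⟨h0, hk0⟩ := Kramers.Setting.of_energy_lt_top hp0 F hE
      obtain ⟨hρT, hkT⟩ := Kramers.Setting.absolutelyContinuous_and_integrableOn_klFun F hT hCE hac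
        htop h0 hk0
      have key := Kramers.Setting.enorm_freeEnergy_sub_le F hT hCE hac htop h0 hk0
      rw [Kramers.Setting.energy_eq_freeEnergy hpT F hρT hkT,
        Kramers.Setting.energy_eq_freeEnergy hp0 F h0 hk0, ← EReal.coe_sub, EReal.abs_def]
      rw [← ofReal_norm, Real.norm_eq_abs] at key
      refine ⟨key, ?_⟩
      rw [← ENNReal.ofReal_toReal htop] at key ⊢
      have h1 := (ENNReal.ofReal_le_ofReal_iff ENNReal.toReal_nonneg).1 key
      rw [EReal.coe_ennreal_ofReal, max_eq_left ENNReal.toReal_nonneg, ← EReal.coe_add]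
      exact EReal.coe_nonneg.2 (by linarith [(abs_le.1 h1).1])
    · exact absurd rfl htop
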